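/- Let $g$ be a smooth ($C^\infty$) Riemannian metric on a non-empty open convex set $U\subset\mathbb R^2$ (a coordinate neighbourhood of a surface; the result is local), let $H(x,p)=\tfrac12 g^{ij}(x)p_ip_j$ on $T^*U$, and let $\{\cdot,\cdot\}$ be the canonical Poisson bracket with $\{H,F\}=X_H(F)$. A fractional-linear integral of the geodesic flow is a fraction $F=P/Q$, where $P=P^i(x)p_i$ and $Q=Q^i(x)p_i$ have smooth coefficients on $U$ and are coprime (at no point $x$ do both linear forms $P(x,\cdot),Q(x,\cdot)$ vanish, and they are linearly independent for $x$ in a dense subset of $U$), such that $\{H,F\}=0$ wherever $Q\ne0$; fractions are identified when $PQ'=P'Q$. Let $\mathcal R=\mathcal R_{2,1,1}(g)$ be the space of all such $F$, with the quotient of the topology of locally uniform convergence of the coefficients of $(P,Q)$. The group $PGL_2(\mathbb R)$ acts on $\mathcal R$ by $F\mapsto\frac{aF+b}{cF+d}$. We say that $\mathcal R$ has dimension $d$ if it is non-empty and each of its points has a neighbourhood parametrised, homeomorphically onto an open set, by an open subset of $\mathbb R^d$, the coefficients of $(P,Q)$ depending smoothly on the parameters and on $x$, and $F$ depending on the parameters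 immersively. 1. If $\mathcal R$ is non-empty, then it has dimension $5$ or $3$. 2. $\mathcal R$ has dimension $5$ if and only if $g$ has constant Gaussian curvature on $U$. 3. If $\mathcal R$ has dimension $5$, then $\mathcal R$ is connected and the cofactor of each integral is gauge-trivial: for every $F=P/Q\in\mathcal R$ there is a smooth function $L=L^i(x)p_i$ with $\{H,P\}=LP$, $\{H,Q\}=LQ$ and $L=\{H,\varphi\}$ for some $\varphi\in C^\infty(U)$. 4. If $\mathcal R$ has dimension $3$, then $\mathcal R$ is the union of finitely many $PGL_2(\mathbb R)$-orbits, each of which is open and closed in $\mathcal R$; in particular $\mathcal R$ has finitely many connected components, and the connected component of each $F$ is its orbit under the identity component $\{ad-bc>0\}/\mathbb R^*$ of $PGL_2(\mathbb R)$ (so that each $PGL_2(\mathbb R)$-orbit consists of two connected components). -/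

import Mathlib

open scoped ContDiff

namespace FracLin

/-- Points of a coordinate domain of a surface, and also momenta `p = (p₁, p₂)`. -/
abbrev E : Type := Fin 2 → ℝ

/-- `g` is a smooth Riemannian metric on the coordinate domain `U`, with components `g x i j`. -/
structure IsMetric (g : E → Matrix (Fin 2) (Fin 2) ℝ) (U : Set E) : Prop where
  smooth : ∀ i j, ContDiffOn ℝ ∞ (fun x => g x i j) U
  posDef : ∀ x ∈ U, (g x).PosDef

/-- The partial derivative `∂f/∂xᵢ` of a function of two variables. -/
noncomputable def pd (i : Fin 2) (f : E → ℝ) (x : E) : ℝ := fderiv ℝ f x (Pi.single i 1)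

/-- The Poisson bracket of functions `A(x,p)`, `B(x,p)` on the cotangent bundle,
`{A,B} = ∑ᵢ (∂A/∂pᵢ ∂B/∂xᵢ - ∂A/∂xᵢ ∂B/∂pᵢ)`, so that `{H,F} = X_H(F)`. -/
noncomputable def poisson (A B : E → E → ℝ) (x p : E) : ℝ :=
  ∑ i, (pd i (fun q => A x q) p * pd i (fun y => B y p) x
    - pd i (fun y => A y p) x * pd i (fun q => B x q) p)

/-- The Hamiltonian `H(x,p) = ½ gⁱʲ(x) pᵢ pⱼ` of the geodesic flow. -/
noncomputable def ham (g : E → Matrix (Fin 2) (Fin 2) ℝ) (x p : E) : ℝ :=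
  (1 / 2) * ∑ i, ∑ j, (g x)⁻¹ i j * p i * p j

/-- The function `X¹(x) p₁ + X²(x) p₂` on the cotangent bundle given by a vector field `X`. -/
noncomputable def lin (X : E → E) (x p : E) : ℝ := ∑ i, X x i * p i

/-- The Christoffel symbols `Γᵏᵢⱼ`. -/
noncomputable def christoffel (g : E → Matrix (Fin 2) (Fin 2) ℝ) (k i j : Fin 2) (x : E) : ℝ :=
  (1 / 2) * ∑ l, (g x)⁻¹ k l *
    (pd i (fun y => g y j l) x + pd j (fun y => g y i l) x - pd l (fun y => g y i j) x)

/-- The component `Rˡ` of `R(∂ᵢ,∂ⱼ)∂ₖ = Rˡ ∂ₗ`, where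
`R(X,Y)Z = ∇_X ∇_Y Z - ∇_Y ∇_X Z - ∇_[X,Y] Z`. -/
noncomputable def riemann (g : E → Matrix (Fin 2) (Fin 2) ℝ) (l i j k : Fin 2) (x : E) : ℝ :=
  pd i (christoffel g l j k) x - pd j (christoffel g l i k) x
    + ∑ m, (christoffel g l i m x * christoffel g m j k x
      - christoffel g l j m x * christoffel g m i k x)

/-- The Gaussian curvature `g(R(∂₁,∂₂)∂₂, ∂₁) / det g`. -/
noncomputable def gaussK (g : E → Matrix (Fin 2) (Fin 2) ℝ) (x : E) : ℝ :=
  (∑ l, g x 0 l * riemann g l 0 1 1 x) / (g x).det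

/-- `g` has constant curvature on `U`. -/
def ConstCurv (g : E → Matrix (Fin 2) (Fin 2) ℝ) (U : Set E) : Prop :=
  ∃ c : ℝ, ∀ x ∈ U, gaussK g x = c

/-- A numerator `P` and a denominator `Q` of a fractional-linear integral `F = P / Q` of the
geodesic flow on `U`. The two linear functions of `p` are coprime: no common zero in `x`, and no
common linear factor over any nonempty open set of `x`. -/
structure Rep (g : E → Matrix (Fin 2) (Fin 2) ℝ) (U : Set E) where
  P : E → E
  Q : E → E
  smooth_P : ContDiffOn ℝ ∞ P U
  smooth_Q : ContDiffOn ℝ ∞ Q U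
  no_zero : ∀ x ∈ U, ¬ (P x = 0 ∧ Q x = 0)
  indep : U ⊆ closure {x ∈ U | P x 0 * Q x 1 - P x 1 * Q x 0 ≠ 0}
  integral : ∀ x ∈ U, ∀ p : E, lin Q x p ≠ 0 →
    poisson (ham g) (fun y q => lin P y q / lin Q y q) x p = 0

variable {g : E → Matrix (Fin 2) (Fin 2) ℝ} {U : Set E}

/-- Two pairs define the same fraction `P / Q = P' / Q'`. -/
def Same (r s : Rep g U) : Prop :=
  ∀ x ∈ U, ∀ p : E, lin r.P x p * lin s.Q x p = lin s.P x p * lin r.Q x p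

theorem lin_two (X : E → E) (x p : E) : lin X x p = X x 0 * p 0 + X x 1 * p 1 := by
  simp [lin, Fin.sum_univ_two]

theorem lin_contDiffOn {X : E → E} (h : ContDiffOn ℝ ∞ X U) :
    ContDiffOn ℝ ∞ (fun z : E × E => lin X z.1 z.2) (U ×ˢ Set.univ) := by
  have h1 : ContDiffOn ℝ ∞ (fun z : E × E => X z.1) (U ×ˢ Set.univ) :=
    h.comp contDiff_fst.contDiffOn (fun z hz => hz.1)
  have h2 : ∀ i, ContDiffOn ℝ ∞ (fun z : E × E => X z.1 i) (U ×ˢ Set.univ) :=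
    fun i => contDiffOn_pi.1 h1 i
  have h3 : ∀ i, ContDiffOn ℝ ∞ (fun z : E × E => z.2 i) (U ×ˢ Set.univ) :=
    fun i => (by fun_prop : ContDiff ℝ ∞ (fun z : E × E => z.2 i)).contDiffOn
  unfold lin
  exact ContDiffOn.sum fun i _ => (h2 i).mul (h3 i)

/-- The pairs `(x,p)` with nonvanishing denominator are dense over `U`. -/
theorem dense_denominator (r : Rep g U) :
    (U ×ˢ (Set.univ : Set E)) ⊆ closure {z : E × E | z.1 ∈ U ∧ lin r.Q z.1 z.2 ≠ 0} := by
  set G := {x ∈ U | r.P x 0 * r.Q x 1 - r.P x 1 * r.Q x 0 ≠ 0} with hG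
  have key : G ×ˢ (Set.univ : Set E) ⊆
      closure {z : E × E | z.1 ∈ U ∧ lin r.Q z.1 z.2 ≠ 0} := by
    rintro ⟨x, p⟩ ⟨hx, -⟩
    have hx2 : r.P x 0 * r.Q x 1 - r.P x 1 * r.Q x 0 ≠ 0 := hx.2
    by_cases hp : lin r.Q x p ≠ 0
    · exact subset_closure ⟨hx.1, hp⟩
    · push Not at hp
      have hq : 0 < r.Q x 0 ^ 2 + r.Q x 1 ^ 2 := by
        by_contra hcon
        have h0 : r.Q x 0 = 0 := by nlinarith [sq_nonneg (r.Q x 0), sq_nonneg (r.Q x 1)]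
        have h1 : r.Q x 1 = 0 := by nlinarith [sq_nonneg (r.Q x 0), sq_nonneg (r.Q x 1)]
        exact hx2 (by rw [h0, h1]; ring)
      have hc : Filter.Tendsto (fun t : ℝ => ((x, p + t • r.Q x) : E × E))
          (nhdsWithin 0 {0}ᶜ) (nhds (x, p)) := by
        have : Continuous (fun t : ℝ => ((x, p + t • r.Q x) : E × E)) := by fun_prop
        have h := this.tendsto 0
        simp only [zero_smul, add_zero] at h
        exact h.mono_left nhdsWithin_le_nhds
      refine mem_closure_of_tendsto hc ?_
      filter_upwards [self_mem_nhdsWithin] with t ht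
      refine ⟨hx.1, ?_⟩
      have e : lin r.Q x (p + t • r.Q x) = t * (r.Q x 0 ^ 2 + r.Q x 1 ^ 2) := by
        rw [lin_two] at hp ⊢
        simp only [Pi.add_apply, Pi.smul_apply, smul_eq_mul]
        linear_combination hp
      simp only [e]
      exact mul_ne_zero ht hq.ne'
  have h2 : (U ×ˢ (Set.univ : Set E)) ⊆ closure (G ×ˢ (Set.univ : Set E)) := by
    rw [closure_prod_eq, closure_univ]
    exact Set.prod_mono r.indep le_rfl
  exact h2.trans (closure_minimal key isClosed_closure)

/-- A continuous function vanishing where the denominator is nonzero vanishes over `U`. -/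
theorem eq_zero_of_denominator (r : Rep g U) {f : E × E → ℝ}
    (hf : ContinuousOn f (U ×ˢ Set.univ))
    (h : ∀ x ∈ U, ∀ p : E, lin r.Q x p ≠ 0 → f (x, p) = 0) :
    ∀ x ∈ U, ∀ p : E, f (x, p) = 0 := by
  intro x hx p
  have h0 : Set.EqOn f (fun _ => 0) {z : E × E | z.1 ∈ U ∧ lin r.Q z.1 z.2 ≠ 0} :=
    fun z hz => h z.1 hz.1 z.2 hz.2
  exact h0.of_subset_closure hf continuousOn_const (fun z hz => ⟨hz.1, trivial⟩)
    (dense_denominator r) ⟨hx, trivial⟩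

theorem same_trans (r s t : Rep g U) (h1 : Same r s) (h2 : Same s t) : Same r t := by
  have hc : ContinuousOn (fun z : E × E =>
      lin r.P z.1 z.2 * lin t.Q z.1 z.2 - lin t.P z.1 z.2 * lin r.Q z.1 z.2)
      (U ×ˢ Set.univ) :=
    ((lin_contDiffOn r.smooth_P).continuousOn.mul (lin_contDiffOn t.smooth_Q).continuousOn).sub
      ((lin_contDiffOn t.smooth_P).continuousOn.mul (lin_contDiffOn r.smooth_Q).continuousOn)
  intro x hx p
  refine sub_eq_zero.1 (eq_zero_of_denominator s hc (fun y hy q hq => ?_) x hx p)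
  have e1 := h1 y hy q
  have e2 := h2 y hy q
  refine mul_left_cancel₀ hq ?_
  linear_combination lin t.Q y q * e1 + lin r.Q y q * e2

instance repSetoid (g : E → Matrix (Fin 2) (Fin 2) ℝ) (U : Set E) : Setoid (Rep g U) where
  r := Same
  iseqv := ⟨fun _ _ _ _ => rfl, fun h x hx p => (h x hx p).symm,
    fun {r s t} h1 h2 => same_trans r s t h1 h2⟩

/-- The space of fractional-linear integrals `F = P / Q` of the geodesic flow of `g` on `U`. -/
def FLI (g : E → Matrix (Fin 2) (Fin 2) ℝ) (U : Set E) : Type := Quotient (repSetoid g U)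

/-- The fraction `P / Q`. -/
def Rep.frac (r : Rep g U) : FLI g U := Quotient.mk (repSetoid g U) r

/-- The coefficients of the numerator and of the denominator as continuous functions on `U`. -/
def Rep.coeffs (r : Rep g U) : C(U, E × E) where
  toFun x := (r.P x, r.Q x)
  continuous_toFun := (continuousOn_iff_continuous_domRestrict.1 r.smooth_P.continuousOn).prodMk
    (continuousOn_iff_continuous_domRestrict.1 r.smooth_Q.continuousOn)

/-- Locally uniform convergence of the coefficients (compact-open topology). -/
instance : TopologicalSpace (Rep g U) := TopologicalSpace.induced Rep.coeffs inferInstance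

/-- The quotient topology: fractions are close if they have close numerators and denominators. -/
instance : TopologicalSpace (FLI g U) :=
  inferInstanceAs (TopologicalSpace (Quotient (repSetoid g U)))

/-- `FLI g U` is nonempty and is a `d`-dimensional manifold: near each of its points it is
parametrised, homeomorphically onto an open set, by an open set `V ⊆ ℝᵈ`, the coefficients
depending smoothly on the parameters `v` and on `x`, and the parametrisation `v ↦ P_v / Q_v` is an
immersion: no nonzero tangent vector `w` at a parameter `v` has `(∂_w P_v, ∂_w Q_v)`
proportional to `(P_v, Q_v)` at every point `x` (which would mean `∂_w (P_v / Q_v) = 0`). -/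
def HasDim (g : E → Matrix (Fin 2) (Fin 2) ℝ) (U : Set E) (d : ℕ) : Prop :=
  Nonempty (FLI g U) ∧ ∀ F : FLI g U, ∃ (V : Set (Fin d → ℝ)) (r : (Fin d → ℝ) → Rep g U),
    IsOpen V ∧
    Topology.IsOpenEmbedding (fun v : V => (r v).frac) ∧
    (∃ v ∈ V, (r v).frac = F) ∧
    ContDiffOn ℝ ∞ (fun z : (Fin d → ℝ) × E => ((r z.1).P z.2, (r z.1).Q z.2)) (V ×ˢ U) ∧
    ∀ v ∈ V, ∀ w : Fin d → ℝ, w ≠ 0 → ¬ ∃ f : E → ℝ, ∀ x ∈ U,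
      fderiv ℝ (fun v' => (r v').P x) v w = f x • (r v).P x ∧
      fderiv ℝ (fun v' => (r v').Q x) v w = f x • (r v).Q x

/-- The function `L(x,p) = L¹ p₁ + L² p₂` is a cofactor of the relative Killing vector `X`:
`{H,X} = L X`. -/
def IsCofactor (g : E → Matrix (Fin 2) (Fin 2) ℝ) (U : Set E) (L X : E → E) : Prop :=
  ∀ x ∈ U, ∀ p : E, poisson (ham g) (lin X) x p = lin L x p * lin X x p

/-- `L ∼ 0`: the cofactor `L` is `{H,φ}` for a smooth function `φ` on `U`, i.e. it is the exact
one-form `dφ` with its index raised. Rescaling `X` to `e^φ X` adds `{H,φ}` to the cofactor. -/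
def GaugeTrivial (g : E → Matrix (Fin 2) (Fin 2) ℝ) (U : Set E) (L : E → E) : Prop :=
  ∃ φ : E → ℝ, ContDiffOn ℝ ∞ φ U ∧
    ∀ x ∈ U, ∀ p : E, lin L x p = poisson (ham g) (fun y _ => φ y) x p

section action

theorem fderiv_fst {A : E × E → ℝ} {z : E × E} (h : DifferentiableAt ℝ A z) (v : E) :
    fderiv ℝ (fun y => A (y, z.2)) z.1 v = fderiv ℝ A z (v, 0) := by
  have h1 : HasFDerivAt (fun y : E => (y, z.2)) (ContinuousLinearMap.inl ℝ E E) z.1 :=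
    hasFDerivAt_prodMk_left z.1 z.2
  have h2 : HasFDerivAt A (fderiv ℝ A z) ((fun y : E => (y, z.2)) z.1) := h.hasFDerivAt
  have h3 := (h2.comp z.1 h1).fderiv
  change fderiv ℝ (A ∘ fun y : E => (y, z.2)) z.1 v = _
  rw [h3]; simp

theorem fderiv_snd {A : E × E → ℝ} {z : E × E} (h : DifferentiableAt ℝ A z) (v : E) :
    fderiv ℝ (fun q => A (z.1, q)) z.2 v = fderiv ℝ A z (0, v) := by
  have h1 : HasFDerivAt (fun q : E => (z.1, q)) (ContinuousLinearMap.inr ℝ E E) z.2 :=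
    hasFDerivAt_prodMk_right z.1 z.2
  have h2 : HasFDerivAt A (fderiv ℝ A z) ((fun q : E => (z.1, q)) z.2) := h.hasFDerivAt
  have h3 := (h2.comp z.2 h1).fderiv
  change fderiv ℝ (A ∘ fun q : E => (z.1, q)) z.2 v = _
  rw [h3]; simp

/-- The Poisson bracket through derivatives on the product. -/
theorem poisson_eq {A B : E → E → ℝ} {x p : E}
    (hA : DifferentiableAt ℝ (fun z : E × E => A z.1 z.2) (x, p))
    (hB : DifferentiableAt ℝ (fun z : E × E => B z.1 z.2) (x, p)) :
    poisson A B x p = ∑ i : Fin 2,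
      (fderiv ℝ (fun z : E × E => A z.1 z.2) (x, p) (0, Pi.single i 1) *
          fderiv ℝ (fun z : E × E => B z.1 z.2) (x, p) (Pi.single i 1, 0)
        - fderiv ℝ (fun z : E × E => A z.1 z.2) (x, p) (Pi.single i 1, 0) *
          fderiv ℝ (fun z : E × E => B z.1 z.2) (x, p) (0, Pi.single i 1)) := by
  unfold poisson pd
  refine Finset.sum_congr rfl fun i _ => ?_
  rw [← fderiv_fst hA, ← fderiv_fst hB, ← fderiv_snd hA, ← fderiv_snd hB]

theorem ham_contDiffOn (hg : IsMetric g U) :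
    ContDiffOn ℝ ∞ (fun z : E × E => ham g z.1 z.2) (U ×ˢ Set.univ) := by
  have hc : ∀ i j, ContDiffOn ℝ ∞ (fun z : E × E => g z.1 i j) (U ×ˢ Set.univ) := fun i j =>
    (hg.smooth i j).comp contDiff_fst.contDiffOn (fun z hz => hz.1)
  have hdet : ContDiffOn ℝ ∞ (fun z : E × E => (g z.1).det) (U ×ˢ Set.univ) := by
    simp only [Matrix.det_fin_two]
    exact ((hc 0 0).mul (hc 1 1)).sub ((hc 0 1).mul (hc 1 0))
  have hadj : ∀ i j, ContDiffOn ℝ ∞ (fun z : E × E => (g z.1).adjugate i j)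
      (U ×ˢ Set.univ) := by
    intro i j
    simp only [Matrix.adjugate_fin_two]
    fin_cases i <;> fin_cases j <;> simp
    · exact hc 1 1
    · exact (hc 0 1).neg
    · exact (hc 1 0).neg
    · exact hc 0 0
  have hinv : ∀ i j, ContDiffOn ℝ ∞ (fun z : E × E => (g z.1)⁻¹ i j) (U ×ˢ Set.univ) := by
    intro i j
    simp only [Matrix.inv_def, Matrix.smul_apply, Ring.inverse_eq_inv', smul_eq_mul]
    exact (hdet.inv fun z hz => (hg.posDef z.1 hz.1).det_pos.ne').mul (hadj i j)
  have h3 : ∀ i, ContDiffOn ℝ ∞ (fun z : E × E => z.2 i) (U ×ˢ Set.univ) :=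
    fun i => (by fun_prop : ContDiff ℝ ∞ (fun z : E × E => z.2 i)).contDiffOn
  unfold ham
  exact contDiffOn_const.mul (ContDiffOn.sum fun i _ => ContDiffOn.sum fun j _ =>
    ((hinv i j).mul (h3 i)).mul (h3 j))

theorem diffAt (hU : IsOpen U) {A : E × E → ℝ} (h : ContDiffOn ℝ ∞ A (U ×ˢ Set.univ))
    {x p : E} (hx : x ∈ U) : DifferentiableAt ℝ A (x, p) :=
  (h.contDiffAt ((hU.prod isOpen_univ).mem_nhds ⟨hx, trivial⟩)).differentiableAt (by simp)

theorem poisson_continuousOn (hU : IsOpen U) {A B : E → E → ℝ}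
    (hA : ContDiffOn ℝ ∞ (fun z : E × E => A z.1 z.2) (U ×ˢ Set.univ))
    (hB : ContDiffOn ℝ ∞ (fun z : E × E => B z.1 z.2) (U ×ˢ Set.univ)) :
    ContinuousOn (fun z : E × E => poisson A B z.1 z.2) (U ×ˢ Set.univ) := by
  have hW : IsOpen (U ×ˢ (Set.univ : Set E)) := hU.prod isOpen_univ
  have cA := hA.continuousOn_fderiv_of_isOpen hW (by simp)
  have cB := hB.continuousOn_fderiv_of_isOpen hW (by simp)
  have : ContinuousOn (fun z : E × E => ∑ i : Fin 2,
      (fderiv ℝ (fun z : E × E => A z.1 z.2) z (0, Pi.single i 1) *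
          fderiv ℝ (fun z : E × E => B z.1 z.2) z (Pi.single i 1, 0)
        - fderiv ℝ (fun z : E × E => A z.1 z.2) z (Pi.single i 1, 0) *
          fderiv ℝ (fun z : E × E => B z.1 z.2) z (0, Pi.single i 1))) (U ×ˢ Set.univ) :=
    continuousOn_finsetSum _ fun i _ =>
      ((cA.clm_apply continuousOn_const).mul (cB.clm_apply continuousOn_const)).sub
        ((cA.clm_apply continuousOn_const).mul (cB.clm_apply continuousOn_const))
  exact this.congr fun z hz => poisson_eq (diffAt hU hA hz.1) (diffAt hU hB hz.1)

theorem poisson_div (hU : IsOpen U) (hg : IsMetric g U) {X Y : E → E}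
    (hX : ContDiffOn ℝ ∞ X U) (hY : ContDiffOn ℝ ∞ Y U) {x p : E} (hx : x ∈ U)
    (h : lin Y x p ≠ 0) :
    poisson (ham g) (fun y q => lin X y q / lin Y y q) x p =
      (poisson (ham g) (lin X) x p * lin Y x p - lin X x p * poisson (ham g) (lin Y) x p)
        / lin Y x p ^ 2 := by
  have dH := diffAt hU (ham_contDiffOn hg) (p := p) hx
  have dX := diffAt hU (lin_contDiffOn hX) (p := p) hx
  have dY := diffAt hU (lin_contDiffOn hY) (p := p) hx
  have e := dX.hasFDerivAt.mul ((hasDerivAt_inv h).comp_hasFDerivAt (x, p) dY.hasFDerivAt)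
  have e1 : HasFDerivAt (fun z : E × E => lin X z.1 z.2 / lin Y z.1 z.2) _ (x, p) :=
    e.congr_of_eventuallyEq (Filter.Eventually.of_forall fun z => div_eq_mul_inv _ _)
  rw [poisson_eq dH e1.differentiableAt, poisson_eq dH dX, poisson_eq dH dY, e1.fderiv]
  simp only [Fin.sum_univ_two, smul_apply, add_apply, smul_eq_mul, Function.comp_apply]
  field_simp
  ring

/-- The integral condition without denominators. -/
theorem Rep.bracket (hU : IsOpen U) (hg : IsMetric g U) (r : Rep g U) :
    ∀ x ∈ U, ∀ p : E, poisson (ham g) (lin r.P) x p * lin r.Q x p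
      - lin r.P x p * poisson (ham g) (lin r.Q) x p = 0 := by
  have cP := lin_contDiffOn r.smooth_P
  have cQ := lin_contDiffOn r.smooth_Q
  have cH := ham_contDiffOn hg
  refine eq_zero_of_denominator r (f := fun z => poisson (ham g) (lin r.P) z.1 z.2 *
    lin r.Q z.1 z.2 - lin r.P z.1 z.2 * poisson (ham g) (lin r.Q) z.1 z.2) ?_ ?_
  · exact ((poisson_continuousOn hU cH cP).mul cQ.continuousOn).sub
      (cP.continuousOn.mul (poisson_continuousOn hU cH cQ))
  · intro x hx p hp
    have h := r.integral x hx p hp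
    rw [poisson_div hU hg r.smooth_P r.smooth_Q hx hp, div_eq_zero_iff] at h
    exact h.resolve_right (pow_ne_zero 2 hp)

theorem lin_comb (a b : ℝ) (X Y : E → E) (x p : E) :
    lin (fun y => a • X y + b • Y y) x p = a * lin X x p + b * lin Y x p := by
  simp only [lin_two, Pi.add_apply, Pi.smul_apply, smul_eq_mul]; ring

theorem poisson_comb (hU : IsOpen U) (hg : IsMetric g U) (a b : ℝ) {X Y : E → E}
    (hX : ContDiffOn ℝ ∞ X U) (hY : ContDiffOn ℝ ∞ Y U) {x : E} (hx : x ∈ U) (p : E) :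
    poisson (ham g) (lin (fun y => a • X y + b • Y y)) x p =
      a * poisson (ham g) (lin X) x p + b * poisson (ham g) (lin Y) x p := by
  have dH := diffAt hU (ham_contDiffOn hg) (p := p) hx
  have dX := diffAt hU (lin_contDiffOn hX) (p := p) hx
  have dY := diffAt hU (lin_contDiffOn hY) (p := p) hx
  have e := (dX.hasFDerivAt.const_mul a).add (dY.hasFDerivAt.const_mul b)
  have e' : HasFDerivAt (fun z : E × E => lin (fun y => a • X y + b • Y y) z.1 z.2) _ (x, p) :=
    e.congr_of_eventuallyEq (Filter.Eventually.of_forall fun z => lin_comb a b X Y z.1 z.2)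
  rw [poisson_eq dH e'.differentiableAt, poisson_eq dH dX, poisson_eq dH dY, e'.fderiv]
  simp only [Fin.sum_univ_two, smul_apply, add_apply,
    smul_eq_mul]
  ring

/-- The pair `(a P + b Q, c P + d Q)` for an invertible matrix `A = (a b; c d)`. -/
def Rep.moebius (hU : IsOpen U) (hg : IsMetric g U) (A : GL (Fin 2) ℝ) (r : Rep g U) :
    Rep g U where
  P x := A 0 0 • r.P x + A 0 1 • r.Q x
  Q x := A 1 0 • r.P x + A 1 1 • r.Q x
  smooth_P := (r.smooth_P.const_smul _).add (r.smooth_Q.const_smul _)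
  smooth_Q := (r.smooth_P.const_smul _).add (r.smooth_Q.const_smul _)
  no_zero := by
    rintro x hx ⟨h1, h2⟩
    have hA : A 0 0 * A 1 1 - A 0 1 * A 1 0 ≠ 0 := by
      rw [← Matrix.det_fin_two]; exact A.det_ne_zero
    refine r.no_zero x hx ⟨?_, ?_⟩
    · have : (A 0 0 * A 1 1 - A 0 1 * A 1 0) • r.P x = 0 := by
        have := congrArg₂ (fun u v => A 1 1 • u - A 0 1 • v) h1 h2
        simp only [smul_zero, sub_zero] at this
        rw [← this]; module
      exact (smul_eq_zero.1 this).resolve_left hA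
    · have : (A 0 0 * A 1 1 - A 0 1 * A 1 0) • r.Q x = 0 := by
        have := congrArg₂ (fun u v => A 0 0 • v - A 1 0 • u) h1 h2
        simp only [smul_zero, sub_zero] at this
        rw [← this]; module
      exact (smul_eq_zero.1 this).resolve_left hA
  indep := by
    have hA : A 0 0 * A 1 1 - A 0 1 * A 1 0 ≠ 0 := by
      rw [← Matrix.det_fin_two]; exact A.det_ne_zero
    refine r.indep.trans (closure_mono ?_)
    rintro x ⟨hx, h⟩
    refine ⟨hx, ?_⟩
    have := mul_ne_zero hA h
    contrapose! this
    simp only [Pi.add_apply, Pi.smul_apply, smul_eq_mul] at this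
    linear_combination this
  integral := by
    intro x hx p hp
    rw [poisson_div hU hg ((r.smooth_P.const_smul _).add (r.smooth_Q.const_smul _))
      ((r.smooth_P.const_smul _).add (r.smooth_Q.const_smul _)) hx hp,
      poisson_comb hU hg _ _ r.smooth_P r.smooth_Q hx, lin_comb,
      poisson_comb hU hg _ _ r.smooth_P r.smooth_Q hx, lin_comb, div_eq_zero_iff]
    left
    linear_combination (A 0 0 * A 1 1 - A 0 1 * A 1 0) * r.bracket hU hg x hx p

/-- The action of `GL₂(ℝ)` on fractional-linear integrals,
`A · (P / Q) = (a P + b Q) / (c P + d Q)` for `A = (a b; c d)`. Scalar matrices act trivially, so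
that it is an action of `PGL₂(ℝ)`, with the same orbits. -/
def moeb (hU : IsOpen U) (hg : IsMetric g U) (A : GL (Fin 2) ℝ) : FLI g U → FLI g U :=
  Quotient.map (Rep.moebius hU hg A) (by
    intro r s h x hx p
    have h := h x hx p
    simp only [Rep.moebius, lin_comb]
    linear_combination (A 0 0 * A 1 1 - A 0 1 * A 1 0) * h)

theorem moeb_one (hU : IsOpen U) (hg : IsMetric g U) (F : FLI g U) : moeb hU hg 1 F = F := by
  induction F using Quotient.inductionOn with
  | h r =>
    refine Quotient.sound fun x hx p => ?_
    simp only [Rep.moebius, lin_comb]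
    simp

theorem moeb_mul (hU : IsOpen U) (hg : IsMetric g U) (A B : GL (Fin 2) ℝ) (F : FLI g U) :
    moeb hU hg (A * B) F = moeb hU hg A (moeb hU hg B F) := by
  induction F using Quotient.inductionOn with
  | h r =>
    refine Quotient.sound fun x hx p => ?_
    simp only [Rep.moebius, lin_comb]
    simp only [Units.val_mul, Matrix.mul_apply, Fin.sum_univ_two]
    ring

/-- The orbit of `F` under the action of a subgroup `G` of `GL₂(ℝ)`. -/
def orb (hU : IsOpen U) (hg : IsMetric g U) (G : Subgroup (GL (Fin 2) ℝ)) (F : FLI g U) :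
    Set (FLI g U) :=
  {F' | ∃ A ∈ G, F' = moeb hU hg A F}

end action

end FracLin

/-! Lower the index of the numerator and of the denominator and call the resulting covectors a and
b. The identity {H,P}Q = P{H,Q} is one of cubic polynomials in p, and coprimality forces P to divide
{H,P} and Q to divide {H,Q}, with one smooth cofactor L (`Rep.exists_relKilling`). So a and b solve
the same relative Killing equation. It closes after one prolongation: if r is the skew part of the
derivative of a, then (a₀, a₁, r) solves a linear total system (`RelKilling.deriv_skew`,
`RelKilling.sys`). On a convex domain a solution is therefore fixed by three numbers at a point, and
the determinant w of the pair has only simple zeros (`KillingPair.exists_deriv_ne_zero`). Let Ω =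
∂₀L₁ - ∂₁L₀, let T be the trace of the Christoffel symbols and κ the rotated differential of K. The
integrability conditions combine into D(Ωw³) = (4T + 6L)Ωw³ + κw³
(`RelKilling.deriv_curvature_mul`).

Constant curvature. Here κ = 0, and commuting derivatives of Ωw³ gives Ω²w³ = 0, so L is closed,
hence exact, L = dφ. Multiplication by exp(-φ) turns numerator and denominator into Killing fields.
The prolonged Killing system is now flat, so Killing fields form a copy of ℝ³, and integrals are
linearly independent pairs in ℝ³ × ℝ³ up to a common constant (`KillingPair.eq_smul_of_par`): an
open connected part of projective five-space. The quotient topology agrees with the projective one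
by compactness of the sphere (`KillingBasis.isOpen_cone`). Dimension three is impossible, since
three parameters and two scale factors cannot fill an open set of pairs in ℝ⁶.

Nonconstant curvature. The point is that there are finitely many orbits (`finite_orbits`). Where w ≠
0, the form m = (b r - a s)/w, with s the skew part of b, does not change under rescaling of the
pair or under constant linear changes of it. The unknowns (m, Ω) satisfy a closed system
(`CharForm`) whose integrability conditions are three algebraic equations with coefficients from the
metric alone. Eliminating m leaves a nonzero polynomial of degree at most six for Ω at each point
where κ ≠ 0. Conversely, if Ω agrees for two integrals on an open set where κ ≠ 0, then so does m,
and (m, Ω) at one point determines the orbit (`KillingPair.exists_par_moebius`). This is unique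
continuation for a system in which Ω is itself unknown and is governed by an equation that
degenerates where w = 0; simplicity of the zeros makes it well posed along transversal segments
(`singular_unique`, `KillingPair.par_of_sameJet`). Seven distinct orbits would give seven roots at a
generic point.

Consequences of finiteness. Orbits are always closed, because membership can be written as pointwise
equations without the group element (`mem_orb_iff`); finitely many closed orbits are also open. The
projective group acts freely, so an orbit is a three-manifold with two components separated by the
sign of a determinant (`hasDim_three`, `isClopen_orb_glpos`), and a five-parameter immersed family
cannot stay in one orbit (`not_hasDim_five`). -/

namespace FracLin

/-! ### Smooth functions on an open set as a differential ring -/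

/-- Extension by zero of a function on an open set. -/
noncomputable def extZero (O : TopologicalSpace.Opens E) (f : O → ℝ) : E → ℝ :=
  Function.extend Subtype.val f 0

theorem extZero_apply {O : TopologicalSpace.Opens E} (f : O → ℝ) (x : O) :
    extZero O f x = f x :=
  Subtype.val_injective.extend_apply _ _ _

theorem extZero_eqOn {O : TopologicalSpace.Opens E} (F : E → ℝ) :
    Set.EqOn (extZero O fun x => F x) F O := fun x hx => extZero_apply (fun x : O => F x) ⟨x, hx⟩

/-- The algebra of smooth functions on an open set of coordinates. -/
noncomputable def SmoothFn (O : TopologicalSpace.Opens E) : Subalgebra ℝ (O → ℝ) where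
  carrier := {f | ContDiffOn ℝ ∞ (extZero O f) O}
  mul_mem' {a b} ha hb := (ha.mul hb).congr fun x hx => by
    lift x to O using hx
    simp [extZero_apply]
  add_mem' {a b} ha hb := (ha.add hb).congr fun x hx => by
    lift x to O using hx
    simp [extZero_apply]
  algebraMap_mem' r := (contDiffOn_const (c := r)).congr fun x hx => by
    lift x to O using hx
    simp [extZero_apply]

variable {O : TopologicalSpace.Opens E}

theorem smoothFn_smooth (f : SmoothFn O) : ContDiffOn ℝ ∞ (extZero O f.1) O := f.2

/-- A function that is smooth on `O` as an element of the algebra of smooth functions. -/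
noncomputable def toSm (F : E → ℝ) (hF : ContDiffOn ℝ ∞ F O) : SmoothFn O :=
  ⟨fun x => F x, hF.congr (extZero_eqOn F)⟩

@[simp] theorem toSm_apply (F : E → ℝ) (hF : ContDiffOn ℝ ∞ F O) (x : O) :
    (toSm F hF).1 x = F x := rfl

theorem contDiffOn_pd {O : Set E} (hO : IsOpen O) {F : E → ℝ} (hF : ContDiffOn ℝ ∞ F O)
    (i : Fin 2) : ContDiffOn ℝ ∞ (pd i F) O :=
  (hF.fderiv_of_isOpen hO (by simp)).clm_apply contDiffOn_const

/-- Only the germ matters for a derivative, and an open set is a neighbourhood of each of its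
points; this makes the extension by zero harmless. -/
theorem pd_congr {O : Set E} (hO : IsOpen O) {F G : E → ℝ} (h : Set.EqOn F G O) (i : Fin 2) :
    Set.EqOn (pd i F) (pd i G) O := fun x hx => by
  unfold pd
  rw [(h.eventuallyEq_of_mem (hO.mem_nhds hx)).fderiv_eq]

theorem diffAt_of_contDiffOn {O : Set E} (hO : IsOpen O) {F : E → ℝ} (hF : ContDiffOn ℝ ∞ F O)
    {x : E} (hx : x ∈ O) : DifferentiableAt ℝ F x :=
  (hF.contDiffAt (hO.mem_nhds hx)).differentiableAt (by simp)

/-- Symmetry of the second Fréchet derivative; every integrability condition of the differential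
algebra rests on it. -/
theorem pd_comm {O : Set E} (hO : IsOpen O) {F : E → ℝ} (hF : ContDiffOn ℝ ∞ F O) (i j : Fin 2)
    {x : E} (hx : x ∈ O) : pd i (pd j F) x = pd j (pd i F) x := by
  have h2 : ∀ i j : Fin 2, pd i (pd j F) x =
      fderiv ℝ (fderiv ℝ F) x (Pi.single i 1) (Pi.single j 1) := by
    intro i j
    have hd : DifferentiableAt ℝ (fderiv ℝ F) x :=
      ((hF.fderiv_of_isOpen hO (m := ∞) (by simp)).contDiffAt (hO.mem_nhds hx)).differentiableAt
        (by simp)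
    change fderiv ℝ (fun y => fderiv ℝ F y (Pi.single j 1)) x (Pi.single i 1) = _
    rw [fderiv_clm_apply hd (by fun_prop)]
    simp
  rw [h2, h2]
  exact (hF.contDiffAt (hO.mem_nhds hx)).isSymmSndFDerivAt
    (by simpa using WithTop.coe_le_coe.2 (le_top : (2 : ℕ∞) ≤ ⊤)) _ _

/-- The partial derivatives as derivations. -/
noncomputable def sd (O : TopologicalSpace.Opens E) (i : Fin 2) :
    Derivation ℝ (SmoothFn O) (SmoothFn O) :=
  Derivation.mk'
    { toFun := fun f => toSm (pd i (extZero O f.1)) (contDiffOn_pd O.2 (smoothFn_smooth f) i)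
      map_add' := fun f g => by
        ext x
        have := pd_congr O.2 (F := extZero O (f + g).1) (G := fun y => extZero O f.1 y + extZero O g.1 y)
          (fun y hy => by lift y to O using hy; simp [extZero_apply]) i x.2
        change pd i (extZero O (f + g).1) x = pd i (extZero O f.1) x + pd i (extZero O g.1) x
        rw [this]
        simp [pd, fderiv_fun_add (diffAt_of_contDiffOn O.2 (smoothFn_smooth f) x.2) (diffAt_of_contDiffOn O.2 (smoothFn_smooth g) x.2)]
      map_smul' := fun c f => by
        ext x
        have := pd_congr O.2 (F := extZero O (c • f).1) (G := fun y => c * extZero O f.1 y)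
          (fun y hy => by lift y to O using hy; simp [extZero_apply]) i x.2
        change pd i (extZero O (c • f).1) x = c * pd i (extZero O f.1) x
        rw [this]
        simp [pd, fderiv_const_mul (diffAt_of_contDiffOn O.2 (smoothFn_smooth f) x.2)] }
    (fun f g => by
      ext x
      have := pd_congr O.2 (F := extZero O (f * g).1) (G := fun y => extZero O f.1 y * extZero O g.1 y)
        (fun y hy => by lift y to O using hy; simp [extZero_apply]) i x.2
      change pd i (extZero O (f * g).1) x = f.1 x * pd i (extZero O g.1) x + g.1 x * pd i (extZero O f.1) x
      rw [this, ← extZero_apply f.1, ← extZero_apply g.1]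
      simp [pd, fderiv_fun_mul (diffAt_of_contDiffOn O.2 (smoothFn_smooth f) x.2) (diffAt_of_contDiffOn O.2 (smoothFn_smooth g) x.2)])

theorem sd_toSm (i : Fin 2) (F : E → ℝ) (hF : ContDiffOn ℝ ∞ F O) :
    sd O i (toSm F hF) = toSm (pd i F) (contDiffOn_pd O.2 hF i) := by
  ext x
  exact pd_congr O.2 (extZero_eqOn F) i x.2

theorem toSm_extZero (f : SmoothFn O) : toSm (extZero O f.1) (smoothFn_smooth f) = f := by
  ext x
  exact extZero_apply _ _

theorem sd_comm (f : SmoothFn O) : sd O 0 (sd O 1 f) = sd O 1 (sd O 0 f) := by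
  rw [← toSm_extZero f, sd_toSm, sd_toSm, sd_toSm, sd_toSm]
  ext x
  exact pd_comm O.2 (smoothFn_smooth f) 0 1 x.2

end FracLin

namespace FracLin

/-! ### Differential algebra of relative Killing covectors on a surface -/

section algebra

variable {R : Type*} [CommRing R] [Algebra ℝ R] {D : Fin 2 → Derivation ℝ R R}
  {g : Fin 2 → Fin 2 → R} {G : Fin 2 → Fin 2 → Fin 2 → R} {K : R}

/-- A symmetric connection `G`, compatible with a metric `g` of curvature `K`, in a ring with two
commuting derivations. -/
structure MetricConn (D : Fin 2 → Derivation ℝ R R) (g : Fin 2 → Fin 2 → R)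
    (G : Fin 2 → Fin 2 → Fin 2 → R) (K : R) : Prop where
  comm : ∀ f, D 0 (D 1 f) = D 1 (D 0 f)
  g_symm : g 1 0 = g 0 1
  G_symm : ∀ k, G k 1 0 = G k 0 1
  compat : ∀ k i j, D k (g i j) = ∑ m, (G m k i * g m j + G m k j * g i m)
  curv00 : D 0 (G 0 1 0) - D 1 (G 0 0 0) + ∑ n, (G 0 0 n * G n 1 0 - G 0 1 n * G n 0 0) = K * g 0 1
  curv01 : D 0 (G 0 1 1) - D 1 (G 0 0 1) + ∑ n, (G 0 0 n * G n 1 1 - G 0 1 n * G n 0 1) = K * g 1 1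
  curv10 : D 0 (G 1 1 0) - D 1 (G 1 0 0) + ∑ n, (G 1 0 n * G n 1 0 - G 1 1 n * G n 0 0) =
    -(K * g 0 0)
  curv11 : D 0 (G 1 1 1) - D 1 (G 1 0 1) + ∑ n, (G 1 0 n * G n 1 1 - G 1 1 n * G n 0 1) =
    -(K * g 0 1)

/-- The relative Killing equation for a covector `a` with cofactor `L`; `r` is the skew part of
the covariant derivative. -/
structure RelKilling (D : Fin 2 → Derivation ℝ R R) (G : Fin 2 → Fin 2 → Fin 2 → R)
    (L a : Fin 2 → R) (r : R) : Prop where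
  diag : ∀ i, D i (a i) = ∑ k, G k i i * a k + L i * a i
  up : D 0 (a 1) = ∑ k, G k 0 1 * a k + L 0 * a 1 + r
  down : D 1 (a 0) = ∑ k, G k 1 0 * a k + L 1 * a 0 - r

/-- The Killing equation fixes every first derivative of a except for the skew part r. Commuting
second derivatives of a₀ produces D₀r, and of a₁ produces D₁r, so no new unknown appears after one
prolongation. The connection terms assemble into the curvature. -/
theorem RelKilling.deriv_skew (h : MetricConn D g G K) {L a : Fin 2 → R} {r : R}
    (ha : RelKilling D G L a r) (k : Fin 2) :
    D k r = (∑ m, G m k m) * r + L k * r + (D 0 (L 1) - D 1 (L 0)) * a k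
      + K * (g k 1 * a 0 - g k 0 * a 1) := by
  have d0 := ha.diag 0
  have d1 := ha.diag 1
  have u := ha.up
  have d := ha.down
  have c00 := h.curv00
  have c01 := h.curv01
  have c10 := h.curv10
  have c11 := h.curv11
  have s0 := h.G_symm 0
  have s1 := h.G_symm 1
  have gs := h.g_symm
  simp only [Fin.sum_univ_two] at d0 d1 u d c00 c01 c10 c11
  fin_cases k
  · have e := h.comm (a 0)
    rw [d, d0] at e
    simp only [map_add, map_sub, Derivation.leibniz, smul_eq_mul, d0, d1, u, d, s0, s1] at e
    simp only [s0, s1] at c00 c01 c10 c11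
    simp only [Fin.sum_univ_two, Fin.zero_eta, s0, s1]
    linear_combination -e + a 0 * c00 + a 1 * c10
  · have e := h.comm (a 1)
    rw [d1, u] at e
    simp only [map_add, map_sub, Derivation.leibniz, smul_eq_mul, d0, d1, u, d, s0, s1] at e
    simp only [s0, s1] at c00 c01 c10 c11
    simp only [Fin.sum_univ_two, Fin.mk_one, s0, s1, gs]
    linear_combination -e + a 0 * c01 + a 1 * c11

/-- A metric connection has trace-free curvature: in the sum of the two diagonal curvature equations
the terms K g₀₁ cancel. -/
theorem MetricConn.trace_closed (h : MetricConn D g G K) :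
    D 0 (∑ m, G m 1 m) = D 1 (∑ m, G m 0 m) := by
  have c00 := h.curv00
  have c11 := h.curv11
  have s0 := h.G_symm 0
  have s1 := h.G_symm 1
  simp only [Fin.sum_univ_two, s0, s1] at c00 c11
  simp only [Fin.sum_univ_two, s0, s1, map_add]
  linear_combination c00 + c11

/-- The derivatives of r are now known, so D₀D₁r = D₁D₀r is an algebraic condition, linear in (a₀,
a₁, r), with coefficients made from the metric and the curvature of the cofactor. -/
theorem RelKilling.integrability (h : MetricConn D g G K) {L a : Fin 2 → R} {r Om : R}
    (hOm : Om = D 0 (L 1) - D 1 (L 0)) (ha : RelKilling D G L a r) :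
    (D 0 Om - (∑ m, G m 0 m) * Om - (D 0 K * g 0 1 - D 1 K * g 0 0)) * a 1
      - (D 1 Om - (∑ m, G m 1 m) * Om - (D 0 K * g 1 1 - D 1 K * g 0 1)) * a 0
      + 3 * Om * r = 0 := by
  have d0 := ha.diag 0
  have d1 := ha.diag 1
  have u := ha.up
  have d := ha.down
  have s0 := h.G_symm 0
  have s1 := h.G_symm 1
  have gs := h.g_symm
  have r0 := ha.deriv_skew h 0
  have r1 := ha.deriv_skew h 1
  have t := h.trace_closed
  have k1 := h.compat 0 0 1
  have k2 := h.compat 0 1 1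
  have k3 := h.compat 1 0 0
  have k4 := h.compat 1 0 1
  rw [← hOm] at r0 r1
  simp only [Fin.sum_univ_two, s0, s1, gs] at d0 d1 u d r0 r1 t k1 k2 k3 k4
  have e := h.comm r
  rw [r1, r0] at e
  simp only [map_add, map_sub, Derivation.leibniz, smul_eq_mul, d0, d1, u, d, r0, r1, k1, k2, k3,
    k4] at e
  simp only [map_add] at t
  simp only [Fin.sum_univ_two, s0, s1]
  linear_combination e - r * t + r * hOm

/-- The determinant of two covectors. -/
def wedge (a b : Fin 2 → R) : R := a 0 * b 1 - a 1 * b 0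

/-- The symmetric part of the equation acts on a determinant by the trace and twice the cofactor.
What is left, a s - b r, is the gradient of the determinant at its zeros. -/
theorem RelKilling.deriv_wedge (h : MetricConn D g G K) {L a b : Fin 2 → R} {r s : R}
    (ha : RelKilling D G L a r) (hb : RelKilling D G L b s) (k : Fin 2) :
    D k (wedge a b) = (∑ m, G m k m + 2 * L k) * wedge a b + (a k * s - b k * r) := by
  have d0 := ha.diag 0
  have d1 := ha.diag 1
  have u := ha.up
  have d := ha.down
  have d0' := hb.diag 0
  have d1' := hb.diag 1
  have u' := hb.up
  have d' := hb.down
  have s0 := h.G_symm 0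
  have s1 := h.G_symm 1
  simp only [Fin.sum_univ_two, s0, s1] at d0 d1 u d d0' d1' u' d'
  fin_cases k
  · simp only [wedge, map_sub, Derivation.leibniz, smul_eq_mul, Fin.zero_eta, d0, u, d0', u',
      Fin.sum_univ_two, s0, s1]
    ring
  · simp only [wedge, map_sub, Derivation.leibniz, smul_eq_mul, Fin.mk_one, d1, d, d1', d',
      Fin.sum_univ_two, s0, s1]
    ring

/-- The density `∗dK`. -/
def curvForm (D : Fin 2 → Derivation ℝ R R) (g : Fin 2 → Fin 2 → R) (K : R) (k : Fin 2) : R :=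
  D 0 K * g k 1 - D 1 K * g k 0

/-- Eliminates between the integrability conditions of a and of b: the combination with weights -b k
and a k turns the coefficients into the determinant. -/
theorem RelKilling.deriv_curvature (h : MetricConn D g G K) {L a b : Fin 2 → R} {r s Om : R}
    (hOm : Om = D 0 (L 1) - D 1 (L 0))
    (ha : RelKilling D G L a r) (hb : RelKilling D G L b s) (k : Fin 2) :
    wedge a b * (D k Om - (∑ m, G m k m) * Om - curvForm D g K k)
      + 3 * Om * (a k * s - b k * r) = 0 := by
  have e1 := ha.integrability h hOm
  have e2 := hb.integrability h hOm
  have gs := h.g_symm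
  fin_cases k
  · simp only [wedge, curvForm, Fin.zero_eta]
    linear_combination a 0 * e2 - b 0 * e1
  · simp only [wedge, curvForm, Fin.mk_one, gs]
    linear_combination a 1 * e2 - b 1 * e1

/-- The exponent 3 matches the factor 3 in front of Ω(a s - b r): in the product with w³ the skew
derivatives r and s cancel, and no division by w remains. This is the form of the equation that
makes sense across the zeros of w. -/
theorem RelKilling.deriv_curvature_mul (h : MetricConn D g G K) {L a b : Fin 2 → R} {r s Om : R}
    (hOm : Om = D 0 (L 1) - D 1 (L 0))
    (ha : RelKilling D G L a r) (hb : RelKilling D G L b s) (k : Fin 2) :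
    D k (Om * wedge a b ^ 3) = (4 * ∑ m, G m k m + 6 * L k) * (Om * wedge a b ^ 3)
      + curvForm D g K k * wedge a b ^ 3 := by
  have e1 := ha.deriv_curvature h hOm hb k
  have e2 := ha.deriv_wedge h hb k
  rw [Derivation.leibniz, Derivation.leibniz_pow, e2]
  simp only [smul_eq_mul, nsmul_eq_mul]
  push_cast
  linear_combination wedge a b ^ 2 * e1

/-- In constant curvature the curvature of the cofactor vanishes where the covectors are
independent. -/
theorem RelKilling.curvature_sq_mul (h : MetricConn D g G K) {L a b : Fin 2 → R} {r s Om : R}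
    (hOm : Om = D 0 (L 1) - D 1 (L 0))
    (ha : RelKilling D G L a r) (hb : RelKilling D G L b s) (h0 : D 0 K = 0) (h1 : D 1 K = 0) :
    6 * (Om ^ 2 * wedge a b ^ 3) = 0 := by
  have e0 := ha.deriv_curvature_mul h hOm hb 0
  have e1 := ha.deriv_curvature_mul h hOm hb 1
  have t := h.trace_closed
  simp only [curvForm, h0, h1, zero_mul, sub_zero, add_zero] at e0 e1
  have z : ∀ i, D i (4 : R) = 0 := fun i => by simpa using (D i).map_natCast 4
  have z6 : ∀ i, D i (6 : R) = 0 := fun i => by simpa using (D i).map_natCast 6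
  -- For q = Ωw³ there remains Dq = (4T + 6L)q. Since T is closed, commuting the two derivatives of
  -- q leaves only the curvature of 6L, that is 6Ωq = 0.
  suffices H : 6 * Om * (Om * wedge a b ^ 3) = 0 by linear_combination H
  generalize Om * wedge a b ^ 3 = q at e0 e1 ⊢
  have e := h.comm q
  rw [e1, e0] at e
  simp only [Derivation.leibniz, map_add, z, z6, e0, e1, smul_eq_mul, mul_zero, add_zero] at e t
  linear_combination e - 4 * q * t + 6 * q * hOm

/-- The connection form `m` of the projectively flat connection of a fractional-linear integral,
where its numerator and denominator are independent. -/
structure CharForm (D : Fin 2 → Derivation ℝ R R) (g : Fin 2 → Fin 2 → R)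
    (G : Fin 2 → Fin 2 → Fin 2 → R) (K : R) (m : Fin 2 → R) (Om : R) : Prop where
  diag : ∀ i, D i (m i) = ∑ n, G n i i * m n + m i * m i + K * g i i
  up : D 0 (m 1) = ∑ n, G n 0 1 * m n + m 0 * m 1 + K * g 0 1 + Om
  down : D 1 (m 0) = ∑ n, G n 0 1 * m n + m 0 * m 1 + K * g 0 1 - Om
  deriv : ∀ k, D k Om = (∑ n, G n k n) * Om + 3 * Om * m k + curvForm D g K k

/-- The vector m = (b r - a s)/w depends neither on a common rescaling of the pair nor on a constant
linear change of it. Its derivatives follow from those of a, b, r, s, and the cofactor enters the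
result only through Ω. -/
theorem RelKilling.charForm (h : MetricConn D g G K) {L a b m : Fin 2 → R} {r s Om : R}
    (hOm : Om = D 0 (L 1) - D 1 (L 0)) (ha : RelKilling D G L a r) (hb : RelKilling D G L b s)
    (hw : IsUnit (wedge a b)) (hm : ∀ k, m k * wedge a b = b k * r - a k * s) :
    CharForm D g G K m Om := by
  have W := ha.deriv_wedge h hb
  have ra := ha.deriv_skew h
  have rb := hb.deriv_skew h
  rw [← hOm] at ra rb
  have gs := h.g_symm
  have s0 := h.G_symm 0
  have s1 := h.G_symm 1
  have key : ∀ i k, wedge a b * D i (m k) = D i (b k) * r + b k * D i r - D i (a k) * s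
      - a k * D i s - m k * D i (wedge a b) := fun i k => by
    have e := congrArg (D i) (hm k)
    simp only [map_sub, Derivation.leibniz, smul_eq_mul] at e
    linear_combination e
  have da := ha.diag
  have ua := ha.up
  have wa := ha.down
  have db := hb.diag
  have ub := hb.up
  have wb := hb.down
  simp only [Fin.sum_univ_two, s0, s1] at W ra rb da ua wa db ub wb
  refine ⟨fun i => ?_, ?_, ?_, fun k => ?_⟩
  · refine hw.mul_left_cancel ?_
    rw [key, da, db, ra, rb, W]
    simp only [Fin.sum_univ_two]
    have m0 := hm 0
    have m1 := hm 1
    fin_cases i <;> simp only [wedge, Fin.zero_eta, Fin.mk_one, gs, s0, s1] at m0 m1 ⊢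
    · linear_combination (-G 0 0 0 - 2 * L 0 - G 0 0 0 - G 1 0 1 - m 0) * m0 - G 1 0 0 * m1
    · linear_combination (-G 0 1 1) * m0 + (-2 * L 1 - G 1 1 1 - G 0 0 1 - G 1 1 1 - m 1) * m1
  · refine hw.mul_left_cancel ?_
    rw [key, ua, ub, ra, rb, W]
    simp only [Fin.sum_univ_two]
    have m0 := hm 0
    have m1 := hm 1
    simp only [wedge, gs, s0, s1] at m0 m1 ⊢
    linear_combination (-G 0 0 1 - m 1) * m0 - (G 1 0 1 + 2 * L 0 + G 0 0 0 + G 1 0 1) * m1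
  · refine hw.mul_left_cancel ?_
    rw [key, wa, wb, ra, rb, W]
    simp only [Fin.sum_univ_two]
    have m0 := hm 0
    have m1 := hm 1
    simp only [wedge, gs, s0, s1] at m0 m1 ⊢
    linear_combination (-G 0 0 1 - 2 * L 1 - G 0 0 1 - G 1 1 1) * m0 - (G 1 0 1 + m 0) * m1
  · refine hw.mul_left_cancel ?_
    linear_combination ha.deriv_curvature h hOm hb k - 3 * Om * hm k

/-- The coefficient of order zero in the first integrability condition. -/
def intCoeff (D : Fin 2 → Derivation ℝ R R) (g : Fin 2 → Fin 2 → R)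
    (G : Fin 2 → Fin 2 → Fin 2 → R) (K : R) : R :=
  D 0 (curvForm D g K 1) - D 1 (curvForm D g K 0)
    - (∑ n, G n 0 n) * curvForm D g K 1 + (∑ n, G n 1 n) * curvForm D g K 0

/-- Commuting derivatives of Ω: the terms in m₀m₁ are symmetric and drop out, while the
antisymmetric part of Dm is 2Ω, whence 6Ω². -/
theorem CharForm.integrability (h : MetricConn D g G K) {m : Fin 2 → R} {Om : R}
    (hm : CharForm D g G K m Om) :
    6 * Om ^ 2 + 3 * (curvForm D g K 0 * m 1 - curvForm D g K 1 * m 0) + intCoeff D g G K = 0 := by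
  have u := hm.up
  have d := hm.down
  have e0 := hm.deriv 0
  have e1 := hm.deriv 1
  have t := h.trace_closed
  unfold intCoeff
  generalize curvForm D g K 0 = k0 at *
  generalize curvForm D g K 1 = k1 at *
  generalize (∑ n, G n 0 n) = T0 at *
  generalize (∑ n, G n 1 n) = T1 at *
  have z : ∀ i, D i (3 : R) = 0 := fun i => by simpa using (D i).map_natCast 3
  have e := h.comm Om
  rw [e1, e0] at e
  simp only [map_add, Derivation.leibniz, z, e0, e1, u, d, smul_eq_mul] at e
  linear_combination e - Om * t

/-- The linear part of the second integrability condition. -/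
def intLin (D : Fin 2 → Derivation ℝ R R) (g : Fin 2 → Fin 2 → R)
    (G : Fin 2 → Fin 2 → Fin 2 → R) (K : R) (i j : Fin 2) : R :=
  3 * (curvForm D g K 0 * G j i 1 - curvForm D g K 1 * G j i 0
    + (if j = 1 then D i (curvForm D g K 0) else -D i (curvForm D g K 1)))

/-- The part of order zero of the second integrability condition. -/
def intConst (D : Fin 2 → Derivation ℝ R R) (g : Fin 2 → Fin 2 → R)
    (G : Fin 2 → Fin 2 → Fin 2 → R) (K : R) (i : Fin 2) : R :=
  3 * K * (curvForm D g K 0 * g i 1 - curvForm D g K 1 * g i 0) + D i (intCoeff D g G K)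

/-- Differentiating the first condition gives no new unknowns, because the derivatives of m and Ω
are expressed by m and Ω. After reduction by that condition the result is linear in m. -/
theorem CharForm.integrability_deriv (h : MetricConn D g G K) {m : Fin 2 → R} {Om : R}
    (hm : CharForm D g G K m Om) (i : Fin 2) :
    (30 * Om ^ 2 - intCoeff D g G K) * m i + ∑ j, intLin D g G K i j * m j
      + 12 * (∑ n, G n i n) * Om ^ 2 + 15 * curvForm D g K i * Om + intConst D g G K i = 0 := by
  have C := hm.integrability h
  have e := congrArg (D i) C
  have z : ∀ i, D i (3 : R) = 0 := fun i => by simpa using (D i).map_natCast 3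
  have z6 : ∀ i, D i (6 : R) = 0 := fun i => by simpa using (D i).map_natCast 6
  have s0 := h.G_symm 0
  have s1 := h.G_symm 1
  have gs := h.g_symm
  have u := hm.up
  have d := hm.down
  have d0 := hm.diag 0
  have d1 := hm.diag 1
  have eO0 := hm.deriv 0
  have eO1 := hm.deriv 1
  simp only [intLin, intConst, Fin.sum_univ_two, one_ne_zero, zero_ne_one, if_true, if_false] at *
  generalize hk0 : curvForm D g K 0 = k0 at *
  generalize hk1 : curvForm D g K 1 = k1 at *
  generalize intCoeff D g G K = c at *
  fin_cases i
  · simp only [map_add, map_sub, map_zero, Derivation.leibniz, Derivation.leibniz_pow, z, z6, eO0,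
      u, d0, smul_eq_mul, Fin.zero_eta, hk0, s0, s1, gs, nsmul_eq_mul] at e C ⊢
    push_cast at e
    -- Subtracting m times the first condition removes all terms quadratic in m and turns 36Ω²m into
    -- 30Ω²m.
    linear_combination e - m 0 * C
  · simp only [map_add, map_sub, map_zero, Derivation.leibniz, Derivation.leibniz_pow, z, z6, eO1,
      d, d1, smul_eq_mul, Fin.mk_one, hk1, s0, s1, gs, nsmul_eq_mul] at e C ⊢
    push_cast at e
    linear_combination e - m 1 * C

end algebra

end FracLin

namespace FracLin

/-! ### The Levi-Civita connection in coordinates -/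

section metric

variable {g : E → Matrix (Fin 2) (Fin 2) ℝ} {U : Set E}

theorem IsMetric.symm (hg : IsMetric g U) {x : E} (hx : x ∈ U) : g x 1 0 = g x 0 1 := by
  simpa using (hg.posDef x hx).1.apply 0 1

theorem IsMetric.det_pos (hg : IsMetric g U) {x : E} (hx : x ∈ U) :
    0 < g x 0 0 * g x 1 1 - g x 0 1 * g x 0 1 := by
  have := (hg.posDef x hx).det_pos
  rw [Matrix.det_fin_two, hg.symm hx] at this
  exact this

theorem IsMetric.inv_apply (hg : IsMetric g U) {x : E} (hx : x ∈ U) :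
    (g x)⁻¹ 0 0 = g x 1 1 / (g x 0 0 * g x 1 1 - g x 0 1 * g x 0 1) ∧
    (g x)⁻¹ 0 1 = -g x 0 1 / (g x 0 0 * g x 1 1 - g x 0 1 * g x 0 1) ∧
    (g x)⁻¹ 1 0 = -g x 0 1 / (g x 0 0 * g x 1 1 - g x 0 1 * g x 0 1) ∧
    (g x)⁻¹ 1 1 = g x 0 0 / (g x 0 0 * g x 1 1 - g x 0 1 * g x 0 1) := by
  simp only [Matrix.inv_def, Matrix.smul_apply, Ring.inverse_eq_inv', smul_eq_mul,
    Matrix.adjugate_fin_two, Matrix.det_fin_two, hg.symm hx]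
  simp [div_eq_inv_mul]

theorem IsMetric.smooth_inv (hg : IsMetric g U) (i j : Fin 2) :
    ContDiffOn ℝ ∞ (fun x => (g x)⁻¹ i j) U := by
  have hd : ContDiffOn ℝ ∞ (fun x => g x 0 0 * g x 1 1 - g x 0 1 * g x 0 1) U :=
    ((hg.smooth 0 0).mul (hg.smooth 1 1)).sub ((hg.smooth 0 1).mul (hg.smooth 0 1))
  have hn : ∀ x ∈ U, g x 0 0 * g x 1 1 - g x 0 1 * g x 0 1 ≠ 0 := fun x hx => (hg.det_pos hx).ne'
  fin_cases i <;> fin_cases j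
  · exact ((hg.smooth 1 1).div hd hn).congr fun x hx => (hg.inv_apply hx).1
  · exact ((hg.smooth 0 1).neg.div hd hn).congr fun x hx => (hg.inv_apply hx).2.1
  · exact ((hg.smooth 0 1).neg.div hd hn).congr fun x hx => (hg.inv_apply hx).2.2.1
  · exact ((hg.smooth 0 0).div hd hn).congr fun x hx => (hg.inv_apply hx).2.2.2

theorem IsMetric.smooth_christoffel (hg : IsMetric g U) (hU : IsOpen U) (k i j : Fin 2) :
    ContDiffOn ℝ ∞ (christoffel g k i j) U := by
  unfold christoffel
  exact contDiffOn_const.mul (ContDiffOn.sum fun l _ => (hg.smooth_inv k l).mul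
    (((contDiffOn_pd hU (hg.smooth j l) i).add (contDiffOn_pd hU (hg.smooth i l) j)).sub
      (contDiffOn_pd hU (hg.smooth i j) l)))

theorem IsMetric.smooth_riemann (hg : IsMetric g U) (hU : IsOpen U) (l i j k : Fin 2) :
    ContDiffOn ℝ ∞ (riemann g l i j k) U := by
  have hc := hg.smooth_christoffel hU
  unfold riemann
  exact ((contDiffOn_pd hU (hc l j k) i).sub (contDiffOn_pd hU (hc l i k) j)).add
    (ContDiffOn.sum fun m _ => ((hc l i m).mul (hc m j k)).sub ((hc l j m).mul (hc m i k)))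

theorem IsMetric.smooth_gaussK (hg : IsMetric g U) (hU : IsOpen U) :
    ContDiffOn ℝ ∞ (gaussK g) U := by
  unfold gaussK
  refine ContDiffOn.div (ContDiffOn.sum fun l _ => (hg.smooth 0 l).mul
    (hg.smooth_riemann hU l 0 1 1)) ?_ fun x hx => (hg.posDef x hx).det_pos.ne'
  simp only [Matrix.det_fin_two]
  exact ((hg.smooth 0 0).mul (hg.smooth 1 1)).sub ((hg.smooth 0 1).mul (hg.smooth 1 0))

theorem IsMetric.pd_symm (hg : IsMetric g U) (hU : IsOpen U) {x : E} (hx : x ∈ U) (k : Fin 2) :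
    pd k (fun y => g y 1 0) x = pd k (fun y => g y 0 1) x :=
  pd_congr hU (F := fun y => g y 1 0) (G := fun y => g y 0 1) (fun _ hy => hg.symm hy) k hx

theorem IsMetric.christoffel_symm (hg : IsMetric g U) (hU : IsOpen U) {x : E} (hx : x ∈ U)
    (k : Fin 2) : christoffel g k 1 0 x = christoffel g k 0 1 x := by
  simp only [christoffel, Fin.sum_univ_two, hg.pd_symm hU hx]
  ring

theorem IsMetric.compat (hg : IsMetric g U) (hU : IsOpen U) {x : E} (hx : x ∈ U)
    (k i j : Fin 2) : pd k (fun y => g y i j) x =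
      ∑ m, (christoffel g m k i x * g x m j + christoffel g m k j x * g x i m) := by
  have hd := (hg.det_pos hx).ne'
  obtain ⟨h1, h2, h3, h4⟩ := hg.inv_apply hx
  generalize hD : g x 0 0 * g x 1 1 - g x 0 1 * g x 0 1 = d at hd h1 h2 h3 h4
  simp only [christoffel, Fin.sum_univ_two, h1, h2, h3, h4]
  fin_cases k <;> fin_cases i <;> fin_cases j <;>
    simp only [Fin.zero_eta, Fin.mk_one, hg.pd_symm hU hx, hg.symm hx] <;> field_simp <;>
    rw [← hD] <;> ring

variable {O : TopologicalSpace.Opens E}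

/-- The components of the metric as smooth functions on `O`. -/
noncomputable def metSm (hg : IsMetric g O) (i j : Fin 2) : SmoothFn O :=
  toSm (fun x => g x i j) (hg.smooth i j)

/-- The Christoffel symbols as smooth functions on `O`. -/
noncomputable def chrSm (hg : IsMetric g O) (k i j : Fin 2) : SmoothFn O :=
  toSm (christoffel g k i j) (hg.smooth_christoffel O.2 k i j)

/-- The Gaussian curvature as a smooth function on `O`. -/
noncomputable def curvSm (hg : IsMetric g O) : SmoothFn O :=
  toSm (gaussK g) (hg.smooth_gaussK O.2)

theorem IsMetric.riemSm (hg : IsMetric g O) (m j : Fin 2) :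
    toSm (riemann g m 0 1 j) (hg.smooth_riemann O.2 m 0 1 j) =
      sd O 0 (chrSm hg m 1 j) - sd O 1 (chrSm hg m 0 j)
        + ∑ n, (chrSm hg m 0 n * chrSm hg n 1 j - chrSm hg m 1 n * chrSm hg n 0 j) := by
  simp only [chrSm, sd_toSm, Fin.sum_univ_two]
  ext x
  simp [toSm, riemann, Fin.sum_univ_two]
  ring

theorem IsMetric.compatSm (hg : IsMetric g O) (k i j : Fin 2) : sd O k (metSm hg i j) =
    ∑ m, (chrSm hg m k i * metSm hg m j + chrSm hg m k j * metSm hg i m) := by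
  simp only [metSm, sd_toSm, Fin.sum_univ_two]
  ext x
  have := hg.compat O.2 x.2 k i j
  simpa [toSm, chrSm, Fin.sum_univ_two] using this

/-- Commute the second derivatives of the metric components and expand both sides by compatibility:
what survives is the curvature contracted with the metric and symmetrised. -/
theorem IsMetric.riem_skew (hg : IsMetric g O) (i j : Fin 2) :
    ∑ m, (metSm hg m i * toSm (riemann g m 0 1 j) (hg.smooth_riemann O.2 m 0 1 j)
      + metSm hg m j * toSm (riemann g m 0 1 i) (hg.smooth_riemann O.2 m 0 1 i)) = 0 := by
  have e := sd_comm (metSm hg i j)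
  have gs : metSm hg 1 0 = metSm hg 0 1 := by ext x; exact hg.symm x.2
  rw [hg.compatSm, hg.compatSm] at e
  simp only [hg.riemSm, Fin.sum_univ_two, map_add, Derivation.leibniz, smul_eq_mul,
    hg.compatSm] at e ⊢
  fin_cases i <;> fin_cases j <;> simp only [Fin.zero_eta, Fin.mk_one, gs] at e ⊢ <;>
    linear_combination e

/-- In dimension two skewness leaves one independent component, which is K times the area; the four
formulas come from solving the three skewness relations together with the definition of K. -/
theorem IsMetric.riem_eq (hg : IsMetric g O) {x : E} (hx : x ∈ O) :
    riemann g 0 0 1 0 x = gaussK g x * g x 0 1 ∧ riemann g 0 0 1 1 x = gaussK g x * g x 1 1 ∧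
    riemann g 1 0 1 0 x = -(gaussK g x * g x 0 0) ∧
    riemann g 1 0 1 1 x = -(gaussK g x * g x 0 1) := by
  have hd := (hg.det_pos hx).ne'
  have e : ∀ i j, ∑ m, (g x m i * riemann g m 0 1 j x + g x m j * riemann g m 0 1 i x) = 0 :=
    fun i j => by
      have := congrArg (fun f : SmoothFn O => f.1 ⟨x, hx⟩) (hg.riem_skew i j)
      simpa [Fin.sum_univ_two, metSm] using this
  have hk : gaussK g x * (g x 0 0 * g x 1 1 - g x 0 1 * g x 0 1) =
      g x 0 0 * riemann g 0 0 1 1 x + g x 0 1 * riemann g 1 0 1 1 x := by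
    unfold gaussK
    rw [Matrix.det_fin_two, hg.symm hx, div_mul_cancel₀ _ hd, Fin.sum_univ_two]
  have e00 := e 0 0
  have e01 := e 0 1
  have e11 := e 1 1
  simp only [Fin.sum_univ_two, hg.symm hx] at e00 e01 e11
  refine ⟨mul_left_cancel₀ hd ?_, mul_left_cancel₀ hd ?_, mul_left_cancel₀ hd ?_,
    mul_left_cancel₀ hd ?_⟩
  · linear_combination g x 1 1 / 2 * e00 - g x 0 1 * e01 - g x 0 1 * hk
  · linear_combination (-g x 1 1) * hk - g x 0 1 / 2 * e11
  · linear_combination g x 0 0 * e01 - g x 0 1 / 2 * e00 + g x 0 0 * hk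
  · linear_combination g x 0 0 / 2 * e11 + g x 0 1 * hk

theorem IsMetric.metricConn (hg : IsMetric g O) :
    MetricConn (sd O) (metSm hg) (chrSm hg) (curvSm hg) where
  comm := sd_comm
  g_symm := by ext x; exact hg.symm x.2
  G_symm k := by ext x; exact hg.christoffel_symm O.2 x.2 k
  compat := hg.compatSm
  curv00 := by rw [← hg.riemSm]; ext x; exact (hg.riem_eq x.2).1
  curv01 := by rw [← hg.riemSm]; ext x; exact (hg.riem_eq x.2).2.1
  curv10 := by rw [← hg.riemSm]; ext x; exact (hg.riem_eq x.2).2.2.1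
  curv11 := by rw [← hg.riemSm]; ext x; exact (hg.riem_eq x.2).2.2.2

end metric

end FracLin

namespace FracLin

/-! ### The relative Killing equation of the numerator and the denominator -/

variable {g : E → Matrix (Fin 2) (Fin 2) ℝ} {O : TopologicalSpace.Opens E}

theorem contDiffOn_comp {U : Set E} {X : E → E} (hX : ContDiffOn ℝ ∞ X U) (i : Fin 2) :
    ContDiffOn ℝ ∞ (fun x => X x i) U := contDiffOn_pi.1 hX i

/-- The components of the covector field dual to the vector field `X`. -/
noncomputable def low (g : E → Matrix (Fin 2) (Fin 2) ℝ) (X : E → E) (j : Fin 2) (x : E) : ℝ :=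
  ∑ i, g x j i * X x i

theorem low_smooth {U : Set E} (hg : IsMetric g U) {X : E → E} (hX : ContDiffOn ℝ ∞ X U)
    (j : Fin 2) : ContDiffOn ℝ ∞ (low g X j) U :=
  ContDiffOn.sum fun i _ => (hg.smooth j i).mul (contDiffOn_comp hX i)

theorem low_wedge {U : Set E} (hg : IsMetric g U) (X Y : E → E) {x : E} (hx : x ∈ U) :
    low g X 0 x * low g Y 1 x - low g X 1 x * low g Y 0 x =
      (g x 0 0 * g x 1 1 - g x 0 1 * g x 0 1) * (X x 0 * Y x 1 - X x 1 * Y x 0) := by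
  simp only [low, Fin.sum_univ_two, hg.symm hx]
  ring

theorem low_eq_zero {U : Set E} (hg : IsMetric g U) {X : E → E} {x : E} (hx : x ∈ U)
    (h : ∀ j, low g X j x = 0) : X x = 0 := by
  have hd := (hg.det_pos hx).ne'
  have h0 := h 0
  have h1 := h 1
  simp only [low, Fin.sum_univ_two, hg.symm hx] at h0 h1
  ext i
  fin_cases i
  · refine (mul_eq_zero.1 (?_ : (g x 0 0 * g x 1 1 - g x 0 1 * g x 0 1) * X x 0 = 0)).resolve_left hd
    linear_combination g x 1 1 * h0 - g x 0 1 * h1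
  · refine (mul_eq_zero.1 (?_ : (g x 0 0 * g x 1 1 - g x 0 1 * g x 0 1) * X x 1 = 0)).resolve_left hd
    linear_combination g x 0 0 * h1 - g x 0 1 * h0

/-- The momentum of the velocity `v`. -/
noncomputable def mom (g : E → Matrix (Fin 2) (Fin 2) ℝ) (x v : E) : E :=
  fun a => ∑ b, g x a b * v b

theorem lin_mom {U : Set E} (hg : IsMetric g U) (X : E → E) {x : E} (hx : x ∈ U) (v : E) :
    lin X x (mom g x v) = ∑ j, low g X j x * v j := by
  simp only [lin, mom, low, Fin.sum_univ_two, hg.symm hx]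
  ring

theorem mom_surjective {U : Set E} (hg : IsMetric g U) {x : E} (hx : x ∈ U) (p : E) :
    ∃ v, p = mom g x v := by
  have hd := (hg.det_pos hx).ne'
  refine ⟨![(g x 1 1 * p 0 - g x 0 1 * p 1) / (g x 0 0 * g x 1 1 - g x 0 1 * g x 0 1),
    (g x 0 0 * p 1 - g x 0 1 * p 0) / (g x 0 0 * g x 1 1 - g x 0 1 * g x 0 1)], ?_⟩
  ext i
  generalize hD : g x 0 0 * g x 1 1 - g x 0 1 * g x 0 1 = d at hd
  fin_cases i <;> simp [mom, Fin.sum_univ_two, hg.symm hx] <;> field_simp <;> rw [← hD] <;> ring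

theorem pd_lin (X : E → E) (x p : E) (i : Fin 2) : pd i (fun q => lin X x q) p = X x i := by
  have : (fun q : E => lin X x q) = fun q => X x 0 * q 0 + X x 1 * q 1 := by
    ext q; exact lin_two X x q
  have h0 : HasFDerivAt (fun q : E => X x 0 * q 0 + X x 1 * q 1)
      (X x 0 • ContinuousLinearMap.proj (R := ℝ) (φ := fun _ : Fin 2 => ℝ) 0
        + X x 1 • ContinuousLinearMap.proj (R := ℝ) (φ := fun _ : Fin 2 => ℝ) 1) p :=
    ((hasFDerivAt_apply 0 p).const_mul _).add ((hasFDerivAt_apply 1 p).const_mul _)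
  rw [this, pd, h0.fderiv]
  fin_cases i <;> simp

theorem pd_ham (x p : E) (i : Fin 2) : pd i (fun q => ham g x q) p =
    1 / 2 * ∑ j, ((g x)⁻¹ i j + (g x)⁻¹ j i) * p j := by
  have : (fun q : E => ham g x q) = fun q => (1 / 2) * (((g x)⁻¹ 0 0 * (q 0 * q 0)
      + ((g x)⁻¹ 0 1 + (g x)⁻¹ 1 0) * (q 0 * q 1)) + (g x)⁻¹ 1 1 * (q 1 * q 1)) := by
    ext q; simp only [ham, Fin.sum_univ_two]; ring
  have p0 := hasFDerivAt_apply (𝕜 := ℝ) (0 : Fin 2) p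
  have p1 := hasFDerivAt_apply (𝕜 := ℝ) (1 : Fin 2) p
  have h := ((((p0.mul p0).const_mul ((g x)⁻¹ 0 0)).add
    ((p0.mul p1).const_mul ((g x)⁻¹ 0 1 + (g x)⁻¹ 1 0))).add
    ((p1.mul p1).const_mul ((g x)⁻¹ 1 1))).const_mul (1 / 2)
  have h' : HasFDerivAt (fun q : E => (1 / 2) * (((g x)⁻¹ 0 0 * (q 0 * q 0)
      + ((g x)⁻¹ 0 1 + (g x)⁻¹ 1 0) * (q 0 * q 1)) + (g x)⁻¹ 1 1 * (q 1 * q 1))) _ p := h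
  rw [this, pd, h'.fderiv]
  fin_cases i <;> simp <;> ring

/-- Along a geodesic the pairing of a with the velocity v changes at the rate (∇a)(v, v). In terms
of velocities instead of momenta the bracket is therefore the symmetrised covariant derivative of
the dual covector. -/
theorem poisson_lin (hg : IsMetric g O) {X : E → E} (hX : ContDiffOn ℝ ∞ X O) {x : E}
    (hx : x ∈ O) (v : E) : poisson (ham g) (lin X) x (mom g x v) =
      ∑ i, ∑ j, v i * v j * (pd i (low g X j) x - ∑ k, christoffel g k i j x * low g X k x) := by
  have h := hg.metricConn
  have gs := h.g_symm
  -- The bracket differentiates in x at fixed momentum. The components of the momentum become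
  -- constants c of the ring, and w = g⁻¹c is the velocity field with that momentum at every point;
  -- it equals v at x.
  set c : Fin 2 → SmoothFn O := fun i => algebraMap ℝ _ (mom g x v i) with hc
  have Dc : ∀ i a, sd O i (c a) = 0 := fun i a => (sd O i).map_algebraMap _
  set I : Fin 2 → Fin 2 → SmoothFn O := fun i j => toSm (fun y => (g y)⁻¹ i j) (hg.smooth_inv i j)
  have Is : I 1 0 = I 0 1 := by
    ext y
    exact (hg.inv_apply y.2).2.2.1.trans (hg.inv_apply y.2).2.1.symm
  set w : Fin 2 → SmoothFn O := fun i => ∑ j, I i j * c j with hw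
  have hwv : ∀ i, (w i).1 ⟨x, hx⟩ = v i := by
    intro i
    have hd := (hg.det_pos hx).ne'
    have e : (w i).1 ⟨x, hx⟩ = ∑ j, (g x)⁻¹ i j * mom g x v j := by
      simp [hw, hc, I, Fin.sum_univ_two]
    rw [e]
    clear e
    obtain ⟨h1, h2, h3, h4⟩ := hg.inv_apply hx
    generalize hD : g x 0 0 * g x 1 1 - g x 0 1 * g x 0 1 = d at hd h1 h2 h3 h4
    fin_cases i <;> simp [mom, Fin.sum_univ_two, hg.symm hx, h1, h2, h3, h4] <;> field_simp <;>
      rw [← hD] <;> ring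
  have hcw : ∀ a, c a = ∑ b, metSm hg a b * w b := by
    intro a
    ext y
    have hd := (hg.det_pos y.2).ne'
    obtain ⟨h1, h2, h3, h4⟩ := hg.inv_apply y.2
    have e : ∀ i, (w i).1 y = ∑ j, (g y)⁻¹ i j * mom g x v j := fun i => by
      simp [hw, hc, I, Fin.sum_univ_two]
    have e' : (∑ b, metSm hg a b * w b : SmoothFn O).1 y =
        ∑ b, g y a b * ∑ j, (g y)⁻¹ b j * mom g x v j := by
      simp [Fin.sum_univ_two, e, metSm]
    rw [e']
    generalize hD : g y 0 0 * g y 1 1 - g y 0 1 * g y 0 1 = d at hd h1 h2 h3 h4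
    fin_cases a <;> simp [hc, Fin.sum_univ_two, hg.symm y.2, h1, h2, h3, h4] <;> field_simp <;>
      rw [← hD] <;> ring
  set Y : Fin 2 → SmoothFn O := fun i => toSm (fun y => X y i) (contDiffOn_comp hX i) with hY
  have eh : ∀ i, pd i (fun y => ham g y (mom g x v)) x =
      (1 / 2) * (∑ a, c a * sd O i (w a) : SmoothFn O).1 ⟨x, hx⟩ := by
    intro i
    have hs : ContDiffOn ℝ ∞ (fun y => ham g y (mom g x v)) O := by
      unfold ham
      exact contDiffOn_const.mul (ContDiffOn.sum fun i _ => ContDiffOn.sum fun j _ =>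
        ((hg.smooth_inv i j).mul contDiffOn_const).mul contDiffOn_const)
    have e1 : toSm _ hs = (1 / 2 : ℝ) • ∑ a, c a * w a := by
      ext y
      simp [toSm, hw, hc, I, ham, Fin.sum_univ_two]
      ring
    have e2 := congrArg (fun f : SmoothFn O => f.1 ⟨x, hx⟩) (congrArg (sd O i) e1)
    rw [sd_toSm] at e2
    simp only [toSm_apply] at e2
    rw [e2]
    simp [Fin.sum_univ_two, Derivation.leibniz, Dc]
    ring
  have el : ∀ i, pd i (fun y => lin X y (mom g x v)) x =
      (∑ j, c j * sd O i (Y j) : SmoothFn O).1 ⟨x, hx⟩ := by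
    intro i
    have hs : ContDiffOn ℝ ∞ (fun y => lin X y (mom g x v)) O := by
      unfold lin
      exact ContDiffOn.sum fun i _ => (contDiffOn_comp hX i).mul contDiffOn_const
    have e1 : toSm _ hs = ∑ a, c a * Y a := by
      ext y
      simp [toSm, hc, hY, lin, Fin.sum_univ_two]
      ring
    have e2 := congrArg (fun f : SmoothFn O => f.1 ⟨x, hx⟩) (congrArg (sd O i) e1)
    rw [sd_toSm] at e2
    simp only [toSm_apply] at e2
    rw [e2]
    simp [Fin.sum_univ_two, Derivation.leibniz, Dc]
  have ep : ∀ i, pd i (fun q => ham g x q) (mom g x v) = (w i).1 ⟨x, hx⟩ := by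
    intro i
    obtain ⟨h1, h2, h3, h4⟩ := hg.inv_apply hx
    have e : (w i).1 ⟨x, hx⟩ = ∑ j, (g x)⁻¹ i j * mom g x v j := by
      simp [hw, hc, I, Fin.sum_univ_two]
    rw [pd_ham, e]
    fin_cases i <;> simp only [Fin.sum_univ_two, Fin.zero_eta, Fin.mk_one, h3.trans h2.symm] <;> ring
  set A : Fin 2 → SmoothFn O := fun j => toSm (low g X j) (low_smooth hg hX j) with hA
  have hAY : ∀ j, A j = ∑ k, metSm hg j k * Y k := by
    intro j
    ext y
    simp [hA, hY, metSm, low, Fin.sum_univ_two]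
  have main : ∑ i, (w i * ∑ j, c j * sd O i (Y j)) * 2 - ∑ i, (∑ a, c a * sd O i (w a)) * Y i =
      2 * ∑ i, ∑ j, w i * w j * (sd O i (A j) - ∑ k, chrSm hg k i j * A k) := by
    -- Differentiating the constant c = g w trades the derivatives of w for those of the metric,
    -- which compatibility turns into Christoffel symbols.
    have dc : ∀ i a, ∑ b, (metSm hg a b * sd O i (w b) + w b * sd O i (metSm hg a b)) = 0 := by
      intro i a
      have := Dc i a
      rw [hcw] at this
      simpa [Fin.sum_univ_two, Derivation.leibniz] using this
    simp only [hAY, map_sum, Derivation.leibniz, smul_eq_mul, hcw, h.compat, Fin.sum_univ_two,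
      map_add, h.G_symm, gs] at dc ⊢
    have d00 := dc 0 0
    have d01 := dc 0 1
    have d10 := dc 1 0
    have d11 := dc 1 1
    simp only [gs, h.G_symm] at d00 d01 d10 d11
    clear_value c w Y A
    linear_combination (-Y 0) * (w 0 * d00 + w 1 * d01) - Y 1 * (w 0 * d10 + w 1 * d11)
  have m2 := congrArg (fun f : SmoothFn O => f.1 ⟨x, hx⟩) main
  have sA : ∀ i j, (sd O i (A j)).1 ⟨x, hx⟩ = pd i (low g X j) x := fun i j => by
    rw [hA, sd_toSm]; rfl
  simp only [poisson, ep, eh, el, pd_lin, Fin.sum_univ_two]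
  simp only [Fin.sum_univ_two] at m2
  have hYv : ∀ i, (Y i).1 ⟨x, hx⟩ = X x i := fun i => rfl
  have hAv : ∀ i, (A i).1 ⟨x, hx⟩ = low g X i x := fun i => rfl
  have hGv : ∀ i j k, (chrSm hg i j k).1 ⟨x, hx⟩ = christoffel g i j k x := fun i j k => rfl
  clear_value c w Y A
  have two : (2 : SmoothFn O).1 ⟨x, hx⟩ = 2 := rfl
  simp [hwv, sA, hYv, hAv, hGv, two] at m2 ⊢
  linear_combination m2 / 2

end FracLin

/-! ### The common smooth cofactor of numerator and denominator. -/

namespace FracLin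

variable {g : E → Matrix (Fin 2) (Fin 2) ℝ} {O : TopologicalSpace.Opens E}

/-- Evaluation at a point as a ring homomorphism. -/
noncomputable def evalSm (x : O) : SmoothFn O →ₐ[ℝ] ℝ :=
  (Pi.evalAlgHom ℝ (fun _ : O => ℝ) x).comp (SmoothFn O).val

theorem evalSm_apply (x : O) (f : SmoothFn O) : evalSm x f = f.1 x := rfl

@[simp] theorem evalSm_two (x : O) : evalSm x 2 = 2 := rfl

@[simp] theorem evalSm_toSm (x : O) (F : E → ℝ) (hF : ContDiffOn ℝ ∞ F O) :
    evalSm x (toSm F hF) = F x := rfl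

theorem smoothFn_ext {f h : SmoothFn O} (e : ∀ x : O, evalSm x f = evalSm x h) : f = h := by
  refine Subtype.ext (funext e)

theorem continuous_smoothFn (f : SmoothFn O) : Continuous f.1 := by
  have : Continuous fun x : O => extZero O f.1 x :=
    continuousOn_iff_continuous_domRestrict.1 (smoothFn_smooth f).continuousOn
  exact this.congr fun x => extZero_apply f.1 x

/-- A smooth function is a zero divisor only if it vanishes on an open set. -/
theorem smoothFn_eq_zero_of_mul {f w : SmoothFn O} (hw : Dense {x : O | evalSm x w ≠ 0})
    (h : w * f = 0) : f = 0 := by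
  have h1 : Set.EqOn f.1 (fun _ => 0) {x : O | evalSm x w ≠ 0} := fun x hx => by
    have := congrArg (evalSm x) h
    rw [map_mul, map_zero] at this
    exact (mul_eq_zero.1 this).resolve_left hx
  have := Continuous.ext_on hw (continuous_smoothFn f) continuous_const h1
  ext x
  exact congrFun this x

/-- The covector field dual to a smooth vector field. -/
noncomputable def lowSm (hg : IsMetric g O) {X : E → E} (hX : ContDiffOn ℝ ∞ X O) (j : Fin 2) :
    SmoothFn O := toSm (low g X j) (low_smooth hg hX j)

theorem evalSm_sd_lowSm (hg : IsMetric g O) {X : E → E} (hX : ContDiffOn ℝ ∞ X O) (i j : Fin 2)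
    (x : O) : evalSm x (sd O i (lowSm hg hX j)) = pd i (low g X j) x := by
  rw [lowSm, sd_toSm, evalSm_toSm]

theorem dense_wedge (hg : IsMetric g O) (r : Rep g O) :
    Dense {x : O | evalSm x (wedge (lowSm hg r.smooth_P) (lowSm hg r.smooth_Q)) ≠ 0} := by
  intro x
  rw [mem_closure_iff]
  intro V hV hxV
  obtain ⟨W, hW, rfl⟩ := isOpen_induced_iff.1 hV
  obtain ⟨y, hyW, hyO, hy⟩ := mem_closure_iff.1 (r.indep x.2) W hW hxV
  refine ⟨⟨y, hyO⟩, hyW, ?_⟩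
  have := low_wedge hg r.P r.Q hyO
  change low g r.P 0 y * low g r.Q 1 y - low g r.P 1 y * low g r.Q 0 y ≠ 0
  rw [this]
  exact mul_ne_zero (hg.det_pos hyO).ne' hy

/-- The symmetrised covariant derivative of a covector, as a quadratic form. -/
noncomputable def symDer (hg : IsMetric g O) (a : Fin 2 → SmoothFn O) (i j : Fin 2) : SmoothFn O :=
  sd O i (a j) + sd O j (a i) - 2 * ∑ k, chrSm hg k i j * a k

theorem smoothFn_half {f h : SmoothFn O} (e : 2 * f = 2 * h) : f = h := smoothFn_ext fun x => by
  have := congrArg (evalSm x) e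
  rw [map_mul, map_mul, evalSm_two] at this
  linarith

theorem relKilling_of_symDer (hg : IsMetric g O) {L c : Fin 2 → SmoothFn O}
    (h0 : symDer hg c 0 0 = 2 * (L 0 * c 0)) (h1 : symDer hg c 1 1 = 2 * (L 1 * c 1))
    (h2 : symDer hg c 0 1 = L 0 * c 1 + L 1 * c 0) :
    RelKilling (sd O) (chrSm hg) L c
      (sd O 0 (c 1) - ∑ k, chrSm hg k 0 1 * c k - L 0 * c 1) := by
  have gs := hg.metricConn.G_symm
  refine ⟨fun i => smoothFn_half ?_, by ring, ?_⟩
  · fin_cases i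
    · simp only [symDer, Fin.zero_eta] at h0 ⊢
      linear_combination h0
    · simp only [symDer, Fin.mk_one] at h1 ⊢
      linear_combination h1
  · simp only [symDer, gs] at h2 ⊢
    linear_combination h2

/-- Divisibility of two quadratic forms by two linear forms which are not both zero: the common
quotient is given by a smooth formula. -/
theorem exists_common_quotient {a0 a1 b0 b1 A00 A01 A11 B00 B01 B11 : ℝ}
    (e1 : A00 * b0 = a0 * B00) (e2 : A11 * b1 = a1 * B11)
    (e3 : A00 * b1 + A01 * b0 = a1 * B00 + a0 * B01)
    (e4 : A01 * b1 + A11 * b0 = a1 * B01 + a0 * B11)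
    (hA : A00 * a1 ^ 2 - A01 * a0 * a1 + A11 * a0 ^ 2 = 0)
    (hB : B00 * b1 ^ 2 - B01 * b0 * b1 + B11 * b0 ^ 2 = 0)
    (h : a0 ^ 2 + a1 ^ 2 + b0 ^ 2 + b1 ^ 2 ≠ 0) :
    ∃ l0 l1, (A00 = l0 * a0 ∧ A11 = l1 * a1 ∧ A01 = l0 * a1 + l1 * a0) ∧
      (B00 = l0 * b0 ∧ B11 = l1 * b1 ∧ B01 = l0 * b1 + l1 * b0) := by
  have key : ∀ {a0 a1 b0 b1 A00 A01 A11 B00 B01 B11 : ℝ} (_ : A00 * b0 = a0 * B00)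
      (_ : A11 * b1 = a1 * B11) (_ : A00 * b1 + A01 * b0 = a1 * B00 + a0 * B01)
      (_ : A01 * b1 + A11 * b0 = a1 * B01 + a0 * B11)
      (_ : B00 * b1 ^ 2 - B01 * b0 * b1 + B11 * b0 ^ 2 = 0) (_ : b0 ≠ 0 ∨ b1 ≠ 0),
      ∃ l0 l1, (A00 = l0 * a0 ∧ A11 = l1 * a1 ∧ A01 = l0 * a1 + l1 * a0) ∧
      (B00 = l0 * b0 ∧ B11 = l1 * b1 ∧ B01 = l0 * b1 + l1 * b0) := by
    intro a0 a1 b0 b1 A00 A01 A11 B00 B01 B11 e1 e2 e3 e4 hB h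
    by_cases h0 : b0 = 0
    · have h1 : b1 ≠ 0 := h.resolve_left (not_not.2 h0)
      subst h0
      have hB0 : B00 = 0 := by
        refine (mul_eq_zero.1 (?_ : B00 * b1 ^ 2 = 0)).resolve_right (pow_ne_zero 2 h1)
        linear_combination hB
      subst hB0
      have hA11 : A11 = B11 / b1 * a1 := by field_simp; linear_combination e2
      have hA01 : A01 = B01 / b1 * a1 + B11 / b1 * a0 := by
        field_simp; linear_combination e4
      have hA00 : A00 = B01 / b1 * a0 := by
        field_simp; linear_combination e3
      refine ⟨B01 / b1, B11 / b1, ⟨hA00, hA11, hA01⟩, by simp, by field_simp, by field_simp; ring⟩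
    · have l1 : B11 = (B01 * b0 - B00 * b1) / b0 ^ 2 * b1 := by
        field_simp; linear_combination hB
      have h00 : A00 = B00 / b0 * a0 := by field_simp; linear_combination e1
      have h01 : A01 = B00 / b0 * a1 + (B01 * b0 - B00 * b1) / b0 ^ 2 * a0 := by
        field_simp; linear_combination b0 * e3 - b1 * e1
      have h11 : A11 = (B01 * b0 - B00 * b1) / b0 ^ 2 * a1 := by
        rw [div_mul_eq_mul_div, eq_div_iff (pow_ne_zero 2 h0)]
        refine mul_left_cancel₀ h0 ?_
        linear_combination b0 ^ 2 * e4 - b0 * b1 * e3 + b1 ^ 2 * e1 + a0 * hB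
      exact ⟨B00 / b0, (B01 * b0 - B00 * b1) / b0 ^ 2, ⟨h00, h11, h01⟩, by field_simp, l1,
        by field_simp; ring⟩
  by_cases hb : b0 ≠ 0 ∨ b1 ≠ 0
  · exact key e1 e2 e3 e4 hB hb
  · push Not at hb
    have ha : a0 ≠ 0 ∨ a1 ≠ 0 := by
      by_contra hc
      push Not at hc
      exact h (by rw [hc.1, hc.2, hb.1, hb.2]; ring)
    obtain ⟨l0, l1, h1, h2⟩ := key (a0 := b0) (a1 := b1) (A00 := B00) (A01 := B01) (A11 := B11)
      (by linear_combination -e1) (by linear_combination -e2)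
      (by linear_combination -e3) (by linear_combination -e4) hA ha
    exact ⟨l0, l1, h2, h1⟩

theorem sq_add_sq_ne_zero {a0 a1 b0 b1 : ℝ} (h : a0 ^ 2 + a1 ^ 2 + b0 ^ 2 + b1 ^ 2 ≠ 0) :
    (a0 ^ 2 + a1 ^ 2) ^ 2 + (b0 ^ 2 + b1 ^ 2) ^ 2 ≠ 0 := by
  have : 0 < a0 ^ 2 + a1 ^ 2 + b0 ^ 2 + b1 ^ 2 := lt_of_le_of_ne (by positivity) h.symm
  rcases (show 0 ≤ a0 ^ 2 + a1 ^ 2 by positivity).eq_or_lt with h1 | h1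
  · have : 0 < b0 ^ 2 + b1 ^ 2 := by linarith
    positivity
  · positivity

/-- The numerator of the quotient of the quadratic form `S` by the linear form `a`. -/
def quotNum {R : Type*} [CommRing R] (S : Fin 2 → Fin 2 → R) (a : Fin 2 → R) (i : Fin 2) : R :=
  2 * (S i 0 * a 0 + S i 1 * a 1) * (a 0 ^ 2 + a 1 ^ 2)
    - (S 0 0 * a 0 ^ 2 + (S 0 1 + S 1 0) * a 0 * a 1 + S 1 1 * a 1 ^ 2) * a i

/-- For S = l ⊙ a one has 2S(a, ·) = |a|² l + (l·a) a and S(a, a) = (l·a)|a|². Eliminating l·a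
isolates l by a polynomial expression in S and a, so that the quotient by a linear form is smooth
wherever the form is nonzero. -/
theorem quotNum_eq {S : Fin 2 → Fin 2 → ℝ} {a : Fin 2 → ℝ} {l : Fin 2 → ℝ}
    (h0 : S 0 0 = l 0 * a 0) (h1 : S 1 1 = l 1 * a 1)
    (h2 : 2 * S 0 1 = l 0 * a 1 + l 1 * a 0) (h3 : S 1 0 = S 0 1) (i : Fin 2) :
    quotNum S a i = l i * (a 0 ^ 2 + a 1 ^ 2) ^ 2 := by
  have h2' : S 0 1 = (l 0 * a 1 + l 1 * a 0) / 2 := by linarith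
  fin_cases i <;> simp only [quotNum, Fin.zero_eta, Fin.mk_one, h3, h0, h1, h2'] <;> ring

theorem map_quotNum {R R' : Type*} [CommRing R] [CommRing R'] (f : R →+* R')
    (S : Fin 2 → Fin 2 → R) (a : Fin 2 → R) (i : Fin 2) :
    f (quotNum S a i) = quotNum (fun i j => f (S i j)) (fun j => f (a j)) i := by
  simp only [quotNum, map_sub, map_mul, map_add, map_pow, map_ofNat]

/-- Over the dense set where a and b are independent, unique factorisation shows that each linear
form divides its own quadratic form, with the same quotient. Vanishing of the quadratic form at the
root of the linear form passes to the closure; then the quotient exists at every point, because a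
and b never vanish together, and it is given by a smooth formula. -/
theorem Rep.exists_relKilling (hg : IsMetric g O) (r : Rep g O) :
    ∃ (L : Fin 2 → SmoothFn O) (ρ σ : SmoothFn O),
      RelKilling (sd O) (chrSm hg) L (lowSm hg r.smooth_P) ρ ∧
      RelKilling (sd O) (chrSm hg) L (lowSm hg r.smooth_Q) σ := by
  set a := lowSm hg r.smooth_P with ha
  set b := lowSm hg r.smooth_Q with hb
  -- The bracket identity at the momentum of v, twice, as a cubic in v. Its four coefficients are
  -- read off below at (1,0), (0,1) and (1,±1).
  have cub : ∀ (x : O) (v : E),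
      (∑ i, ∑ j, v i * v j * evalSm x (symDer hg a i j)) * (∑ j, evalSm x (b j) * v j) =
      (∑ j, evalSm x (a j) * v j) * ∑ i, ∑ j, v i * v j * evalSm x (symDer hg b i j) := by
    intro x v
    have h := r.bracket O.2 hg x x.2 (mom g x v)
    have gs := hg.christoffel_symm O.2 x.2
    rw [poisson_lin hg r.smooth_P x.2, poisson_lin hg r.smooth_Q x.2, lin_mom hg _ x.2,
      lin_mom hg _ x.2] at h
    simp only [symDer, map_add, map_sub, map_mul, map_sum, ha, hb, evalSm_sd_lowSm,
      Fin.sum_univ_two, map_ofNat] at h ⊢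
    simp only [lowSm, chrSm, evalSm_toSm, gs] at h ⊢
    linear_combination 2 * h
  have sy : ∀ c : Fin 2 → SmoothFn O, symDer hg c 1 0 = symDer hg c 0 1 := fun c => by
    simp only [symDer, hg.metricConn.G_symm]; ring
  have E1 : symDer hg a 0 0 * b 0 = a 0 * symDer hg b 0 0 := smoothFn_ext fun x => by
    have := cub x ![1, 0]
    simpa [Fin.sum_univ_two] using this
  have E2 : symDer hg a 1 1 * b 1 = a 1 * symDer hg b 1 1 := smoothFn_ext fun x => by
    have := cub x ![0, 1]
    simpa [Fin.sum_univ_two] using this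
  have E3 : symDer hg a 0 0 * b 1 + 2 * symDer hg a 0 1 * b 0 =
      a 1 * symDer hg b 0 0 + a 0 * (2 * symDer hg b 0 1) := smoothFn_ext fun x => by
    have h1 := cub x ![1, 1]
    have h2 := cub x ![1, -1]
    have h3 := congrArg (evalSm x) E2
    simp [Fin.sum_univ_two, sy] at h1 h2 h3 ⊢
    linear_combination h1 / 2 - h2 / 2 - h3
  have E4 : 2 * symDer hg a 0 1 * b 1 + symDer hg a 1 1 * b 0 =
      a 1 * (2 * symDer hg b 0 1) + a 0 * symDer hg b 1 1 := smoothFn_ext fun x => by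
    have h1 := cub x ![1, 1]
    have h2 := cub x ![1, -1]
    have h3 := congrArg (evalSm x) E1
    simp [Fin.sum_univ_two, sy] at h1 h2 h3 ⊢
    linear_combination h1 / 2 + h2 / 2 - h3
  -- At v = (b₁, -b₀) the cubic identity reads w · S_b(v) = 0, where S_b is the quadratic form of b;
  -- the determinant w is nonzero on a dense set.
  have HB : symDer hg b 0 0 * b 1 ^ 2 - 2 * symDer hg b 0 1 * b 0 * b 1
      + symDer hg b 1 1 * b 0 ^ 2 = 0 := by
    refine smoothFn_eq_zero_of_mul (dense_wedge hg r) ?_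
    change (a 0 * b 1 - a 1 * b 0) * _ = 0
    linear_combination (-b 1 ^ 3) * E1 + b 0 ^ 3 * E2 + b 1 ^ 2 * b 0 * E3 - b 1 * b 0 ^ 2 * E4
  have HA : symDer hg a 0 0 * a 1 ^ 2 - 2 * symDer hg a 0 1 * a 0 * a 1
      + symDer hg a 1 1 * a 0 ^ 2 = 0 := by
    refine smoothFn_eq_zero_of_mul (dense_wedge hg r) ?_
    change (a 0 * b 1 - a 1 * b 0) * _ = 0
    linear_combination (-a 1 ^ 3) * E1 + a 0 ^ 3 * E2 + a 1 ^ 2 * a 0 * E3 - a 1 * a 0 ^ 2 * E4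
  have hne : ∀ x : O, evalSm x (a 0) ^ 2 + evalSm x (a 1) ^ 2 + evalSm x (b 0) ^ 2
      + evalSm x (b 1) ^ 2 ≠ 0 := by
    intro x hx
    refine r.no_zero x x.2 ⟨low_eq_zero hg x.2 fun j => ?_, low_eq_zero hg x.2 fun j => ?_⟩
    · change evalSm x (a j) = 0
      fin_cases j <;> simp only [Fin.zero_eta, Fin.mk_one] <;> nlinarith [sq_nonneg (evalSm x (a 0)),
        sq_nonneg (evalSm x (a 1)), sq_nonneg (evalSm x (b 0)), sq_nonneg (evalSm x (b 1))]
    · change evalSm x (b j) = 0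
      fin_cases j <;> simp only [Fin.zero_eta, Fin.mk_one] <;> nlinarith [sq_nonneg (evalSm x (a 0)),
        sq_nonneg (evalSm x (a 1)), sq_nonneg (evalSm x (b 0)), sq_nonneg (evalSm x (b 1))]
  -- The denominator |a|⁴ + |b|⁴ serves both quotient formulas at once, so that no choice of the
  -- nonzero covector is needed.
  set N : SmoothFn O := (a 0 ^ 2 + a 1 ^ 2) ^ 2 + (b 0 ^ 2 + b 1 ^ 2) ^ 2 with hN
  have hN0 : ∀ x : O, evalSm x N ≠ 0 := fun x => by
    have := sq_add_sq_ne_zero (hne x)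
    simpa [hN] using this
  set I : SmoothFn O := toSm (fun x => (extZero O N.1 x)⁻¹) ((smoothFn_smooth N).inv fun x hx => by
    have := hN0 ⟨x, hx⟩
    rwa [evalSm_apply, ← extZero_apply N.1] at this) with hI
  have hIx : ∀ x : O, evalSm x I = (evalSm x N)⁻¹ := fun x => by
    rw [hI, evalSm_toSm, extZero_apply]; rfl
  -- The factor 1/2 is there because `symDer` is twice the symmetrised derivative.
  set L : Fin 2 → SmoothFn O := fun i => algebraMap ℝ _ (1 / 2) *
    (quotNum (symDer hg a) a i + quotNum (symDer hg b) b i) * I with hL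
  have div : ∀ c, c = a ∨ c = b → symDer hg c 0 0 = 2 * (L 0 * c 0) ∧
      symDer hg c 1 1 = 2 * (L 1 * c 1) ∧ symDer hg c 0 1 = L 0 * c 1 + L 1 * c 0 := by
    have pt : ∀ x : O, ∀ c, c = a ∨ c = b →
        evalSm x (symDer hg c 0 0) = 2 * (evalSm x (L 0) * evalSm x (c 0)) ∧
        evalSm x (symDer hg c 1 1) = 2 * (evalSm x (L 1) * evalSm x (c 1)) ∧
        evalSm x (symDer hg c 0 1) = evalSm x (L 0) * evalSm x (c 1) +
          evalSm x (L 1) * evalSm x (c 0) := by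
      intro x
      have e1 := congrArg (evalSm x) E1
      have e2 := congrArg (evalSm x) E2
      have e3 := congrArg (evalSm x) E3
      have e4 := congrArg (evalSm x) E4
      have hA := congrArg (evalSm x) HA
      have hB := congrArg (evalSm x) HB
      simp only [map_mul, map_add, map_sub, map_pow, map_ofNat, map_zero] at e1 e2 e3 e4 hA hB
      obtain ⟨l0, l1, ⟨p1, p2, p3⟩, p4, p5, p6⟩ := exists_common_quotient e1 e2 e3 e4 hA hB (hne x)
      have hn := hN0 x
      have hLi : ∀ i, evalSm x (L i) = ![l0, l1] i / 2 := fun i => by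
        have qa := quotNum_eq (S := fun i j => evalSm x (symDer hg a i j))
          (a := fun j => evalSm x (a j)) (l := ![l0, l1]) p1 p2 p3 (congrArg (evalSm x) (sy a)) i
        have qb := quotNum_eq (S := fun i j => evalSm x (symDer hg b i j))
          (a := fun j => evalSm x (b j)) (l := ![l0, l1]) p4 p5 p6 (congrArg (evalSm x) (sy b)) i
        have ma := map_quotNum (evalSm x).toRingHom (symDer hg a) a i
        have mb := map_quotNum (evalSm x).toRingHom (symDer hg b) b i
        have ea : evalSm x (quotNum (symDer hg a) a i) = _ := ma.trans qa
        have eb : evalSm x (quotNum (symDer hg b) b i) = _ := mb.trans qb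
        have eN : evalSm x N = (evalSm x (a 0) ^ 2 + evalSm x (a 1) ^ 2) ^ 2 +
          (evalSm x (b 0) ^ 2 + evalSm x (b 1) ^ 2) ^ 2 := by simp only [hN, map_add, map_pow]
        simp only [hL, map_mul, map_add, ea, eb, hIx, AlgHom.commutes, Algebra.algebraMap_self,
          RingHom.id_apply]
        rw [← mul_add, ← eN]
        field_simp
      have L0 : evalSm x (L 0) = l0 / 2 := hLi 0
      have L1 : evalSm x (L 1) = l1 / 2 := hLi 1
      rintro c (rfl | rfl)
      · rw [L0, L1]; refine ⟨?_, ?_, ?_⟩ <;> linarith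
      · rw [L0, L1]; refine ⟨?_, ?_, ?_⟩ <;> linarith
    intro c hc
    refine ⟨smoothFn_ext fun x => ?_, smoothFn_ext fun x => ?_, smoothFn_ext fun x => ?_⟩
    · simpa using (pt x c hc).1
    · simpa using (pt x c hc).2.1
    · simpa using (pt x c hc).2.2
  obtain ⟨a1, a2, a3⟩ := div a (Or.inl rfl)
  obtain ⟨b1, b2, b3⟩ := div b (Or.inr rfl)
  exact ⟨L, _, _, relKilling_of_symDer hg a1 a2 a3, relKilling_of_symDer hg b1 b2 b3⟩

end FracLin

namespace FracLin

/-! ### Orbits of the group of fractional-linear transformations -/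

variable {g : E → Matrix (Fin 2) (Fin 2) ℝ} {U : Set E}

/-- The coefficient matrix of a pair. -/
def Rep.mat (r : Rep g U) (x : E) : Matrix (Fin 2) (Fin 2) ℝ := Matrix.of ![r.P x, r.Q x]

/-- Proportionality of matrices. -/
def Par (A B : Matrix (Fin 2) (Fin 2) ℝ) : Prop := ∀ i j k l, A i j * B k l = A k l * B i j

theorem par_of_smul {c : ℝ} (B : Matrix (Fin 2) (Fin 2) ℝ) : Par (c • B) B := fun i j k l => by
  simp only [Matrix.smul_apply, smul_eq_mul]; ring

theorem Par.symm {A B : Matrix (Fin 2) (Fin 2) ℝ} (h : Par A B) : Par B A := fun i j k l => by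
  linear_combination -(h i j k l)

theorem Par.exists_smul {A B : Matrix (Fin 2) (Fin 2) ℝ} (h : Par A B) (hB : B ≠ 0) :
    ∃ c : ℝ, A = c • B := by
  obtain ⟨k, l, hkl⟩ : ∃ k l, B k l ≠ 0 := by
    by_contra hc
    push Not at hc
    exact hB (Matrix.ext hc)
  refine ⟨A k l / B k l, Matrix.ext fun i j => ?_⟩
  have := h i j k l
  simp only [Matrix.smul_apply, smul_eq_mul]
  field_simp
  linear_combination this

theorem Rep.mat_ne_zero (r : Rep g U) {x : E} (hx : x ∈ U) : r.mat x ≠ 0 := by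
  intro h
  refine r.no_zero x hx ⟨?_, ?_⟩
  · ext j; exact congrFun (congrFun h 0) j
  · ext j; exact congrFun (congrFun h 1) j

theorem Rep.det_mat (r : Rep g U) (x : E) :
    (r.mat x).det = r.P x 0 * r.Q x 1 - r.P x 1 * r.Q x 0 := by
  simp [Rep.mat, Matrix.det_fin_two]

theorem Rep.continuousOn_mat (r : Rep g U) (i j : Fin 2) : ContinuousOn (fun x => r.mat x i j) U := by
  fin_cases i
  · exact (contDiffOn_comp r.smooth_P j).continuousOn
  · exact (contDiffOn_comp r.smooth_Q j).continuousOn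

theorem Rep.continuousOn_det (r : Rep g U) : ContinuousOn (fun x => (r.mat x).det) U := by
  simp only [Matrix.det_fin_two]
  exact ((r.continuousOn_mat 0 0).mul (r.continuousOn_mat 1 1)).sub
    ((r.continuousOn_mat 0 1).mul (r.continuousOn_mat 1 0))

/-- Unique factorisation of PY = XQ with P, Q independent: Y is a multiple of Q, X is a multiple of
P, and the two factors are equal. Each relation is obtained after multiplication by the determinant
of P and Q. -/
theorem par_of_det {P Q X Y : E} (hw : P 0 * Q 1 - P 1 * Q 0 ≠ 0)
    (h : ∀ p : E, (∑ i, P i * p i) * (∑ i, Y i * p i) = (∑ i, X i * p i) * ∑ i, Q i * p i) :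
    Par (Matrix.of ![P, Q]) (Matrix.of ![X, Y]) := by
  have e0 := h ![1, 0]
  have e1 := h ![0, 1]
  have e2 := h ![1, 1]
  simp [Fin.sum_univ_two] at e0 e1 e2
  have y0 : Y 0 * Q 1 = Y 1 * Q 0 := by
    refine mul_left_cancel₀ hw ?_
    linear_combination (Q 1 ^ 2 + Q 0 * Q 1) * e0 + (Q 0 ^ 2 + Q 0 * Q 1) * e1 - Q 0 * Q 1 * e2
  have x0 : X 0 * P 1 = X 1 * P 0 := by
    refine mul_left_cancel₀ hw ?_
    linear_combination (P 1 ^ 2 + P 0 * P 1) * e0 + (P 0 ^ 2 + P 0 * P 1) * e1 - P 0 * P 1 * e2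
  have m : ∀ i j, P i * Y j = Q j * X i := by
    intro i j
    refine mul_left_cancel₀ hw ?_
    fin_cases i <;> fin_cases j <;> simp only [Fin.zero_eta, Fin.mk_one]
    · linear_combination (P 0 * Q 1 - P 1 * Q 0) * e0
    · linear_combination P 0 * Q 1 * (e2 - e0 - e1) - 2 * P 1 * Q 1 * e0 + P 0 * P 1 * y0
        - Q 0 * Q 1 * x0
    · linear_combination -P 1 * Q 0 * (e2 - e0 - e1) + 2 * P 1 * Q 1 * e0 - P 0 * P 1 * y0
        + Q 0 * Q 1 * x0
    · linear_combination (P 0 * Q 1 - P 1 * Q 0) * e1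
  intro i j k l
  fin_cases i <;> fin_cases k <;> simp
  · fin_cases j <;> fin_cases l <;> simp <;> linarith
  · exact m j l
  · linear_combination -(m l j)
  · fin_cases j <;> fin_cases l <;> simp <;> linarith

/-- Factorisation gives proportionality only where the pair is independent; the relations between
the entries are closed and so hold on the closure. -/
theorem same_iff_par (r s : Rep g U) : Same r s ↔ ∀ x ∈ U, Par (r.mat x) (s.mat x) := by
  constructor
  · intro h x hx i j k l
    have key : Set.EqOn (fun x => r.mat x i j * s.mat x k l - r.mat x k l * s.mat x i j) (fun _ => 0)
        {x ∈ U | r.P x 0 * r.Q x 1 - r.P x 1 * r.Q x 0 ≠ 0} := fun y hy => by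
      have := par_of_det hy.2 (h y hy.1) i j k l
      exact sub_eq_zero.2 this
    have := key.of_subset_closure (t := U) (((r.continuousOn_mat i j).mul (s.continuousOn_mat k l)).sub
      ((r.continuousOn_mat k l).mul (s.continuousOn_mat i j))) continuousOn_const (fun y hy => hy.1)
      r.indep hx
    exact sub_eq_zero.1 this
  · intro h x hx p
    have m : ∀ i j, r.P x i * s.Q x j = r.Q x j * s.P x i := fun i j => h x hx 0 i 1 j
    simp only [lin_two]
    linear_combination p 0 * p 0 * m 0 0 + p 0 * p 1 * m 0 1 + p 1 * p 0 * m 1 0 + p 1 * p 1 * m 1 1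

theorem frac_eq_iff (r s : Rep g U) : r.frac = s.frac ↔ ∀ x ∈ U, Par (r.mat x) (s.mat x) :=
  (Quotient.eq (r := repSetoid g U)).trans (same_iff_par r s)

theorem frac_surjective (F : FLI g U) : ∃ r : Rep g U, r.frac = F := Quotient.exists_rep F

theorem isQuotientMap_frac : Topology.IsQuotientMap (Rep.frac : Rep g U → FLI g U) :=
  isQuotientMap_quotient_mk'

theorem continuous_coeffs : Continuous (Rep.coeffs : Rep g U → C(U, E × E)) :=
  continuous_induced_dom

theorem continuous_mat {x : E} (hx : x ∈ U) : Continuous fun r : Rep g U => r.mat x := by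
  have h : Continuous fun r : Rep g U => r.coeffs ⟨x, hx⟩ :=
    (continuous_eval_const (⟨x, hx⟩ : U)).comp continuous_coeffs
  have h1 : Continuous fun r : Rep g U => r.P x := h.fst
  have h2 : Continuous fun r : Rep g U => r.Q x := h.snd
  refine continuous_matrix fun i j => ?_
  fin_cases i
  · exact (continuous_apply j).comp h1
  · exact (continuous_apply j).comp h2

theorem frac_moebius (hU : IsOpen U) (hg : IsMetric g U) (A : GL (Fin 2) ℝ) (r : Rep g U) :
    (r.moebius hU hg A).frac = moeb hU hg A r.frac := rfl

theorem mat_moebius (hU : IsOpen U) (hg : IsMetric g U) (A : GL (Fin 2) ℝ) (r : Rep g U) (x : E) :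
    (r.moebius hU hg A).mat x = A.1 * r.mat x := by
  ext i j
  fin_cases i <;> simp [Rep.mat, Rep.moebius, Matrix.mul_apply, Fin.sum_univ_two]

theorem frac_eq_moeb_iff (hU : IsOpen U) (hg : IsMetric g U) (A : GL (Fin 2) ℝ) (r s : Rep g U) :
    s.frac = moeb hU hg A r.frac ↔ ∀ x ∈ U, Par (s.mat x) (A.1 * r.mat x) := by
  rw [← frac_moebius, frac_eq_iff]
  simp only [mat_moebius]

/-- Two pairs are simultaneously independent near some point. -/
theorem exists_det_ne_zero (hU : IsOpen U) (r s : Rep g U) {V : Set E} (hV : IsOpen V)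
    (h : (V ∩ U).Nonempty) : ∃ x ∈ V ∩ U, (r.mat x).det ≠ 0 ∧ (s.mat x).det ≠ 0 := by
  obtain ⟨x, hxV, hxU⟩ := h
  obtain ⟨y, hyV, hyU, hy⟩ := mem_closure_iff.1 (r.indep hxU) V hV hxV
  have ho : IsOpen (U ∩ (fun x => (r.mat x).det) ⁻¹' {0}ᶜ) :=
    r.continuousOn_det.isOpen_inter_preimage hU isOpen_compl_singleton
  obtain ⟨z, ⟨hzV, hz1⟩, hz2⟩ := mem_closure_iff.1 (s.indep hyU) _ (hV.inter ho)
    ⟨hyV, hyU, by simpa [Rep.det_mat] using hy⟩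
  exact ⟨z, ⟨hzV, hz1.1⟩, hz1.2, by simpa [Rep.det_mat] using hz2.2⟩

theorem Rep.exists_det_ne_zero (hU : IsOpen U) (hne : U.Nonempty) (r : Rep g U) :
    ∃ x ∈ U, (r.mat x).det ≠ 0 := by
  obtain ⟨x, hx, h, -⟩ := FracLin.exists_det_ne_zero hU r r isOpen_univ (by simpa using hne)
  exact ⟨x, hx.2, h⟩

section orbit

variable (hU : IsOpen U) (hg : IsMetric g U)

/-- If s = A r up to scale, then s(x) times the adjugate of r(x) is A up to scale. Substituting this
for A removes the group element from the condition; where r(x) is singular the product vanishes and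
the relation is empty. Conversely, A can be read off at a point where both pairs are independent. -/
theorem mem_orb_iff (hne : U.Nonempty) (r s : Rep g U) : s.frac ∈ orb hU hg ⊤ r.frac ↔
    ∀ x ∈ U, ∀ y ∈ U, Par (s.mat y) (s.mat x * (r.mat x).adjugate * r.mat y) := by
  constructor
  · rintro ⟨A, -, hA⟩ x hx y hy
    rw [frac_eq_moeb_iff] at hA
    obtain ⟨c, hc⟩ := (hA x hx).exists_smul (by
      rw [← mat_moebius hU hg]; exact Rep.mat_ne_zero _ hx)
    obtain ⟨d, hd⟩ := (hA y hy).symm.exists_smul (s.mat_ne_zero hy)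
    rw [hc, Matrix.smul_mul, mul_assoc A.1, Matrix.mul_adjugate, Matrix.smul_mul, Matrix.mul_smul,
      mul_one, Matrix.smul_mul, hd, smul_smul, smul_smul]
    exact (par_of_smul _).symm
  · intro h
    obtain ⟨x, ⟨-, hx⟩, h1, h2⟩ := exists_det_ne_zero hU r s isOpen_univ (by simpa using hne)
    refine ⟨Matrix.GeneralLinearGroup.mkOfDetNeZero (s.mat x * (r.mat x).adjugate) ?_, trivial, ?_⟩
    · rw [Matrix.det_mul, Matrix.det_adjugate]
      exact mul_ne_zero h2 (pow_ne_zero _ h1)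
    · rw [frac_eq_moeb_iff]
      exact fun y hy => h x hx y hy

theorem continuous_entry {α : Type*} [TopologicalSpace α] {f : α → Matrix (Fin 2) (Fin 2) ℝ}
    (hf : Continuous f) (i j : Fin 2) : Continuous fun a => f a i j :=
  (continuous_apply j).comp ((continuous_apply i).comp hf)

/-- After removal of the group element, membership is a family of polynomial equations between
values of the representative at two points, and evaluation is continuous. -/
theorem isClosed_orb (hne : U.Nonempty) (F : FLI g U) : IsClosed (orb hU hg ⊤ F) := by
  obtain ⟨r, rfl⟩ := frac_surjective F
  rw [← isQuotientMap_frac.isClosed_preimage]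
  have : Rep.frac ⁻¹' orb hU hg ⊤ r.frac = ⋂ x ∈ U, ⋂ y ∈ U, ⋂ (i) (j) (k) (l),
      {s : Rep g U | s.mat y i j * (s.mat x * (r.mat x).adjugate * r.mat y) k l =
        s.mat y k l * (s.mat x * (r.mat x).adjugate * r.mat y) i j} := by
    ext s
    simp only [Set.mem_preimage, mem_orb_iff hU hg hne, Set.mem_iInter]
    rfl
  rw [this]
  refine isClosed_biInter fun x hx => isClosed_biInter fun y hy => isClosed_iInter fun i =>
    isClosed_iInter fun j => isClosed_iInter fun k => isClosed_iInter fun l => isClosed_eq ?_ ?_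
  all_goals
    exact (continuous_entry (continuous_mat hy) _ _).mul
      (continuous_entry (((continuous_mat hx).mul continuous_const).mul continuous_const) _ _)

theorem moeb_inv (A : GL (Fin 2) ℝ) (F : FLI g U) : moeb hU hg A⁻¹ (moeb hU hg A F) = F := by
  rw [← moeb_mul, inv_mul_cancel, moeb_one]

theorem mem_orb_self (G : Subgroup (GL (Fin 2) ℝ)) (F : FLI g U) : F ∈ orb hU hg G F :=
  ⟨1, G.one_mem, (moeb_one hU hg F).symm⟩

theorem orb_eq_of_mem {G : Subgroup (GL (Fin 2) ℝ)} {F F' : FLI g U} (h : F' ∈ orb hU hg G F) :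
    orb hU hg G F' = orb hU hg G F := by
  obtain ⟨A, hA, rfl⟩ := h
  ext F''
  constructor
  · rintro ⟨B, hB, rfl⟩
    exact ⟨B * A, G.mul_mem hB hA, (moeb_mul hU hg B A F).symm⟩
  · rintro ⟨B, hB, rfl⟩
    exact ⟨B * A⁻¹, G.mul_mem hB (G.inv_mem hA), by rw [moeb_mul, moeb_inv]⟩

/-- The complement is a union of other orbits, finitely many of them and each closed. -/
theorem isOpen_orb (hne : U.Nonempty)
    (hfin : {O : Set (FLI g U) | ∃ F, O = orb hU hg ⊤ F}.Finite) (F : FLI g U) :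
    IsOpen (orb hU hg ⊤ F) := by
  rw [← isClosed_compl_iff]
  have : (orb hU hg ⊤ F)ᶜ =
      ⋃ O ∈ {O : Set (FLI g U) | ∃ F, O = orb hU hg ⊤ F} \ {orb hU hg ⊤ F}, O := by
    ext F'
    simp only [Set.mem_compl_iff, Set.mem_iUnion, Set.mem_sdiff, Set.mem_ofPred_eq,
      Set.mem_singleton_iff, exists_prop]
    constructor
    · intro h
      refine ⟨orb hU hg ⊤ F', ⟨⟨F', rfl⟩, fun e => h ?_⟩, mem_orb_self hU hg ⊤ F'⟩
      rw [← e]; exact mem_orb_self hU hg ⊤ F'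
    · rintro ⟨_, ⟨⟨F'', rfl⟩, h⟩, h'⟩ hc
      exact h ((orb_eq_of_mem hU hg h').symm.trans (orb_eq_of_mem hU hg hc))
  rw [this]
  refine (hfin.subset Set.sdiff_subset).isClosed_biUnion ?_
  rintro _ ⟨⟨F', rfl⟩, -⟩
  exact isClosed_orb hU hg hne F'

/-- The matrix of the transformation between two elements of an orbit, computed at a point. -/
theorem frac_eq_moeb_of_mem_orb (r s : Rep g U) (h : s.frac ∈ orb hU hg ⊤ r.frac) {x : E}
    (hx : x ∈ U) (hr : (r.mat x).det ≠ 0) :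
    ∃ (hs : (s.mat x * (r.mat x).adjugate).det ≠ 0),
      s.frac = moeb hU hg (Matrix.GeneralLinearGroup.mkOfDetNeZero _ hs) r.frac := by
  obtain ⟨A, -, hA⟩ := h
  have hs : (s.mat x * (r.mat x).adjugate).det ≠ 0 := by
    rw [frac_eq_moeb_iff] at hA
    obtain ⟨d, hd⟩ := (hA x hx).symm.exists_smul (s.mat_ne_zero hx)
    have := congrArg Matrix.det hd
    rw [Matrix.det_mul, Matrix.det_smul] at this
    have h1 : A.1.det * (r.mat x).det ≠ 0 := mul_ne_zero A.det_ne_zero hr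
    rw [Matrix.det_mul, Matrix.det_adjugate]
    refine mul_ne_zero (fun h0 => h1 ?_) (pow_ne_zero _ hr)
    rw [this, h0, mul_zero]
  refine ⟨hs, ?_⟩
  rw [frac_eq_moeb_iff]
  exact fun y hy => (mem_orb_iff hU hg ⟨x, hx⟩ r s).1 ⟨A, trivial, hA⟩ x hx y hy

/-- Freeness of the projective action: an invertible value of r cancels. -/
theorem par_of_moeb_eq (r : Rep g U) {A B : GL (Fin 2) ℝ} {x : E} (hx : x ∈ U)
    (hr : (r.mat x).det ≠ 0) (h : moeb hU hg A r.frac = moeb hU hg B r.frac) : Par A.1 B.1 := by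
  rw [← frac_moebius, frac_eq_moeb_iff] at h
  have := h x hx
  rw [mat_moebius] at this
  obtain ⟨c, hc⟩ := this.exists_smul (by
      rw [← mat_moebius hU hg]; exact Rep.mat_ne_zero _ hx)
  have e : A.1 = c • B.1 := by
    have := congrArg (· * (r.mat x)⁻¹) hc
    simpa [mul_assoc, Matrix.mul_nonsing_inv _ (isUnit_iff_ne_zero.2 hr)] using this
  rw [e]
  exact par_of_smul _

end orbit

end FracLin

/-! ### Orbits as three-dimensional manifolds, and their components. -/

namespace FracLin

variable {g : E → Matrix (Fin 2) (Fin 2) ℝ} {U : Set E}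

theorem continuous_family {d : ℕ} {V : Set (Fin d → ℝ)} {r : (Fin d → ℝ) → Rep g U}
    (h : ContDiffOn ℝ ∞ (fun z : (Fin d → ℝ) × E => ((r z.1).P z.2, (r z.1).Q z.2)) (V ×ˢ U)) :
    Continuous fun v : V => r v := by
  refine continuous_induced_rng.2 (ContinuousMap.continuous_of_continuous_uncurry _ ?_)
  exact h.continuousOn.comp_continuous
    (f := fun q : V × U => ((q.1 : Fin d → ℝ), (q.2 : E))) (by fun_prop) fun q => ⟨q.1.2, q.2.2⟩

section orbit

variable (hU : IsOpen U) (hg : IsMetric g U)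

/-- The matrix, up to scale, taking the pair `r` to the pair `s` at the point `x`. -/
def transMat (r s : Rep g U) (x : E) : Matrix (Fin 2) (Fin 2) ℝ := s.mat x * (r.mat x).adjugate

theorem continuous_transMat (r : Rep g U) {x : E} (hx : x ∈ U) (i j : Fin 2) :
    Continuous fun s : Rep g U => transMat r s x i j :=
  continuous_entry ((continuous_mat hx).mul continuous_const) i j

/-- The matrix with affine coordinates `v`. -/
def affMat (v : Fin 3 → ℝ) : Matrix (Fin 2) (Fin 2) ℝ := !![v 0, v 1; v 2, 1]

/-- Affine coordinates of a matrix up to scale. -/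
noncomputable def affCoord (A : Matrix (Fin 2) (Fin 2) ℝ) : Fin 3 → ℝ :=
  ![A 0 0 / A 1 1, A 0 1 / A 1 1, A 1 0 / A 1 1]

theorem par_affMat_iff {A : Matrix (Fin 2) (Fin 2) ℝ} (hA : A ≠ 0) (v : Fin 3 → ℝ) :
    Par A (affMat v) ↔ A 1 1 ≠ 0 ∧ v = affCoord A := by
  constructor
  · intro h
    obtain ⟨c, rfl⟩ := h.exists_smul (fun h0 => by
      have := congrFun (congrFun h0 1) 1
      simp [affMat] at this)
    have hc : c ≠ 0 := by rintro rfl; exact hA (zero_smul _ _)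
    refine ⟨by simpa [affMat] using hc, ?_⟩
    ext i
    fin_cases i <;> simp [affCoord, affMat] <;> field_simp
  · rintro ⟨h, rfl⟩
    have : A = A 1 1 • affMat (affCoord A) := by
      ext i j
      fin_cases i <;> fin_cases j <;> simp [affMat, affCoord] <;> field_simp
    intro i j k l
    rw [this]
    have e := par_of_smul (c := A 1 1) (affMat (affCoord A)) i j k l
    rwa [← this] at e ⊢

theorem ne_zero_of_det {A : Matrix (Fin 2) (Fin 2) ℝ} (h : A.det ≠ 0) : A ≠ 0 := by
  rintro rfl
  simp at h

open Classical in
/-- The orbit of `r` in affine coordinates. -/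
noncomputable def orbChart (r : Rep g U) (v : Fin 3 → ℝ) : Rep g U :=
  if h : (affMat v).det ≠ 0 then
    r.moebius hU hg (Matrix.GeneralLinearGroup.mkOfDetNeZero (affMat v) h) else r

theorem orbChart_PQ (r : Rep g U) {v : Fin 3 → ℝ} (h : (affMat v).det ≠ 0) (x : E) :
    (orbChart hU hg r v).P x = v 0 • r.P x + v 1 • r.Q x ∧
    (orbChart hU hg r v).Q x = v 2 • r.P x + r.Q x := by
  rw [orbChart, dif_pos h]
  constructor
  · simp [Rep.moebius, Matrix.GeneralLinearGroup.mkOfDetNeZero, affMat]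
  · simp [Rep.moebius, Matrix.GeneralLinearGroup.mkOfDetNeZero, affMat]

/-- Since the action is free, the transformation from r to s is determined up to scale by the value
of s at a single point where r is independent. This gives the inverse of the chart as a continuous
function of s. -/
theorem frac_orbChart_iff (r s : Rep g U) {x : E} (hx : x ∈ U)
    (hr : (r.mat x).det ≠ 0) {v : Fin 3 → ℝ} (h : (affMat v).det ≠ 0) :
    (orbChart hU hg r v).frac = s.frac ↔
      s.frac ∈ orb hU hg ⊤ r.frac ∧ transMat r s x 1 1 ≠ 0 ∧ v = affCoord (transMat r s x) := by
  rw [orbChart, dif_pos h, frac_moebius]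
  constructor
  · intro e
    have hs : s.frac ∈ orb hU hg ⊤ r.frac := ⟨_, trivial, e.symm⟩
    obtain ⟨hd, e'⟩ := frac_eq_moeb_of_mem_orb hU hg r s hs hx hr
    refine ⟨hs, (par_affMat_iff (ne_zero_of_det hd) v).1 ?_⟩
    exact par_of_moeb_eq hU hg r hx hr (e'.symm.trans e.symm)
  · rintro ⟨hs, hv⟩
    obtain ⟨hd, e'⟩ := frac_eq_moeb_of_mem_orb hU hg r s hs hx hr
    have hp : Par (transMat r s x) (affMat v) := (par_affMat_iff (ne_zero_of_det hd) v).2 hv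
    rw [e', eq_comm, ← frac_moebius, frac_eq_moeb_iff]
    intro y _
    rw [mat_moebius]
    obtain ⟨c, hc⟩ := hp.exists_smul (ne_zero_of_det h)
    change Par (transMat r s x * r.mat y) (affMat v * r.mat y)
    rw [hc, Matrix.smul_mul]
    exact par_of_smul _

theorem det_affMat (v : Fin 3 → ℝ) : (affMat v).det = v 0 - v 1 * v 2 := by
  simp [affMat, Matrix.det_fin_two]

theorem isOpen_affMat : IsOpen {v : Fin 3 → ℝ | (affMat v).det ≠ 0} := by
  simp only [det_affMat]
  exact isOpen_ne_fun (by fun_prop) continuous_const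

theorem continuousOn_affCoord (r : Rep g U) {x : E} (hx : x ∈ U) :
    ContinuousOn (fun s : Rep g U => affCoord (transMat r s x)) {s | transMat r s x 1 1 ≠ 0} := by
  have h := fun i j => (continuous_transMat r hx i j).continuousOn (s := {s | transMat r s x 1 1 ≠ 0})
  refine continuousOn_pi.2 fun i => ?_
  fin_cases i
  · exact (h 0 0).div (h 1 1) fun s hs => hs
  · exact (h 0 1).div (h 1 1) fun s hs => hs
  · exact (h 1 0).div (h 1 1) fun s hs => hs

/-- An orbit is a copy of the projective group, charted by matrices with lower right entry 1.
Finiteness enters only through openness of the orbit, which makes the image of the chart open in the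
whole space. -/
theorem hasDim_three (hne : U.Nonempty) (hN : Nonempty (FLI g U))
    (hfin : {O : Set (FLI g U) | ∃ F, O = orb hU hg ⊤ F}.Finite) : HasDim g U 3 := by
  refine ⟨hN, fun F => ?_⟩
  obtain ⟨r, rfl⟩ := frac_surjective F
  obtain ⟨x, hx, hr⟩ := r.exists_det_ne_zero hU hne
  set V : Set (Fin 3 → ℝ) := {v | (affMat v).det ≠ 0} with hV
  have hVo : IsOpen V := isOpen_affMat
  have hsm : ContDiffOn ℝ ∞ (fun z : (Fin 3 → ℝ) × E =>
      ((orbChart hU hg r z.1).P z.2, (orbChart hU hg r z.1).Q z.2)) (V ×ˢ U) := by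
    have hP : ContDiffOn ℝ ∞ (fun z : (Fin 3 → ℝ) × E => r.P z.2) (V ×ˢ U) :=
      r.smooth_P.comp contDiff_snd.contDiffOn fun z hz => hz.2
    have hQ : ContDiffOn ℝ ∞ (fun z : (Fin 3 → ℝ) × E => r.Q z.2) (V ×ˢ U) :=
      r.smooth_Q.comp contDiff_snd.contDiffOn fun z hz => hz.2
    have hc : ∀ i, ContDiffOn ℝ ∞ (fun z : (Fin 3 → ℝ) × E => z.1 i) (V ×ˢ U) := fun i =>
      (by fun_prop : ContDiff ℝ ∞ (fun z : (Fin 3 → ℝ) × E => z.1 i)).contDiffOn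
    refine ((((hc 0).smul hP).add ((hc 1).smul hQ)).prodMk (((hc 2).smul hP).add hQ)).congr
      fun z hz => ?_
    exact Prod.ext (orbChart_PQ hU hg r hz.1 z.2).1 (orbChart_PQ hU hg r hz.1 z.2).2
  refine ⟨V, orbChart hU hg r, hVo, ?_, ?_, hsm, ?_⟩
  · refine .of_continuous_injective_isOpenMap ?_ ?_ ?_
    · exact isQuotientMap_frac.continuous.comp (continuous_family hsm)
    · intro v w hvw
      have h1 := (frac_orbChart_iff hU hg r _ hx hr v.2).1 hvw
      have h2 := (frac_orbChart_iff hU hg r (orbChart hU hg r w) hx hr w.2).1 rfl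
      exact Subtype.ext (h1.2.2.trans h2.2.2.symm)
    · intro V' hV'
      obtain ⟨W, hW, rfl⟩ := isOpen_induced_iff.1 hV'
      rw [← isQuotientMap_frac.isOpen_preimage]
      have : Rep.frac ⁻¹' ((fun v : V => (orbChart hU hg r v).frac) '' (Subtype.val ⁻¹' W)) =
          Rep.frac ⁻¹' orb hU hg ⊤ r.frac ∩ ({s | transMat r s x 1 1 ≠ 0} ∩
            (fun s : Rep g U => affCoord (transMat r s x)) ⁻¹' (V ∩ W)) := by
        ext s
        constructor
        · rintro ⟨v, hv, e⟩
          obtain ⟨h1, h2, h3⟩ := (frac_orbChart_iff hU hg r s hx hr v.2).1 e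
          refine ⟨h1, h2, ?_⟩
          change affCoord (transMat r s x) ∈ V ∩ W
          rw [← h3]
          exact ⟨v.2, hv⟩
        · rintro ⟨h1, h2, h3, h4⟩
          exact ⟨⟨_, h3⟩, h4, (frac_orbChart_iff hU hg r s hx hr h3).2 ⟨h1, h2, rfl⟩⟩
      rw [this]
      refine ((isOpen_orb hU hg hne hfin _).preimage isQuotientMap_frac.continuous).inter ?_
      refine (continuousOn_affCoord r hx).isOpen_inter_preimage ?_ (hVo.inter hW)
      exact isOpen_ne_fun (continuous_transMat r hx 1 1) continuous_const
  -- The parameter (1,0,0) is the identity matrix, so each integral is the centre of its own chart.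
  · have h1 : (affMat ![1, 0, 0]).det ≠ 0 := by simp [det_affMat]
    refine ⟨![1, 0, 0], h1, ?_⟩
    rw [frac_eq_iff]
    intro y _
    have := orbChart_PQ hU hg r h1 y
    have e : (orbChart hU hg r ![1, 0, 0]).mat y = (1 : ℝ) • r.mat y := by
      rw [one_smul]
      simp only [Rep.mat, this.1, this.2]
      simp
    rw [e]
    exact par_of_smul _
  · rintro v hv w hw ⟨f, hf⟩
    obtain ⟨h1, h2⟩ := hf x hx
    have hev : ∀ᶠ v' in nhds v, v' ∈ V := hVo.mem_nhds hv
    have e1 : fderiv ℝ (fun v' => (orbChart hU hg r v').P x) v w = w 0 • r.P x + w 1 • r.Q x := by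
      have : (fun v' => (orbChart hU hg r v').P x) =ᶠ[nhds v]
          fun v' => v' 0 • r.P x + v' 1 • r.Q x :=
        hev.mono fun v' h => (orbChart_PQ hU hg r h x).1
      rw [this.fderiv_eq, HasFDerivAt.fderiv (((hasFDerivAt_apply (0 : Fin 3) v).smul_const _).fun_add
        ((hasFDerivAt_apply (1 : Fin 3) v).smul_const _))]
      simp
    have e2 : fderiv ℝ (fun v' => (orbChart hU hg r v').Q x) v w = w 2 • r.P x := by
      have : (fun v' => (orbChart hU hg r v').Q x) =ᶠ[nhds v]
          fun v' => v' 2 • r.P x + r.Q x :=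
        hev.mono fun v' h => (orbChart_PQ hU hg r h x).2
      rw [this.fderiv_eq, HasFDerivAt.fderiv
        (((hasFDerivAt_apply (2 : Fin 3) v).smul_const _).add_const _)]
      simp
    rw [e1, (orbChart_PQ hU hg r hv x).1] at h1
    rw [e2, (orbChart_PQ hU hg r hv x).2] at h2
    rw [Rep.det_mat] at hr
    have ind : ∀ a b : ℝ, a • r.P x + b • r.Q x = 0 → a = 0 ∧ b = 0 := by
      intro a b h
      have h0 := congrFun h 0
      have h1 := congrFun h 1
      simp at h0 h1
      constructor
      · refine (mul_eq_zero.1 (?_ : a * _ = 0)).resolve_right hr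
        linear_combination r.Q x 1 * h0 - r.Q x 0 * h1
      · refine (mul_eq_zero.1 (?_ : b * _ = 0)).resolve_right hr
        linear_combination r.P x 0 * h1 - r.P x 1 * h0
    have i2 := ind (w 2 - f x * v 2) (-f x) (by
      have : w 2 • r.P x - f x • (v 2 • r.P x + r.Q x) = 0 := sub_eq_zero.2 h2
      rw [← this]; module)
    have i1 := ind (w 0 - f x * v 0) (w 1 - f x * v 1) (by
      have : w 0 • r.P x + w 1 • r.Q x - f x • (v 0 • r.P x + v 1 • r.Q x) = 0 := sub_eq_zero.2 h1
      rw [← this]; module)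
    -- The lower right entry is constantly 1, so the Q-coefficient of the variation of the
    -- denominator is zero, and the proportionality factor must be zero.
    have hf0 : f x = 0 := by linarith [i2.2]
    simp only [hf0, zero_mul, sub_zero] at i1 i2
    refine hw (funext fun i => ?_)
    fin_cases i
    · exact i1.1
    · exact i1.2
    · exact i2.1

/-- The matrices of positive determinant are connected. -/
theorem isPreconnected_det_pos :
    IsPreconnected {p : (Fin 2 → ℝ) × (Fin 2 → ℝ) | 0 < p.1 0 * p.2 1 - p.1 1 * p.2 0} := by
  refine isPreconnected_of_forall_pair fun p hp q hq => ?_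
  set S := {p : (Fin 2 → ℝ) × (Fin 2 → ℝ) | 0 < p.1 0 * p.2 1 - p.1 1 * p.2 0}
  -- A segment moves the second row to the first row turned by a right angle without losing
  -- positivity; the matrices so reached form a copy of the punctured plane.
  have hrot : ∀ v : Fin 2 → ℝ, v ≠ 0 → (v, ![-v 1, v 0]) ∈ S := by
    intro v hv
    change 0 < v 0 * ![-v 1, v 0] 1 - v 1 * ![-v 1, v 0] 0
    simp only [Matrix.cons_val_zero, Matrix.cons_val_one]
    by_contra hc
    refine hv (funext fun i => ?_)
    fin_cases i <;> simp <;> nlinarith [sq_nonneg (v 0), sq_nonneg (v 1)]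
  have hne : ∀ p ∈ S, p.1 ≠ 0 := by
    rintro p hp h0
    simp [S, h0] at hp
  have hseg : ∀ p ∈ S, JoinedIn S p (p.1, ![-p.1 1, p.1 0]) := by
    intro p hp
    refine JoinedIn.of_segment_subset ?_
    rintro _ ⟨a, b, ha, hb, hab, rfl⟩
    have h2 := hrot p.1 (hne p hp)
    have h1 : 0 < p.1 0 * p.2 1 - p.1 1 * p.2 0 := hp
    change 0 < p.1 0 * ![-p.1 1, p.1 0] 1 - p.1 1 * ![-p.1 1, p.1 0] 0 at h2
    simp only [S, Set.mem_ofPred_eq, Prod.fst_add, Prod.snd_add, Prod.smul_fst, Prod.smul_snd,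
      Pi.add_apply, Pi.smul_apply, smul_eq_mul, ← add_mul, hab, one_mul]
    rcases ha.eq_or_lt with h | h
    · subst h; simp only [zero_add] at hab; subst hab; linarith
    · nlinarith [mul_pos h h1, mul_nonneg hb h2.le]
  have hmid : JoinedIn S (p.1, ![-p.1 1, p.1 0]) (q.1, ![-q.1 1, q.1 0]) := by
    have hc : IsPathConnected ({0}ᶜ : Set (Fin 2 → ℝ)) :=
      isPathConnected_compl_singleton_of_one_lt_rank (by simp) 0
    have := (hc.joinedIn p.1 (hne p hp) q.1 (hne q hq)).map
      (f := fun v : Fin 2 → ℝ => (v, ![-v 1, v 0])) (by fun_prop)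
    exact this.mono (by rintro _ ⟨v, hv, rfl⟩; exact hrot v hv)
  have hj := ((hseg p hp).trans hmid).trans (hseg q hq).symm
  obtain ⟨γ, hγ⟩ := hj
  exact ⟨Set.range γ, by rintro _ ⟨t, rfl⟩; exact hγ t, ⟨0, γ.source⟩, ⟨1, γ.target⟩,
    isPreconnected_range γ.continuous⟩

/-- Rescaling a 2×2 matrix multiplies its determinant by a square, so the sign of the transition
determinant is well defined on the projective group. -/
theorem mem_orb_glpos_iff (r s : Rep g U) {x : E} (hx : x ∈ U) (hr : (r.mat x).det ≠ 0) :
    s.frac ∈ orb hU hg (Matrix.GLPos (Fin 2) ℝ) r.frac ↔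
      s.frac ∈ orb hU hg ⊤ r.frac ∧ 0 < (transMat r s x).det := by
  constructor
  · rintro ⟨A, hA, e⟩
    have hs : s.frac ∈ orb hU hg ⊤ r.frac := ⟨A, trivial, e⟩
    obtain ⟨hd, e'⟩ := frac_eq_moeb_of_mem_orb hU hg r s hs hx hr
    have hp := par_of_moeb_eq hU hg r hx hr (e.symm.trans e')
    obtain ⟨c, hc⟩ := hp.exists_smul (ne_zero_of_det hd)
    have hA' : 0 < A.1.det := hA
    rw [hc, Matrix.det_smul] at hA'
    refine ⟨hs, pos_of_mul_pos_right hA' ?_⟩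
    simp only [Fintype.card_fin]
    positivity
  · rintro ⟨hs, h⟩
    obtain ⟨hd, e'⟩ := frac_eq_moeb_of_mem_orb hU hg r s hs hx hr
    exact ⟨_, h, e'⟩

/-- On the full orbit the transition determinant at one good point is continuous and never zero. The
conditions ≥ 0 and > 0 therefore coincide there, and one is closed while the other is open. -/
theorem isClopen_orb_glpos (hne : U.Nonempty)
    (hfin : {O : Set (FLI g U) | ∃ F, O = orb hU hg ⊤ F}.Finite) (F : FLI g U) :
    IsClopen (orb hU hg (Matrix.GLPos (Fin 2) ℝ) F) := by
  obtain ⟨r, rfl⟩ := frac_surjective F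
  obtain ⟨x, hx, hr⟩ := r.exists_det_ne_zero hU hne
  have hc : Continuous fun s : Rep g U => (transMat r s x).det := by
    simp only [Matrix.det_fin_two]
    have := continuous_transMat r hx
    exact ((this 0 0).mul (this 1 1)).sub ((this 0 1).mul (this 1 0))
  constructor
  · rw [← isQuotientMap_frac.isClosed_preimage]
    have : Rep.frac ⁻¹' orb hU hg (Matrix.GLPos (Fin 2) ℝ) r.frac =
        Rep.frac ⁻¹' orb hU hg ⊤ r.frac ∩ {s | 0 ≤ (transMat r s x).det} := by
      ext s
      refine (mem_orb_glpos_iff hU hg r s hx hr).trans (and_congr_right fun hs => ?_)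
      obtain ⟨hd, -⟩ := frac_eq_moeb_of_mem_orb hU hg r s hs hx hr
      exact ⟨fun h => h.le, fun h => lt_of_le_of_ne h (Ne.symm hd)⟩
    rw [this]
    exact ((isClosed_orb hU hg hne _).preimage isQuotientMap_frac.continuous).inter
      (isClosed_le continuous_const hc)
  · rw [← isQuotientMap_frac.isOpen_preimage]
    have : Rep.frac ⁻¹' orb hU hg (Matrix.GLPos (Fin 2) ℝ) r.frac =
        Rep.frac ⁻¹' orb hU hg ⊤ r.frac ∩ {s | 0 < (transMat r s x).det} := by
      ext s
      exact mem_orb_glpos_iff hU hg r s hx hr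
    rw [this]
    exact ((isOpen_orb hU hg hne hfin _).preimage isQuotientMap_frac.continuous).inter
      (isOpen_lt continuous_const hc)

theorem isPreconnected_orb_glpos (F : FLI g U) :
    IsPreconnected (orb hU hg (Matrix.GLPos (Fin 2) ℝ) F) := by
  obtain ⟨r, rfl⟩ := frac_surjective F
  set S := {p : (Fin 2 → ℝ) × (Fin 2 → ℝ) | 0 < p.1 0 * p.2 1 - p.1 1 * p.2 0} with hS
  have hdet : ∀ p : S, (Matrix.of ![p.1.1, p.1.2]).det ≠ 0 := fun p => by
    have := p.2
    rw [Matrix.det_fin_two]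
    exact ne_of_gt (by simpa [hS] using this)
  set f : S → Rep g U := fun p =>
    r.moebius hU hg (Matrix.GeneralLinearGroup.mkOfDetNeZero _ (hdet p)) with hf
  have hfc : Continuous f := by
    refine continuous_induced_rng.2 (ContinuousMap.continuous_of_continuous_uncurry _ ?_)
    have hP : Continuous fun q : S × U => r.P q.2 :=
      r.smooth_P.continuousOn.comp_continuous (f := fun q : S × U => (q.2 : E)) (by fun_prop)
        fun q => q.2.2
    have hQ : Continuous fun q : S × U => r.Q q.2 :=
      r.smooth_Q.continuousOn.comp_continuous (f := fun q : S × U => (q.2 : E)) (by fun_prop)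
        fun q => q.2.2
    have h1 : ∀ i, Continuous fun q : S × U => q.1.1.1 i := fun i => by fun_prop
    have h2 : ∀ i, Continuous fun q : S × U => q.1.1.2 i := fun i => by fun_prop
    exact (((h1 0).smul hP).add ((h1 1).smul hQ)).prodMk (((h2 0).smul hP).add ((h2 1).smul hQ))
  have : PreconnectedSpace S := Subtype.preconnectedSpace isPreconnected_det_pos
  have hr := isPreconnected_range (isQuotientMap_frac.continuous.comp hfc)
  convert hr using 1
  ext F'
  constructor
  · rintro ⟨A, hA, rfl⟩
    have hA' : 0 < A.1.det := hA
    rw [Matrix.det_fin_two] at hA'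
    refine ⟨⟨(A.1 0, A.1 1), hA'⟩, ?_⟩
    change moeb hU hg _ r.frac = _
    congr 1
    ext i j
    fin_cases i <;> rfl
  · rintro ⟨p, rfl⟩
    refine ⟨_, ?_, rfl⟩
    have := p.2
    change 0 < (Matrix.of ![p.1.1, p.1.2]).det
    rw [Matrix.det_fin_two]
    simpa [hS] using this

theorem connectedComponent_eq_orb (hne : U.Nonempty)
    (hfin : {O : Set (FLI g U) | ∃ F, O = orb hU hg ⊤ F}.Finite) (F : FLI g U) :
    connectedComponent F = orb hU hg (Matrix.GLPos (Fin 2) ℝ) F :=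
  Set.Subset.antisymm
    ((isClopen_orb_glpos hU hg hne hfin F).connectedComponent_subset (mem_orb_self hU hg _ F))
    ((isPreconnected_orb_glpos hU hg F).subset_connectedComponent (mem_orb_self hU hg _ F))

/-- Each full orbit consists of the positive orbits of one of its members and of the reflected
member, so there are at most two components per orbit. -/
theorem finite_connectedComponents (hne : U.Nonempty)
    (hfin : {O : Set (FLI g U) | ∃ F, O = orb hU hg ⊤ F}.Finite) :
    Finite (ConnectedComponents (FLI g U)) := by
  have hd : (!![(-1 : ℝ), 0; 0, 1]).det ≠ 0 := by simp [Matrix.det_fin_two]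
  set J : GL (Fin 2) ℝ := Matrix.GeneralLinearGroup.mkOfDetNeZero _ hd with hJ
  have : Finite {O : Set (FLI g U) | ∃ F, O = orb hU hg ⊤ F} := hfin
  let f : {O : Set (FLI g U) | ∃ F, O = orb hU hg ⊤ F} × Bool → ConnectedComponents (FLI g U) :=
    fun p => if p.2 then ConnectedComponents.mk p.1.2.choose
      else ConnectedComponents.mk (moeb hU hg J p.1.2.choose)
  refine Finite.of_surjective f fun c => ?_
  obtain ⟨F, rfl⟩ := ConnectedComponents.surjective_coe c
  set O : {O : Set (FLI g U) | ∃ F, O = orb hU hg ⊤ F} := ⟨orb hU hg ⊤ F, F, rfl⟩ with hO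
  have h0 : orb hU hg ⊤ F = orb hU hg ⊤ O.2.choose := O.2.choose_spec
  obtain ⟨A, -, hA⟩ : F ∈ orb hU hg ⊤ O.2.choose := h0 ▸ mem_orb_self hU hg ⊤ F
  have comp : ∀ F', F ∈ orb hU hg (Matrix.GLPos (Fin 2) ℝ) F' →
      ConnectedComponents.mk F' = ConnectedComponents.mk F := fun F' h => by
    rw [ConnectedComponents.coe_eq_coe, connectedComponent_eq_orb hU hg hne hfin,
      connectedComponent_eq_orb hU hg hne hfin, orb_eq_of_mem hU hg h]
  have hAd : A.1.det ≠ 0 := A.det_ne_zero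
  rcases lt_or_gt_of_ne hAd with h | h
  · refine ⟨(O, false), comp _ ⟨A * J⁻¹, ?_, ?_⟩⟩
    · have e : A.1.det = (A * J⁻¹).1.det * J.1.det := by
        rw [← Matrix.det_mul, ← Units.val_mul, inv_mul_cancel_right]
      have hJd : J.1.det = -1 := by
        change (!![(-1 : ℝ), 0; 0, 1]).det = -1
        simp [Matrix.det_fin_two]
      rw [hJd] at e
      change 0 < (A * J⁻¹).1.det
      linarith
    · rw [← moeb_mul, inv_mul_cancel_right]
      exact hA
  · exact ⟨(O, true), comp _ ⟨A, h, hA⟩⟩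

end orbit

end FracLin

namespace FracLin

/-! ### Finitely many orbits exclude dimension five -/

variable {g : E → Matrix (Fin 2) (Fin 2) ℝ} {U : Set E}

theorem par_of_smul_ne_zero {A B : Matrix (Fin 2) (Fin 2) ℝ} {c : ℝ} (hc : c ≠ 0) (hA : A ≠ 0)
    {M : Matrix (Fin 2) (Fin 2) ℝ} (h1 : Par M A) (h2 : B = c • A) : ∃ f : ℝ, M = f • B := by
  obtain ⟨d, rfl⟩ := h1.exists_smul hA
  exact ⟨d / c, by rw [h2, smul_smul, div_mul_cancel₀ _ hc]⟩

theorem contDiffOn_slice {d : ℕ} {V : Set (Fin d → ℝ)} {r : (Fin d → ℝ) → Rep g U}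
    (h : ContDiffOn ℝ ∞ (fun z : (Fin d → ℝ) × E => ((r z.1).P z.2, (r z.1).Q z.2)) (V ×ˢ U))
    {x : E} (hx : x ∈ U) (i : Fin 2) : ContDiffOn ℝ ∞ (fun v => (r v).mat x i) V := by
  have h1 : ContDiffOn ℝ ∞ (fun v : Fin d → ℝ => ((r v).P x, (r v).Q x)) V :=
    h.comp (f := fun v : Fin d → ℝ => (v, x)) (by fun_prop) fun v hv => ⟨hv, hx⟩
  fin_cases i
  · exact h1.fst
  · exact h1.snd

/-- A chart stays in one open orbit near its centre, and there the value at a single point x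
determines the integral everywhere. With five parameters and four matrix entries at x, some
direction w leaves the value at x unchanged to first order; then it changes every other value only
by a scalar factor, against immersivity. -/
theorem not_hasDim_five (hU : IsOpen U) (hg : IsMetric g U) (hne : U.Nonempty)
    (hfin : {O : Set (FLI g U) | ∃ F, O = orb hU hg ⊤ F}.Finite) : ¬ HasDim g U 5 := by
  rintro ⟨⟨F⟩, h⟩
  obtain ⟨V, r, hV, hemb, ⟨v, hv, rfl⟩, hsm, him⟩ := h F
  obtain ⟨x, hx, hr⟩ := (r v).exists_det_ne_zero hU hne
  have hev : ∀ᶠ v' in nhds v, (r v').frac ∈ orb hU hg ⊤ (r v).frac := by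
    have h1 := (isOpen_orb hU hg hne hfin (r v).frac).preimage hemb.continuous
    obtain ⟨W, hW, hWV⟩ := isOpen_induced_iff.1 h1
    have hvW : v ∈ W := by
      have : (⟨v, hv⟩ : V) ∈ Subtype.val ⁻¹' W := by
        rw [hWV]; exact mem_orb_self hU hg ⊤ _
      exact this
    filter_upwards [hW.mem_nhds hvW, hV.mem_nhds hv] with v' h1 h2
    have : (⟨v', h2⟩ : V) ∈ Subtype.val ⁻¹' W := h1
    rw [hWV] at this
    exact this
  have hd : ∀ y ∈ U, ∀ i, DifferentiableAt ℝ (fun v' => (r v').mat y i) v := fun y hy i =>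
    ((contDiffOn_slice hsm hy i).contDiffAt (hV.mem_nhds hv)).differentiableAt (by simp)
  have hd' : ∀ y ∈ U, ∀ i j, DifferentiableAt ℝ (fun v' => (r v').mat y i j) v := fun y hy i j =>
    differentiableAt_pi.1 (hd y hy i) j
  -- The four entries of the matrix at x depend on five parameters, so their common differential has
  -- a kernel.
  have hker : LinearMap.ker (LinearMap.pi fun q : Fin 2 × Fin 2 =>
      (fderiv ℝ (fun v' => (r v').mat x q.1 q.2) v).toLinearMap) ≠ ⊥ := by
    refine LinearMap.ker_ne_bot_of_finrank_lt ?_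
    simp
  obtain ⟨w, hw, hw0⟩ := (Submodule.ne_bot_iff _).1 hker
  have hw1 : ∀ i j, fderiv ℝ (fun v' => (r v').mat x i j) v w = 0 := fun i j =>
    congrFun (LinearMap.mem_ker.1 hw) (i, j)
  have key : ∀ y ∈ U, ∃ f : ℝ, Matrix.of (fun i j => fderiv ℝ (fun v' => (r v').mat y i j) v w) =
      f • (r v).mat y := by
    intro y hy
    set B := ((r v).mat x).adjugate * (r v).mat y with hB
    have hN : ∀ v' i j, ((r v').mat x * ((r v).mat x).adjugate * (r v).mat y) i j =
        ∑ k, (r v').mat x i k * B k j := fun v' i j => by rw [mul_assoc, Matrix.mul_apply]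
    refine par_of_smul_ne_zero (A := (r v).mat y) one_ne_zero ((r v).mat_ne_zero hy) ?_
      (one_smul ℝ _).symm
    intro i j k l
    have hdet : ((r v).mat x) * B = ((r v).mat x).det • (r v).mat y := by
      rw [hB, ← mul_assoc, Matrix.mul_adjugate, Matrix.smul_mul, one_mul]
    -- Inside the orbit the value at y is proportional to the value at x times the fixed matrix B.
    -- Differentiating the proportionality along w kills the derivatives of the factors at x.
    have hp : (fun v' => (r v').mat y i j * ∑ n, (r v').mat x k n * B n l) =ᶠ[nhds v]
        fun v' => (r v').mat y k l * ∑ n, (r v').mat x i n * B n j := by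
      filter_upwards [hev] with v' h1
      have := (mem_orb_iff hU hg hne (r v) (r v')).1 h1 x hx y hy i j k l
      rwa [hN, hN] at this
    have e : ∀ k l, HasFDerivAt (fun v' => ∑ n, (r v').mat x k n * B n l)
        (∑ n, B n l • fderiv ℝ (fun v' => (r v').mat x k n) v) v := fun k l =>
      HasFDerivAt.fun_sum fun n _ => (hd' x hx k n).hasFDerivAt.mul_const _
    have e1 := ((hd' y hy i j).hasFDerivAt.mul (e k l)).congr_of_eventuallyEq hp.symm
    have e2 := ((hd' y hy k l).hasFDerivAt.mul (e i j))
    have e3 := congrArg (fun T : (Fin 5 → ℝ) →L[ℝ] ℝ => T w) (e1.unique e2)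
    have hs : ∀ k l, ∑ n, (r v).mat x k n * B n l = ((r v).mat x).det * (r v).mat y k l :=
      fun k l => by
        have := congrFun (congrFun hdet k) l
        rwa [Matrix.mul_apply] at this
    simp only [add_apply, smul_apply, smul_eq_mul, hs, Fin.sum_univ_two, hw1, mul_zero, add_zero,
      zero_add] at e3
    refine mul_left_cancel₀ hr ?_
    simp only [Matrix.of_apply]
    linear_combination e3
  choose! f hf using key
  have hrow : ∀ y ∈ U, ∀ i, fderiv ℝ (fun v' => (r v').mat y i) v w = f y • (r v).mat y i := by
    intro y hy i
    ext j
    rw [fderiv_pi (differentiableAt_pi.1 (hd y hy i))]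
    exact congrFun (congrFun (hf y hy) i) j
  exact him v hv w hw0 ⟨f, fun y hy => ⟨hrow y hy 0, hrow y hy 1⟩⟩

end FracLin

namespace FracLin

/-! ### Linear differential equations -/

/-- Truncation of the coordinates to `[-R, R]`. -/
noncomputable def clamp {n : ℕ} (R : ℝ) (y : Fin n → ℝ) : Fin n → ℝ := fun i => max (-R) (min R (y i))

theorem clamp_eq {n : ℕ} {R : ℝ} {y : Fin n → ℝ} (h : ‖y‖ ≤ R) : clamp R y = y := by
  ext i
  have := (norm_le_pi_norm y i).trans h
  rw [Real.norm_eq_abs, abs_le] at this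
  rw [clamp, min_eq_right this.2, max_eq_right this.1]

theorem norm_clamp_le {n : ℕ} {R : ℝ} (hR : 0 ≤ R) (y : Fin n → ℝ) : ‖clamp R y‖ ≤ R := by
  refine (pi_norm_le_iff_of_nonneg hR).2 fun i => ?_
  rw [Real.norm_eq_abs, abs_le]
  exact ⟨le_max_left _ _, max_le (by linarith) (min_le_left _ _)⟩

theorem norm_clamp_le_norm {n : ℕ} {R : ℝ} (hR : 0 ≤ R) (y : Fin n → ℝ) : ‖clamp R y‖ ≤ ‖y‖ := by
  refine (pi_norm_le_iff_of_nonneg (norm_nonneg _)).2 fun i => le_trans ?_ (norm_le_pi_norm y i)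
  rw [Real.norm_eq_abs, Real.norm_eq_abs, clamp]
  rcases le_total 0 (y i) with h | h
  · rw [abs_of_nonneg h, abs_le]
    exact ⟨le_max_of_le_right (le_min (by linarith) (by linarith)),
      max_le (by linarith) (min_le_right _ _)⟩
  · rw [abs_of_nonpos h, abs_le, min_eq_right (h.trans hR), neg_neg]
    exact ⟨le_max_right _ _, max_le (by linarith) (by linarith)⟩

theorem lipschitzWith_clamp {n : ℕ} (R : ℝ) : LipschitzWith 1 (clamp R : (Fin n → ℝ) → Fin n → ℝ) := by
  refine LipschitzWith.of_dist_le_mul fun x y => ?_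
  rw [NNReal.coe_one, one_mul]
  refine (dist_pi_le_iff dist_nonneg).2 fun i => le_trans ?_ (dist_le_pi_dist x y i)
  rw [Real.dist_eq, Real.dist_eq]
  refine (abs_max_sub_max_le_max _ _ _ _).trans ?_
  refine max_le (by simp) ((abs_min_sub_min_le_max _ _ _ _).trans (by simp))

theorem exists_bound_Icc {X F : Type*} [TopologicalSpace X] [SeminormedAddCommGroup F] {K : Set X}
    (hK : IsCompact K) {f : X → F} (hf : ContinuousOn f K) : ∃ M : ℝ, 0 < M ∧ ∀ t ∈ K, ‖f t‖ ≤ M := by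
  obtain ⟨M, hM⟩ := hK.exists_bound_of_continuousOn hf
  exact ⟨max M 1, by positivity, fun t ht => (hM t ht).trans (le_max_left _ _)⟩

theorem hasDerivWithinAt_Ici_of_Icc {F : Type*} [NormedAddCommGroup F] [NormedSpace ℝ F] {f : ℝ → F}
    {f' : F} {a b t : ℝ} (ht : t ∈ Set.Ico a b) (h : HasDerivWithinAt f f' (Set.Icc a b) t) :
    HasDerivWithinAt f f' (Set.Ici t) t :=
  (h.mono (Set.Icc_subset_Icc_left ht.1)).mono_of_mem_nhdsWithin (Icc_mem_nhdsGE ht.2)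

/-- Picard–Lindelöf on all of [0,1] needs a bounded right-hand side, so the state is truncated at R.
Truncation does not increase the norm, hence Grönwall bounds the solution by ‖y₀‖ exp M = R, and the
truncation is never active. -/
theorem exists_linear_ode {n : ℕ} {B : ℝ → (Fin n → ℝ) →L[ℝ] (Fin n → ℝ)}
    (hB : ContinuousOn B (Set.Icc 0 1)) (y₀ : Fin n → ℝ) :
    ∃ y : ℝ → Fin n → ℝ, y 0 = y₀ ∧
      ∀ t ∈ Set.Icc (0 : ℝ) 1, HasDerivWithinAt y (B t (y t)) (Set.Icc 0 1) t := by
  obtain ⟨M, hM0, hM⟩ := exists_bound_Icc isCompact_Icc hB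
  obtain ⟨R, hR⟩ : ∃ R, R = ‖y₀‖ * Real.exp M := ⟨_, rfl⟩
  have hR0 : 0 ≤ R := by rw [hR]; positivity
  lift M to NNReal using hM0.le
  lift R to NNReal using hR0
  have hR0 : (0 : ℝ) ≤ R := R.2
  have hpl : IsPicardLindelof (fun t y => B t (clamp R y)) (⟨0, by simp⟩ : Set.Icc (0 : ℝ) 1) y₀
      (M * R) 0 (M * R) M := by
    constructor
    · intro t ht
      have := ((B t).lipschitz.comp (lipschitzWith_clamp (n := n) R)).lipschitzOnWith
        (s := Metric.closedBall y₀ (M * R : NNReal))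
      refine this.weaken ?_
      rw [mul_one]
      exact hM t ht
    · exact fun x _ => hB.clm_apply continuousOn_const
    · intro t ht x _
      exact ((B t).le_opNorm _).trans (by
        push_cast; exact mul_le_mul (hM t ht) (norm_clamp_le hR0 x) (norm_nonneg _) hM0.le)
    · simp
  obtain ⟨y, hy0, hy⟩ := hpl.exists_eq_forall_mem_Icc_hasDerivWithinAt₀
  have hyR : ∀ t ∈ Set.Icc (0 : ℝ) 1, ‖y t‖ ≤ R := by
    intro t ht
    have h := norm_le_gronwallBound_of_norm_deriv_right_le (δ := ‖y₀‖) (K := M) (ε := 0)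
      (fun t ht => (hy t ht).continuousWithinAt)
      (fun t ht => hasDerivWithinAt_Ici_of_Icc ht (hy t (Set.Ico_subset_Icc_self ht)))
      (by rw [← hy0]) (fun t ht => by
        rw [add_zero]
        exact ((B t).le_opNorm _).trans (mul_le_mul (hM t (Set.Ico_subset_Icc_self ht))
          (norm_clamp_le_norm hR0 _) (norm_nonneg _) hM0.le)) t ht
    rw [gronwallBound_ε0] at h
    refine h.trans ?_
    rw [hR]
    gcongr
    nlinarith [ht.2]
  refine ⟨y, hy0, fun t ht => ?_⟩
  have := hy t ht
  rwa [clamp_eq (hyR t ht)] at this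

/-- Two solutions of a linear equation that agree initially agree. -/
theorem linear_ode_unique {F : Type*} [NormedAddCommGroup F] [NormedSpace ℝ F] {B : ℝ → F →L[ℝ] F}
    (hB : ContinuousOn B (Set.Icc 0 1)) {y z : ℝ → F}
    (hy : ∀ t ∈ Set.Icc (0 : ℝ) 1, HasDerivWithinAt y (B t (y t)) (Set.Icc 0 1) t)
    (hz : ∀ t ∈ Set.Icc (0 : ℝ) 1, HasDerivWithinAt z (B t (z t)) (Set.Icc 0 1) t)
    (h0 : y 0 = z 0) : Set.EqOn y z (Set.Icc 0 1) := by
  obtain ⟨M, hM0, hM⟩ := exists_bound_Icc isCompact_Icc hB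
  intro t ht
  refine sub_eq_zero.1 (eq_zero_of_abs_deriv_le_mul_abs_self_of_eq_zero_right (K := M)
    (f := fun t => y t - z t) (f' := fun t => B t (y t) - B t (z t))
    ((fun t ht => ((hy t ht).sub (hz t ht)).continuousWithinAt))
    (fun t ht => hasDerivWithinAt_Ici_of_Icc ht ((hy t (Set.Ico_subset_Icc_self ht)).sub
      (hz t (Set.Ico_subset_Icc_self ht)))) (by simp [h0]) (fun t ht => ?_) t ht)
  rw [← map_sub]
  exact (B t).le_of_opNorm_le (hM t (Set.Ico_subset_Icc_self ht)) _

/-- The differential approximates a continuously differentiable function uniformly on compacts. -/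
theorem eventually_uniform_approx {X F : Type*} [NormedAddCommGroup X] [NormedSpace ℝ X]
    [NormedAddCommGroup F] [NormedSpace ℝ F] {U K : Set X} (hU : IsOpen U) {f : X → F}
    (hf : ContDiffOn ℝ 1 f U) (hK : IsCompact K) (hKU : K ⊆ U) {ε : ℝ} (hε : 0 < ε) :
    ∀ᶠ h in nhds (0 : X), ∀ x ∈ K, ‖f (x + h) - f x - fderiv ℝ f x h‖ ≤ ε * ‖h‖ := by
  refine hK.eventually_forall_of_forall_eventually fun x hx => ?_
  have hs : HasStrictFDerivAt f (fderiv ℝ f x) x :=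
    (hf.contDiffAt (hU.mem_nhds (hKU hx))).hasStrictFDerivAt (by simp)
  have h1 := hs.isLittleO.def (half_pos hε)
  have hc : Filter.Tendsto (fun p : X × X => (p.2 + p.1, p.2)) (nhds (0, x)) (nhds (x, x)) := by
    have : Continuous (fun p : X × X => (p.2 + p.1, p.2)) := by fun_prop
    simpa using this.tendsto (0, x)
  have h2 := hc.eventually h1
  have hc2 : ContinuousAt (fderiv ℝ f) x :=
    (hf.continuousOn_fderiv_of_isOpen hU (by simp)).continuousAt (hU.mem_nhds (hKU hx))
  have h3 : ∀ᶠ y in nhds x, ‖fderiv ℝ f y - fderiv ℝ f x‖ ≤ ε / 2 := by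
    have := (Metric.tendsto_nhds.1 hc2 (ε / 2) (half_pos hε))
    exact this.mono fun y hy => by rw [← dist_eq_norm]; exact hy.le
  have h4 := (continuous_snd.tendsto ((0 : X), x)).eventually h3
  filter_upwards [h2, h4] with p hp hp'
  simp only [add_sub_cancel_left] at hp
  have e : f (p.2 + p.1) - f p.2 - fderiv ℝ f p.2 p.1 =
      (f (p.2 + p.1) - f p.2 - fderiv ℝ f x p.1) - (fderiv ℝ f p.2 - fderiv ℝ f x) p.1 := by
    simp
  change ‖f (p.2 + p.1) - f p.2 - fderiv ℝ f p.2 p.1‖ ≤ _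
  rw [e]
  refine (norm_sub_le _ _).trans ?_
  have := ContinuousLinearMap.le_of_opNorm_le _ hp' p.1
  linarith

theorem exists_bound_fderiv {X F : Type*} [NormedAddCommGroup X] [NormedSpace ℝ X]
    [NormedAddCommGroup F] [NormedSpace ℝ F] {U K : Set X} (hU : IsOpen U) {f : X → F}
    (hf : ContDiffOn ℝ 1 f U) (hK : IsCompact K) (hKU : K ⊆ U) :
    ∃ M : ℝ, 0 < M ∧ ∀ x ∈ K, ‖fderiv ℝ f x‖ ≤ M :=
  exists_bound_Icc hK ((hf.continuousOn_fderiv_of_isOpen hU (by simp)).mono hKU)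

theorem norm_le_sub_sub {G : Type*} [SeminormedAddCommGroup G] (a b c : G) :
    ‖a‖ ≤ ‖a - b - c‖ + ‖b‖ + ‖c‖ := by
  have e : a = a - b - c + b + c := by abel
  exact (congrArg norm e).trans_le norm_add₃_le

theorem norm_smul_le_of_mem_Icc {G : Type*} [SeminormedAddCommGroup G] [NormedSpace ℝ G] {t : ℝ}
    (ht : t ∈ Set.Icc (0 : ℝ) 1) (z : G) : ‖t • z‖ ≤ ‖z‖ := by
  rw [norm_smul, Real.norm_of_nonneg ht.1]
  exact mul_le_of_le_one_left (norm_nonneg _) ht.2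

section flat

variable {X F : Type*} [NormedAddCommGroup X] [NormedSpace ℝ X] [NormedAddCommGroup F]
  [NormedSpace ℝ F]

theorem apply_two_le {A : F →L[ℝ] X →L[ℝ] F} {a b c : ℝ} {y : F} {h : X} (hA : ‖A‖ ≤ a) (hy : ‖y‖ ≤ b)
    (hh : ‖h‖ ≤ c) : ‖A y h‖ ≤ a * b * c := by
  have ha : 0 ≤ a := (norm_nonneg A).trans hA
  have hb : 0 ≤ b := (norm_nonneg y).trans hy
  refine (A.le_opNorm₂ y h).trans ?_
  gcongr

/-- The defect of the first order variation of a solution along a ray. -/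
theorem variation_defect_le {A A' D : F →L[ℝ] X →L[ℝ] F} {y : F} {ξ h : X} {t M ε : ℝ} (hM : 1 ≤ M)
    (ht0 : 0 ≤ t) (ht1 : t ≤ 1) (hh : ‖h‖ ≤ ε) (hε : ε ≤ 1)
    (hA : ‖A‖ ≤ M) (hy : ‖y‖ ≤ M) (hξ : ‖ξ‖ ≤ M) (hD : ‖D‖ ≤ M * ‖h‖)
    (hR : ‖A' - A - t • D‖ ≤ ε * ‖h‖) :
    ‖A' (y + t • A y h) (ξ + h) - (A y ξ + A y h + t • (D y ξ + A (A y h) ξ))‖ ≤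
      20 * M ^ 4 * ε * ‖h‖ := by
  have hM0 : 0 ≤ M := by linarith
  have hε0 : 0 ≤ ε := (norm_nonneg h).trans hh
  -- The defect is the remainder of the first-order expansion of A plus three terms quadratic in h.
  have e : A' (y + t • A y h) (ξ + h) - (A y ξ + A y h + t • (D y ξ + A (A y h) ξ)) =
      (A' - A - t • D) (y + t • A y h) (ξ + h) + t ^ 2 • D (A y h) ξ +
        t • D (y + t • A y h) h + t • A (A y h) h := by
    simp only [sub_apply, add_apply, smul_apply, map_add, map_smul, smul_add, smul_sub]
    module
  have hAy : ‖A y h‖ ≤ M * M * ‖h‖ := apply_two_le hA hy le_rfl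
  have hh1 : ‖h‖ ≤ 1 := hh.trans hε
  have hw : ‖y + t • A y h‖ ≤ 2 * M ^ 2 := by
    refine (norm_add_le _ _).trans ?_
    rw [norm_smul, Real.norm_of_nonneg ht0]
    have : t * ‖A y h‖ ≤ 1 * (M * M * 1) := by gcongr; exact hAy.trans (by gcongr)
    nlinarith
  have hx : ‖ξ + h‖ ≤ 2 * M := (norm_add_le _ _).trans (by linarith)
  have n1 := apply_two_le hR hw hx
  have n2 := apply_two_le hD hAy hξ
  have n3 := apply_two_le hD hw (le_refl ‖h‖)
  have n4 := apply_two_le hA hAy (le_refl ‖h‖)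
  have hsm : ∀ (s : ℝ) (z : F), 0 ≤ s → s ≤ 1 → ‖s • z‖ ≤ ‖z‖ := fun s z h0 h1 => by
    rw [norm_smul, Real.norm_of_nonneg h0]
    exact mul_le_of_le_one_left (norm_nonneg _) h1
  rw [e]
  refine (norm_add₄_le).trans ?_
  have m2 := (hsm (t ^ 2) (D (A y h) ξ) (by positivity) (pow_le_one₀ ht0 ht1)).trans n2
  have m3 := (hsm t (D (y + t • A y h) h) ht0 ht1).trans n3
  have m4 := (hsm t (A (A y h) h) ht0 ht1).trans n4
  have hq : ‖h‖ * ‖h‖ ≤ ε * ‖h‖ := by gcongr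
  have p3 : M ^ 3 ≤ M ^ 4 := pow_le_pow_right₀ hM (by norm_num)
  have q0 : 0 ≤ ε * ‖h‖ := by positivity
  have q1 : M ^ 3 * (ε * ‖h‖) ≤ M ^ 4 * (ε * ‖h‖) := by gcongr
  have q2 : M ^ 4 * (‖h‖ * ‖h‖) ≤ M ^ 4 * (ε * ‖h‖) := by gcongr
  have q3 : M ^ 3 * (‖h‖ * ‖h‖) ≤ M ^ 4 * (ε * ‖h‖) := by gcongr
  calc _ ≤ ε * ‖h‖ * (2 * M ^ 2) * (2 * M) + M * ‖h‖ * (M * M * ‖h‖) * M +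
        M * ‖h‖ * (2 * M ^ 2) * ‖h‖ + M * (M * M * ‖h‖) * ‖h‖ := by gcongr
    _ = 4 * (M ^ 3 * (ε * ‖h‖)) + M ^ 4 * (‖h‖ * ‖h‖) + 3 * (M ^ 3 * (‖h‖ * ‖h‖)) := by ring
    _ ≤ 4 * (M ^ 4 * (ε * ‖h‖)) + M ^ 4 * (ε * ‖h‖) + 3 * (M ^ 4 * (ε * ‖h‖)) := by gcongr
    _ ≤ _ := by nlinarith [mul_nonneg (pow_nonneg hM0 4) q0]

/-- The ray from `x₀` to `x`. -/
def ray (x₀ x : X) (t : ℝ) : X := x₀ + t • (x - x₀)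

theorem ray_mem {U : Set X} (hc : Convex ℝ U) {x₀ x : X} (hx₀ : x₀ ∈ U) (hx : x ∈ U) {t : ℝ}
    (ht : t ∈ Set.Icc (0 : ℝ) 1) : ray x₀ x t ∈ U :=
  hc.add_smul_sub_mem hx₀ hx ht

theorem continuous_ray (x₀ x : X) : Continuous (ray x₀ x) := by unfold ray; fun_prop

theorem hasDerivAt_ray (x₀ x : X) (t : ℝ) : HasDerivAt (ray x₀ x) (x - x₀) t := by
  have h := ((hasDerivAt_id t).smul_const (x - x₀)).const_add x₀
  rw [one_smul] at h
  exact h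

/-- The variation of the solution along rays. -/
theorem ray_solution_variation {U : Set X} (hU : IsOpen U) (hc : Convex ℝ U)
    {A : X → F →L[ℝ] X →L[ℝ] F} (hA : ContDiffOn ℝ 1 A U)
    (hflat : ∀ x ∈ U, ∀ y h k, fderiv ℝ A x h y k + A x (A x y h) k =
      fderiv ℝ A x k y h + A x (A x y k) h) {x₀ x : X} (hx₀ : x₀ ∈ U) (hx : x ∈ U)
    {y : X → ℝ → F}
    (hy0 : ∀ z, y z 0 = y x₀ 0)
    (hy : ∀ z ∈ U, ∀ t ∈ Set.Icc (0 : ℝ) 1,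
      HasDerivWithinAt (y z) (A (ray x₀ z t) (y z t) (z - x₀)) (Set.Icc 0 1) t) :
    HasFDerivAt (fun z => y z 1) (A x (y x 1)) x := by
  have hI : IsCompact (Set.Icc (0 : ℝ) 1) := isCompact_Icc
  have hmem : ∀ t ∈ Set.Icc (0 : ℝ) 1, ray x₀ x t ∈ U := fun t ht => ray_mem hc hx₀ hx ht
  have hcA : ContinuousOn (fun t => A (ray x₀ x t)) (Set.Icc 0 1) :=
    hA.continuousOn.comp (continuous_ray x₀ x).continuousOn hmem
  obtain ⟨M1, -, hM1⟩ := exists_bound_Icc (F := F →L[ℝ] X →L[ℝ] F) hI hcA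
  obtain ⟨M2, -, hM2⟩ := exists_bound_fderiv hU hA (hI.image (continuous_ray x₀ x))
    (Set.image_subset_iff.2 hmem)
  obtain ⟨M3, -, hM3⟩ := exists_bound_Icc hI
    (f := y x) fun t ht => (hy x hx t ht).continuousWithinAt
  obtain ⟨M, hM, b1, b2, b3, b4⟩ : ∃ M : ℝ, 1 ≤ M ∧ M1 ≤ M ∧ M2 ≤ M ∧ M3 ≤ M ∧ ‖x - x₀‖ ≤ M :=
    ⟨max 1 (max (max M1 M2) (max M3 ‖x - x₀‖)), by simp, by simp, by simp, by simp, by simp⟩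
  have hM0 : 0 < M := by linarith
  -- K bounds the coefficient of the equation along the displaced ray, where ‖A‖ ≤ 2M + 1 and the
  -- direction has norm at most M + 1; C is the resulting Grönwall factor at time 1.
  set K : ℝ := (2 * M + 1) * (M + 1) with hK
  have hK0 : 0 < K := by positivity
  set C : ℝ := 20 * M ^ 4 * ((Real.exp K - 1) / K) with hC
  have hC0 : 0 < C := by
    have : 0 < Real.exp K - 1 := by linarith [Real.add_one_lt_exp hK0.ne']
    positivity
  rw [hasFDerivAt_iff_isLittleO_nhds_zero, Asymptotics.isLittleO_iff]
  intro c hc0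
  obtain ⟨ε, hε0, hε1, hεc⟩ : ∃ ε : ℝ, 0 < ε ∧ ε ≤ 1 ∧ C * ε ≤ c := by
    refine ⟨min 1 (c / C), by positivity, min_le_left _ _, ?_⟩
    calc C * min 1 (c / C) ≤ C * (c / C) := by gcongr; exact min_le_right _ _
      _ = c := by field_simp
  have hev := eventually_uniform_approx hU hA (hI.image (continuous_ray x₀ x))
    (Set.image_subset_iff.2 hmem) hε0
  obtain ⟨δ, hδ, hev⟩ := Metric.eventually_nhds_iff_ball.1 hev
  have hxU : ∀ᶠ h in nhds (0 : X), x + h ∈ U := by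
    have : Filter.Tendsto (fun h : X => x + h) (nhds 0) (nhds x) := by
      simpa using (by fun_prop : Continuous fun h : X => x + h).tendsto 0
    exact this.eventually (hU.mem_nhds hx)
  filter_upwards [hxU, Metric.ball_mem_nhds (0 : X) hδ, Metric.ball_mem_nhds (0 : X) hε0]
    with h hxh hhδ hhε
  rw [mem_ball_zero_iff] at hhδ hhε
  -- The approximate solution along the displaced ray: the point at time t moves by t h, and a flat
  -- section would change by A applied to that displacement.
  set w : ℝ → F := fun t => y x t + t • A (ray x₀ x t) (y x t) h with hw
  have hray : ∀ t, ray x₀ (x + h) t = ray x₀ x t + t • h := fun t => by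
    simp only [ray]; module
  have happ : ∀ t ∈ Set.Icc (0 : ℝ) 1,
      ‖A (ray x₀ (x + h) t) - A (ray x₀ x t) - t • fderiv ℝ A (ray x₀ x t) h‖ ≤ ε * ‖h‖ := by
    intro t ht
    have hth : ‖t • h‖ ≤ ‖h‖ := norm_smul_le_of_mem_Icc ht h
    have := hev (t • h) (mem_ball_zero_iff.2 (hth.trans_lt hhδ)) _ ⟨t, ht, rfl⟩
    rw [map_smul] at this
    rw [hray]
    exact this.trans (by gcongr)
  have hwd : ∀ t ∈ Set.Icc (0 : ℝ) 1, HasDerivWithinAt w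
      (A (ray x₀ x t) (y x t) (x - x₀) + A (ray x₀ x t) (y x t) h +
        t • (fderiv ℝ A (ray x₀ x t) h (y x t) (x - x₀) +
          A (ray x₀ x t) (A (ray x₀ x t) (y x t) h) (x - x₀))) (Set.Icc 0 1) t := by
    intro t ht
    have hdA : HasDerivWithinAt (fun t => A (ray x₀ x t)) (fderiv ℝ A (ray x₀ x t) (x - x₀))
        (Set.Icc 0 1) t :=
      ((hA.contDiffAt (hU.mem_nhds (hmem t ht))).differentiableAt
        (by simp)).hasFDerivAt.comp_hasDerivWithinAt t (hasDerivAt_ray x₀ x t).hasDerivWithinAt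
    have h1 := (hdA.clm_apply (hy x hx t ht)).clm_apply (hasDerivWithinAt_const t (Set.Icc 0 1) h)
    have h2 := (hy x hx t ht).add ((hasDerivWithinAt_id t (Set.Icc 0 1)).smul h1)
    refine h2.congr_deriv ?_
    -- Flatness interchanges h and x - x₀; this is what makes w solve the displaced equation up to
    -- the defect.
    have := hflat _ (hmem t ht) (y x t) h (x - x₀)
    rw [this]
    simp only [id, add_apply, map_zero, one_smul, add_zero]
    module
  have hz := hy (x + h) hxh
  have hgr := norm_le_gronwallBound_of_norm_deriv_right_le (f := fun t => y (x + h) t - w t)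
    (a := 0) (b := 1) (δ := 0) (K := K) (ε := 20 * M ^ 4 * ε * ‖h‖)
    (fun t ht => ((hz t ht).sub (hwd t ht)).continuousWithinAt)
    (fun t ht => hasDerivWithinAt_Ici_of_Icc ht ((hz t (Set.Ico_subset_Icc_self ht)).sub
      (hwd t (Set.Ico_subset_Icc_self ht)))) (by simp [hw, hy0 (x + h), hy0 x]) (by
      intro t ht
      replace ht := Set.Ico_subset_Icc_self ht
      have hD : ‖fderiv ℝ A (ray x₀ x t) h‖ ≤ M * ‖h‖ :=
        ContinuousLinearMap.le_of_opNorm_le _ ((hM2 _ ⟨t, ht, rfl⟩).trans b2) h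
      have hdef := variation_defect_le hM ht.1 ht.2 hhε.le hε1 ((hM1 t ht).trans b1)
        ((hM3 t ht).trans b3) b4 hD (happ t ht)
      have hA' : ‖A (ray x₀ (x + h) t)‖ ≤ 2 * M + 1 := by
        refine (norm_le_sub_sub (G := F →L[ℝ] X →L[ℝ] F) _ (A (ray x₀ x t))
          (t • fderiv ℝ A (ray x₀ x t) h)).trans ?_
        have h1 : ‖t • fderiv ℝ A (ray x₀ x t) h‖ ≤ M := by
          refine (norm_smul_le_of_mem_Icc (G := F →L[ℝ] X →L[ℝ] F) ht _).trans (hD.trans ?_)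
          exact mul_le_of_le_one_right hM0.le (by linarith)
        have h2 : ε * ‖h‖ ≤ 1 * 1 := by gcongr; linarith
        linarith [(hM1 t ht).trans b1, happ t ht]
      have hxh' : ‖x + h - x₀‖ ≤ M + 1 := by
        rw [add_sub_right_comm]
        exact (norm_add_le _ _).trans (by linarith)
      have e : A (ray x₀ (x + h) t) (y (x + h) t) (x + h - x₀) -
          (A (ray x₀ x t) (y x t) (x - x₀) + A (ray x₀ x t) (y x t) h +
          t • (fderiv ℝ A (ray x₀ x t) h (y x t) (x - x₀) +
            A (ray x₀ x t) (A (ray x₀ x t) (y x t) h) (x - x₀))) =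
          A (ray x₀ (x + h) t) (y (x + h) t - w t) (x + h - x₀) +
          (A (ray x₀ (x + h) t) (w t) (x - x₀ + h) -
          (A (ray x₀ x t) (y x t) (x - x₀) + A (ray x₀ x t) (y x t) h +
          t • (fderiv ℝ A (ray x₀ x t) h (y x t) (x - x₀) +
            A (ray x₀ x t) (A (ray x₀ x t) (y x t) h) (x - x₀)))) := by
        rw [map_sub (A (ray x₀ (x + h) t)) (y (x + h) t), sub_apply, add_sub_right_comm x h x₀]
        abel
      rw [e]
      refine (norm_add_le _ _).trans (add_le_add ?_ hdef)
      refine (apply_two_le hA' le_rfl hxh').trans (le_of_eq ?_)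
      rw [hK]; ring) 1 (by simp)
  rw [gronwallBound_of_K_ne_0 hK0.ne'] at hgr
  have hr1 : ray x₀ x 1 = x := by simp [ray]
  have e : y (x + h) 1 - y x 1 - A x (y x 1) h = y (x + h) 1 - w 1 := by
    simp only [hw, one_smul, hr1]; abel
  rw [e]
  refine hgr.trans ?_
  calc _ = C * ε * ‖h‖ := by rw [hC]; simp; ring
    _ ≤ c * ‖h‖ := by gcongr

/-- The equation expresses dY through Y, so each order of smoothness yields the next. -/
theorem contDiffOn_of_linear {U : Set X} (hU : IsOpen U) {A : X → F →L[ℝ] X →L[ℝ] F}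
    (hA : ContDiffOn ℝ ∞ A U) {Y : X → F} (hY : ∀ x ∈ U, HasFDerivAt Y (A x (Y x)) x) :
    ContDiffOn ℝ ∞ Y U := by
  refine contDiffOn_infty.2 fun m => ?_
  induction m with
  | zero => exact contDiffOn_zero.2 fun x hx => (hY x hx).continuousAt.continuousWithinAt
  | succ m ih =>
    push_cast
    refine (contDiffOn_succ_iff_fderiv_of_isOpen hU).2
      ⟨fun x hx => (hY x hx).differentiableAt.differentiableWithinAt, by simp, ?_⟩
    exact ((hA.of_le (by exact_mod_cast le_top)).clm_apply ih).congr fun x hx => (hY x hx).fderiv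

/-- A linear system `dY = A(x) Y` satisfying the integrability condition has global solutions on a
convex open set. -/
theorem exists_flat_section {n : ℕ} {U : Set X} (hU : IsOpen U) (hc : Convex ℝ U)
    {A : X → (Fin n → ℝ) →L[ℝ] X →L[ℝ] (Fin n → ℝ)} (hA : ContDiffOn ℝ ∞ A U)
    (hflat : ∀ x ∈ U, ∀ y h k, fderiv ℝ A x h y k + A x (A x y h) k =
      fderiv ℝ A x k y h + A x (A x y k) h) {x₀ : X} (hx₀ : x₀ ∈ U) (y₀ : Fin n → ℝ) :
    ∃ Y : X → Fin n → ℝ, Y x₀ = y₀ ∧ ContDiffOn ℝ ∞ Y U ∧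
      ∀ x ∈ U, HasFDerivAt Y (A x (Y x)) x := by
  -- Initial values are transported along rays from x₀; a constant path is the default for endpoints
  -- outside the domain.
  have hex : ∀ z, ∃ y : ℝ → Fin n → ℝ, y 0 = y₀ ∧ (z ∈ U → ∀ t ∈ Set.Icc (0 : ℝ) 1,
      HasDerivWithinAt y (A (ray x₀ z t) (y t) (z - x₀)) (Set.Icc 0 1) t) := by
    intro z
    by_cases hz : z ∈ U
    · have hB : ContinuousOn (fun t => (A (ray x₀ z t)).flip (z - x₀)) (Set.Icc 0 1) :=
        ((ContinuousLinearMap.flipₗᵢ ℝ _ _ _).continuous.comp_continuousOn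
          (hA.continuousOn.comp (continuous_ray x₀ z).continuousOn fun t ht =>
            ray_mem hc hx₀ hz ht)).clm_apply continuousOn_const
      obtain ⟨y, h0, hy⟩ := exists_linear_ode hB y₀
      exact ⟨y, h0, fun _ => hy⟩
    · exact ⟨fun _ => y₀, rfl, fun h => absurd h hz⟩
  choose y hy0 hy using hex
  have hd : ∀ x ∈ U, HasFDerivAt (fun z => y z 1) (A x (y x 1)) x := fun x hx =>
    ray_solution_variation hU hc (hA.of_le (by exact_mod_cast le_top)) hflat hx₀ hx
      (fun z => (hy0 z).trans (hy0 x₀).symm) hy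
  refine ⟨fun z => y z 1, ?_, contDiffOn_of_linear hU hA hd, hd⟩
  have h1 := hy x₀ hx₀
  have h2 : Set.EqOn (y x₀) (fun _ => y₀) (Set.Icc 0 1) :=
    linear_ode_unique (B := fun _ => 0) continuousOn_const
      (fun t ht => by simpa using h1 t ht) (fun t ht => by simpa using hasDerivWithinAt_const t _ y₀)
      (hy0 x₀)
  exact h2 (by simp)

/-- Solutions of a linear system on a convex set that agree at a point agree. -/
theorem flat_section_unique {U : Set X} (hc : Convex ℝ U) {A : X → F →L[ℝ] X →L[ℝ] F}
    (hA : ContinuousOn A U) {Y Z : X → F} (hY : ∀ x ∈ U, HasFDerivAt Y (A x (Y x)) x)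
    (hZ : ∀ x ∈ U, HasFDerivAt Z (A x (Z x)) x) {x₀ : X} (hx₀ : x₀ ∈ U) (h0 : Y x₀ = Z x₀) :
    Set.EqOn Y Z U := by
  intro x hx
  have hB : ContinuousOn (fun t => (A (ray x₀ x t)).flip (x - x₀)) (Set.Icc 0 1) :=
    ((ContinuousLinearMap.flipₗᵢ ℝ _ _ _).continuous.comp_continuousOn
      (hA.comp (continuous_ray x₀ x).continuousOn fun t ht =>
        ray_mem hc hx₀ hx ht)).clm_apply continuousOn_const
  have hcomp : ∀ {Y : X → F}, (∀ x ∈ U, HasFDerivAt Y (A x (Y x)) x) → ∀ t ∈ Set.Icc (0 : ℝ) 1,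
      HasDerivWithinAt (fun t => Y (ray x₀ x t)) ((A (ray x₀ x t)).flip (x - x₀) (Y (ray x₀ x t)))
        (Set.Icc 0 1) t := fun hY t ht =>
    (hY _ (ray_mem hc hx₀ hx ht)).comp_hasDerivWithinAt t (hasDerivAt_ray x₀ x t).hasDerivWithinAt
  have := linear_ode_unique hB (hcomp hY) (hcomp hZ) (by simpa [ray] using h0)
    (Set.right_mem_Icc.2 zero_le_one)
  simpa [ray] using this

end flat

end FracLin

namespace FracLin

/-! ### Flat linear systems in coordinates -/

variable {O : TopologicalSpace.Opens E}

/-- The bilinear map `(y, h) ↦ hᵢ yₗ eₖ`. -/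
noncomputable def elemMap {n : ℕ} (i : Fin 2) (k l : Fin n) :
    (Fin n → ℝ) →L[ℝ] E →L[ℝ] (Fin n → ℝ) :=
  ((ContinuousLinearMap.smulRightL ℝ E (Fin n → ℝ))
    (ContinuousLinearMap.proj (R := ℝ) (φ := fun _ : Fin 2 => ℝ) i)).comp
    ((ContinuousLinearMap.proj (R := ℝ) (φ := fun _ : Fin n => ℝ) l).smulRight (Pi.single k 1))

theorem elemMap_apply {n : ℕ} (i : Fin 2) (k l : Fin n) (y : Fin n → ℝ) (h : E) (m : Fin n) :
    elemMap i k l y h m = if m = k then h i * y l else 0 := by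
  simp [elemMap, Pi.single_apply, mul_comm]

/-- The operator of a linear system with coefficients `c`. -/
noncomputable def sysMap {n : ℕ} (c : Fin 2 → Fin n → Fin n → E → ℝ) (x : E) :
    (Fin n → ℝ) →L[ℝ] E →L[ℝ] (Fin n → ℝ) :=
  ∑ i, ∑ k, ∑ l, c i k l x • elemMap i k l

theorem sum_elemMap {n : ℕ} (c : Fin 2 → Fin n → Fin n → ℝ) (y : Fin n → ℝ) (h : E) (m : Fin n) :
    (∑ i, ∑ k, ∑ l, c i k l • elemMap i k l) y h m = ∑ i, h i * ∑ l, c i m l * y l := by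
  simp only [sum_apply, smul_apply, Finset.sum_apply, Pi.smul_apply, elemMap_apply, smul_eq_mul,
    mul_ite, mul_zero]
  refine Finset.sum_congr rfl fun i _ => ?_
  rw [Finset.mul_sum, Finset.sum_comm]
  refine Finset.sum_congr rfl fun l _ => ?_
  rw [Finset.sum_ite_eq Finset.univ m]
  simp only [Finset.mem_univ, if_true]
  ring

theorem fderiv_eq_sum_pd (F : E → ℝ) (x h : E) : fderiv ℝ F x h = ∑ i, h i * pd i F x := by
  have : h = ∑ i, h i • (Pi.single i 1 : E) := by
    ext j
    simp [Finset.sum_apply, Pi.single_apply]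
  conv_lhs => rw [this]
  simp only [map_sum, map_smul, smul_eq_mul, pd]

theorem hasFDerivAt_sum_smul {X G : Type*} [NormedAddCommGroup X] [NormedSpace ℝ X]
    [NormedAddCommGroup G] [NormedSpace ℝ G] {n : ℕ} {c : Fin 2 → Fin n → Fin n → X → ℝ} {x : X}
    (hc : ∀ i k l, DifferentiableAt ℝ (c i k l) x) (e : Fin 2 → Fin n → Fin n → G) :
    HasFDerivAt (fun x => ∑ i, ∑ k, ∑ l, c i k l x • e i k l)
      (∑ i, ∑ k, ∑ l, (fderiv ℝ (c i k l) x).smulRight (e i k l)) x :=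
  HasFDerivAt.fun_sum fun i _ => HasFDerivAt.fun_sum fun k _ => HasFDerivAt.fun_sum fun l _ =>
    (hc i k l).hasFDerivAt.smul_const _

theorem contDiffOn_sum_smul {X G : Type*} [NormedAddCommGroup X] [NormedSpace ℝ X]
    [NormedAddCommGroup G] [NormedSpace ℝ G] {n : ℕ} {c : Fin 2 → Fin n → Fin n → X → ℝ} {U : Set X}
    (hc : ∀ i k l, ContDiffOn ℝ ∞ (c i k l) U) (e : Fin 2 → Fin n → Fin n → G) :
    ContDiffOn ℝ ∞ (fun x => ∑ i, ∑ k, ∑ l, c i k l x • e i k l) U :=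
  ContDiffOn.sum fun i _ => ContDiffOn.sum fun k _ => ContDiffOn.sum fun l _ =>
    (hc i k l).smul contDiffOn_const

theorem fderiv_sysMap {n : ℕ} {c : Fin 2 → Fin n → Fin n → E → ℝ} {x : E}
    (hc : ∀ i k l, DifferentiableAt ℝ (c i k l) x) (h : E) (y : Fin n → ℝ) (v : E) (m : Fin n) :
    fderiv ℝ (sysMap c) x h y v m = ∑ i, v i * ∑ l, fderiv ℝ (c i m l) x h * y l := by
  have e : HasFDerivAt (sysMap c) _ x := hasFDerivAt_sum_smul hc elemMap
  rw [e.fderiv, ← sum_elemMap (fun i k l => fderiv ℝ (c i k l) x h)]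
  simp only [sum_apply, ContinuousLinearMap.smulRight_apply]

theorem contDiffOn_sysMap {n : ℕ} {c : Fin 2 → Fin n → Fin n → E → ℝ} {U : Set E}
    (hc : ∀ i k l, ContDiffOn ℝ ∞ (c i k l) U) : ContDiffOn ℝ ∞ (sysMap c) U :=
  contDiffOn_sum_smul hc elemMap

theorem hasFDerivAt_sysMap_iff {n : ℕ} {c : Fin 2 → Fin n → Fin n → E → ℝ} {Y : E → Fin n → ℝ}
    {x : E} : HasFDerivAt Y (sysMap c x (Y x)) x ↔
      DifferentiableAt ℝ Y x ∧ ∀ i k, pd i (fun y => Y y k) x = ∑ l, c i k l x * Y x l := by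
  have hs : ∀ h m, sysMap c x (Y x) h m = ∑ i, h i * ∑ l, c i m l x * Y x l := fun h m =>
    sum_elemMap (fun i k l => c i k l x) (Y x) h m
  constructor
  · intro hY
    refine ⟨hY.differentiableAt, fun i k => ?_⟩
    rw [pd, (hasFDerivAt_pi'.1 hY k).fderiv]
    change sysMap c x (Y x) (Pi.single i 1) k = _
    rw [hs]
    simp [Pi.single_apply]
  · rintro ⟨hd, h⟩
    refine hd.hasFDerivAt.congr_fderiv ?_
    ext v m
    rw [hs, fderiv_pi (differentiableAt_pi.1 hd)]
    change fderiv ℝ (fun y => Y y m) x v = _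
    rw [fderiv_eq_sum_pd]
    simp only [h]

theorem evalSm_sd (i : Fin 2) (f : SmoothFn O) (x : O) :
    evalSm x (sd O i f) = pd i (extZero O f.1) x := rfl

theorem evalSm_extZero (f : SmoothFn O) (x : O) : extZero O f.1 x = evalSm x f := extZero_apply _ _

/-- Global solutions of a flat linear system on a convex open set. -/
theorem exists_flat_solution (hc : Convex ℝ (O : Set E)) {n : ℕ}
    {C : Fin 2 → Fin n → Fin n → SmoothFn O}
    (hC : ∀ k l, sd O 0 (C 1 k l) + ∑ m, C 1 k m * C 0 m l =
      sd O 1 (C 0 k l) + ∑ m, C 0 k m * C 1 m l) (x₀ : O) (y₀ : Fin n → ℝ) :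
    ∃ y : Fin n → SmoothFn O, (∀ k, evalSm x₀ (y k) = y₀ k) ∧
      ∀ i k, sd O i (y k) = ∑ l, C i k l * y l := by
  set c : Fin 2 → Fin n → Fin n → E → ℝ := fun i k l => extZero O (C i k l).1 with hcdef
  have hcs : ∀ i k l, ContDiffOn ℝ ∞ (c i k l) O := fun i k l => smoothFn_smooth _
  have flat : ∀ x ∈ O, ∀ k l, pd 0 (c 1 k l) x + ∑ m, c 1 k m x * c 0 m l x =
      pd 1 (c 0 k l) x + ∑ m, c 0 k m x * c 1 m l x := by
    intro x hx k l
    lift x to O using hx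
    have := congrArg (evalSm x) (hC k l)
    simp only [map_add, map_sum, map_mul, evalSm_sd] at this
    simpa only [c, evalSm_extZero] using this
  obtain ⟨Y, hY0, hYs, hY⟩ := exists_flat_section O.2 hc (contDiffOn_sysMap hcs) (by
    intro x hx y h v
    have hd : ∀ i k l, DifferentiableAt ℝ (c i k l) x := fun i k l =>
      diffAt_of_contDiffOn O.2 (hcs i k l) hx
    ext m
    have hs : ∀ y h m, sysMap c x y h m = ∑ i, h i * ∑ l, c i m l x * y l := fun y h m =>
      sum_elemMap (fun i k l => c i k l x) y h m
    have e : ∀ i j, ∑ l, c i m l x * ∑ p, c j l p x * y p =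
        ∑ p, (∑ l, c i m l x * c j l p x) * y p := fun i j => by
      simp only [Finset.mul_sum, Finset.sum_mul]
      rw [Finset.sum_comm]
      simp only [mul_assoc]
    have key : ∑ p, pd 0 (c 1 m p) x * y p + ∑ l, c 1 m l x * ∑ p, c 0 l p x * y p =
        ∑ p, pd 1 (c 0 m p) x * y p + ∑ l, c 0 m l x * ∑ p, c 1 l p x * y p := by
      rw [e, e, ← Finset.sum_add_distrib, ← Finset.sum_add_distrib]
      refine Finset.sum_congr rfl fun p _ => ?_
      rw [← add_mul, flat x hx, add_mul]
    have e1 : ∀ (a b : ℝ) (f f' f'' : Fin n → ℝ), ∑ p, (a * f p + b * f' p) * f'' p =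
        a * ∑ p, f p * f'' p + b * ∑ p, f' p * f'' p := fun a b f f' f'' => by
      simp only [add_mul, Finset.sum_add_distrib, Finset.mul_sum, mul_assoc]
    have e2 : ∀ (a b : ℝ) (f f' f'' : Fin n → ℝ), ∑ p, f'' p * (a * f p + b * f' p) =
        a * ∑ p, f'' p * f p + b * ∑ p, f'' p * f' p := fun a b f f' f'' => by
      simp only [mul_add, Finset.sum_add_distrib, Finset.mul_sum]
      congr 1 <;> exact Finset.sum_congr rfl fun _ _ => by ring
    simp only [Pi.add_apply, fderiv_sysMap hd, hs, fderiv_eq_sum_pd, Fin.sum_univ_two, e1, e2]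
    -- In two variables flatness is a single identity, multiplied by the area spanned by the two
    -- directions.
    linear_combination (h 0 * v 1 - h 1 * v 0) * key) x₀.2 y₀
  refine ⟨fun k => toSm (fun x => Y x k) (contDiffOn_pi.1 hYs k), fun k => ?_, fun i k => ?_⟩
  · rw [evalSm_toSm, hY0]
  · rw [sd_toSm]
    refine smoothFn_ext fun x => ?_
    rw [evalSm_toSm, (hasFDerivAt_sysMap_iff.1 (hY x x.2)).2 i k]
    simp only [map_sum, map_mul, evalSm_toSm, hcdef, evalSm_extZero]

/-- A solution of a linear system on a convex open set that vanishes at a point is zero. -/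
theorem flat_solution_eq_zero (hc : Convex ℝ (O : Set E)) {n : ℕ}
    {C : Fin 2 → Fin n → Fin n → SmoothFn O} {y : Fin n → SmoothFn O}
    (hy : ∀ i k, sd O i (y k) = ∑ l, C i k l * y l) {x₀ : O} (h0 : ∀ k, evalSm x₀ (y k) = 0) :
    y = 0 := by
  set c : Fin 2 → Fin n → Fin n → E → ℝ := fun i k l => extZero O (C i k l).1 with hcdef
  have hcs : ∀ i k l, ContDiffOn ℝ ∞ (c i k l) O := fun i k l => smoothFn_smooth _
  have key := flat_section_unique (Y := fun x k => extZero O (y k).1 x) (Z := fun _ => 0) hc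
    (contDiffOn_sysMap hcs).continuousOn (fun x hx => by
      rw [hasFDerivAt_sysMap_iff]
      refine ⟨differentiableAt_pi.2 fun k => diffAt_of_contDiffOn O.2 (smoothFn_smooth (y k)) hx,
        fun i k => ?_⟩
      lift x to O using hx
      have := congrArg (evalSm x) (hy i k)
      simpa only [map_sum, map_mul, evalSm_sd, c, evalSm_extZero] using this)
    (fun x _ => by rw [map_zero]; exact hasFDerivAt_const _ _) x₀.2
    (by ext k; simpa [evalSm_extZero] using h0 k)
  ext k x
  exact (evalSm_extZero (y k) x).symm.trans (congrFun (key x.2) k)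

end FracLin

namespace FracLin

/-! ### Prolongation of the Killing equation -/

section prolongation

variable {g : E → Matrix (Fin 2) (Fin 2) ℝ} {O : TopologicalSpace.Opens E} (hg : IsMetric g O)

/-- The coefficients of the prolonged relative Killing equation, for the unknowns `(a₀, a₁, r)`. -/
noncomputable def relSys (L : Fin 2 → SmoothFn O) (i : Fin 2) : Fin 3 → Fin 3 → SmoothFn O :=
  ![![chrSm hg 0 i 0 + L i, chrSm hg 1 i 0, ![0, -1] i],
    ![chrSm hg 0 i 1, chrSm hg 1 i 1 + L i, ![1, 0] i],
    ![(sd O 0 (L 1) - sd O 1 (L 0)) * ![1, 0] i + curvSm hg * metSm hg i 1,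
      (sd O 0 (L 1) - sd O 1 (L 0)) * ![0, 1] i - curvSm hg * metSm hg i 0,
      ∑ m, chrSm hg m i m + L i]]

variable {hg}

/-- Four Killing equations and the two formulas for Dr are exactly the six first derivatives of
three unknowns. -/
theorem RelKilling.sys {L a : Fin 2 → SmoothFn O} {r : SmoothFn O}
    (ha : RelKilling (sd O) (chrSm hg) L a r) (i : Fin 2) (k : Fin 3) :
    sd O i (![a 0, a 1, r] k) = ∑ l, relSys hg L i k l * ![a 0, a 1, r] l := by
  have h := ha.deriv_skew hg.metricConn i
  have d := ha.diag
  have u := ha.up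
  have w := ha.down
  have gs := hg.metricConn.G_symm
  simp only [Fin.sum_univ_two] at h d u w
  simp only [Fin.sum_univ_three]
  fin_cases k
  · fin_cases i
    · simp [relSys, d]; ring
    · simp [relSys, w]; ring
  · fin_cases i
    · simp [relSys, u]; ring
    · simp [relSys, d]; ring
  · fin_cases i
    · simp [relSys] at h ⊢; rw [h]; ring
    · simp [relSys] at h ⊢; rw [h]; ring

/-- Only the two rows for the covector are used; the row for the skew part is a consequence of them.
-/
theorem relKilling_of_sys {y : Fin 3 → SmoothFn O}
    (hy : ∀ i k, sd O i (y k) = ∑ l, relSys hg 0 i k l * y l) :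
    RelKilling (sd O) (chrSm hg) 0 ![y 0, y 1] (y 2) := by
  simp only [Fin.sum_univ_three] at hy
  refine ⟨fun i => ?_, ?_, ?_⟩
  · fin_cases i
    · have := hy 0 0
      simp [relSys, Fin.sum_univ_two] at this ⊢
      linear_combination this
    · have := hy 1 1
      simp [relSys, Fin.sum_univ_two] at this ⊢
      linear_combination this
  · have := hy 0 1
    simp [relSys, Fin.sum_univ_two] at this ⊢
    linear_combination this
  · have := hy 1 0
    simp [relSys, Fin.sum_univ_two] at this ⊢
    linear_combination this

/-- In constant curvature the prolonged Killing equation is integrable. -/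
theorem relSys_flat (hK : ∀ i, sd O i (curvSm hg) = 0) (k l : Fin 3) :
    sd O 0 (relSys hg 0 1 k l) + ∑ m, relSys hg 0 1 k m * relSys hg 0 0 m l =
      sd O 1 (relSys hg 0 0 k l) + ∑ m, relSys hg 0 0 k m * relSys hg 0 1 m l := by
  have h := hg.metricConn
  have c00 := h.curv00
  have c01 := h.curv01
  have c10 := h.curv10
  have c11 := h.curv11
  have s0 := h.G_symm 0
  have s1 := h.G_symm 1
  have gs := h.g_symm
  have t := h.trace_closed
  have cp := h.compat
  simp only [Fin.sum_univ_two, s0, s1, map_add] at c00 c01 c10 c11 t cp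
  simp only [Fin.sum_univ_three]
  fin_cases k <;> fin_cases l <;>
    simp [relSys, Fin.sum_univ_two, s0, s1, gs, hK, cp]
  · linear_combination c00
  · linear_combination c10
  · ring
  · linear_combination c01
  · linear_combination c11
  · ring
  · ring
  · ring
  · linear_combination t

/-- The prolonged system is linear and total, so zero initial values propagate over a convex set. -/
theorem RelKilling.eq_zero (hc : Convex ℝ (O : Set E)) {L a : Fin 2 → SmoothFn O} {r : SmoothFn O}
    (ha : RelKilling (sd O) (chrSm hg) L a r) {x : O} (h0 : ∀ i, evalSm x (a i) = 0)
    (hr : evalSm x r = 0) : a = 0 ∧ r = 0 := by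
  have h := flat_solution_eq_zero hc ha.sys (x₀ := x) (fun k => by
    fin_cases k
    · exact h0 0
    · exact h0 1
    · exact hr)
  refine ⟨funext fun i => ?_, congrFun h 2⟩
  fin_cases i
  · exact congrFun h 0
  · exact congrFun h 1

theorem RelKilling.comb {L a b : Fin 2 → SmoothFn O} {r s : SmoothFn O}
    (ha : RelKilling (sd O) (chrSm hg) L a r) (hb : RelKilling (sd O) (chrSm hg) L b s) (c d : ℝ) :
    RelKilling (sd O) (chrSm hg) L (c • a + d • b) (c • r + d • s) := by
  have e : ∀ i j, sd O i ((c • a + d • b) j) = c • sd O i (a j) + d • sd O i (b j) := fun i j => by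
    simp
  refine ⟨fun i => ?_, ?_, ?_⟩
  · rw [e, ha.diag, hb.diag]
    simp only [Fin.sum_univ_two, Pi.add_apply, Pi.smul_apply]
    simp only [Algebra.smul_def]
    ring
  · rw [e, ha.up, hb.up]
    simp only [Fin.sum_univ_two, Pi.add_apply, Pi.smul_apply]
    simp only [Algebra.smul_def]
    ring
  · rw [e, ha.down, hb.down]
    simp only [Fin.sum_univ_two, Pi.add_apply, Pi.smul_apply]
    simp only [Algebra.smul_def]
    ring

/-- A pair of relative Killing covectors with the same cofactor, linearly independent over the
constants. -/
structure KillingPair (hg : IsMetric g O) (L a b : Fin 2 → SmoothFn O) (r s : SmoothFn O) :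
    Prop where
  fst : RelKilling (sd O) (chrSm hg) L a r
  snd : RelKilling (sd O) (chrSm hg) L b s
  indep : ∀ c d : ℝ, c • a + d • b = 0 → c = 0 ∧ d = 0

namespace KillingPair

variable {L a b : Fin 2 → SmoothFn O} {r s : SmoothFn O}

theorem comb_eq_zero (h : KillingPair hg L a b r s) (hc : Convex ℝ (O : Set E)) {x : O} {c d : ℝ}
    (h0 : ∀ i, c * evalSm x (a i) + d * evalSm x (b i) = 0)
    (hr : c * evalSm x r + d * evalSm x s = 0) : c = 0 ∧ d = 0 := by
  refine h.indep c d ((h.fst.comb h.snd c d).eq_zero hc (x := x) (fun i => ?_) ?_).1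
  · simpa using h0 i
  · simpa using hr

/-- If both covectors vanished at x, their jets there would be (0, 0, r) and (0, 0, s), which are
linearly dependent; a constant combination would then be identically zero. -/
theorem exists_ne_zero (h : KillingPair hg L a b r s) (hc : Convex ℝ (O : Set E)) (x : O) :
    ∃ i, evalSm x (a i) ≠ 0 ∨ evalSm x (b i) ≠ 0 := by
  by_contra hcon
  push Not at hcon
  have h1 := h.comb_eq_zero hc (x := x) (c := evalSm x s) (d := -evalSm x r)
    (fun i => by rw [(hcon i).1, (hcon i).2]; ring) (by ring)
  have h2 := h.comb_eq_zero hc (x := x) (c := 1) (d := 0)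
    (fun i => by rw [(hcon i).1, (hcon i).2]; ring) (by linarith [h1.2])
  exact one_ne_zero h2.1

/-- The zeros of the determinant of the pair are simple. -/
theorem exists_deriv_ne_zero (h : KillingPair hg L a b r s) (hc : Convex ℝ (O : Set E)) {x : O}
    (hw : evalSm x (wedge a b) = 0) : ∃ k, evalSm x (a k * s - b k * r) ≠ 0 := by
  by_contra hcon
  push Not at hcon
  simp only [wedge, map_sub, map_mul] at hw hcon
  obtain ⟨j, hj⟩ := h.exists_ne_zero hc x
  -- If w and a k * s - b k * r all vanish at x, the combination with constant weights b j and -a j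
  -- has zero value and zero skew derivative there.
  have h1 := h.comb_eq_zero hc (x := x) (c := evalSm x (b j)) (d := -evalSm x (a j))
    (fun i => by
      fin_cases i <;> fin_cases j <;> simp only [Fin.zero_eta, Fin.mk_one] <;> linarith)
    (by linarith [hcon j])
  rcases hj with h2 | h2
  · exact h2 (by linarith [h1.2])
  · exact h2 h1.1

theorem evalSm_sd_of_eventually {f : SmoothFn O} {x : O} {V : Set E} (hV : IsOpen V) (hx : (x : E) ∈ V)
    (h : ∀ y : O, (y : E) ∈ V → evalSm y f = 0) (i : Fin 2) : evalSm x (sd O i f) = 0 := by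
  have : extZero O f.1 =ᶠ[nhds (x : E)] fun _ => 0 := by
    filter_upwards [hV.mem_nhds hx, O.2.mem_nhds x.2] with y h1 h2
    exact (evalSm_extZero f ⟨y, h2⟩).trans (h ⟨y, h2⟩ h1)
  rw [evalSm_sd, pd, this.fderiv_eq]
  simp

/-- On an open set of zeros the gradient of the determinant would vanish as well, against simplicity
of the zeros. -/
theorem dense_wedge_ne_zero (h : KillingPair hg L a b r s) (hc : Convex ℝ (O : Set E)) :
    Dense {x : O | evalSm x (wedge a b) ≠ 0} := by
  intro x
  rw [mem_closure_iff]
  intro V hV hxV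
  obtain ⟨W, hW, rfl⟩ := isOpen_induced_iff.1 hV
  by_contra hcon
  have h0 : ∀ y : O, (y : E) ∈ W → evalSm y (wedge a b) = 0 := fun y hy => by
    by_contra hne
    exact hcon ⟨y, hy, hne⟩
  obtain ⟨k, hk⟩ := h.exists_deriv_ne_zero hc (h0 x hxV)
  have e := congrArg (evalSm x) (h.fst.deriv_wedge hg.metricConn h.snd k)
  rw [evalSm_sd_of_eventually hW hxV h0, map_add, map_mul, h0 x hxV, mul_zero, zero_add] at e
  exact hk e.symm

end KillingPair

theorem Rep.exists_killingPair (hg : IsMetric g O) (hne : (O : Set E).Nonempty) (r : Rep g O) :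
    ∃ (L : Fin 2 → SmoothFn O) (ρ σ : SmoothFn O),
      KillingPair hg L (lowSm hg r.smooth_P) (lowSm hg r.smooth_Q) ρ σ := by
  obtain ⟨L, ρ, σ, h1, h2⟩ := r.exists_relKilling hg
  have : Nonempty O := hne.to_subtype
  obtain ⟨x, hx⟩ := (dense_wedge hg r).nonempty
  refine ⟨L, ρ, σ, h1, h2, fun c d h => ?_⟩
  have e : ∀ i, c * evalSm x (lowSm hg r.smooth_P i) + d * evalSm x (lowSm hg r.smooth_Q i) = 0 :=
    fun i => by simpa using congrArg (evalSm x) (congrFun h i)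
  have hx' : evalSm x (wedge (lowSm hg r.smooth_P) (lowSm hg r.smooth_Q)) ≠ 0 := hx
  simp only [wedge, map_sub, map_mul] at hx'
  have e0 := e 0
  have e1 := e 1
  constructor
  · refine (mul_eq_zero.1 (?_ : c * _ = 0)).resolve_right hx'
    linear_combination evalSm x (lowSm hg r.smooth_Q 1) * e0 - evalSm x (lowSm hg r.smooth_Q 0) * e1
  · refine (mul_eq_zero.1 (?_ : d * _ = 0)).resolve_right hx'
    linear_combination evalSm x (lowSm hg r.smooth_P 0) * e1 - evalSm x (lowSm hg r.smooth_P 1) * e0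

end prolongation

end FracLin

namespace FracLin

/-! ### Fractional-linear integrals from pairs of covectors -/

section raise

variable {g : E → Matrix (Fin 2) (Fin 2) ℝ} {O : TopologicalSpace.Opens E} {hg : IsMetric g O}

/-- The vector field dual to a covector field. -/
noncomputable def raise (g : E → Matrix (Fin 2) (Fin 2) ℝ) (a : Fin 2 → SmoothFn O) (x : E) : E :=
  fun i => ∑ j, (g x)⁻¹ i j * extZero O (a j).1 x

theorem raise_smooth (hg : IsMetric g O) (a : Fin 2 → SmoothFn O) : ContDiffOn ℝ ∞ (raise g a) O :=
  contDiffOn_pi.2 fun i => ContDiffOn.sum fun j _ => (hg.smooth_inv i j).mul (smoothFn_smooth (a j))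

theorem low_raise (hg : IsMetric g O) (a : Fin 2 → SmoothFn O) (j : Fin 2) (x : O) :
    low g (raise g a) j x = evalSm x (a j) := by
  have hd := (hg.det_pos x.2).ne'
  obtain ⟨h1, h2, h3, h4⟩ := hg.inv_apply x.2
  generalize hD : g x 0 0 * g x 1 1 - g x 0 1 * g x 0 1 = d at hd h1 h2 h3 h4
  simp only [low, raise, Fin.sum_univ_two, h1, h2, h3, h4, evalSm_extZero]
  fin_cases j <;> simp only [Fin.zero_eta, Fin.mk_one, hg.symm x.2] <;> field_simp <;> rw [← hD] <;>
    ring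

/-- The bracket sees only the symmetrised derivative, so the skew part cancels between the two mixed
equations. -/
theorem RelKilling.poisson_eq {X : E → E} (hX : ContDiffOn ℝ ∞ X O) {L : Fin 2 → SmoothFn O}
    {r : SmoothFn O} (h : RelKilling (sd O) (chrSm hg) L (lowSm hg hX) r) :
    IsCofactor g O (raise g L) X := by
  intro x hx p
  lift x to O using hx
  obtain ⟨v, rfl⟩ := mom_surjective hg x.2 p
  have gs := hg.christoffel_symm O.2 x.2
  have d0 := congrArg (evalSm x) (h.diag 0)
  have d1 := congrArg (evalSm x) (h.diag 1)
  have u := congrArg (evalSm x) h.up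
  have w := congrArg (evalSm x) h.down
  rw [poisson_lin hg hX x.2, lin_mom hg _ x.2, lin_mom hg _ x.2]
  simp only [map_add, map_sub, map_mul, Fin.sum_univ_two, evalSm_sd_lowSm] at d0 d1 u w
  simp only [lowSm, chrSm, evalSm_toSm, gs] at d0 d1 u w
  have hl := fun j => low_raise hg L j x
  simp only [Fin.sum_univ_two, hl, gs]
  linear_combination v 0 * v 0 * d0 + v 1 * v 1 * d1 + v 0 * v 1 * u + v 0 * v 1 * w

theorem gaugeTrivial_of_sd (hg : IsMetric g O) {L : Fin 2 → SmoothFn O} {φ : SmoothFn O}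
    (h : ∀ i, sd O i φ = L i) : GaugeTrivial g O (raise g L) := by
  refine ⟨extZero O φ.1, smoothFn_smooth φ, fun x hx p => ?_⟩
  lift x to O using hx
  have e : ∀ i, pd i (extZero O φ.1) x = evalSm x (L i) := fun i => by rw [← h, evalSm_sd]
  have z : ∀ i, pd i (fun _ : E => evalSm x φ) p = 0 := fun i => by simp [pd]
  obtain ⟨h1, h2, h3, h4⟩ := hg.inv_apply x.2
  simp only [lin, raise, poisson, pd_ham, e, Fin.sum_univ_two, evalSm_extZero, z, h2, h3]
  ring

/-- The fraction of two vector fields dual to a Killing pair. -/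
noncomputable def KillingPair.rep (hc : Convex ℝ (O : Set E)) {X Y : E → E}
    (hX : ContDiffOn ℝ ∞ X O) (hY : ContDiffOn ℝ ∞ Y O) {L : Fin 2 → SmoothFn O} {r s : SmoothFn O}
    (h : KillingPair hg L (lowSm hg hX) (lowSm hg hY) r s) : Rep g O where
  P := X
  Q := Y
  smooth_P := hX
  smooth_Q := hY
  no_zero := by
    rintro x hx ⟨h1, h2⟩
    lift x to O using hx
    obtain ⟨i, hi⟩ := h.exists_ne_zero hc x
    simp [lowSm, low, h1, h2] at hi
  indep := by
    intro x hx
    rw [mem_closure_iff]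
    intro V hV hxV
    obtain ⟨y, hyV, hy⟩ := (h.dense_wedge_ne_zero hc).inter_open_nonempty _
      (hV.preimage continuous_subtype_val) ⟨⟨x, hx⟩, hxV⟩
    refine ⟨y, hyV, y.2, fun h0 => hy ?_⟩
    change low g X 0 y * low g Y 1 y - low g X 1 y * low g Y 0 y = 0
    rw [low_wedge hg X Y y.2, h0, mul_zero]
  integral := by
    intro x hx p hp
    rw [poisson_div O.2 hg hX hY hx hp, h.fst.poisson_eq hX x hx p, h.snd.poisson_eq hY x hx p]
    ring

theorem Par.mul_right {A B : Matrix (Fin 2) (Fin 2) ℝ} (h : Par A B) (M : Matrix (Fin 2) (Fin 2) ℝ) :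
    Par (A * M) (B * M) := fun i j k l => by
  simp only [Matrix.mul_apply, Fin.sum_univ_two]
  linear_combination M 0 j * M 0 l * h i 0 k 0 + M 0 j * M 1 l * h i 0 k 1 +
    M 1 j * M 0 l * h i 1 k 0 + M 1 j * M 1 l * h i 1 k 1

/-- The matrix of values of a pair of covectors. -/
noncomputable def covMat (a b : Fin 2 → SmoothFn O) (x : O) : Matrix (Fin 2) (Fin 2) ℝ :=
  Matrix.of ![fun j => evalSm x (a j), fun j => evalSm x (b j)]

theorem covMat_lowSm {X Y : E → E} (hX : ContDiffOn ℝ ∞ X O) (hY : ContDiffOn ℝ ∞ Y O) (x : O) :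
    covMat (lowSm hg hX) (lowSm hg hY) x = Matrix.of ![X x, Y x] * g x := by
  ext i j
  fin_cases i <;> fin_cases j <;>
    simp [covMat, lowSm, low, Matrix.mul_apply, Fin.sum_univ_two, hg.symm x.2] <;> ring

theorem par_lowSm_iff {X Y X' Y' : E → E} (hX : ContDiffOn ℝ ∞ X O) (hY : ContDiffOn ℝ ∞ Y O)
    (hX' : ContDiffOn ℝ ∞ X' O) (hY' : ContDiffOn ℝ ∞ Y' O) (x : O) :
    Par (covMat (lowSm hg hX) (lowSm hg hY) x) (covMat (lowSm hg hX') (lowSm hg hY') x) ↔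
      Par (Matrix.of ![X x, Y x]) (Matrix.of ![X' x, Y' x]) := by
  rw [covMat_lowSm, covMat_lowSm]
  constructor
  · intro h
    have := h.mul_right (g x)⁻¹
    have hd : IsUnit (g x).det := isUnit_iff_ne_zero.2 (hg.posDef x x.2).det_pos.ne'
    rwa [Matrix.mul_nonsing_inv_cancel_right _ _ hd, Matrix.mul_nonsing_inv_cancel_right _ _ hd] at this
  · exact fun h => h.mul_right _

/-- Two pairs of relative Killing covectors with the same cofactor that are proportional everywhere
are proportional by a constant. -/
theorem KillingPair.eq_smul_of_par (hc : Convex ℝ (O : Set E)) {L a b a' b' : Fin 2 → SmoothFn O}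
    {r s r' s' : SmoothFn O} (h : KillingPair hg L a b r s)
    (ha' : RelKilling (sd O) (chrSm hg) L a' r') (hb' : RelKilling (sd O) (chrSm hg) L b' s')
    (x : O) (hp : ∀ y, Par (covMat a' b' y) (covMat a b y)) : ∃ c : ℝ, a' = c • a ∧ b' = c • b := by
  have hm : ∀ i j y, evalSm y (a' i) * evalSm y (a j) = evalSm y (a' j) * evalSm y (a i) ∧
      evalSm y (a' i) * evalSm y (b j) = evalSm y (b' j) * evalSm y (a i) ∧
      evalSm y (b' i) * evalSm y (b j) = evalSm y (b' j) * evalSm y (b i) := fun i j y =>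
    ⟨hp y 0 i 0 j, hp y 0 i 1 j, hp y 1 i 1 j⟩
  have ea : ∀ i, wedge a b * a' i = wedge a' b * a i := fun i => smoothFn_ext fun y => by
    have h1 := (hm 0 1 y).1
    simp only [wedge, map_sub, map_mul]
    fin_cases i <;> simp only [Fin.zero_eta, Fin.mk_one]
    · linear_combination (-evalSm y (b 0)) * h1
    · linear_combination (-evalSm y (b 1)) * h1
  have eb : ∀ i, wedge a b * b' i = wedge a' b * b i := fun i => smoothFn_ext fun y => by
    have h1 := (hm 0 i y).2.1
    have h2 := (hm 1 i y).2.1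
    simp only [wedge, map_sub, map_mul]
    linear_combination evalSm y (b 0) * h2 - evalSm y (b 1) * h1
  have : Nonempty O := ⟨x⟩
  obtain ⟨z, hz⟩ := (h.dense_wedge_ne_zero hc).nonempty
  have hz : evalSm z (wedge a b) ≠ 0 := hz
  set w := wedge a b with hw
  set N := wedge a' b with hN
  -- The factor N/w is shown to be stationary at z. The two pairs then have jets at z proportional
  -- by the constant c, and uniqueness does the rest.
  set c : ℝ := evalSm z N / evalSm z w with hcdef
  have hcw : c * evalSm z w = evalSm z N := div_mul_cancel₀ _ hz
  have der : ∀ {p p' : Fin 2 → SmoothFn O}, (∀ i, w * p' i = N * p i) → ∀ i j,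
      (evalSm z (p' i) = c * evalSm z (p i)) ∧
      (evalSm z (sd O j N) - c * evalSm z (sd O j w)) * evalSm z (p i) =
        evalSm z w * (evalSm z (sd O j (p' i)) - c * evalSm z (sd O j (p i))) := by
    intro p p' hpp i j
    have e0 := congrArg (evalSm z) (hpp i)
    simp only [map_mul, ← hcw] at e0
    have e1 : evalSm z (p' i) = c * evalSm z (p i) := mul_left_cancel₀ hz (by linear_combination e0)
    have e2 := congrArg (fun f => evalSm z (sd O j f)) (hpp i)
    simp only [Derivation.leibniz, smul_eq_mul, map_add, map_mul, ← hcw, e1] at e2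
    exact ⟨e1, by linear_combination -e2⟩
  -- The diagonal Killing equations contain no skew part, so the j-th derivative of the factor
  -- annihilates both a j and b j; these are not both zero where w ≠ 0.
  have dN : ∀ j, evalSm z (sd O j N) - c * evalSm z (sd O j w) = 0 := by
    intro j
    have hz' := hz
    simp only [hw, wedge, map_sub, map_mul] at hz'
    have key : ∀ {p p' : Fin 2 → SmoothFn O} {t t' : SmoothFn O}, (∀ i, w * p' i = N * p i) →
        RelKilling (sd O) (chrSm hg) L p t → RelKilling (sd O) (chrSm hg) L p' t' →
        (evalSm z (sd O j N) - c * evalSm z (sd O j w)) * evalSm z (p j) = 0 := by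
      intro p p' t t' hpp h1 h2
      rw [(der hpp j j).2, h1.diag, h2.diag]
      simp only [map_add, map_mul, Fin.sum_univ_two, (der hpp 0 0).1, (der hpp 1 0).1,
        (der hpp j j).1]
      ring
    have k1 := key ea h.fst ha'
    have k2 := key eb h.snd hb'
    by_contra hne
    have k1' := (mul_eq_zero.1 k1).resolve_left hne
    have k2' := (mul_eq_zero.1 k2).resolve_left hne
    apply hz'
    fin_cases j <;> simp only [Fin.zero_eta, Fin.mk_one] at k1' k2' <;> rw [k1', k2'] <;> ring
  have fin : ∀ {p p' : Fin 2 → SmoothFn O} {t t' : SmoothFn O}, (∀ i, w * p' i = N * p i) →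
      RelKilling (sd O) (chrSm hg) L p t → RelKilling (sd O) (chrSm hg) L p' t' → p' = c • p := by
    intro p p' t t' hpp h1 h2
    have hu := (der hpp 1 0).2
    rw [dN, zero_mul, h1.up, h2.up] at hu
    have hu' := (mul_eq_zero.1 hu.symm).resolve_left hz
    simp only [map_add, map_mul, Fin.sum_univ_two, (der hpp 0 0).1, (der hpp 1 0).1] at hu'
    have := ((h2.comb h1 1 (-c)).eq_zero hc (x := z) (fun i => by
      simp [(der hpp i 0).1]) (by simp; linear_combination hu')).1
    refine funext fun i => smoothFn_ext fun y => ?_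
    have e := congrArg (evalSm y) (congrFun this i)
    simp only [Pi.add_apply, Pi.smul_apply, map_add, map_smul, smul_eq_mul, Pi.zero_apply,
      map_zero] at e ⊢
    linarith
  exact ⟨c, fin ea h.fst ha', fin eb h.snd hb'⟩

end raise

end FracLin

namespace FracLin

/-! ### Constant curvature -/

section constCurv

variable {g : E → Matrix (Fin 2) (Fin 2) ℝ} {O : TopologicalSpace.Opens E}

theorem ConstCurv.sd_curvSm (h : ConstCurv g O) (hg : IsMetric g O) (i : Fin 2) :
    sd O i (curvSm hg) = 0 := by
  obtain ⟨c, hc⟩ := h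
  rw [curvSm, sd_toSm]
  refine smoothFn_ext fun x => ?_
  rw [evalSm_toSm, map_zero, pd_congr O.2 (F := gaussK g) (G := fun _ => c) hc i x.2]
  simp [pd]

/-- A closed form on a convex set is exact. -/
theorem exists_primitive (hc : Convex ℝ (O : Set E)) (hne : (O : Set E).Nonempty)
    {L : Fin 2 → SmoothFn O} (hL : sd O 0 (L 1) = sd O 1 (L 0)) :
    ∃ φ : SmoothFn O, ∀ i, sd O i φ = L i := by
  obtain ⟨x, hx⟩ := hne
  -- A primitive as the first unknown of the linear system dy₀ = L y₁, dy₁ = 0 with y₁ = 1; flatness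
  -- of this system is closedness of L.
  obtain ⟨y, hy0, hy⟩ := exists_flat_solution hc (C := fun i => ![![0, L i], ![0, 0]])
    (fun k l => by
      fin_cases k <;> fin_cases l <;> simp [hL]) ⟨x, hx⟩ ![0, 1]
  have h1 : (fun _ : Fin 1 => y 1 - 1) = 0 :=
    flat_solution_eq_zero hc (C := 0) (x₀ := ⟨x, hx⟩) (fun i k => by
      have h : sd O i (y 1) = 0 * y 0 + 0 * y 1 := (hy i 1).trans (Fin.sum_univ_two _)
      have h1 : sd O i (1 : SmoothFn O) = 0 := (sd O i).map_one_eq_zero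
      rw [map_sub, h, h1, Fin.sum_univ_one, Pi.zero_apply, Pi.zero_apply, Pi.zero_apply]
      ring) (fun k => by
      rw [map_sub, map_one, hy0 1]
      exact sub_self 1)
  refine ⟨y 0, fun i => ?_⟩
  have h2 : sd O i (y 0) = 0 * y 0 + L i * y 1 := (hy i 0).trans (Fin.sum_univ_two _)
  rw [h2, sub_eq_zero.1 (congrFun h1 0)]
  ring

theorem exists_exp_neg (φ : SmoothFn O) : ∃ e : SmoothFn O, (∀ x, evalSm x e ≠ 0) ∧
    ∀ i, sd O i e = -(e * sd O i φ) := by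
  have hs : ContDiffOn ℝ ∞ (fun x => Real.exp (-extZero O φ.1 x)) O :=
    (smoothFn_smooth φ).neg.exp
  refine ⟨toSm _ hs, fun x => (Real.exp_pos _).ne', fun i => ?_⟩
  rw [sd_toSm]
  refine smoothFn_ext fun x => ?_
  have hd := ((diffAt_of_contDiffOn O.2 (smoothFn_smooth φ) x.2).hasFDerivAt.fun_neg).exp
  rw [evalSm_toSm, pd, hd.fderiv, map_neg, map_mul, evalSm_sd, evalSm_toSm, pd]
  simp

/-- Rescaling by e adds the logarithmic derivative of e to the cofactor; here that derivative is -L.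
-/
theorem RelKilling.mul_exp {hg : IsMetric g O} {L a : Fin 2 → SmoothFn O} {r e : SmoothFn O}
    (h : RelKilling (sd O) (chrSm hg) L a r) (he : ∀ i, sd O i e = -(e * L i)) :
    RelKilling (sd O) (chrSm hg) 0 (fun i => e * a i) (e * r) := by
  refine ⟨fun i => ?_, ?_, ?_⟩
  · simp only [Derivation.leibniz, smul_eq_mul, he, h.diag, Fin.sum_univ_two, Pi.zero_apply]
    ring
  · simp only [Derivation.leibniz, smul_eq_mul, he, h.up, Fin.sum_univ_two, Pi.zero_apply]
    ring
  · simp only [Derivation.leibniz, smul_eq_mul, he, h.down, Fin.sum_univ_two, Pi.zero_apply]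
    ring

/-- In constant curvature the cofactor of a Killing pair is exact. -/
theorem KillingPair.exists_primitive {hg : IsMetric g O} (hK : ∀ i, sd O i (curvSm hg) = 0)
    (hc : Convex ℝ (O : Set E)) (hne : (O : Set E).Nonempty) {L a b : Fin 2 → SmoothFn O}
    {r s : SmoothFn O} (h : KillingPair hg L a b r s) : ∃ φ : SmoothFn O, ∀ i, sd O i φ = L i := by
  have h6 := RelKilling.curvature_sq_mul hg.metricConn rfl h.fst h.snd (hK 0) (hK 1)
  set Om := sd O 0 (L 1) - sd O 1 (L 0) with hOm
  -- Pointwise Ω²w³ = 0 already gives Ωw = 0, and w is nonzero on a dense set.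
  have : wedge a b * Om = 0 := smoothFn_ext fun x => by
    have e := congrArg (evalSm x) h6
    have e6 : evalSm x 6 = 6 := rfl
    rw [map_mul, map_mul, map_pow, map_pow, map_zero, e6] at e
    rw [map_mul, map_zero]
    by_contra hne
    rw [mul_eq_zero, not_or] at hne
    exact mul_ne_zero (by norm_num) (mul_ne_zero (pow_ne_zero 2 hne.2) (pow_ne_zero 3 hne.1)) e
  exact FracLin.exists_primitive hc hne (sub_eq_zero.1 (smoothFn_eq_zero_of_mul
    (h.dense_wedge_ne_zero hc) this))

theorem exists_gaugeTrivial_cofactor (hg : IsMetric g O) (hK : ConstCurv g O)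
    (hc : Convex ℝ (O : Set E)) (hne : (O : Set E).Nonempty) (r : Rep g O) :
    ∃ L : E → E, ContDiffOn ℝ ∞ L O ∧ IsCofactor g O L r.P ∧ IsCofactor g O L r.Q ∧
      GaugeTrivial g O L := by
  obtain ⟨L, ρ, σ, h⟩ := r.exists_killingPair hg hne
  obtain ⟨φ, hφ⟩ := h.exists_primitive (hK.sd_curvSm hg) hc hne
  exact ⟨raise g L, raise_smooth hg L, h.fst.poisson_eq r.smooth_P, h.snd.poisson_eq r.smooth_Q,
    gaugeTrivial_of_sd hg hφ⟩

/-- A basis of the Killing covectors, given by its values and derivatives at a point. -/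
structure KillingBasis (hg : IsMetric g O) (x₀ : O) (B : Fin 3 → Fin 3 → SmoothFn O) : Prop where
  eval : ∀ l k, evalSm x₀ (B l k) = if l = k then 1 else 0
  sys : ∀ l i k, sd O i (B l k) = ∑ m, relSys hg 0 i k m * B l m

theorem exists_killingBasis {hg : IsMetric g O} (hK : ∀ i, sd O i (curvSm hg) = 0)
    (hc : Convex ℝ (O : Set E)) (x₀ : O) : ∃ B, KillingBasis hg x₀ B := by
  choose B h1 h2 using fun l : Fin 3 =>
    exists_flat_solution hc (relSys_flat hK) x₀ fun k => if l = k then 1 else 0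
  exact ⟨B, h1, h2⟩

/-- The covector with coordinates `u`. -/
noncomputable def killCov (B : Fin 3 → Fin 3 → SmoothFn O) (u : Fin 3 → ℝ) (j : Fin 2) : SmoothFn O :=
  ∑ l, u l • B l j.castSucc

/-- The skew derivative of the covector with coordinates `u`. -/
noncomputable def killSkew (B : Fin 3 → Fin 3 → SmoothFn O) (u : Fin 3 → ℝ) : SmoothFn O :=
  ∑ l, u l • B l 2

theorem killCov_add_smul (B : Fin 3 → Fin 3 → SmoothFn O) (c d : ℝ) (u v : Fin 3 → ℝ) :
    killCov B (c • u + d • v) = c • killCov B u + d • killCov B v := by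
  ext j x
  simp only [killCov, Fin.sum_univ_three, Pi.add_apply, Pi.smul_apply, smul_eq_mul, add_smul,
    mul_smul, smul_add]
  abel_nf

namespace KillingBasis

variable {hg : IsMetric g O} {x₀ : O} {B : Fin 3 → Fin 3 → SmoothFn O}

theorem relKilling (h : KillingBasis hg x₀ B) (u : Fin 3 → ℝ) :
    RelKilling (sd O) (chrSm hg) 0 (killCov B u) (killSkew B u) := by
  have := relKilling_of_sys (hg := hg) (y := fun k => ∑ l, u l • B l k) (fun i k => by
    simp only [map_add, Derivation.map_smul, h.sys, Fin.sum_univ_three, mul_add, smul_add,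
      mul_smul_comm]
    abel)
  convert this using 1
  · ext j
    fin_cases j <;> rfl
  · rfl

theorem evalSm_killCov (h : KillingBasis hg x₀ B) (u : Fin 3 → ℝ) (j : Fin 2) :
    evalSm x₀ (killCov B u j) = u j.castSucc := by
  simp [killCov, h.eval]

theorem evalSm_killSkew (h : KillingBasis hg x₀ B) (u : Fin 3 → ℝ) :
    evalSm x₀ (killSkew B u) = u 2 := by
  simp [killSkew, h.eval]

/-- Every Killing covector is a combination of the basis. -/
theorem eq_killCov (h : KillingBasis hg x₀ B) (hc : Convex ℝ (O : Set E)) {a : Fin 2 → SmoothFn O}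
    {r : SmoothFn O} (ha : RelKilling (sd O) (chrSm hg) 0 a r) :
    a = killCov B ![evalSm x₀ (a 0), evalSm x₀ (a 1), evalSm x₀ r] := by
  have h1 := ((ha.comb (h.relKilling ![evalSm x₀ (a 0), evalSm x₀ (a 1), evalSm x₀ r]) 1
    (-1)).eq_zero hc (x := x₀) (fun i => by
      simp only [Pi.add_apply, Pi.smul_apply, map_add, map_smul, h.evalSm_killCov]
      fin_cases i <;> simp) (by simp [h.evalSm_killSkew])).1
  refine funext fun i => smoothFn_ext fun y => ?_
  have e := congrArg (evalSm y) (congrFun h1 i)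
  simp only [Pi.add_apply, Pi.smul_apply, map_add, map_smul, smul_eq_mul, Pi.zero_apply,
    map_zero] at e ⊢
  linarith

theorem skew_eq_zero {a : Fin 2 → SmoothFn O} {r : SmoothFn O}
    (ha : RelKilling (sd O) (chrSm hg) 0 a r) (h0 : a = 0) : r = 0 := by
  have := ha.up
  simpa [h0] using this.symm

theorem killCov_eq_zero (h : KillingBasis hg x₀ B) {u : Fin 3 → ℝ} (h0 : killCov B u = 0) : u = 0 := by
  have hs := skew_eq_zero (h.relKilling u) h0
  ext k
  fin_cases k
  · have := h.evalSm_killCov u 0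
    simpa [h0] using this.symm
  · have := h.evalSm_killCov u 1
    simpa [h0] using this.symm
  · have := h.evalSm_killSkew u
    simpa [hs] using this.symm

theorem killCov_injective (h : KillingBasis hg x₀ B) {u v : Fin 3 → ℝ}
    (e : killCov B u = killCov B v) : u = v := by
  have h0 : killCov B ((1 : ℝ) • u + (-1 : ℝ) • v) = 0 := by
    rw [killCov_add_smul, e]
    ext j x
    simp
  have := h.killCov_eq_zero h0
  ext k
  have := congrFun this k
  simp at this
  linarith

end KillingBasis

end constCurv

end FracLin

/-! ### Integrals as pairs of Killing fields in coordinates. -/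

namespace FracLin

section killingParam

variable {g : E → Matrix (Fin 2) (Fin 2) ℝ} {O : TopologicalSpace.Opens E}

/-- The first covector of a pair in coordinates. -/
def fstCoord (q : Fin 6 → ℝ) : Fin 3 → ℝ := ![q 0, q 1, q 2]

/-- The second covector of a pair in coordinates. -/
def sndCoord (q : Fin 6 → ℝ) : Fin 3 → ℝ := ![q 3, q 4, q 5]

theorem fstCoord_smul (c : ℝ) (q : Fin 6 → ℝ) : fstCoord (c • q) = c • fstCoord q := by
  simp [fstCoord]

theorem sndCoord_smul (c : ℝ) (q : Fin 6 → ℝ) : sndCoord (c • q) = c • sndCoord q := by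
  simp [sndCoord]

theorem coord_ext {q q' : Fin 6 → ℝ} (h1 : fstCoord q = fstCoord q') (h2 : sndCoord q = sndCoord q') :
    q = q' := by
  have a := fun i => congrFun h1 i
  have b := fun i => congrFun h2 i
  simp only [fstCoord, sndCoord] at a b
  ext i
  fin_cases i
  · exact a 0
  · exact a 1
  · exact a 2
  · exact b 0
  · exact b 1
  · exact b 2

/-- The parameters of linearly independent pairs. -/
def indepSet : Set (Fin 6 → ℝ) :=
  {q | ∃ i j, fstCoord q i * sndCoord q j - fstCoord q j * sndCoord q i ≠ 0}

theorem continuous_fstCoord (i : Fin 3) : Continuous fun q => fstCoord q i := by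
  fin_cases i <;> simp [fstCoord] <;> fun_prop

theorem continuous_sndCoord (i : Fin 3) : Continuous fun q => sndCoord q i := by
  fin_cases i <;> simp [sndCoord] <;> fun_prop

theorem isOpen_indepSet : IsOpen indepSet := by
  have : indepSet = ⋃ i, ⋃ j, {q | fstCoord q i * sndCoord q j - fstCoord q j * sndCoord q i ≠ 0} := by
    ext q; simp [indepSet]
  rw [this]
  exact isOpen_iUnion fun i => isOpen_iUnion fun j => isOpen_ne_fun
    (((continuous_fstCoord i).mul (continuous_sndCoord j)).sub
      ((continuous_fstCoord j).mul (continuous_sndCoord i))) continuous_const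

/-- Rank two means that some 2×2 minor is nonzero: the minors make the condition visibly open, the
linear form makes it usable. -/
theorem mem_indepSet_iff (q : Fin 6 → ℝ) : q ∈ indepSet ↔
    ∀ c d : ℝ, c • fstCoord q + d • sndCoord q = 0 → c = 0 ∧ d = 0 := by
  constructor
  · rintro ⟨i, j, hij⟩ c d h
    have hi := congrFun h i
    have hj := congrFun h j
    simp only [Pi.add_apply, Pi.smul_apply, smul_eq_mul, Pi.zero_apply] at hi hj
    constructor
    · refine (mul_eq_zero.1 (?_ : c * _ = 0)).resolve_right hij
      linear_combination sndCoord q j * hi - sndCoord q i * hj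
    · refine (mul_eq_zero.1 (?_ : d * _ = 0)).resolve_right hij
      linear_combination fstCoord q i * hj - fstCoord q j * hi
  · intro h
    by_contra hcon
    simp only [indepSet, Set.mem_ofPred_eq, not_exists, not_not] at hcon
    have hz : ∀ j, sndCoord q j = 0 ∧ -fstCoord q j = 0 := fun j => h _ _ (by
      ext i
      simp only [Pi.add_apply, Pi.smul_apply, smul_eq_mul, Pi.zero_apply]
      linear_combination hcon i j)
    have := h 1 0 (by
      ext i
      simpa using (hz i).2)
    exact one_ne_zero this.1

theorem smul_mem_indepSet {q : Fin 6 → ℝ} (hq : q ∈ indepSet) {c : ℝ} (hc : c ≠ 0) :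
    c • q ∈ indepSet := by
  obtain ⟨i, j, hij⟩ := hq
  refine ⟨i, j, ?_⟩
  simp only [fstCoord_smul, sndCoord_smul, Pi.smul_apply, smul_eq_mul]
  have : c * fstCoord q i * (c * sndCoord q j) - c * fstCoord q j * (c * sndCoord q i) =
    c ^ 2 * (fstCoord q i * sndCoord q j - fstCoord q j * sndCoord q i) := by ring
  rw [this]
  exact mul_ne_zero (pow_ne_zero 2 hc) hij

/-- The Killing vector field with coordinates `u`. -/
noncomputable def killVec (g : E → Matrix (Fin 2) (Fin 2) ℝ) (B : Fin 3 → Fin 3 → SmoothFn O)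
    (u : Fin 3 → ℝ) (x : E) : E := ∑ l, u l • raise g (fun j => B l j.castSucc) x

theorem killVec_smooth (hg : IsMetric g O) (B : Fin 3 → Fin 3 → SmoothFn O) (u : Fin 3 → ℝ) :
    ContDiffOn ℝ ∞ (killVec g B u) O :=
  ContDiffOn.sum fun l _ => ContDiffOn.const_smul (u l) (raise_smooth hg fun j => B l j.castSucc)

theorem lowSm_killVec (hg : IsMetric g O) (B : Fin 3 → Fin 3 → SmoothFn O) (u : Fin 3 → ℝ) :
    lowSm hg (killVec_smooth hg B u) = killCov B u := by
  refine funext fun j => smoothFn_ext fun x => ?_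
  have := fun l => low_raise hg (fun j => B l j.castSucc) j x
  simp only [lowSm, evalSm_toSm, killCov, map_sum, map_smul, ← this]
  simp only [low, killVec, Fin.sum_univ_two, Fin.sum_univ_three, Pi.add_apply, Pi.smul_apply,
    smul_eq_mul]
  ring

theorem killVec_smul (B : Fin 3 → Fin 3 → SmoothFn O) (c : ℝ) (u : Fin 3 → ℝ) (x : E) :
    killVec g B (c • u) x = c • killVec g B u x := by
  simp only [killVec, Finset.smul_sum, Pi.smul_apply, smul_smul, smul_eq_mul]

/-- The values of the pair of Killing fields with coordinates `q`. -/
noncomputable def killMat (g : E → Matrix (Fin 2) (Fin 2) ℝ) (B : Fin 3 → Fin 3 → SmoothFn O)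
    (q : Fin 6 → ℝ) (x : E) : Matrix (Fin 2) (Fin 2) ℝ :=
  Matrix.of ![killVec g B (fstCoord q) x, killVec g B (sndCoord q) x]

theorem killMat_smul (B : Fin 3 → Fin 3 → SmoothFn O) (c : ℝ) (q : Fin 6 → ℝ) (x : E) :
    killMat g B (c • q) x = c • killMat g B q x := by
  ext i j
  fin_cases i <;> simp [killMat, fstCoord_smul, sndCoord_smul, killVec_smul]

theorem continuous_killMat (B : Fin 3 → Fin 3 → SmoothFn O) (x : E) :
    Continuous fun q => killMat g B q x := by
  refine continuous_matrix fun i j => ?_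
  have h : ∀ f : (Fin 6 → ℝ) → Fin 3 → ℝ, (∀ l, Continuous fun q => f q l) →
      Continuous fun q => killVec g B (f q) x j := fun f hf => by
    simp only [killVec, Fin.sum_univ_three, Pi.add_apply, Pi.smul_apply, smul_eq_mul]
    exact (((hf 0).mul continuous_const).add ((hf 1).mul continuous_const)).add
      ((hf 2).mul continuous_const)
  fin_cases i
  · exact h _ continuous_fstCoord
  · exact h _ continuous_sndCoord

theorem smooth_killVec_family (hg : IsMetric g O) (B : Fin 3 → Fin 3 → SmoothFn O) {d : ℕ}
    {f : (Fin d → ℝ) → Fin 3 → ℝ} (hf : ContDiff ℝ ∞ f) :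
    ContDiffOn ℝ ∞ (fun z : (Fin d → ℝ) × E => killVec g B (f z.1) z.2) (Set.univ ×ˢ O) :=
  ContDiffOn.sum fun l _ => ((contDiff_pi.1 hf l).comp contDiff_fst).contDiffOn.smul
    ((raise_smooth hg _).comp contDiff_snd.contDiffOn fun _ hz => hz.2)

theorem contDiff_fstCoord : ContDiff ℝ ∞ fstCoord := by
  refine contDiff_pi.2 fun i => ?_
  fin_cases i <;> simp [fstCoord] <;> fun_prop

theorem contDiff_sndCoord : ContDiff ℝ ∞ sndCoord := by
  refine contDiff_pi.2 fun i => ?_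
  fin_cases i <;> simp [sndCoord] <;> fun_prop

namespace KillingBasis

variable {hg : IsMetric g O} {x₀ : O} {B : Fin 3 → Fin 3 → SmoothFn O}

theorem killingPair (h : KillingBasis hg x₀ B) {q : Fin 6 → ℝ} (hq : q ∈ indepSet) :
    KillingPair hg 0 (lowSm hg (killVec_smooth hg B (fstCoord q)))
      (lowSm hg (killVec_smooth hg B (sndCoord q))) (killSkew B (fstCoord q))
      (killSkew B (sndCoord q)) := by
  rw [lowSm_killVec, lowSm_killVec]
  refine ⟨h.relKilling _, h.relKilling _, fun c d e => ?_⟩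
  rw [← killCov_add_smul] at e
  exact (mem_indepSet_iff q).1 hq c d (h.killCov_eq_zero e)

/-- The integral given by a pair of Killing fields. -/
noncomputable def rep (h : KillingBasis hg x₀ B) (hc : Convex ℝ (O : Set E)) {q : Fin 6 → ℝ}
    (hq : q ∈ indepSet) : Rep g O :=
  (h.killingPair hq).rep hc _ _

theorem mat_rep (h : KillingBasis hg x₀ B) (hc : Convex ℝ (O : Set E)) {q : Fin 6 → ℝ}
    (hq : q ∈ indepSet) (x : E) : (h.rep hc hq).mat x = killMat g B q x := rfl

/-- All the pairs involved have cofactor 0, so fractions that agree differ by a constant factor in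
the Killing fields, hence in the coordinates. This identifies integrals with points of projective
five-space. -/
theorem eq_smul_of_par (h : KillingBasis hg x₀ B) (hc : Convex ℝ (O : Set E)) {q q' : Fin 6 → ℝ}
    (hq : q ∈ indepSet) (hp : ∀ x ∈ O, Par (killMat g B q' x) (killMat g B q x)) :
    ∃ c : ℝ, q' = c • q := by
  obtain ⟨c, h1, h2⟩ := (h.killingPair hq).eq_smul_of_par hc
    (by rw [lowSm_killVec]; exact h.relKilling (fstCoord q'))
    (by rw [lowSm_killVec]; exact h.relKilling (sndCoord q')) x₀
    fun y => (par_lowSm_iff (killVec_smooth hg B (fstCoord q')) (killVec_smooth hg B (sndCoord q'))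
      (killVec_smooth hg B (fstCoord q)) (killVec_smooth hg B (sndCoord q)) y).2 (hp y y.2)
  have lin : ∀ {u v : Fin 3 → ℝ}, killCov B u = c • killCov B v → u = c • v := fun {u v} e => by
    refine h.killCov_injective ?_
    have := killCov_add_smul B c 0 v v
    simp only [zero_smul, add_zero] at this
    rw [e, this]
  rw [lowSm_killVec, lowSm_killVec] at h1 h2
  exact ⟨c, coord_ext ((lin h1).trans (fstCoord_smul c q).symm)
    ((lin h2).trans (sndCoord_smul c q).symm)⟩

/-- Every fractional-linear integral is a quotient of Killing fields. -/
theorem exists_par (h : KillingBasis hg x₀ B) (hK : ∀ i, sd O i (curvSm hg) = 0)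
    (hc : Convex ℝ (O : Set E)) (s : Rep g O) :
    ∃ q ∈ indepSet, ∀ x ∈ O, Par (s.mat x) (killMat g B q x) := by
  have hne : (O : Set E).Nonempty := ⟨x₀, x₀.2⟩
  obtain ⟨L, ρ, σ, hp⟩ := s.exists_killingPair hg hne
  obtain ⟨φ, hφ⟩ := hp.exists_primitive hK hc hne
  -- The factor exp(-φ) makes numerator and denominator genuine Killing covectors without changing
  -- the fraction; their coordinates are the jets at x₀.
  obtain ⟨e, he, hd⟩ := exists_exp_neg φ
  simp only [hφ] at hd
  have h1 := h.eq_killCov hc (hp.fst.mul_exp hd)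
  have h2 := h.eq_killCov hc (hp.snd.mul_exp hd)
  set u : Fin 3 → ℝ := ![evalSm x₀ (e * lowSm hg s.smooth_P 0), evalSm x₀ (e * lowSm hg s.smooth_P 1),
    evalSm x₀ (e * ρ)]
  set v : Fin 3 → ℝ := ![evalSm x₀ (e * lowSm hg s.smooth_Q 0), evalSm x₀ (e * lowSm hg s.smooth_Q 1),
    evalSm x₀ (e * σ)]
  set q : Fin 6 → ℝ := ![u 0, u 1, u 2, v 0, v 1, v 2]
  have hu : fstCoord q = u := by ext i; fin_cases i <;> rfl
  have hv : sndCoord q = v := by ext i; fin_cases i <;> rfl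
  refine ⟨q, (mem_indepSet_iff q).2 fun c d hcd => ?_, fun x hx => ?_⟩
  · rw [hu, hv] at hcd
    refine hp.indep c d (funext fun i => smoothFn_ext fun y => ?_)
    have := killCov_add_smul B c d u v
    rw [hcd, ← h1, ← h2] at this
    have := congrArg (evalSm y) (congrFun this i)
    simp only [killCov, Pi.add_apply, Pi.smul_apply, map_add, map_smul, map_mul, smul_eq_mul,
      Pi.zero_apply, zero_smul, Finset.sum_const_zero, map_zero] at this ⊢
    exact (mul_eq_zero.1 (by linear_combination -this : evalSm y e * _ = 0)).resolve_left (he y)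
  · have hq : Par (covMat (lowSm hg s.smooth_P) (lowSm hg s.smooth_Q) ⟨x, hx⟩)
        (covMat (lowSm hg (killVec_smooth hg B (fstCoord q)))
          (lowSm hg (killVec_smooth hg B (sndCoord q))) ⟨x, hx⟩) := by
      rw [lowSm_killVec, lowSm_killVec, hu, hv, ← h1, ← h2]
      have : covMat (fun i => e * lowSm hg s.smooth_P i) (fun i => e * lowSm hg s.smooth_Q i) ⟨x, hx⟩ =
          evalSm ⟨x, hx⟩ e • covMat (lowSm hg s.smooth_P) (lowSm hg s.smooth_Q) ⟨x, hx⟩ := by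
        ext i j
        fin_cases i <;> simp [covMat]
      rw [this]
      exact (par_of_smul _).symm
    exact (par_lowSm_iff _ _ _ _ _).1 hq

theorem eq_smul_of_par_rep (h : KillingBasis hg x₀ B) (hc : Convex ℝ (O : Set E)) (s : Rep g O)
    {q q' : Fin 6 → ℝ} (hq : q ∈ indepSet) (hs : ∀ x ∈ O, Par (s.mat x) (killMat g B q x))
    (hs' : ∀ x ∈ O, Par (s.mat x) (killMat g B q' x)) : ∃ c : ℝ, q' = c • q := by
  refine h.eq_smul_of_par hc hq fun x hx => ?_
  obtain ⟨c, hcs⟩ := (hs' x hx).symm.exists_smul (s.mat_ne_zero hx)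
  obtain ⟨d, hd⟩ := (hs x hx).exists_smul (by
    rw [← h.mat_rep hc hq]; exact Rep.mat_ne_zero _ hx)
  rw [hcs, hd, smul_smul]
  exact par_of_smul _

end KillingBasis

end killingParam

end FracLin

/-! ### Affine charts in projective five-space. -/

namespace FracLin

section killingChart

variable {g : E → Matrix (Fin 2) (Fin 2) ℝ} {O : TopologicalSpace.Opens E}
  {hg : IsMetric g O} {x₀ : O} {B : Fin 3 → Fin 3 → SmoothFn O}

namespace KillingBasis

/-- Compares the quotient topology with the projective one. A unit vector outside the cone T does
not represent s, and some point x witnesses this by an inequality that stays true nearby. Unit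
vectors outside T form a compact set, so one neighbourhood of s works for all of them; the
normalised coordinates of a nearby integral must then lie in T. -/
theorem isOpen_cone (h : KillingBasis hg x₀ B) (hK : ∀ i, sd O i (curvSm hg) = 0)
    (hc : Convex ℝ (O : Set E)) {T : Set (Fin 6 → ℝ)} (hT : IsOpen T)
    (hcone : ∀ c : ℝ, c ≠ 0 → ∀ q ∈ T, c • q ∈ T) :
    IsOpen {s : Rep g O | ∃ q ∈ T, q ∈ indepSet ∧ ∀ x ∈ O, Par (s.mat x) (killMat g B q x)} := by
  rw [isOpen_iff_mem_nhds]
  rintro s ⟨q, hqT, hq, hs⟩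
  have hN : IsCompact (Metric.sphere (0 : Fin 6 → ℝ) 1 ∩ Tᶜ) :=
    (isCompact_sphere _ _).inter_right hT.isClosed_compl
  have key := hN.eventually_forall_of_forall_eventually (x₀ := s)
    (P := fun s' q' => ¬ ∀ x ∈ O, Par (s'.mat x) (killMat g B q' x)) (by
      rintro q' ⟨hq1, hq2⟩
      have hns : ¬ ∀ x ∈ O, Par (s.mat x) (killMat g B q' x) := fun hs' => by
        obtain ⟨c, rfl⟩ := h.eq_smul_of_par_rep hc s hq hs hs'
        have hc0 : c ≠ 0 := by
          rintro rfl
          simp at hq1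
        exact hq2 (hcone c hc0 q hqT)
      simp only [Par, not_forall] at hns
      obtain ⟨x, hx, i, j, k, l, hne⟩ := hns
      have c1 : ∀ i j, Continuous fun z : Rep g O × (Fin 6 → ℝ) => z.1.mat x i j := fun i j =>
        (continuous_entry (continuous_mat hx) i j).comp continuous_fst
      have c2 : ∀ i j, Continuous fun z : Rep g O × (Fin 6 → ℝ) => killMat g B z.2 x i j :=
        fun i j => (continuous_entry (continuous_killMat B x) i j).comp continuous_snd
      have ho : IsOpen {z : Rep g O × (Fin 6 → ℝ) | z.1.mat x i j * killMat g B z.2 x k l ≠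
          z.1.mat x k l * killMat g B z.2 x i j} :=
        isOpen_ne_fun ((c1 i j).mul (c2 k l)) ((c1 k l).mul (c2 i j))
      have hev : ∀ᶠ z in nhds (s, q'), z ∈ {z : Rep g O × (Fin 6 → ℝ) |
          z.1.mat x i j * killMat g B z.2 x k l ≠ z.1.mat x k l * killMat g B z.2 x i j} :=
        ho.mem_nhds hne
      exact hev.mono fun z hz hp => hz (hp x hx i j k l))
  filter_upwards [key] with s' hs'
  obtain ⟨q', hq', hp⟩ := h.exists_par hK hc s'
  have h0 : q' ≠ 0 := by
    rintro rfl
    obtain ⟨i, j, hij⟩ := hq'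
    fin_cases i <;> fin_cases j <;> simp [fstCoord, sndCoord] at hij
  have hn : ‖q'‖⁻¹ ≠ 0 := inv_ne_zero (norm_ne_zero_iff.2 h0)
  have hp' : ∀ x ∈ O, Par (s'.mat x) (killMat g B (‖q'‖⁻¹ • q') x) := fun x hx => by
    rw [killMat_smul]
    intro i j k l
    simp only [Matrix.smul_apply, smul_eq_mul]
    linear_combination ‖q'‖⁻¹ * hp x hx i j k l
  refine ⟨‖q'‖⁻¹ • q', ?_, smul_mem_indepSet hq' hn, hp'⟩
  by_contra hcon
  refine hs' _ ⟨?_, hcon⟩ hp'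
  rw [mem_sphere_zero_iff_norm, norm_smul, norm_inv, norm_norm]
  exact inv_mul_cancel₀ (norm_ne_zero_iff.2 h0)

open Classical in
/-- The integrals given by pairs of Killing fields. -/
noncomputable def repD (h : KillingBasis hg x₀ B) (hc : Convex ℝ (O : Set E)) (r₀ : Rep g O)
    (q : Fin 6 → ℝ) : Rep g O := if hq : q ∈ indepSet then h.rep hc hq else r₀

theorem repD_PQ (h : KillingBasis hg x₀ B) (hc : Convex ℝ (O : Set E)) (r₀ : Rep g O)
    {q : Fin 6 → ℝ} (hq : q ∈ indepSet) : (h.repD hc r₀ q).P = killVec g B (fstCoord q) ∧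
      (h.repD hc r₀ q).Q = killVec g B (sndCoord q) := by
  rw [repD, dif_pos hq]
  exact ⟨rfl, rfl⟩

theorem mat_repD (h : KillingBasis hg x₀ B) (hc : Convex ℝ (O : Set E)) (r₀ : Rep g O)
    {q : Fin 6 → ℝ} (hq : q ∈ indepSet) (x : E) : (h.repD hc r₀ q).mat x = killMat g B q x := by
  rw [repD, dif_pos hq, mat_rep]

theorem repD_smooth (h : KillingBasis hg x₀ B) (hc : Convex ℝ (O : Set E)) (r₀ : Rep g O) {d : ℕ}
    {f : (Fin d → ℝ) → Fin 6 → ℝ} (hf : ContDiff ℝ ∞ f) :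
    ContDiffOn ℝ ∞ (fun z : (Fin d → ℝ) × E => ((h.repD hc r₀ (f z.1)).P z.2,
      (h.repD hc r₀ (f z.1)).Q z.2)) ((f ⁻¹' indepSet) ×ˢ O) := by
  have h1 := smooth_killVec_family hg B (contDiff_fstCoord.comp hf)
  have h2 := smooth_killVec_family hg B (contDiff_sndCoord.comp hf)
  refine ((h1.prodMk h2).mono (Set.prod_mono (Set.subset_univ _) subset_rfl)).congr fun z hz => ?_
  have := h.repD_PQ hc r₀ hz.1
  simp only [this, Function.comp_apply]

/-- The affine chart of the space of integrals. -/
theorem exists_chart (h : KillingBasis hg x₀ B) (hK : ∀ i, sd O i (curvSm hg) = 0)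
    (hc : Convex ℝ (O : Set E)) (r₀ : Rep g O) : ∃ (V : Set (Fin 5 → ℝ)) (r : (Fin 5 → ℝ) → Rep g O),
    IsOpen V ∧ Topology.IsOpenEmbedding (fun v : V => (r v).frac) ∧
    (∃ v ∈ V, (r v).frac = r₀.frac) ∧
    ContDiffOn ℝ ∞ (fun z : (Fin 5 → ℝ) × E => ((r z.1).P z.2, (r z.1).Q z.2)) (V ×ˢ O) ∧
    ∀ v ∈ V, ∀ w : Fin 5 → ℝ, w ≠ 0 → ¬ ∃ f : E → ℝ, ∀ x ∈ O,
      fderiv ℝ (fun v' => (r v').P x) v w = f x • (r v).P x ∧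
      fderiv ℝ (fun v' => (r v').Q x) v w = f x • (r v).Q x := by
  obtain ⟨q₀, hq₀, hp₀⟩ := h.exists_par hK hc r₀
  obtain ⟨j, hj⟩ : ∃ j, q₀ j ≠ 0 := by
    by_contra hcon
    push Not at hcon
    obtain ⟨i, k, hik⟩ := hq₀
    fin_cases i <;> fin_cases k <;> simp [fstCoord, sndCoord, hcon] at hik
  -- The affine chart in which the nonzero homogeneous coordinate j equals 1, and its inverse `rem`,
  -- which normalises by that coordinate.
  set ins : (Fin 5 → ℝ) → Fin 6 → ℝ := fun v => Fin.insertNth (α := fun _ => ℝ) j 1 v with hins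
  set rem : (Fin 6 → ℝ) → Fin 5 → ℝ := fun q k => (q j)⁻¹ * q (j.succAbove k) with hrem
  have ins_j : ∀ v, ins v j = 1 := fun v => Fin.insertNth_apply_same _ _ _
  have ins_k : ∀ v k, ins v (j.succAbove k) = v k := fun v k => Fin.insertNth_apply_succAbove _ _ _ _
  have ins_rem : ∀ q, q j ≠ 0 → ins (rem q) = (q j)⁻¹ • q := fun q hq => by
    ext k
    rcases Fin.eq_self_or_eq_succAbove j k with rfl | ⟨k, rfl⟩
    · rw [ins_j, Pi.smul_apply, smul_eq_mul, inv_mul_cancel₀ hq]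
    · rw [ins_k]; rfl
  have ins_smooth : ContDiff ℝ ∞ ins := by
    refine contDiff_pi.2 fun k => ?_
    rcases Fin.eq_self_or_eq_succAbove j k with rfl | ⟨k, rfl⟩
    · simp only [ins_j]; exact contDiff_const
    · simp only [ins_k]; fun_prop
  set V : Set (Fin 5 → ℝ) := ins ⁻¹' indepSet with hV
  have hVo : IsOpen V := isOpen_indepSet.preimage ins_smooth.continuous
  have hsm := h.repD_smooth hc r₀ ins_smooth
  have fr : ∀ v ∈ V, ∀ s : Rep g O, (h.repD hc r₀ (ins v)).frac = s.frac ↔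
      ∀ x ∈ O, Par (s.mat x) (killMat g B (ins v) x) := fun v hv s => by
    rw [eq_comm, frac_eq_iff]
    simp only [h.mat_repD hc r₀ hv]
    rfl
  refine ⟨V, fun v => h.repD hc r₀ (ins v), hVo, ?_, ?_, hsm, ?_⟩
  · refine .of_continuous_injective_isOpenMap ?_ ?_ ?_
    · exact isQuotientMap_frac.continuous.comp (continuous_family (r := fun v => h.repD hc r₀ (ins v)) (V := V) hsm)
    · intro v w hvw
      have h1 := (fr v v.2 _).1 hvw
      simp only [h.mat_repD hc r₀ w.2] at h1
      obtain ⟨c, hcw⟩ := h.eq_smul_of_par hc v.2 h1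
      have e := congrFun hcw j
      rw [ins_j, Pi.smul_apply, ins_j, smul_eq_mul, mul_one] at e
      rw [← e, one_smul] at hcw
      refine Subtype.ext (funext fun k => ?_)
      rw [← ins_k (v : Fin 5 → ℝ) k, ← ins_k (w : Fin 5 → ℝ) k, hcw]
    · intro V' hV'
      obtain ⟨W, hW, rfl⟩ := isOpen_induced_iff.1 hV'
      rw [← isQuotientMap_frac.isOpen_preimage]
      have hrc : ContinuousOn rem {q | q j ≠ 0} := by
        refine continuousOn_pi.2 fun k => ?_
        exact ((continuous_apply j).continuousOn.inv₀ fun q hq => hq).mul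
          (continuous_apply _).continuousOn
      have hTo : IsOpen ({q : Fin 6 → ℝ | q j ≠ 0} ∩ rem ⁻¹' W) :=
        hrc.isOpen_inter_preimage (isOpen_ne_fun (continuous_apply j) continuous_const) hW
      have := h.isOpen_cone hK hc hTo (fun c hc0 q hq => by
        refine ⟨?_, ?_⟩
        · have := hq.1
          simp only [Set.mem_ofPred_eq] at this
          simp [hc0, this]
        · have e : rem (c • q) = rem q := by
            ext k
            have := hq.1
            simp only [Set.mem_ofPred_eq] at this
            simp only [hrem, Pi.smul_apply, smul_eq_mul]
            field_simp
          change rem (c • q) ∈ W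
          rw [e]
          exact hq.2)
      convert this using 1
      ext s
      constructor
      · rintro ⟨v, hv, e⟩
        refine ⟨ins v, ⟨?_, ?_⟩, v.2, (fr v v.2 s).1 e⟩
        · simp [ins_j]
        · change rem (ins v) ∈ W
          have : rem (ins v) = v := by
            ext k
            simp only [hrem, ins_j, ins_k]
            ring
          rw [this]
          exact hv
      · rintro ⟨q, ⟨hqj, hqW⟩, hq, hp⟩
        have hm : ins (rem q) ∈ indepSet := by
          rw [ins_rem q hqj]
          exact smul_mem_indepSet hq (inv_ne_zero hqj)
        refine ⟨⟨rem q, hm⟩, hqW, (fr _ hm s).2 fun x hx => ?_⟩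
        rw [ins_rem q hqj, killMat_smul]
        intro a b c d
        simp only [Matrix.smul_apply, smul_eq_mul]
        linear_combination (q j)⁻¹ * hp x hx a b c d
  · have hm : ins (rem q₀) ∈ indepSet := by
      rw [ins_rem q₀ hj]
      exact smul_mem_indepSet hq₀ (inv_ne_zero hj)
    refine ⟨rem q₀, hm, (fr _ hm r₀).2 fun x hx => ?_⟩
    rw [ins_rem q₀ hj, killMat_smul]
    intro a b c d
    simp only [Matrix.smul_apply, smul_eq_mul]
    linear_combination (q₀ j)⁻¹ * hp₀ x hx a b c d
  · rintro v hv w hw ⟨f, hf⟩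
    -- The chart is affine in v and Killing fields are linear in their coordinates, so the
    -- derivative along w is the Killing pair with coordinates q'.
    set q' : Fin 6 → ℝ := fun k => ins (v + w) k - ins v k with hq'
    have hdir : ∀ (F : (Fin 6 → ℝ) → Fin 3 → ℝ), (∀ q q' : Fin 6 → ℝ, ∀ t : ℝ,
        F (q + t • q') = F q + t • F q') → ∀ x, ∀ t : ℝ,
        killVec g B (F (ins (v + t • w))) x = killVec g B (F (ins v)) x +
          t • killVec g B (F q') x := by
      intro F hF x t
      have e : ins (v + t • w) = ins v + t • q' := by
        ext k
        rcases Fin.eq_self_or_eq_succAbove j k with rfl | ⟨k, rfl⟩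
        · simp [hq', ins_j]
        · simp [hq', ins_k]
      rw [e, hF]
      simp only [killVec, Fin.sum_univ_three, Pi.add_apply, Pi.smul_apply, smul_eq_mul]
      module
    have hder : ∀ x ∈ O, fderiv ℝ (fun v' => (h.repD hc r₀ (ins v')).P x) v w =
        killVec g B (fstCoord q') x ∧
        fderiv ℝ (fun v' => (h.repD hc r₀ (ins v')).Q x) v w = killVec g B (sndCoord q') x := by
      intro x hx
      have line : HasDerivAt (fun t : ℝ => v + t • w) w 0 := by
        have := ((hasDerivAt_id (0 : ℝ)).smul_const w).const_add v
        rw [one_smul] at this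
        exact this
      have hev : ∀ᶠ t in nhds (0 : ℝ), v + t • w ∈ V := by
        have : Filter.Tendsto (fun t : ℝ => v + t • w) (nhds 0) (nhds v) := by
          simpa using line.continuousAt.tendsto
        exact this.eventually (hVo.mem_nhds hv)
      have gen : ∀ (G : (Fin 5 → ℝ) → E) (F : (Fin 6 → ℝ) → Fin 3 → ℝ),
          DifferentiableAt ℝ G v → (∀ v' ∈ V, G v' = killVec g B (F (ins v')) x) →
          (∀ q q' : Fin 6 → ℝ, ∀ t : ℝ, F (q + t • q') = F q + t • F q') →
          fderiv ℝ G v w = killVec g B (F q') x := by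
        intro G F hG hGF hF
        have h1 : HasDerivAt (fun t : ℝ => G (v + t • w)) (fderiv ℝ G v w) 0 :=
          HasFDerivAt.comp_hasDerivAt (l := G) (f := fun t : ℝ => v + t • w) 0
            (by simpa using hG.hasFDerivAt) line
        have h2 : HasDerivAt (fun t : ℝ => killVec g B (F (ins v)) x + t • killVec g B (F q') x)
            (killVec g B (F q') x) 0 := by
          have := ((hasDerivAt_id (0 : ℝ)).smul_const (killVec g B (F q') x)).const_add
            (killVec g B (F (ins v)) x)
          rw [one_smul] at this
          exact this
        refine h1.unique (h2.congr_of_eventuallyEq ?_)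
        filter_upwards [hev] with t ht
        rw [hGF _ ht, hdir F hF]
      have hd : ContDiffOn ℝ ∞ (fun v' => ((h.repD hc r₀ (ins v')).P x,
          (h.repD hc r₀ (ins v')).Q x)) V :=
        hsm.comp (f := fun v' : Fin 5 → ℝ => (v', x)) (by fun_prop) fun v' hv' => ⟨hv', hx⟩
      have hd1 : DifferentiableAt ℝ (fun v' => (h.repD hc r₀ (ins v')).P x) v :=
        (hd.fst.contDiffAt (hVo.mem_nhds hv)).differentiableAt (by simp)
      have hd2 : DifferentiableAt ℝ (fun v' => (h.repD hc r₀ (ins v')).Q x) v :=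
        (hd.snd.contDiffAt (hVo.mem_nhds hv)).differentiableAt (by simp)
      refine ⟨gen _ fstCoord hd1 (fun v' hv' => by rw [(h.repD_PQ hc r₀ hv').1]) ?_,
        gen _ sndCoord hd2 (fun v' hv' => by rw [(h.repD_PQ hc r₀ hv').2]) ?_⟩
      · intro q q' t
        simp [fstCoord]
      · intro q q' t
        simp [sndCoord]
    obtain ⟨c, hcq⟩ := h.eq_smul_of_par hc (q := ins v) (q' := q') hv fun x hx => by
      have e : killMat g B q' x = f x • killMat g B (ins v) x := by
        have h1 := (hf x hx).1
        have h2 := (hf x hx).2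
        rw [(hder x hx).1, (h.repD_PQ hc r₀ hv).1] at h1
        rw [(hder x hx).2, (h.repD_PQ hc r₀ hv).2] at h2
        ext a b
        fin_cases a
        · exact congrFun h1 b
        · exact congrFun h2 b
      rw [e]
      exact par_of_smul _
    -- Coordinate j is 0 for q' and 1 for the base point, hence the factor is zero.
    have e := congrFun hcq j
    simp only [hq', ins_j, sub_self, Pi.smul_apply, smul_eq_mul, mul_one] at e
    rw [← e, zero_smul] at hcq
    refine hw (funext fun k => ?_)
    have := congrFun hcq (j.succAbove k)
    simpa [hq', ins_k] using this

end KillingBasis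

end killingChart

end FracLin

/-! ### Constant curvature: connectedness, dimension five and not three. -/

namespace FracLin

/-- The complement of a line in ℝ³ has codimension two removed, hence is path connected. -/
theorem isPathConnected_indep_right {u : Fin 3 → ℝ} (hu : u ≠ 0) :
    IsPathConnected {v : Fin 3 → ℝ | LinearIndependent ℝ ![u, v]} := by
  have : {v : Fin 3 → ℝ | LinearIndependent ℝ ![u, v]} = (Submodule.span ℝ {u} : Set (Fin 3 → ℝ))ᶜ := by
    ext v
    rw [Set.mem_ofPred_eq, LinearIndependent.pair_iff' hu, Set.mem_compl_iff, SetLike.mem_coe,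
      Submodule.mem_span_singleton, not_exists]
  rw [this]
  refine isPathConnected_compl_of_one_lt_codim ?_
  rw [← Module.finrank_eq_rank]
  have h1 := Submodule.finrank_quotient_add_finrank (Submodule.span ℝ {u})
  rw [finrank_span_singleton hu, Module.finrank_fin_fun] at h1
  have : Module.finrank ℝ ((Fin 3 → ℝ) ⧸ Submodule.span ℝ {u}) = 2 := by omega
  rw [this]
  norm_num

/-- One vector is moved at a time, through an auxiliary vector w outside the span of both first
vectors; such w exists because the space has dimension three. -/
theorem isPathConnected_indep :
    IsPathConnected {z : (Fin 3 → ℝ) × (Fin 3 → ℝ) | LinearIndependent ℝ ![z.1, z.2]} := by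
  set S := {z : (Fin 3 → ℝ) × (Fin 3 → ℝ) | LinearIndependent ℝ ![z.1, z.2]} with hS
  have symm : ∀ {u v : Fin 3 → ℝ}, LinearIndependent ℝ ![u, v] → LinearIndependent ℝ ![v, u] :=
    fun h => LinearIndependent.pair_symm_iff.1 h
  have ne : ∀ {u v : Fin 3 → ℝ}, LinearIndependent ℝ ![u, v] → u ≠ 0 := fun h => h.ne_zero 0
  have right : ∀ {u v w : Fin 3 → ℝ}, LinearIndependent ℝ ![u, v] → LinearIndependent ℝ ![u, w] →
      JoinedIn S (u, v) (u, w) := fun {u v w} h h' =>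
    (((isPathConnected_indep_right (ne h)).image (f := fun y => (u, y)) (by fun_prop)).joinedIn _
      ⟨v, h, rfl⟩ _ ⟨w, h', rfl⟩).mono (by rintro _ ⟨y, hy, rfl⟩; exact hy)
  have left : ∀ {u v w : Fin 3 → ℝ}, LinearIndependent ℝ ![v, u] → LinearIndependent ℝ ![w, u] →
      JoinedIn S (v, u) (w, u) := fun {u v w} h h' =>
    (((isPathConnected_indep_right (ne (symm h))).image (f := fun y => (y, u)) (by fun_prop)).joinedIn _
      ⟨v, symm h, rfl⟩ _ ⟨w, symm h', rfl⟩).mono (by rintro _ ⟨y, hy, rfl⟩; exact symm hy)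
  refine isPathConnected_iff.2 ⟨⟨(![1, 0, 0], ![0, 1, 0]), ?_⟩, ?_⟩
  · rw [hS, Set.mem_ofPred_eq, LinearIndependent.pair_iff]
    intro s t h
    have h0 := congrFun h 0
    have h1 := congrFun h 1
    simp at h0 h1
    exact ⟨h0, h1⟩
  · rintro ⟨u, v⟩ (h : LinearIndependent ℝ ![u, v]) ⟨u', v'⟩ (h' : LinearIndependent ℝ ![u', v'])
    obtain ⟨w, hw⟩ : ∃ w, w ∉ Submodule.span ℝ (Set.range ![u, u']) := by
      by_contra hcon
      push Not at hcon
      have h1 := finrank_range_le_card (R := ℝ) ![u, u']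
      rw [Set.finrank, (Submodule.eq_top_iff').2 hcon, finrank_top, Module.finrank_fin_fun] at h1
      simp at h1
    have mk : ∀ i, ![u, u'] i ≠ 0 → LinearIndependent ℝ ![![u, u'] i, w] := fun i hi => by
      rw [LinearIndependent.pair_iff' hi]
      rintro a rfl
      exact hw (Submodule.smul_mem _ _ (Submodule.subset_span ⟨i, rfl⟩))
    have a0 : LinearIndependent ℝ ![u, w] := mk 0 (ne h)
    have a1 : LinearIndependent ℝ ![u', w] := mk 1 (ne h')
    exact ((right h a0).trans (left a0 a1)).trans (right a1 h')

theorem isConnected_indepSet : IsConnected indepSet := by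
  have : indepSet = (fun z : (Fin 3 → ℝ) × (Fin 3 → ℝ) =>
      (![z.1 0, z.1 1, z.1 2, z.2 0, z.2 1, z.2 2] : Fin 6 → ℝ)) ''
      {z | LinearIndependent ℝ ![z.1, z.2]} := by
    ext q
    rw [mem_indepSet_iff, ← LinearIndependent.pair_iff]
    constructor
    · intro h
      refine ⟨(fstCoord q, sndCoord q), h, ?_⟩
      ext i
      fin_cases i <;> rfl
    · rintro ⟨⟨u, v⟩, h, rfl⟩
      have e1 : fstCoord ![u 0, u 1, u 2, v 0, v 1, v 2] = u := by ext i; fin_cases i <;> rfl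
      have e2 : sndCoord ![u 0, u 1, u 2, v 0, v 1, v 2] = v := by ext i; fin_cases i <;> rfl
      change LinearIndependent ℝ ![fstCoord ![u 0, u 1, u 2, v 0, v 1, v 2],
        sndCoord ![u 0, u 1, u 2, v 0, v 1, v 2]]
      rwa [e1, e2]
  rw [this]
  refine isPathConnected_indep.isConnected.image _ (Continuous.continuousOn ?_)
  refine continuous_pi fun i => ?_
  fin_cases i <;> simp <;> fun_prop

section constCurvDim

variable {g : E → Matrix (Fin 2) (Fin 2) ℝ} {O : TopologicalSpace.Opens E}
  {hg : IsMetric g O} {x₀ : O} {B : Fin 3 → Fin 3 → SmoothFn O}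

namespace KillingBasis

theorem continuousOn_frac_repD (h : KillingBasis hg x₀ B) (hc : Convex ℝ (O : Set E)) (r₀ : Rep g O) :
    Continuous fun q : indepSet => (h.repD hc r₀ (q : Fin 6 → ℝ)).frac :=
  isQuotientMap_frac.continuous.comp
    (continuous_family (r := h.repD hc r₀) (V := indepSet) (h.repD_smooth hc r₀ contDiff_id))

theorem connectedSpace (h : KillingBasis hg x₀ B) (hK : ∀ i, sd O i (curvSm hg) = 0)
    (hc : Convex ℝ (O : Set E)) : ConnectedSpace (FLI g O) := by
  obtain ⟨q₀, hq₀⟩ := isConnected_indepSet.nonempty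
  have : ConnectedSpace indepSet := isConnected_iff_connectedSpace.1 isConnected_indepSet
  refine Function.Surjective.connectedSpace (f := fun q : indepSet =>
    (h.repD hc (h.rep hc hq₀) (q : Fin 6 → ℝ)).frac) (fun F => ?_) (h.continuousOn_frac_repD hc _)
  obtain ⟨s, rfl⟩ := frac_surjective F
  obtain ⟨q, hq, hp⟩ := h.exists_par hK hc s
  refine ⟨⟨q, hq⟩, ?_⟩
  rw [eq_comm, frac_eq_iff]
  simp only [h.mat_repD hc _ hq]
  exact hp

theorem hasDim_five (h : KillingBasis hg x₀ B) (hK : ∀ i, sd O i (curvSm hg) = 0)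
    (hc : Convex ℝ (O : Set E)) : HasDim g O 5 := by
  obtain ⟨q₀, hq₀⟩ := isConnected_indepSet.nonempty
  refine ⟨⟨(h.rep hc hq₀).frac⟩, fun F => ?_⟩
  obtain ⟨s, rfl⟩ := frac_surjective F
  exact h.exists_chart hK hc s

/-- The values of Killing fields at two suitable points determine the field. -/
theorem exists_leftInverse (h : KillingBasis hg x₀ B) : ∃ (x₁ : O) (Ψ : E × E →L[ℝ] (Fin 3 → ℝ)),
    ∀ u, Ψ (killVec g B u x₀, killVec g B u x₁) = u := by
  -- The Killing covector with zero value and unit skew derivative at x₀ is not identically zero; x₁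
  -- is a point where it does not vanish.
  obtain ⟨x₁, j, hj⟩ : ∃ (x₁ : O) (j : Fin 2), evalSm x₁ (B 2 j.castSucc) ≠ 0 := by
    by_contra hcon
    push Not at hcon
    have h0 : killCov B ![0, 0, 1] = 0 := funext fun j => smoothFn_ext fun x => by
      have := hcon x j
      simpa [killCov, Fin.sum_univ_three] using this
    have := congrFun (h.killCov_eq_zero h0) 2
    simp at this
  have add : ∀ u v x, killVec g B (u + v) x = killVec g B u x + killVec g B v x := fun u v x => by
    simp only [killVec, Fin.sum_univ_three, Pi.add_apply]
    module
  let Φ : (Fin 3 → ℝ) →ₗ[ℝ] E × E :=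
    { toFun := fun u => (killVec g B u x₀, killVec g B u x₁)
      map_add' := fun u v => by simp [add]
      map_smul' := fun c u => by simp [killVec_smul] }
  have hlow : ∀ u (x : O) j, evalSm x (killCov B u j) = low g (killVec g B u) j x := fun u x j => by
    rw [← lowSm_killVec hg]
    simp [lowSm]
  have hinj : LinearMap.ker Φ = ⊥ := by
    refine LinearMap.ker_eq_bot'.2 fun u hu => ?_
    have h0 : killVec g B u x₀ = 0 := congrArg Prod.fst hu
    have h1 : killVec g B u x₁ = 0 := congrArg Prod.snd hu
    have e0 : ∀ j : Fin 2, u j.castSucc = 0 := fun j => by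
      rw [← h.evalSm_killCov u j, hlow]
      simp [low, h0]
    have e1 : evalSm x₁ (killCov B u j) = 0 := by
      rw [hlow]
      simp [low, h1]
    have a0 : u 0 = 0 := e0 0
    have a1 : u 1 = 0 := e0 1
    simp only [killCov, Fin.sum_univ_three, a0, a1, zero_smul, zero_add, map_smul, smul_eq_mul] at e1
    have a2 := (mul_eq_zero.1 e1).resolve_right hj
    ext k
    fin_cases k
    · exact a0
    · exact a1
    · exact a2
  obtain ⟨Ψ, hΨ⟩ := Φ.exists_leftInverse_of_injective hinj
  exact ⟨x₁, Ψ.toContinuousLinearMap, fun u => LinearMap.congr_fun hΨ u⟩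

/-- An open set of integrals corresponds to an open set of pairs in ℝ⁶. If it were parametrised by
three numbers, the pairs would lie in the image of a C¹ map from a five-dimensional domain, whose
complement is dense by Hausdorff dimension. -/
theorem not_hasDim_three (h : KillingBasis hg x₀ B) (hK : ∀ i, sd O i (curvSm hg) = 0)
    (hc : Convex ℝ (O : Set E)) : ¬ HasDim g O 3 := by
  rintro ⟨⟨F⟩, hF⟩
  obtain ⟨V, r, hV, hemb, ⟨v₀, hv₀, -⟩, hsm, -⟩ := hF F
  obtain ⟨x₁, Ψ, hΨ⟩ := h.exists_leftInverse
  obtain ⟨ε, hε, hball⟩ := Metric.isOpen_iff.1 hV v₀ hv₀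
  set D := Metric.ball v₀ ε
  -- A fraction knows the values of its Killing pair only up to a factor at each point. The two
  -- extra parameters are these factors at x₀ and x₁, and Ψ recovers the pair from its values there.
  set G : (Fin 3 → ℝ) × ℝ × ℝ → Fin 6 → ℝ := fun z =>
    let u := Ψ (z.2.1 • (r z.1).P x₀, z.2.2 • (r z.1).P x₁)
    let w := Ψ (z.2.1 • (r z.1).Q x₀, z.2.2 • (r z.1).Q x₁)
    ![u 0, u 1, u 2, w 0, w 1, w 2] with hGdef
  have hslice : ∀ x ∈ O, ContDiffOn ℝ 1 (fun z : (Fin 3 → ℝ) × ℝ × ℝ => ((r z.1).P x, (r z.1).Q x))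
      (D ×ˢ Set.univ) := fun x hx =>
    (hsm.of_le (by norm_cast)).comp (f := fun z : (Fin 3 → ℝ) × ℝ × ℝ => (z.1, x)) (by fun_prop)
      fun z hz => ⟨hball hz.1, hx⟩
  have hG : ContDiffOn ℝ 1 G (D ×ˢ Set.univ) := by
    have s1 : ContDiffOn ℝ 1 (fun z : (Fin 3 → ℝ) × ℝ × ℝ => z.2.1) (D ×ˢ Set.univ) := by fun_prop
    have s2 : ContDiffOn ℝ 1 (fun z : (Fin 3 → ℝ) × ℝ × ℝ => z.2.2) (D ×ˢ Set.univ) := by fun_prop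
    have hu := Ψ.contDiff.comp_contDiffOn ((s1.smul (hslice x₀ x₀.2).fst).prodMk
      (s2.smul (hslice x₁ x₁.2).fst))
    have hw := Ψ.contDiff.comp_contDiffOn ((s1.smul (hslice x₀ x₀.2).snd).prodMk
      (s2.smul (hslice x₁ x₁.2).snd))
    rw [contDiffOn_pi] at hu hw ⊢
    intro i
    fin_cases i
    · exact hu 0
    · exact hu 1
    · exact hu 2
    · exact hw 0
    · exact hw 1
    · exact hw 2
  have hdense := hG.dense_compl_image_of_dimH_lt_finrank
    ((convex_ball v₀ ε).prod convex_univ) subset_rfl (by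
      refine (dimH_mono (Set.subset_univ _)).trans_lt ?_
      rw [Real.dimH_univ_eq_finrank]
      simp
      norm_num)
  -- the parameters of integrals in the image of the chart
  have himg : IsOpen ((fun v : V => (r v).frac) '' (Subtype.val ⁻¹' D)) :=
    hemb.isOpenMap _ (Metric.isOpen_ball.preimage continuous_subtype_val)
  have hN : IsOpen (Subtype.val '' ((fun q : indepSet => (h.repD hc (r v₀) (q : Fin 6 → ℝ)).frac) ⁻¹'
      ((fun v : V => (r v).frac) '' (Subtype.val ⁻¹' D)))) :=
    isOpen_indepSet.isOpenMap_subtype_val _ (himg.preimage (h.continuousOn_frac_repD hc _))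
  have hNG : Subtype.val '' ((fun q : indepSet => (h.repD hc (r v₀) (q : Fin 6 → ℝ)).frac) ⁻¹'
      ((fun v : V => (r v).frac) '' (Subtype.val ⁻¹' D))) ⊆ G '' (D ×ˢ Set.univ) := by
    rintro _ ⟨⟨q, hq⟩, ⟨v, hvD, hvq⟩, rfl⟩
    have hp := (frac_eq_iff _ _).1 hvq
    simp only [h.mat_repD hc _ hq] at hp
    obtain ⟨s, hs⟩ := (hp x₀ x₀.2).symm.exists_smul (Rep.mat_ne_zero _ x₀.2)
    obtain ⟨t, ht⟩ := (hp x₁ x₁.2).symm.exists_smul (Rep.mat_ne_zero _ x₁.2)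
    refine ⟨(v, s, t), ⟨hvD, trivial⟩, ?_⟩
    have a0 : killVec g B (fstCoord q) x₀ = s • (r v).P x₀ := congrFun hs 0
    have a1 : killVec g B (sndCoord q) x₀ = s • (r v).Q x₀ := congrFun hs 1
    have b0 : killVec g B (fstCoord q) x₁ = t • (r v).P x₁ := congrFun ht 0
    have b1 : killVec g B (sndCoord q) x₁ = t • (r v).Q x₁ := congrFun ht 1
    simp only [hGdef, ← a0, ← a1, ← b0, ← b1, hΨ]
    ext i
    fin_cases i <;> rfl
  have hne : (Subtype.val '' ((fun q : indepSet => (h.repD hc (r v₀) (q : Fin 6 → ℝ)).frac) ⁻¹'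
      ((fun v : V => (r v).frac) '' (Subtype.val ⁻¹' D)))).Nonempty := by
    obtain ⟨q, hq, hp⟩ := h.exists_par hK hc (r v₀)
    refine ⟨q, ⟨q, hq⟩, ⟨⟨v₀, hv₀⟩, Metric.mem_ball_self hε, ?_⟩, rfl⟩
    rw [frac_eq_iff]
    simp only [h.mat_repD hc _ hq]
    exact hp
  obtain ⟨q, hq, hq'⟩ := hdense.inter_open_nonempty _ hN hne
  exact hq' (hNG hq)

end KillingBasis

end constCurvDim

end FracLin

/-! ### Uniqueness for an equation degenerate at simple zeros of w. -/

namespace FracLin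

section singularUniqueness

open Filter Asymptotics Topology

variable {F : Type*} [NormedAddCommGroup F] [NormedSpace ℝ F]

theorem abs_cube_sub_le {x y m d : ℝ} (hx : |x| ≤ m) (hy : |y| ≤ m) (hd : |x - y| ≤ d) :
    |x ^ 3 - y ^ 3| ≤ 3 * m ^ 2 * d := by
  have hm : 0 ≤ m := (abs_nonneg x).trans hx
  have h1 : |x ^ 2 + x * y + y ^ 2| ≤ 3 * m ^ 2 := by
    refine (abs_add_le _ _).trans (((add_le_add_left (abs_add_le _ _) _)).trans ?_)
    rw [abs_pow, abs_pow, abs_mul]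
    have a1 := pow_le_pow_left₀ (abs_nonneg x) hx 2
    have a2 := pow_le_pow_left₀ (abs_nonneg y) hy 2
    have a3 := mul_le_mul hx hy (abs_nonneg y) hm
    linarith [sq m]
  have : x ^ 3 - y ^ 3 = (x ^ 2 + x * y + y ^ 2) * (x - y) := by ring
  rw [this, abs_mul]
  exact mul_le_mul h1 hd (abs_nonneg _) (by positivity)

/-- Uniqueness for the system `y' = B y + Ω C y`, `(Ω w³)' = k w³`, on an interval on which `w` is
comparable to `s = t - a + s₀`. -/
theorem singular_unique_aux {a c M s₀ : ℝ} {B C : ℝ → F →L[ℝ] F} {k Ω₁ Ω₂ w₁ w₂ : ℝ → ℝ}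
    {y₁ y₂ : ℝ → F} (hac : a ≤ c) (hM : 1 ≤ M) (hs₀ : 0 ≤ s₀) (hcM : 16 * M ^ 9 * (c - a) ≤ 1)
    (hy₁ : ∀ t ∈ Set.Icc a c, HasDerivAt y₁ (B t (y₁ t) + Ω₁ t • C t (y₁ t)) t)
    (hy₂ : ∀ t ∈ Set.Icc a c, HasDerivAt y₂ (B t (y₂ t) + Ω₂ t • C t (y₂ t)) t)
    (hP₁ : ∀ t ∈ Set.Icc a c, HasDerivAt (fun t => Ω₁ t * w₁ t ^ 3) (k t * w₁ t ^ 3) t)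
    (hP₂ : ∀ t ∈ Set.Icc a c, HasDerivAt (fun t => Ω₂ t * w₂ t ^ 3) (k t * w₂ t ^ 3) t)
    (hya : y₁ a = y₂ a) (hPa : Ω₁ a * w₁ a ^ 3 = Ω₂ a * w₂ a ^ 3)
    (bB : ∀ t ∈ Set.Icc a c, ‖B t‖ ≤ M) (bC : ∀ t ∈ Set.Icc a c, ‖C t‖ ≤ M)
    (by₂ : ∀ t ∈ Set.Icc a c, ‖y₂ t‖ ≤ M) (bk : ∀ t ∈ Set.Icc a c, |k t| ≤ M)
    (bs : ∀ t ∈ Set.Icc a c, t - a + s₀ ≤ M)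
    (bΩ₁ : ∀ t ∈ Set.Icc a c, |Ω₁ t| ≤ M * (t - a + s₀))
    (bΩ₂ : ∀ t ∈ Set.Icc a c, |Ω₂ t| ≤ M * (t - a + s₀))
    (bw₁ : ∀ t ∈ Set.Icc a c, |w₁ t| ≤ M * (t - a + s₀))
    (bw₂ : ∀ t ∈ Set.Icc a c, |w₂ t| ≤ M * (t - a + s₀))
    (lw₁ : ∀ t ∈ Set.Icc a c, t - a + s₀ ≤ M * |w₁ t|)
    (bw : ∀ t ∈ Set.Icc a c, |w₁ t - w₂ t| ≤ M * ‖y₁ t - y₂ t‖) :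
    ∀ t ∈ Set.Icc a c, y₁ t = y₂ t ∧ Ω₁ t * w₁ t ^ 3 = Ω₂ t * w₂ t ^ 3 := by
  have hM0 : 0 ≤ M := zero_le_one.trans hM
  have hcont : ContinuousOn (fun t => ‖y₁ t - y₂ t‖) (Set.Icc a c) := fun t ht =>
    ((hy₁ t ht).sub (hy₂ t ht)).continuousAt.continuousWithinAt.norm
  obtain ⟨t₁, ht₁, hmax⟩ := isCompact_Icc.exists_isMaxOn (Set.nonempty_Icc.2 hac) hcont
  -- With s = t - a + s₀, the plan is to bound the difference of Ωw³ by s³D, hence that of Ω by a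
  -- multiple of D, and finally D by 8M⁹(c - a)D, which the choice of c makes at most D/2.
  set D := ‖y₁ t₁ - y₂ t₁‖ with hD
  have hD0 : 0 ≤ D := norm_nonneg _
  have hDle : ∀ t ∈ Set.Icc a c, ‖y₁ t - y₂ t‖ ≤ D := fun t ht => hmax ht
  have hcube : ∀ t ∈ Set.Icc a c, |w₁ t ^ 3 - w₂ t ^ 3| ≤ 3 * (M * (t - a + s₀)) ^ 2 * (M * D) :=
    fun t ht => abs_cube_sub_le (bw₁ t ht) (bw₂ t ht)
      ((bw t ht).trans (mul_le_mul_of_nonneg_left (hDle t ht) hM0))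
  have hP : ∀ t ∈ Set.Icc a c, |Ω₁ t * w₁ t ^ 3 - Ω₂ t * w₂ t ^ 3| ≤
      3 * M ^ 4 * (t - a + s₀) ^ 3 * D := by
    intro t ht
    have key := norm_image_sub_le_of_norm_deriv_le_segment'
      (f := fun t => Ω₁ t * w₁ t ^ 3 - Ω₂ t * w₂ t ^ 3)
      (f' := fun t => k t * w₁ t ^ 3 - k t * w₂ t ^ 3) (a := a) (b := t)
      (C := M * (3 * (M * (t - a + s₀)) ^ 2 * (M * D)))
      (fun u hu => ((hP₁ u ⟨hu.1, hu.2.trans ht.2⟩).sub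
        (hP₂ u ⟨hu.1, hu.2.trans ht.2⟩)).hasDerivWithinAt)
      (fun u hu => by
        have hu' : u ∈ Set.Icc a c := ⟨hu.1, hu.2.le.trans ht.2⟩
        rw [← mul_sub, Real.norm_eq_abs, abs_mul]
        refine mul_le_mul (bk u hu') ((hcube u hu').trans ?_) (abs_nonneg _) hM0
        have h1 : u - a + s₀ ≤ t - a + s₀ := by linarith [hu.2]
        have h2 : 0 ≤ u - a + s₀ := by linarith [hu.1]
        gcongr) t (Set.right_mem_Icc.2 ht.1)
    simp only [hPa, sub_self, sub_zero, Real.norm_eq_abs] at key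
    refine key.trans ?_
    have h3 : t - a ≤ t - a + s₀ := by linarith
    have h4 : 0 ≤ t - a + s₀ := by linarith [ht.1]
    calc M * (3 * (M * (t - a + s₀)) ^ 2 * (M * D)) * (t - a)
        ≤ M * (3 * (M * (t - a + s₀)) ^ 2 * (M * D)) * (t - a + s₀) := by gcongr
      _ = _ := by ring
  -- Division by w³ costs s³, exactly the order gained in the previous bound. At s = 0 both Ω vanish
  -- by their own bounds.
  have hΩ : ∀ t ∈ Set.Icc a c, |Ω₁ t - Ω₂ t| ≤ 6 * M ^ 7 * D := by
    intro t ht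
    have hs : 0 ≤ t - a + s₀ := by linarith [ht.1]
    rcases hs.eq_or_lt with h0 | hpos
    · have e1 := bΩ₁ t ht
      have e2 := bΩ₂ t ht
      rw [← h0, mul_zero] at e1 e2
      rw [abs_nonpos_iff.1 e1, abs_nonpos_iff.1 e2, sub_zero, abs_zero]
      positivity
    · have h1 : |(Ω₁ t - Ω₂ t) * w₁ t ^ 3| ≤ 6 * M ^ 4 * (t - a + s₀) ^ 3 * D := by
        have e : (Ω₁ t - Ω₂ t) * w₁ t ^ 3 =
          (Ω₁ t * w₁ t ^ 3 - Ω₂ t * w₂ t ^ 3) - Ω₂ t * (w₁ t ^ 3 - w₂ t ^ 3) := by ring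
        rw [e]
        refine (abs_sub _ _).trans ?_
        rw [abs_mul (Ω₂ t)]
        have := mul_le_mul (bΩ₂ t ht) (hcube t ht) (abs_nonneg _) (by positivity)
        have := hP t ht
        calc _ ≤ 3 * M ^ 4 * (t - a + s₀) ^ 3 * D +
              M * (t - a + s₀) * (3 * (M * (t - a + s₀)) ^ 2 * (M * D)) := by linarith
          _ = _ := by ring
      have h2 : (t - a + s₀) ^ 3 ≤ M ^ 3 * |w₁ t| ^ 3 := by
        rw [← mul_pow]
        exact pow_le_pow_left₀ hs (lw₁ t ht) 3
      rw [abs_mul, abs_pow] at h1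
      have h3 : |Ω₁ t - Ω₂ t| * (t - a + s₀) ^ 3 ≤ 6 * M ^ 7 * D * (t - a + s₀) ^ 3 :=
        calc |Ω₁ t - Ω₂ t| * (t - a + s₀) ^ 3 ≤ |Ω₁ t - Ω₂ t| * (M ^ 3 * |w₁ t| ^ 3) := by gcongr
          _ = M ^ 3 * (|Ω₁ t - Ω₂ t| * |w₁ t| ^ 3) := by ring
          _ ≤ M ^ 3 * (6 * M ^ 4 * (t - a + s₀) ^ 3 * D) := by gcongr
          _ = _ := by ring
      exact le_of_mul_le_mul_right h3 (by positivity)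
  have hD' : D ≤ 8 * M ^ 9 * D * (t₁ - a) := by
    have key := norm_image_sub_le_of_norm_deriv_le_segment' (f := fun t => y₁ t - y₂ t)
      (f' := fun t => (B t (y₁ t) + Ω₁ t • C t (y₁ t)) - (B t (y₂ t) + Ω₂ t • C t (y₂ t)))
      (a := a) (b := t₁) (C := 8 * M ^ 9 * D)
      (fun u hu => ((hy₁ u ⟨hu.1, hu.2.trans ht₁.2⟩).sub
        (hy₂ u ⟨hu.1, hu.2.trans ht₁.2⟩)).hasDerivWithinAt)
      (fun u hu => by
        have hu' : u ∈ Set.Icc a c := ⟨hu.1, hu.2.le.trans ht₁.2⟩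
        have e : (B u (y₁ u) + Ω₁ u • C u (y₁ u)) - (B u (y₂ u) + Ω₂ u • C u (y₂ u)) =
            B u (y₁ u - y₂ u) + Ω₁ u • C u (y₁ u - y₂ u) + (Ω₁ u - Ω₂ u) • C u (y₂ u) := by
          rw [map_sub, map_sub]
          module
        rw [e]
        have n1 : ‖B u (y₁ u - y₂ u)‖ ≤ M * D :=
          ((B u).le_opNorm _).trans (mul_le_mul (bB u hu') (hDle u hu') (norm_nonneg _) hM0)
        have n2 : ‖C u (y₁ u - y₂ u)‖ ≤ M * D :=
          ((C u).le_opNorm _).trans (mul_le_mul (bC u hu') (hDle u hu') (norm_nonneg _) hM0)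
        have n3 : ‖C u (y₂ u)‖ ≤ M * M :=
          ((C u).le_opNorm _).trans (mul_le_mul (bC u hu') (by₂ u hu') (norm_nonneg _) hM0)
        have n4 : |Ω₁ u| ≤ M * M := (bΩ₁ u hu').trans (mul_le_mul_of_nonneg_left (bs u hu') hM0)
        refine (norm_add₃_le).trans ?_
        rw [norm_smul, norm_smul, Real.norm_eq_abs, Real.norm_eq_abs]
        have n5 := mul_le_mul n4 n2 (norm_nonneg _) (by positivity)
        have n6 := mul_le_mul (hΩ u hu') n3 (norm_nonneg _) (by positivity)
        have m1 : M * D ≤ M ^ 9 * D := by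
          gcongr
          exact le_self_pow₀ hM (by norm_num)
        have m2 : M ^ 3 * D ≤ M ^ 9 * D := by
          gcongr
          · norm_num
        calc _ ≤ M * D + M * M * (M * D) + 6 * M ^ 7 * D * (M * M) := by linarith
          _ = M * D + M ^ 3 * D + 6 * (M ^ 9 * D) := by ring
          _ ≤ _ := by linarith) t₁ (Set.right_mem_Icc.2 ht₁.1)
    simpa only [hya, sub_self, sub_zero] using key
  have hDz : D = 0 := by
    have h1 : 8 * M ^ 9 * D * (t₁ - a) ≤ 8 * M ^ 9 * D * (c - a) := by
      gcongr
      exact ht₁.2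
    nlinarith
  intro t ht
  have e1 := hDle t ht
  have e2 := hP t ht
  rw [hDz, mul_zero] at e2
  rw [hDz] at e1
  exact ⟨sub_eq_zero.1 (norm_le_zero_iff.1 e1), sub_eq_zero.1 (abs_nonpos_iff.1 e2)⟩

/-- The scale is s = t - a if w vanishes at a, and t - a + 1 otherwise. A simple zero makes w
comparable to s from both sides, and Ω, which vanishes there too, is O(s); the same scale serves
both solutions because they start from the same y. -/
theorem singular_unique_local {a b : ℝ} {B C : ℝ → F →L[ℝ] F} {k Ω₁ Ω₂ : ℝ → ℝ} {θ : F → ℝ}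
    {y₁ y₂ : ℝ → F} (hab : a < b) (hθ : ContDiff ℝ 1 θ)
    (hy₁ : ∀ t ∈ Set.Icc a b, HasDerivAt y₁ (B t (y₁ t) + Ω₁ t • C t (y₁ t)) t)
    (hy₂ : ∀ t ∈ Set.Icc a b, HasDerivAt y₂ (B t (y₂ t) + Ω₂ t • C t (y₂ t)) t)
    (hP₁ : ∀ t ∈ Set.Icc a b, HasDerivAt (fun t => Ω₁ t * θ (y₁ t) ^ 3) (k t * θ (y₁ t) ^ 3) t)
    (hP₂ : ∀ t ∈ Set.Icc a b, HasDerivAt (fun t => Ω₂ t * θ (y₂ t) ^ 3) (k t * θ (y₂ t) ^ 3) t)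
    (hB : ContinuousWithinAt B (Set.Ici a) a) (hC : ContinuousWithinAt C (Set.Ici a) a)
    (hk : ContinuousWithinAt k (Set.Ici a) a)
    (hΩ₁ : DifferentiableAt ℝ Ω₁ a) (hΩ₂ : DifferentiableAt ℝ Ω₂ a)
    (hs₁ : θ (y₁ a) = 0 → Ω₁ a = 0 ∧ ∃ d, d ≠ 0 ∧ HasDerivAt (fun t => θ (y₁ t)) d a)
    (hs₂ : θ (y₂ a) = 0 → Ω₂ a = 0 ∧ ∃ d, d ≠ 0 ∧ HasDerivAt (fun t => θ (y₂ t)) d a)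
    (hya : y₁ a = y₂ a) (hPa : Ω₁ a * θ (y₁ a) ^ 3 = Ω₂ a * θ (y₂ a) ^ 3) :
    ∃ c ∈ Set.Ioc a b, ∀ t ∈ Set.Icc a c,
      y₁ t = y₂ t ∧ Ω₁ t * θ (y₁ t) ^ 3 = Ω₂ t * θ (y₂ t) ^ 3 := by
  have c₁ : ContinuousWithinAt y₁ (Set.Ici a) a :=
    (hy₁ a (Set.left_mem_Icc.2 hab.le)).continuousAt.continuousWithinAt
  have c₂ : ContinuousWithinAt y₂ (Set.Ici a) a :=
    (hy₂ a (Set.left_mem_Icc.2 hab.le)).continuousAt.continuousWithinAt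
  have w₁ : ContinuousWithinAt (fun t => θ (y₁ t)) (Set.Ici a) a :=
    hθ.continuous.continuousAt.comp_continuousWithinAt c₁
  have w₂ : ContinuousWithinAt (fun t => θ (y₂ t)) (Set.Ici a) a :=
    hθ.continuous.continuousAt.comp_continuousWithinAt c₂
  -- a scale comparable to both `w`s
  obtain ⟨s₀, hs₀, hs⟩ : ∃ s₀ : ℝ, 0 ≤ s₀ ∧ ∀ (y : ℝ → F) (Ω : ℝ → ℝ), y a = y₁ a →
      ContinuousWithinAt (fun t => θ (y t)) (Set.Ici a) a → DifferentiableAt ℝ Ω a →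
      (θ (y a) = 0 → Ω a = 0 ∧ ∃ d, d ≠ 0 ∧ HasDerivAt (fun t => θ (y t)) d a) →
      (Ω =O[𝓝[≥] a] fun t => t - a + s₀) ∧ ((fun t => θ (y t)) =O[𝓝[≥] a] fun t => t - a + s₀) ∧
        ((fun t => t - a + s₀) =O[𝓝[≥] a] fun t => θ (y t)) := by
    by_cases h0 : θ (y₁ a) = 0
    · refine ⟨0, le_rfl, fun y Ω hy _ hΩ h => ?_⟩
      rw [← hy] at h0
      obtain ⟨h1, d, hd, h2⟩ := h h0
      simp only [add_zero]
      refine ⟨?_, ?_, ?_⟩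
      · have := hΩ.isBigO_sub
        simp only [h1, sub_zero] at this
        exact this.mono nhdsWithin_le_nhds
      · have := h2.differentiableAt.isBigO_sub
        simp only [h0, sub_zero] at this
        exact this.mono nhdsWithin_le_nhds
      · have := (HasDerivAtFilter.isTheta_sub h2 hd).isBigO_symm.comp_tendsto
          (tendsto_id.prodMk (tendsto_const_pure (b := a)))
        simp only [Function.comp_def, id, h0, sub_zero] at this
        exact this.mono nhdsWithin_le_nhds
    · refine ⟨1, zero_le_one, fun y Ω hy hc hΩ _ => ?_⟩
      have cs : ContinuousWithinAt (fun t : ℝ => t - a + 1) (Set.Ici a) a := by fun_prop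
      have ns : (fun t : ℝ => t - a + 1) a ≠ 0 := by simp
      have nw : (fun t => θ (y t)) a ≠ 0 := by simpa [hy] using h0
      have o1 : ∀ f : ℝ → ℝ, ContinuousWithinAt f (Set.Ici a) a →
          f =O[𝓝[≥] a] (1 : ℝ → ℝ) := fun f hf => Filter.Tendsto.isBigO_one ℝ hf
      have o2 : ∀ f : ℝ → ℝ, ContinuousWithinAt f (Set.Ici a) a → f a ≠ 0 →
          (1 : ℝ → ℝ) =O[𝓝[≥] a] f := fun f hf h0 => by
        have h1 := o1 _ (hf.inv₀ h0)
        have h2 : (fun t => f t * (f t)⁻¹) =O[𝓝[≥] a] fun t => f t * (1 : ℝ → ℝ) t :=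
          (isBigO_refl _ _).mul h1
        simp only [Pi.one_apply, mul_one] at h2
        refine IsBigO.congr' h2 ?_ EventuallyEq.rfl
        filter_upwards [hf.eventually_ne h0] with t ht
        simp [ht]
      exact ⟨(o1 _ hΩ.continuousAt.continuousWithinAt).trans (o2 _ cs ns),
        (o1 _ hc).trans (o2 _ cs ns), (o1 _ cs).trans (o2 _ hc nw)⟩
  obtain ⟨p1, q1, l1⟩ := hs y₁ Ω₁ rfl w₁ hΩ₁ hs₁
  obtain ⟨p2, q2, -⟩ := hs y₂ Ω₂ hya.symm w₂ hΩ₂ hs₂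
  have oB : B =O[𝓝[≥] a] (1 : ℝ → ℝ) := Filter.Tendsto.isBigO_one ℝ hB
  have oC : C =O[𝓝[≥] a] (1 : ℝ → ℝ) := Filter.Tendsto.isBigO_one ℝ hC
  have ok : k =O[𝓝[≥] a] (1 : ℝ → ℝ) := Filter.Tendsto.isBigO_one ℝ hk
  have oy : y₂ =O[𝓝[≥] a] (1 : ℝ → ℝ) := Filter.Tendsto.isBigO_one ℝ c₂
  have os : (fun t => t - a + s₀) =O[𝓝[≥] a] (1 : ℝ → ℝ) :=
    Filter.Tendsto.isBigO_one ℝ (ContinuousWithinAt.tendsto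
      (by fun_prop : ContinuousWithinAt (fun t => t - a + s₀) (Set.Ici a) a))
  have ow : (fun t => θ (y₁ t) - θ (y₂ t)) =O[𝓝[≥] a] fun t => y₁ t - y₂ t := by
    obtain ⟨K, u, hu, hK⟩ := (hθ.contDiffAt (x := y₁ a)).exists_lipschitzOnWith
    refine IsBigO.of_bound K ?_
    filter_upwards [c₁ hu, c₂ (hya ▸ hu)] with t h1 h2
    exact hK.norm_sub_le h1 h2
  simp only [isBigO_iff_eventually] at p1 q1 l1 p2 q2 oB oC ok oy os ow
  -- One constant M serves all the bounds; only afterwards is the interval shortened to beat M⁹.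
  obtain ⟨M, hM1, p1, q1, l1, p2, q2, oB, oC, ok, oy, os, ow⟩ :=
    ((eventually_ge_atTop (1 : ℝ)).and <| p1.and <| q1.and <| l1.and <| p2.and <| q2.and <| oB.and <|
      oC.and <| ok.and <| oy.and <| os.and ow).exists
  have hsmall : ∀ᶠ t in 𝓝[≥] a, 16 * M ^ 9 * (t - a) ≤ 1 := by
    have : ContinuousWithinAt (fun t => 16 * M ^ 9 * (t - a)) (Set.Ici a) a := by fun_prop
    have h := this.tendsto
    simp only [sub_self, mul_zero] at h
    exact (h.eventually (gt_mem_nhds zero_lt_one)).mono fun t ht => le_of_lt ht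
  have hall := hsmall.and <| p1.and <| q1.and <| l1.and <| p2.and <| q2.and <| oB.and <|
      oC.and <| ok.and <| oy.and <| os.and ow
  obtain ⟨c₀, hc₀, hsub₀⟩ := mem_nhdsGE_iff_exists_Icc_subset.1 hall
  obtain ⟨c, hc, hsub⟩ : ∃ c ∈ Set.Ioc a b, Set.Icc a c ⊆ _ :=
    ⟨min c₀ b, ⟨lt_min hc₀ hab, min_le_right _ _⟩, fun t ht =>
      hsub₀ ⟨ht.1, ht.2.trans (min_le_left _ _)⟩⟩
  have hIcc : ∀ t ∈ Set.Icc a c, t ∈ Set.Icc a b := fun t ht => ⟨ht.1, ht.2.trans hc.2⟩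
  have hsn : ∀ t ∈ Set.Icc a c, ‖t - a + s₀‖ = t - a + s₀ := fun t ht => by
    rw [Real.norm_eq_abs, abs_of_nonneg]
    linarith [ht.1]
  refine ⟨c, hc, singular_unique_aux hc.1.le hM1 hs₀ (hsub ⟨hc.1.le, le_rfl⟩).1
    (fun t ht => hy₁ t (hIcc t ht)) (fun t ht => hy₂ t (hIcc t ht))
    (fun t ht => hP₁ t (hIcc t ht)) (fun t ht => hP₂ t (hIcc t ht)) hya hPa
    (fun t ht => ?_) (fun t ht => ?_) (fun t ht => ?_) (fun t ht => ?_) (fun t ht => ?_)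
    (fun t ht => ?_) (fun t ht => ?_) (fun t ht => ?_) (fun t ht => ?_) (fun t ht => ?_)
    (fun t ht => ?_)⟩ <;>
  · obtain ⟨-, p1, q1, l1, p2, q2, oB, oC, ok, oy, os, ow⟩ := hsub ht
    simp only [hsn t ht, Pi.one_apply, norm_one, mul_one, Real.norm_eq_abs] at p1 q1 l1 p2 q2 oB oC ok oy os ow
    first | exact p1 | exact q1 | exact l1 | exact p2 | exact q2 | exact oB | exact oC | exact ok | exact oy | exact os | exact ow

/-- Uniqueness for the system `y' = B y + Ω C y`, `(Ω w³)' = k w³`, where `w = θ(y)` has only simple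
zeros. -/
theorem singular_unique {a b : ℝ} {B C : ℝ → F →L[ℝ] F} {k Ω₁ Ω₂ : ℝ → ℝ} {θ : F → ℝ}
    {y₁ y₂ : ℝ → F} (hab : a ≤ b) (hθ : ContDiff ℝ 1 θ)
    (hy₁ : ∀ t ∈ Set.Icc a b, HasDerivAt y₁ (B t (y₁ t) + Ω₁ t • C t (y₁ t)) t)
    (hy₂ : ∀ t ∈ Set.Icc a b, HasDerivAt y₂ (B t (y₂ t) + Ω₂ t • C t (y₂ t)) t)
    (hP₁ : ∀ t ∈ Set.Icc a b, HasDerivAt (fun t => Ω₁ t * θ (y₁ t) ^ 3) (k t * θ (y₁ t) ^ 3) t)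
    (hP₂ : ∀ t ∈ Set.Icc a b, HasDerivAt (fun t => Ω₂ t * θ (y₂ t) ^ 3) (k t * θ (y₂ t) ^ 3) t)
    (hB : ∀ t ∈ Set.Icc a b, ContinuousAt B t) (hC : ∀ t ∈ Set.Icc a b, ContinuousAt C t)
    (hk : ∀ t ∈ Set.Icc a b, ContinuousAt k t)
    (hΩ₁ : ∀ t ∈ Set.Icc a b, DifferentiableAt ℝ Ω₁ t)
    (hΩ₂ : ∀ t ∈ Set.Icc a b, DifferentiableAt ℝ Ω₂ t)
    (hs₁ : ∀ t ∈ Set.Icc a b, θ (y₁ t) = 0 →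
      Ω₁ t = 0 ∧ ∃ d, d ≠ 0 ∧ HasDerivAt (fun t => θ (y₁ t)) d t)
    (hs₂ : ∀ t ∈ Set.Icc a b, θ (y₂ t) = 0 →
      Ω₂ t = 0 ∧ ∃ d, d ≠ 0 ∧ HasDerivAt (fun t => θ (y₂ t)) d t)
    (hya : y₁ a = y₂ a) (hPa : Ω₁ a * θ (y₁ a) ^ 3 = Ω₂ a * θ (y₂ a) ^ 3) : y₁ b = y₂ b := by
  -- Continuous induction. The value of Ωw³ is carried along with y because local uniqueness starts
  -- from both.
  set S := {t | y₁ t = y₂ t ∧ Ω₁ t * θ (y₁ t) ^ 3 = Ω₂ t * θ (y₂ t) ^ 3} with hS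
  have hcl : IsClosed (S ∩ Set.Icc a b) := by
    have h1 : ContinuousOn (fun t => (y₁ t - y₂ t, Ω₁ t * θ (y₁ t) ^ 3 - Ω₂ t * θ (y₂ t) ^ 3))
        (Set.Icc a b) := fun t ht =>
      (((hy₁ t ht).continuousAt.sub (hy₂ t ht).continuousAt).prodMk
        ((hP₁ t ht).continuousAt.sub (hP₂ t ht).continuousAt)).continuousWithinAt
    have := h1.preimage_isClosed_of_isClosed isClosed_Icc (isClosed_singleton (x := (0, 0)))
    convert this using 1
    ext t
    simp [hS, sub_eq_zero, and_comm]
  have := hcl.Icc_subset_of_forall_exists_gt ⟨hya, hPa⟩ fun t ht z hz => by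
    have ht' : t ∈ Set.Icc a b := ⟨ht.2.1, ht.2.2.le⟩
    have hsub : ∀ u ∈ Set.Icc t b, u ∈ Set.Icc a b := fun u hu => ⟨ht'.1.trans hu.1, hu.2⟩
    obtain ⟨c, hc, hcS⟩ := singular_unique_local ht.2.2 hθ (fun u hu => hy₁ u (hsub u hu))
      (fun u hu => hy₂ u (hsub u hu)) (fun u hu => hP₁ u (hsub u hu))
      (fun u hu => hP₂ u (hsub u hu)) (hB t ht').continuousWithinAt (hC t ht').continuousWithinAt
      (hk t ht').continuousWithinAt (hΩ₁ t ht') (hΩ₂ t ht') (hs₁ t ht') (hs₂ t ht') ht.1.1 ht.1.2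
    exact ⟨min c z, hcS _ ⟨le_min hc.1.le (le_of_lt hz), min_le_left _ _⟩, lt_min hc.1 hz,
      min_le_right _ _⟩
  exact (this (Set.right_mem_Icc.2 hab)).1

end singularUniqueness

end FracLin

/-! ### Killing pairs along a segment. -/

namespace FracLin

section line

variable {g : E → Matrix (Fin 2) (Fin 2) ℝ} {O : TopologicalSpace.Opens E} {hg : IsMetric g O}

/-- The restriction of a smooth function to a line. -/
noncomputable def onLine (x v : E) (f : SmoothFn O) (t : ℝ) : ℝ := extZero O f.1 (x + t • v)

theorem onLine_eq {x v : E} {t : ℝ} (ht : x + t • v ∈ O) (f : SmoothFn O) :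
    onLine x v f t = evalSm ⟨x + t • v, ht⟩ f := evalSm_extZero f ⟨x + t • v, ht⟩

/-- The derivative of a smooth function in a constant direction. -/
noncomputable def dirD (v : E) (f : SmoothFn O) : SmoothFn O := ∑ i, v i • sd O i f

theorem hasDerivAt_onLine {x v : E} {t : ℝ} (ht : x + t • v ∈ O) (f : SmoothFn O) :
    HasDerivAt (onLine x v f) (onLine x v (dirD v f) t) t := by
  have line : HasDerivAt (fun t : ℝ => x + t • v) v t := by
    have := ((hasDerivAt_id t).smul_const v).const_add x
    rw [one_smul] at this
    exact this
  have h1 := (diffAt_of_contDiffOn O.2 (smoothFn_smooth f) ht).hasFDerivAt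
  have h2 := HasFDerivAt.comp_hasDerivAt (l := extZero O f.1) (f := fun t : ℝ => x + t • v) t h1 line
  refine h2.congr_deriv ?_
  rw [fderiv_eq_sum_pd, onLine_eq ht]
  simp only [dirD, map_sum, map_smul, evalSm_sd, smul_eq_mul]

/-- Rescaling factors along a segment with given logarithmic derivative. -/
theorem exists_line_factor {x v : E} (hO : ∀ t ∈ Set.Icc (0 : ℝ) 1, x + t • v ∈ O) (h : SmoothFn O)
    {c : ℝ} (hc : c ≠ 0) : ∃ f : ℝ → ℝ, f 0 = c ∧ (∀ t, f t ≠ 0) ∧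
      ∀ t ∈ Set.Icc (0 : ℝ) 1, HasDerivAt f (-(onLine x v h t * f t)) t := by
  have hcont : ContinuousOn (onLine x v h) (Set.Icc 0 1) := fun t ht =>
    (hasDerivAt_onLine (hO t ht) h).continuousAt.continuousWithinAt
  set k := Set.IccExtend (zero_le_one (α := ℝ)) (Set.domRestrict (Set.Icc 0 1) (onLine x v h)) with hk
  have hkc : Continuous k := (continuousOn_iff_continuous_domRestrict.1 hcont).Icc_extend'
  refine ⟨fun t => c * Real.exp (-∫ u in (0 : ℝ)..t, k u), by simp, fun t => by positivity,
    fun t ht => ?_⟩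
  have h1 : HasDerivAt (fun t => ∫ u in (0 : ℝ)..t, k u) (k t) t := hkc.integral_hasStrictDerivAt 0 t |>.hasDerivAt
  have h2 := (h1.neg.exp).const_mul c
  have e : k t = onLine x v h t := Set.IccExtend_of_mem _ _ ht
  refine h2.congr_deriv ?_
  simp only [e, Pi.neg_apply]
  ring

/-- Values of a pair of covectors and of their skew derivatives. -/
abbrev PairJet : Type := Fin 2 → Fin 3 → ℝ

/-- The elementary operators on pairs. -/
noncomputable def pairElem (k l : Fin 3) : PairJet →L[ℝ] PairJet :=
  ContinuousLinearMap.pi fun j => ContinuousLinearMap.pi fun m =>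
    if m = k then (ContinuousLinearMap.proj (R := ℝ) (φ := fun _ : Fin 3 => ℝ) l).comp
      (ContinuousLinearMap.proj (R := ℝ) (φ := fun _ : Fin 2 => Fin 3 → ℝ) j) else 0

/-- The operator acting on both members of a pair by a matrix. -/
noncomputable def pairOp (n : Fin 3 → Fin 3 → ℝ) : PairJet →L[ℝ] PairJet :=
  ∑ k, ∑ l, n k l • pairElem k l

theorem pairOp_apply (n : Fin 3 → Fin 3 → ℝ) (y : PairJet) (j : Fin 2) (m : Fin 3) :
    pairOp n y j m = ∑ l, n m l * y j l := by
  have : ∀ k l, pairElem k l y j m = if m = k then y j l else 0 := fun k l => by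
    simp only [pairElem, ContinuousLinearMap.coe_pi']
    split_ifs <;> rfl
  simp only [pairOp, sum_apply, smul_apply, Finset.sum_apply, Pi.smul_apply, this, smul_eq_mul,
    mul_ite, mul_zero]
  rw [Finset.sum_comm]
  simp

theorem continuousAt_pairOp {n : ℝ → Fin 3 → Fin 3 → ℝ} {t : ℝ}
    (h : ∀ k l, ContinuousAt (fun t => n t k l) t) : ContinuousAt (fun t => pairOp (n t)) t :=
  tendsto_finsetSum _ fun k _ => tendsto_finsetSum _ fun l _ => (h k l).smul continuousAt_const

/-- The determinant of a pair of covectors. -/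
def jetDet (y : PairJet) : ℝ := y 0 0 * y 1 1 - y 0 1 * y 1 0

theorem contDiff_jetDet : ContDiff ℝ 1 jetDet := by
  unfold jetDet
  fun_prop

/-- The coefficients of the prolonged relative Killing equation along a line, after rescaling. -/
noncomputable def lineCoef (hg : IsMetric g O) (v : E) (k l : Fin 3) : SmoothFn O :=
  ∑ i, v i • (relSys hg 0 i k l - if k = l then (2 / 3 : ℝ) • ∑ m, chrSm hg m i m else 0)

/-- The coefficients of the curvature in the prolonged relative Killing equation along a line. -/
def lineSkew (v : E) : Fin 3 → Fin 3 → ℝ := ![0, 0, ![v 0, v 1, 0]]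

/-- The cofactor enters only as a scalar matrix, which a rescaling removes along a line, and through
Ω in the row of the skew part. -/
theorem relSys_eq (L : Fin 2 → SmoothFn O) (i : Fin 2) (k l : Fin 3) :
    relSys hg L i k l = relSys hg 0 i k l + (if k = l then L i else 0) +
      (sd O 0 (L 1) - sd O 1 (L 0)) * (if k = 2 ∧ l = i.castSucc then 1 else 0) := by
  fin_cases i <;> fin_cases k <;> fin_cases l <;> simp [relSys] <;> ring

namespace KillingPair

variable {L a b : Fin 2 → SmoothFn O} {r s : SmoothFn O}

/-- At a zero of w the curvature equation reduces to 3Ω(a s - b r) = 0, and the second factor is the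
nonzero gradient of w. -/
theorem curvature_eq_zero (h : KillingPair hg L a b r s) (hc : Convex ℝ (O : Set E)) {x : O}
    (hw : evalSm x (wedge a b) = 0) : evalSm x (sd O 0 (L 1) - sd O 1 (L 0)) = 0 := by
  obtain ⟨k, hk⟩ := h.exists_deriv_ne_zero hc hw
  have e := congrArg (evalSm x) (h.fst.deriv_curvature hg.metricConn rfl h.snd k)
  have h3 : evalSm x 3 = 3 := rfl
  rw [map_add, map_mul, hw, zero_mul, zero_add, map_mul, map_mul, h3, map_zero] at e
  have := (mul_eq_zero.1 e).resolve_right hk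
  linarith

/-- The prolonged equation of a pair along a segment, normalised by a rescaling. -/
theorem exists_line (h : KillingPair hg L a b r s) (hc : Convex ℝ (O : Set E)) {x v : E}
    (hO : ∀ t ∈ Set.Icc (0 : ℝ) 1, x + t • v ∈ O)
    (hv : ∀ y : O, (∃ t ∈ Set.Icc (0 : ℝ) 1, (y : E) = x + t • v) → evalSm y (wedge a b) = 0 →
      evalSm y (dirD v (wedge a b)) ≠ 0) {c : ℝ} (hc0 : c ≠ 0) :
    ∃ y : ℝ → PairJet,
      (∀ j k, y 0 j k = c * onLine x v (![![a 0, a 1, r], ![b 0, b 1, s]] j k) 0) ∧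
      (∃ c', c' ≠ 0 ∧ ∀ j k, y 1 j k = c' * onLine x v (![![a 0, a 1, r], ![b 0, b 1, s]] j k) 1) ∧
      (∀ t ∈ Set.Icc (0 : ℝ) 1, HasDerivAt y
        (pairOp (fun k l => onLine x v (lineCoef hg v k l) t) (y t) +
          onLine x v (sd O 0 (L 1) - sd O 1 (L 0)) t • pairOp (lineSkew v) (y t)) t) ∧
      (∀ t ∈ Set.Icc (0 : ℝ) 1, HasDerivAt
        (fun t => onLine x v (sd O 0 (L 1) - sd O 1 (L 0)) t * jetDet (y t) ^ 3)
        (onLine x v (∑ i, v i • curvForm (sd O) (metSm hg) (curvSm hg) i) t * jetDet (y t) ^ 3) t) ∧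
      ∀ t ∈ Set.Icc (0 : ℝ) 1, jetDet (y t) = 0 →
        onLine x v (sd O 0 (L 1) - sd O 1 (L 0)) t = 0 ∧
        ∃ d, d ≠ 0 ∧ HasDerivAt (fun t => jetDet (y t)) d t := by
  set Om := sd O 0 (L 1) - sd O 1 (L 0) with hOm
  set T : SmoothFn O := ∑ i, v i • ∑ m, chrSm hg m i m with hT
  set l : SmoothFn O := ∑ i, v i • L i with hl
  -- The rescaled determinant is f²w, so Ω times its cube is f⁶Ωw³. The weight 2/3 on T makes the
  -- factor f⁶ cancel both 4T and 6L.
  obtain ⟨f, hf0, hfne, hfd⟩ := exists_line_factor hO (l + (2 / 3 : ℝ) • T) hc0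
  set Y : Fin 2 → Fin 3 → SmoothFn O := ![![a 0, a 1, r], ![b 0, b 1, s]] with hY
  have hdet : ∀ t, ∀ ht : x + t • v ∈ O, jetDet (fun j k => f t * onLine x v (Y j k) t) =
      f t ^ 2 * onLine x v (wedge a b) t := fun t ht => by
    simp only [jetDet, onLine_eq ht, wedge, map_sub, map_mul, hY]
    simp
    ring
  have hev : ∀ t ∈ Set.Icc (0 : ℝ) 1, ∀ᶠ u in nhds t, x + u • v ∈ O := fun t ht => by
    have : Continuous fun u : ℝ => x + u • v := by fun_prop
    exact this.continuousAt.eventually (O.2.mem_nhds (hO t ht))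
  have hYd : ∀ j k, dirD v (Y j k) = ∑ m, (lineCoef hg v k m) * Y j m + (l + (2 / 3 : ℝ) • T) * Y j k
      + Om * ∑ m, lineSkew v k m • Y j m := by
    intro j k
    have e : ∀ i, sd O i (Y j k) = ∑ m, relSys hg L i k m * Y j m := fun i => by
      fin_cases j
      · exact h.fst.sys i k
      · exact h.snd.sys i k
    refine smoothFn_ext fun y => ?_
    simp only [dirD, e, hl, hT, lineCoef, ← hOm, relSys_eq L]
    fin_cases k <;>
    · simp [Fin.sum_univ_two, Fin.sum_univ_three, lineSkew, map_sub, map_add, map_mul, map_smul]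
      ring
  have hWd : ∀ k, sd O k (Om * wedge a b ^ 3) = (4 * ∑ m, chrSm hg m k m + 6 * L k) *
      (Om * wedge a b ^ 3) + curvForm (sd O) (metSm hg) (curvSm hg) k * wedge a b ^ 3 := fun k =>
    h.fst.deriv_curvature_mul hg.metricConn hOm h.snd k
  refine ⟨fun t j k => f t * onLine x v (Y j k) t, fun j k => congrArg (· * _) hf0, ⟨f 1, hfne 1, fun j k => rfl⟩,
    fun t ht => ?_, fun t ht => ?_, fun t ht h0 => ?_⟩
  · refine hasDerivAt_pi.2 fun j => hasDerivAt_pi.2 fun k => ?_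
    refine ((hfd t ht).mul (hasDerivAt_onLine (hO t ht) (Y j k))).congr_deriv ?_
    rw [hYd]
    simp only [Pi.add_apply, Pi.smul_apply, pairOp_apply, onLine_eq (hO t ht), map_add, map_mul,
      map_smul, smul_eq_mul, Fin.sum_univ_three]
    ring
  · have h1 := ((hfd t ht).pow 6).mul (hasDerivAt_onLine (hO t ht) (Om * wedge a b ^ 3))
    refine (h1.congr_of_eventuallyEq ?_).congr_deriv ?_
    · filter_upwards [hev t ht] with u hu
      rw [hdet u hu]
      simp only [Pi.mul_apply, Pi.pow_apply, onLine_eq hu, map_mul, map_pow]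
      ring
    · rw [hdet t (hO t ht)]
      have h4 : ∀ y : O, evalSm y 4 = 4 := fun _ => rfl
      have h6 : ∀ y : O, evalSm y 6 = 6 := fun _ => rfl
      simp only [dirD, hWd, onLine_eq (hO t ht), map_add, map_mul, map_smul, map_pow, hl, hT,
        Fin.sum_univ_two, smul_eq_mul, h4, h6, Pi.pow_apply]
      push_cast
      ring
  · have h0' := h0
    rw [hdet t (hO t ht)] at h0
    have hw := (mul_eq_zero.1 h0).resolve_left (pow_ne_zero 2 (hfne t))
    rw [onLine_eq (hO t ht)] at hw
    refine ⟨by rw [onLine_eq (hO t ht)]; exact h.curvature_eq_zero hc hw,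
      f t ^ 2 * onLine x v (dirD v (wedge a b)) t, mul_ne_zero (pow_ne_zero 2 (hfne t)) ?_, ?_⟩
    · rw [onLine_eq (hO t ht)]
      exact hv _ ⟨t, ht, rfl⟩ hw
    · have h1 := ((hfd t ht).pow 2).mul (hasDerivAt_onLine (hO t ht) (wedge a b))
      refine (h1.congr_of_eventuallyEq ?_).congr_deriv ?_
      · filter_upwards [hev t ht] with u hu
        rw [hdet u hu]
        rfl
      · rw [onLine_eq (hO t ht) (wedge a b), hw]
        simp

end KillingPair

/-- Two pairs have proportional values, with proportional skew derivatives, and cofactors with the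
same curvature at a point. -/
def SameJet (x : O) (L a b : Fin 2 → SmoothFn O) (r s : SmoothFn O) (L' a' b' : Fin 2 → SmoothFn O)
    (r' s' : SmoothFn O) : Prop :=
  ∃ c : ℝ, c ≠ 0 ∧ (∀ i, evalSm x (a i) = c * evalSm x (a' i)) ∧
    (∀ i, evalSm x (b i) = c * evalSm x (b' i)) ∧ evalSm x r = c * evalSm x r' ∧
    evalSm x s = c * evalSm x s' ∧
    evalSm x (sd O 0 (L 1) - sd O 1 (L 0)) = evalSm x (sd O 0 (L' 1) - sd O 1 (L' 0))

/-- Unique continuation of pairs along a segment on which their determinants have only simple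
zeros. -/
theorem SameJet.par_of_line {L a b L' a' b' : Fin 2 → SmoothFn O} {r s r' s' : SmoothFn O}
    (h : KillingPair hg L a b r s) (h' : KillingPair hg L' a' b' r' s') (hc : Convex ℝ (O : Set E))
    {x z : O} (hj : SameJet x L a b r s L' a' b' r' s')
    (hv : ∀ y : O, (y : E) ∈ segment ℝ (x : E) z → evalSm y (wedge a b) = 0 →
      evalSm y (dirD ((z : E) - x) (wedge a b)) ≠ 0)
    (hv' : ∀ y : O, (y : E) ∈ segment ℝ (x : E) z → evalSm y (wedge a' b') = 0 →
      evalSm y (dirD ((z : E) - x) (wedge a' b')) ≠ 0) :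
    Par (covMat a b z) (covMat a' b' z) := by
  set v : E := (z : E) - x with hvdef
  have hseg : ∀ t ∈ Set.Icc (0 : ℝ) 1, (x : E) + t • v ∈ segment ℝ (x : E) z := fun t ht => by
    rw [segment_eq_image']
    exact ⟨t, ht, rfl⟩
  have hO : ∀ t ∈ Set.Icc (0 : ℝ) 1, (x : E) + t • v ∈ O := fun t ht =>
    hc.segment_subset x.2 z.2 (hseg t ht)
  obtain ⟨c, hc0, ha, hb, hr, hs, hΩ⟩ := hj
  obtain ⟨y₁, i₁, ⟨c₁, hc₁, e₁⟩, d₁, p₁, s₁⟩ := h.exists_line hc hO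
    (fun y ⟨t, ht, hy⟩ => hv y (hy ▸ hseg t ht)) one_ne_zero
  obtain ⟨y₂, i₂, ⟨c₂, hc₂, e₂⟩, d₂, p₂, s₂⟩ := h'.exists_line hc hO
    (fun y ⟨t, ht, hy⟩ => hv' y (hy ▸ hseg t ht)) hc0
  have hx0 : ∀ f : SmoothFn O, onLine x v f 0 = evalSm x f := fun f => by
    have h0 := hO 0 ⟨le_rfl, zero_le_one⟩
    rw [onLine_eq h0]
    congr 1
    simp
  have hz1 : ∀ f : SmoothFn O, onLine x v f 1 = evalSm z f := fun f => by
    have h1 := hO 1 ⟨zero_le_one, le_rfl⟩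
    rw [onLine_eq h1]
    congr 1
    simp [hvdef]
  have hy0 : y₁ 0 = y₂ 0 := by
    funext j k
    rw [i₁, i₂, hx0, hx0, one_mul]
    fin_cases j <;> fin_cases k
    · exact ha 0
    · exact ha 1
    · exact hr
    · exact hb 0
    · exact hb 1
    · exact hs
  have cont : ∀ f : SmoothFn O, ∀ t ∈ Set.Icc (0 : ℝ) 1, ContinuousAt (onLine x v f) t :=
    fun f t ht => (hasDerivAt_onLine (hO t ht) f).continuousAt
  -- After rescaling, both pairs solve the same system, with coefficients from the metric and the
  -- direction; the cofactors survive only through their curvatures.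
  have key := singular_unique zero_le_one contDiff_jetDet d₁ d₂ p₁ p₂
    (fun t ht => continuousAt_pairOp fun k l => cont _ t ht) (fun t ht => continuousAt_const)
    (fun t ht => cont _ t ht) (fun t ht => (hasDerivAt_onLine (hO t ht) _).differentiableAt)
    (fun t ht => (hasDerivAt_onLine (hO t ht) _).differentiableAt) s₁ s₂ hy0
    (by rw [hy0, hx0, hx0, hΩ])
  have e : ∀ j k, c₁ * evalSm z (![![a 0, a 1, r], ![b 0, b 1, s]] j k) =
      c₂ * evalSm z (![![a' 0, a' 1, r'], ![b' 0, b' 1, s']] j k) := fun j k => by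
    rw [← hz1, ← hz1, ← e₁, ← e₂, key]
  have : covMat a b z = (c₁⁻¹ * c₂) • covMat a' b' z := by
    ext j k
    have e00 := e 0 0
    have e01 := e 0 1
    have e10 := e 1 0
    have e11 := e 1 1
    simp at e00 e01 e10 e11
    fin_cases j <;> fin_cases k <;> simp [covMat] <;> field_simp <;> linarith
  rw [this]
  exact par_of_smul _

end line

end FracLin

/-! ### Unique continuation of Killing pairs. -/

namespace FracLin

section continuation

variable {g : E → Matrix (Fin 2) (Fin 2) ℝ} {O : TopologicalSpace.Opens E} {hg : IsMetric g O}

theorem exists_smoothFn_inv {f : SmoothFn O} (hf : ∀ y, evalSm y f ≠ 0) :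
    ∃ f' : SmoothFn O, ∀ y, evalSm y f' = (evalSm y f)⁻¹ := by
  have hs : ContDiffOn ℝ ∞ (fun x => (extZero O f.1 x)⁻¹) O :=
    (smoothFn_smooth f).inv fun x hx => by
      lift x to O using hx
      rw [evalSm_extZero]
      exact hf x
  exact ⟨toSm _ hs, fun y => by rw [evalSm_toSm, evalSm_extZero]⟩

namespace KillingPair

variable {L a b L' a' b' : Fin 2 → SmoothFn O} {r s r' s' : SmoothFn O}

theorem covMat_ne_zero (h : KillingPair hg L a b r s) (hc : Convex ℝ (O : Set E)) (x : O) :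
    covMat a b x ≠ 0 := by
  intro h0
  obtain ⟨i, hi⟩ := h.exists_ne_zero hc x
  have h1 : evalSm x (a i) = 0 := congrFun (congrFun h0 0) i
  have h2 : evalSm x (b i) = 0 := congrFun (congrFun h0 1) i
  tauto

/-- Pairs that are proportional near a point have the same jet there. -/
theorem sameJet_of_par (h : KillingPair hg L a b r s) (h' : KillingPair hg L' a' b' r' s')
    (hc : Convex ℝ (O : Set E)) {Z : Set E} (hZ : IsOpen Z)
    (hp : ∀ y : O, (y : E) ∈ Z → Par (covMat a b y) (covMat a' b' y)) {x : O} (hx : (x : E) ∈ Z) :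
    SameJet x L a b r s L' a' b' r' s' := by
  set n : SmoothFn O := a' 0 ^ 2 + a' 1 ^ 2 + b' 0 ^ 2 + b' 1 ^ 2 with hn
  have hn0 : ∀ y, evalSm y n ≠ 0 := fun y => by
    obtain ⟨i, hi⟩ := h'.exists_ne_zero hc y
    simp only [hn, map_add, map_pow]
    refine ne_of_gt ?_
    fin_cases i <;> rcases hi with hi | hi <;> simp only [Fin.zero_eta, Fin.mk_one] at hi <;> positivity
  obtain ⟨n', hn'⟩ := exists_smoothFn_inv hn0
  -- The least-squares factor: smooth everywhere, and equal to the true factor of proportionality in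
  -- Z.
  set c : SmoothFn O := (a 0 * a' 0 + a 1 * a' 1 + b 0 * b' 0 + b 1 * b' 1) * n' with hcdef
  have hprop : ∀ y : O, (y : E) ∈ Z → (∀ i, evalSm y (a i) = evalSm y c * evalSm y (a' i)) ∧
      ∀ i, evalSm y (b i) = evalSm y c * evalSm y (b' i) := by
    intro y hy
    obtain ⟨t, ht⟩ := (hp y hy).exists_smul (h'.covMat_ne_zero hc y)
    have ta : ∀ i, evalSm y (a i) = t * evalSm y (a' i) := fun i => congrFun (congrFun ht 0) i
    have tb : ∀ i, evalSm y (b i) = t * evalSm y (b' i) := fun i => congrFun (congrFun ht 1) i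
    have e : evalSm y c = t := by
      have := hn0 y
      rw [hcdef, map_mul, hn', mul_inv_eq_iff_eq_mul₀ this]
      simp only [hn, map_add, map_mul, map_pow, ta, tb]
      ring
    rw [e]
    exact ⟨ta, tb⟩
  have hpa : ∀ i j, ∀ y : O, (y : E) ∈ Z → evalSm y (sd O i (a j)) =
      evalSm y (sd O i c) * evalSm y (a' j) + evalSm y c * evalSm y (sd O i (a' j)) :=
    fun i j y hy => by
      have := evalSm_sd_of_eventually (f := a j - c * a' j) hZ hy (fun z hz => by
        rw [map_sub, map_mul, (hprop z hz).1 j, sub_self]) i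
      simp only [map_sub, Derivation.leibniz, smul_eq_mul, map_add, map_mul] at this
      linarith
  have hpb : ∀ i j, ∀ y : O, (y : E) ∈ Z → evalSm y (sd O i (b j)) =
      evalSm y (sd O i c) * evalSm y (b' j) + evalSm y c * evalSm y (sd O i (b' j)) :=
    fun i j y hy => by
      have := evalSm_sd_of_eventually (f := b j - c * b' j) hZ hy (fun z hz => by
        rw [map_sub, map_mul, (hprop z hz).2 j, sub_self]) i
      simp only [map_sub, Derivation.leibniz, smul_eq_mul, map_add, map_mul] at this
      linarith
  have gen : ∀ (a a' : Fin 2 → SmoothFn O) (r r' : SmoothFn O), RelKilling (sd O) (chrSm hg) L a r →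
      RelKilling (sd O) (chrSm hg) L' a' r' → ∀ y : O,
      (∀ i, evalSm y (a i) = evalSm y c * evalSm y (a' i)) →
      (∀ i j, evalSm y (sd O i (a j)) =
        evalSm y (sd O i c) * evalSm y (a' j) + evalSm y c * evalSm y (sd O i (a' j))) →
      ∀ u : Fin 2 → ℝ, (∀ i, u i = evalSm y c * (evalSm y (L i) - evalSm y (L' i)) -
        evalSm y (sd O i c)) → u 0 * evalSm y (a' 0) = 0 ∧ u 1 * evalSm y (a' 1) = 0 ∧
        u 0 * evalSm y (a' 1) + (evalSm y r - evalSm y c * evalSm y r') = 0 ∧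
        u 1 * evalSm y (a' 0) - (evalSm y r - evalSm y c * evalSm y r') = 0 := by
    intro a a' r r' ha ha' y h0 h1 u hu
    have d := fun i => h1 i i
    have p := h1 0 1
    have q := h1 1 0
    simp only [ha.diag, ha'.diag, ha.up, ha'.up, ha.down, ha'.down, Fin.sum_univ_two, map_add,
      map_sub, map_mul, h0] at d p q
    simp only [hu]
    exact ⟨by linear_combination d 0, by linear_combination d 1, by linear_combination p,
      by linear_combination q⟩
  have hu : ∀ y : O, (y : E) ∈ Z →
      (∀ i, evalSm y c * (evalSm y (L i) - evalSm y (L' i)) - evalSm y (sd O i c) = 0) ∧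
      evalSm y r = evalSm y c * evalSm y r' ∧ evalSm y s = evalSm y c * evalSm y s' := by
    intro y hy
    -- Substituting a = c a' and b = c b' into the Killing equations leaves the symmetric products
    -- of u with a' and with b' equal to zero; one of the covectors is nonzero, so u = 0.
    set u : Fin 2 → ℝ := fun i => evalSm y c * (evalSm y (L i) - evalSm y (L' i)) -
      evalSm y (sd O i c) with hudef
    obtain ⟨a0, a1, ap, aq⟩ := gen a a' r r' h.fst h'.fst y (hprop y hy).1
      (fun i j => hpa i j y hy) u fun i => rfl
    obtain ⟨b0, b1, bp, bq⟩ := gen b b' s s' h.snd h'.snd y (hprop y hy).2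
      (fun i j => hpb i j y hy) u fun i => rfl
    have aux : ∀ p q : ℝ, u 0 * p = 0 → u 1 * q = 0 → u 0 * q + u 1 * p = 0 → p ≠ 0 ∨ q ≠ 0 →
        u 0 = 0 ∧ u 1 = 0 := by
      rintro p q h1 h2 h3 (hp | hq)
      · have e0 := (mul_eq_zero.1 h1).resolve_right hp
        rw [e0, zero_mul, zero_add] at h3
        exact ⟨e0, (mul_eq_zero.1 h3).resolve_right hp⟩
      · have e1 := (mul_eq_zero.1 h2).resolve_right hq
        rw [e1, zero_mul, add_zero] at h3
        exact ⟨(mul_eq_zero.1 h3).resolve_right hq, e1⟩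
    have hz : u 0 = 0 ∧ u 1 = 0 := by
      obtain ⟨i, hi⟩ := h'.exists_ne_zero hc y
      rcases hi with hi | hi
      · refine aux _ _ a0 a1 (by linarith) ?_
        fin_cases i
        · exact Or.inl hi
        · exact Or.inr hi
      · refine aux _ _ b0 b1 (by linarith) ?_
        fin_cases i
        · exact Or.inl hi
        · exact Or.inr hi
    rw [hz.1, zero_mul, zero_add, sub_eq_zero] at ap bp
    refine ⟨fun i => ?_, ap, bp⟩
    fin_cases i
    · exact hz.1
    · exact hz.2
  have hc0 : evalSm x c ≠ 0 := fun h0 => by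
    obtain ⟨i, hi⟩ := h.exists_ne_zero hc x
    rw [(hprop x hx).1, (hprop x hx).2, h0, zero_mul, zero_mul] at hi
    tauto
  refine ⟨evalSm x c, hc0, (hprop x hx).1, (hprop x hx).2, (hu x hx).2.1, (hu x hx).2.2, ?_⟩
  -- Differentiate c(L - L') = dc and antisymmetrise: the second derivatives of c cancel, so the
  -- curvatures agree.
  have dd : ∀ i j, evalSm x (sd O j c) * (evalSm x (L i) - evalSm x (L' i)) +
      evalSm x c * (evalSm x (sd O j (L i)) - evalSm x (sd O j (L' i))) =
      evalSm x (sd O j (sd O i c)) := fun i j => by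
    have := evalSm_sd_of_eventually (f := c * (L i - L' i) - sd O i c) hZ hx (fun z hz => by
      simp only [map_sub, map_mul]
      exact (hu z hz).1 i) j
    simp only [map_sub, Derivation.leibniz, smul_eq_mul, map_add, map_mul] at this
    linarith
  have e1 := dd 1 0
  have e0 := dd 0 1
  rw [sd_comm] at e1
  have u0 := (hu x hx).1 0
  have u1 := (hu x hx).1 1
  simp only [map_sub]
  refine mul_left_cancel₀ hc0 ?_
  linear_combination e1 - e0 + (evalSm x (L 1) - evalSm x (L' 1)) * u0 -
    (evalSm x (L 0) - evalSm x (L' 0)) * u1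

theorem dirD_smul (t : ℝ) (v : E) (f : SmoothFn O) : dirD (t • v) f = t • dirD v f := by
  simp only [dirD, Fin.sum_univ_two, Pi.smul_apply, smul_eq_mul, mul_smul, smul_add]

/-- Proportionality propagates in a direction that is transversal to the zeros of the
determinants. -/
theorem par_translate (h : KillingPair hg L a b r s) (h' : KillingPair hg L' a' b' r' s')
    (hc : Convex ℝ (O : Set E)) {B : Set E} (hBc : Convex ℝ B) {v : E}
    (hv : ∀ y : O, (y : E) ∈ B → evalSm y (wedge a b) = 0 → evalSm y (dirD v (wedge a b)) ≠ 0)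
    (hv' : ∀ y : O, (y : E) ∈ B → evalSm y (wedge a' b') = 0 → evalSm y (dirD v (wedge a' b')) ≠ 0)
    (hBO : B ⊆ O) {z : E} {η t : ℝ} (h1 : Metric.ball z η ⊆ B) (h2 : Metric.ball (z + t • v) η ⊆ B)
    (hp : ∀ y : O, (y : E) ∈ Metric.ball z η → Par (covMat a b y) (covMat a' b' y)) :
    ∀ y : O, (y : E) ∈ Metric.ball (z + t • v) η → Par (covMat a b y) (covMat a' b' y) := by
  intro y hy
  have hw : (y : E) - t • v ∈ Metric.ball z η := by
    rw [Metric.mem_ball, dist_eq_norm] at hy ⊢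
    convert hy using 2
    abel
  rcases eq_or_ne t 0 with rfl | ht
  · refine hp y ?_
    simpa using hw
  · set w : O := ⟨(y : E) - t • v, hBO (h1 hw)⟩ with hwdef
    have hd : (y : E) - w = t • v := by simp [hwdef]
    have seg : segment ℝ (w : E) y ⊆ B := hBc.segment_subset (h1 hw) (h2 hy)
    -- Each point of the translated ball is reached from the original ball by a segment parallel to
    -- v, transversal to both zero sets.
    refine SameJet.par_of_line h h' hc (h.sameJet_of_par h' hc Metric.isOpen_ball hp (x := w) hw)
      (fun u hu h0 => ?_) (fun u hu h0 => ?_)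
    · rw [hd, dirD_smul, map_smul, smul_eq_mul]
      exact mul_ne_zero ht (hv u (seg hu) h0)
    · rw [hd, dirD_smul, map_smul, smul_eq_mul]
      exact mul_ne_zero ht (hv' u (seg hu) h0)

theorem exists_nhds_transversal {f : SmoothFn O} {v : E} {x : O}
    (h : evalSm x f = 0 → evalSm x (dirD v f) ≠ 0) :
    ∀ᶠ y in nhds (x : E), ∀ hy : y ∈ O, evalSm ⟨y, hy⟩ f = 0 → evalSm ⟨y, hy⟩ (dirD v f) ≠ 0 := by
  have cont : ∀ f : SmoothFn O, ContinuousAt (extZero O f.1) x := fun f =>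
    (smoothFn_smooth f).continuousOn.continuousAt (O.2.mem_nhds x.2)
  by_cases h0 : evalSm x f = 0
  · have h1 := h h0
    rw [← evalSm_extZero] at h1
    filter_upwards [(cont _).eventually_ne h1] with y h2 hy _
    rwa [← evalSm_extZero]
  · rw [← evalSm_extZero] at h0
    filter_upwards [(cont _).eventually_ne h0] with y h2 hy h3
    rw [← evalSm_extZero] at h3
    exact absurd h3 h2

/-- A zero of w is simple, so its gradient annihilates a single direction, which is at most one
slope m. -/
theorem finite_not_transversal (h : KillingPair hg L a b r s) (hc : Convex ℝ (O : Set E)) (x : O) :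
    {m : ℝ | ¬(evalSm x (wedge a b) = 0 → evalSm x (dirD ![1, m] (wedge a b)) ≠ 0)}.Finite := by
  by_cases h0 : evalSm x (wedge a b) = 0
  · obtain ⟨k, hk⟩ := h.exists_deriv_ne_zero hc h0
    have e : ∀ k, evalSm x (sd O k (wedge a b)) = evalSm x (a k * s - b k * r) := fun k => by
      rw [h.fst.deriv_wedge hg.metricConn h.snd k, map_add, map_mul, h0, mul_zero, zero_add]
    refine (Set.finite_singleton (-evalSm x (sd O 0 (wedge a b)) / evalSm x (sd O 1 (wedge a b)))).subset
      fun m hm => ?_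
    simp only [Set.mem_ofPred_eq, not_forall, not_not, dirD, Fin.sum_univ_two, map_add, map_smul,
      smul_eq_mul, Matrix.cons_val_zero, Matrix.cons_val_one, one_mul] at hm
    obtain ⟨-, hm⟩ := hm
    by_cases h1 : evalSm x (sd O 1 (wedge a b)) = 0
    · rw [h1, mul_zero, add_zero] at hm
      rw [← e] at hk
      fin_cases k
      · exact absurd hm hk
      · exact absurd h1 hk
    · rw [Set.mem_singleton_iff, eq_div_iff h1]
      linarith
  · simp [h0]

/-- Pairs that have the same jet at a point where they are independent are proportional. -/
theorem par_of_sameJet (h : KillingPair hg L a b r s) (h' : KillingPair hg L' a' b' r' s')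
    (hc : Convex ℝ (O : Set E)) {x : O} (hw : evalSm x (wedge a b) ≠ 0)
    (hw' : evalSm x (wedge a' b') ≠ 0) (hj : SameJet x L a b r s L' a' b' r' s') (y : O) :
    Par (covMat a b y) (covMat a' b' y) := by
  set Z : Set E := interior {y | ∀ hy : y ∈ O, Par (covMat a b ⟨y, hy⟩) (covMat a' b' ⟨y, hy⟩)} with hZ
  suffices (O : Set E) ⊆ Z from interior_subset (this y.2) y.2
  have cont : ∀ f : SmoothFn O, ContinuousAt (extZero O f.1) x := fun f =>
    (smoothFn_smooth f).continuousOn.continuousAt (O.2.mem_nhds x.2)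
  -- The open set Z where proportionality holds is nonempty and must be shown to contain its limit
  -- points in the connected set O.
  refine hc.isPreconnected.subset_of_closure_inter_subset isOpen_interior ⟨x, x.2, ?_⟩ ?_
  · rw [← evalSm_extZero] at hw hw'
    obtain ⟨ε, hε, hB⟩ := Metric.mem_nhds_iff.1 (Filter.inter_mem (O.2.mem_nhds x.2)
      (((cont _).eventually_ne hw).and ((cont _).eventually_ne hw')))
    rw [hZ, mem_interior]
    refine ⟨Metric.ball x ε, fun z hz hzO => ?_, Metric.isOpen_ball, Metric.mem_ball_self hε⟩
    have seg : segment ℝ (x : E) z ⊆ Metric.ball x ε :=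
      (convex_ball _ _).segment_subset (Metric.mem_ball_self hε) hz
    refine SameJet.par_of_line h h' hc (z := ⟨z, hzO⟩) hj (fun u hu h0 => ?_) (fun u hu h0 => ?_)
    · rw [← evalSm_extZero] at h0
      exact absurd h0 (hB (seg hu)).2.1
    · rw [← evalSm_extZero] at h0
      exact absurd h0 (hB (seg hu)).2.2
  · rintro z ⟨hzc, hzO⟩
    lift z to O using hzO
    have hfin := (h.finite_not_transversal hc z).union (h'.finite_not_transversal hc z)
    -- Only finitely many slopes are bad at z, so two independent transversal directions are
    -- available.
    obtain ⟨m₁, hm₁, m₂, hm₂, hne⟩ := hfin.infinite_compl.nontrivial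
    simp only [Set.mem_compl_iff, Set.mem_union, Set.mem_ofPred_eq, not_or, not_not] at hm₁ hm₂
    set v₁ : E := ![1, m₁] with hv₁
    set v₂ : E := ![1, m₂] with hv₂
    obtain ⟨δ, hδ, hB⟩ := Metric.mem_nhds_iff.1 (Filter.inter_mem (O.2.mem_nhds z.2)
      ((exists_nhds_transversal hm₁.1).and <| (exists_nhds_transversal hm₁.2).and <|
        (exists_nhds_transversal hm₂.1).and (exists_nhds_transversal hm₂.2)))
    have hBO : Metric.ball (z : E) δ ⊆ O := fun u hu => (hB hu).1
    -- coordinates of the displacement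
    set β : E → ℝ := fun p => ((z : E) 1 - p 1 - m₁ * ((z : E) 0 - p 0)) / (m₂ - m₁) with hβ
    set α : E → ℝ := fun p => (z : E) 0 - p 0 - β p with hα
    have hm : m₂ - m₁ ≠ 0 := sub_ne_zero.2 (Ne.symm hne)
    have hsum : ∀ p : E, p + α p • v₁ + β p • v₂ = z := fun p => by
      have e0 : p 0 + α p * 1 + β p * 1 = (z : E) 0 := by
        simp only [hα]
        ring
      have e1 : p 1 + α p * m₁ + β p * m₂ = (z : E) 1 := by
        simp only [hα, hβ]
        field_simp
        ring
      ext i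
      fin_cases i
      · exact e0
      · exact e1
    have hcont : Continuous fun p : E => p + α p • v₁ := by
      simp only [hα, hβ]
      fun_prop
    have hz0 : (z : E) + α z • v₁ = z := by
      simp [hα, hβ]
    have hnear : ∀ᶠ p in nhds (z : E), p ∈ Metric.ball (z : E) δ ∧
        p + α p • v₁ ∈ Metric.ball (z : E) δ :=
      Filter.Eventually.and (p := fun p => p ∈ Metric.ball (z : E) δ) (Metric.ball_mem_nhds _ hδ)
        (hcont.continuousAt.eventually (by beta_reduce; rw [hz0]; exact Metric.ball_mem_nhds _ hδ))
    obtain ⟨p, ⟨hp1, hp2⟩, hpZ⟩ := mem_closure_iff_nhds.1 hzc _ hnear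
    obtain ⟨η, hη, hηs⟩ : ∃ η > 0, Metric.ball p η ⊆ Z ∩ Metric.ball (z : E) δ ∧
        Metric.ball (p + α p • v₁) η ⊆ Metric.ball (z : E) δ ∧
        Metric.ball (z : E) η ⊆ Metric.ball (z : E) δ := by
      obtain ⟨η₁, h1, s1⟩ := Metric.isOpen_iff.1 (isOpen_interior.inter Metric.isOpen_ball) p ⟨hpZ, hp1⟩
      obtain ⟨η₂, h2, s2⟩ := Metric.isOpen_iff.1 Metric.isOpen_ball _ hp2
      refine ⟨min (min η₁ η₂) δ, lt_min (lt_min h1 h2) hδ, ?_, ?_, ?_⟩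
      · exact (Metric.ball_subset_ball ((min_le_left _ _).trans (min_le_left _ _))).trans s1
      · exact (Metric.ball_subset_ball ((min_le_left _ _).trans (min_le_right _ _))).trans s2
      · exact Metric.ball_subset_ball (min_le_right _ _)
    obtain ⟨s1, s2, s3⟩ := hηs
    have q0 : ∀ y : O, (y : E) ∈ Metric.ball p η → Par (covMat a b y) (covMat a' b' y) :=
      fun y hy => interior_subset (s1 hy).1 y.2
    have q1 := h.par_translate h' hc (convex_ball (z : E) δ) (v := v₁)
      (fun y hy => (hB hy).2.1 y.2) (fun y hy => (hB hy).2.2.1 y.2) hBO (s1.trans Set.inter_subset_right)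
      s2 q0
    have q2 := h.par_translate h' hc (convex_ball (z : E) δ) (v := v₂) (t := β p)
      (fun y hy => (hB hy).2.2.2.1 y.2) (fun y hy => (hB hy).2.2.2.2 y.2) hBO s2
      (by rw [hsum]; exact s3) q1
    rw [hsum] at q2
    exact mem_interior.2 ⟨Metric.ball (z : E) η, fun u hu huO => q2 ⟨u, huO⟩ hu, Metric.isOpen_ball,
      Metric.mem_ball_self hη⟩

/-- A linear change of a pair. -/
theorem moebius (h : KillingPair hg L a b r s) (A : GL (Fin 2) ℝ) :
    KillingPair hg L (A 0 0 • a + A 0 1 • b) (A 1 0 • a + A 1 1 • b) (A 0 0 • r + A 0 1 • s)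
      (A 1 0 • r + A 1 1 • s) := by
  refine ⟨h.fst.comb h.snd _ _, h.fst.comb h.snd _ _, fun c d e => ?_⟩
  have hA : A 0 0 * A 1 1 - A 0 1 * A 1 0 ≠ 0 := by
    rw [← Matrix.det_fin_two]; exact A.det_ne_zero
  obtain ⟨h1, h2⟩ := h.indep (c * A 0 0 + d * A 1 0) (c * A 0 1 + d * A 1 1) (by
    rw [← e]
    module)
  constructor
  · refine (mul_eq_zero.1 (?_ : c * _ = 0)).resolve_right hA
    linear_combination A 1 1 * h1 - A 1 0 * h2
  · refine (mul_eq_zero.1 (?_ : d * _ = 0)).resolve_right hA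
    linear_combination A 0 0 * h2 - A 0 1 * h1

theorem covMat_moebius (A : GL (Fin 2) ℝ) (x : O) :
    covMat (A 0 0 • a + A 0 1 • b) (A 1 0 • a + A 1 1 • b) x = A.1 * covMat a b x := by
  ext i j
  fin_cases i <;> simp [covMat, Matrix.mul_apply, Fin.sum_univ_two]

theorem det_covMat (x : O) : (covMat a b x).det = evalSm x (wedge a b) := by
  simp [covMat, Matrix.det_fin_two, wedge]

/-- Integrals whose pairs have the same connection form and the same curvature at a point are
equivalent. -/
theorem exists_par_moebius (h : KillingPair hg L a b r s) (h' : KillingPair hg L' a' b' r' s')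
    (hc : Convex ℝ (O : Set E)) {x : O} (hw : evalSm x (wedge a b) ≠ 0)
    (hw' : evalSm x (wedge a' b') ≠ 0)
    (hm : ∀ k, evalSm x (b k * r - a k * s) / evalSm x (wedge a b) =
      evalSm x (b' k * r' - a' k * s') / evalSm x (wedge a' b'))
    (hOm : evalSm x (sd O 0 (L 1) - sd O 1 (L 0)) = evalSm x (sd O 0 (L' 1) - sd O 1 (L' 0))) :
    ∃ A : GL (Fin 2) ℝ, ∀ y, Par (covMat a b y) (A.1 * covMat a' b' y) := by
  have hd : IsUnit (covMat a' b' x).det := by rw [det_covMat]; exact isUnit_iff_ne_zero.2 hw'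
  -- The constant matrix that makes the two pairs agree at x.
  have hA : (covMat a b x * (covMat a' b' x)⁻¹).det ≠ 0 := by
    rw [Matrix.det_mul, Matrix.det_nonsing_inv, det_covMat, det_covMat, Ring.inverse_eq_inv']
    exact mul_ne_zero hw (inv_ne_zero hw')
  set A : GL (Fin 2) ℝ := Matrix.GeneralLinearGroup.mkOfDetNeZero _ hA with hAdef
  have hAx : A.1 * covMat a' b' x = covMat a b x := Matrix.nonsing_inv_mul_cancel_right _ _ hd
  refine ⟨A, fun y => ?_⟩
  rw [← covMat_moebius]
  have hx := hAx
  rw [← covMat_moebius] at hx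
  have ea : ∀ i, evalSm x (a i) = evalSm x ((A 0 0 • a' + A 0 1 • b') i) := fun i =>
    (congrFun (congrFun hx 0) i).symm
  have eb : ∀ i, evalSm x (b i) = evalSm x ((A 1 0 • a' + A 1 1 • b') i) := fun i =>
    (congrFun (congrFun hx 1) i).symm
  have hw2 : evalSm x (wedge (A 0 0 • a' + A 0 1 • b') (A 1 0 • a' + A 1 1 • b')) ≠ 0 := by
    rw [← det_covMat, hx, det_covMat]
    exact hw
  refine h.par_of_sameJet (h'.moebius A) hc hw hw2 ⟨1, one_ne_zero, fun i => by rw [one_mul, ea],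
    fun i => by rw [one_mul, eb], ?_⟩ y
  have hW : evalSm x (wedge a b) = (A 0 0 * A 1 1 - A 0 1 * A 1 0) * evalSm x (wedge a' b') := by
    rw [← det_covMat, ← det_covMat, ← hAx, Matrix.det_mul, Matrix.det_fin_two A.1]
  -- Equality of m says that the discrepancies of the skew parts satisfy b(r - r̃) = a(s - s̃);
  -- independence of a and b makes both vanish.
  have hk : ∀ k, evalSm x (b k) * (evalSm x r - (A 0 0 * evalSm x r' + A 0 1 * evalSm x s')) =
      evalSm x (a k) * (evalSm x s - (A 1 0 * evalSm x r' + A 1 1 * evalSm x s')) := fun k => by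
    have h1 := hm k
    rw [div_eq_div_iff hw hw', hW] at h1
    have h2 := ea k
    have h3 := eb k
    simp only [Pi.add_apply, Pi.smul_apply, map_add, map_smul, map_sub, map_mul, smul_eq_mul] at h1 h2 h3
    refine mul_right_cancel₀ hw' ?_
    rw [h2, h3] at h1 ⊢
    linear_combination h1
  have hwx := hw
  simp only [wedge, map_sub, map_mul] at hwx
  have hr : evalSm x r - (A 0 0 * evalSm x r' + A 0 1 * evalSm x s') = 0 := by
    refine (mul_eq_zero.1 ?_).resolve_left hwx
    linear_combination evalSm x (a 0) * hk 1 - evalSm x (a 1) * hk 0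
  have hs : evalSm x s - (A 1 0 * evalSm x r' + A 1 1 * evalSm x s') = 0 := by
    refine (mul_eq_zero.1 ?_).resolve_left hwx
    linear_combination evalSm x (b 0) * hk 1 - evalSm x (b 1) * hk 0
  refine ⟨?_, ?_, hOm⟩
  · simp only [map_add, map_smul, smul_eq_mul]
    linarith
  · simp only [map_add, map_smul, smul_eq_mul]
    linarith

end KillingPair

theorem mem_orb_of_covMat {r s : Rep g O} {A : GL (Fin 2) ℝ}
    (h : ∀ y : O, Par (covMat (lowSm hg s.smooth_P) (lowSm hg s.smooth_Q) y)
      (A.1 * covMat (lowSm hg r.smooth_P) (lowSm hg r.smooth_Q) y)) :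
    s.frac ∈ orb O.2 hg ⊤ r.frac := by
  refine ⟨A, trivial, (frac_eq_moeb_iff O.2 hg A r s).2 fun x hx => ?_⟩
  have h1 := h ⟨x, hx⟩
  rw [covMat_lowSm, covMat_lowSm, ← Matrix.mul_assoc] at h1
  have := h1.mul_right (g x)⁻¹
  have hd : IsUnit (g x).det := isUnit_iff_ne_zero.2 (hg.posDef x hx).det_pos.ne'
  rwa [Matrix.mul_nonsing_inv_cancel_right _ _ hd, Matrix.mul_nonsing_inv_cancel_right _ _ hd] at this

end continuation

end FracLin

/-! ### Algebraic integrability conditions at a point. -/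

namespace FracLin

section differentialMaps

variable {R R' : Type*} [CommRing R] [Algebra ℝ R] [CommRing R'] [Algebra ℝ R']
  {D : Fin 2 → Derivation ℝ R R} {D' : Fin 2 → Derivation ℝ R' R'} {g : Fin 2 → Fin 2 → R}
  {G : Fin 2 → Fin 2 → Fin 2 → R} {K : R}

/-- The structure equations are polynomial in the entries and their derivatives, so they pass
through differential homomorphisms; the one needed is restriction to a smaller open set. -/
theorem MetricConn.map (h : MetricConn D g G K) (φ : R →ₐ[ℝ] R')
    (hφ : ∀ i f, φ (D i f) = D' i (φ f)) (hD' : ∀ f, D' 0 (D' 1 f) = D' 1 (D' 0 f)) :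
    MetricConn D' (fun i j => φ (g i j)) (fun k i j => φ (G k i j)) (φ K) := by
  refine ⟨hD', congrArg φ h.g_symm, fun k => congrArg φ (h.G_symm k), fun k i j => ?_, ?_, ?_, ?_, ?_⟩
  · rw [← hφ, h.compat]; simp
  · simpa [hφ] using congrArg φ h.curv00
  · simpa [hφ] using congrArg φ h.curv01
  · simpa [hφ] using congrArg φ h.curv10
  · simpa [hφ] using congrArg φ h.curv11

theorem RelKilling.map {L a : Fin 2 → R} {r : R} (h : RelKilling D G L a r) (φ : R →ₐ[ℝ] R')
    (hφ : ∀ i f, φ (D i f) = D' i (φ f)) :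
    RelKilling D' (fun k i j => φ (G k i j)) (fun i => φ (L i)) (fun i => φ (a i)) (φ r) := by
  refine ⟨fun i => ?_, ?_, ?_⟩
  · simpa [hφ] using congrArg φ (h.diag i)
  · simpa [hφ] using congrArg φ h.up
  · simpa [hφ] using congrArg φ h.down

theorem map_curvForm (φ : R →ₐ[ℝ] R') (hφ : ∀ i f, φ (D i f) = D' i (φ f))
    (k : Fin 2) :
    φ (curvForm D g K k) = curvForm D' (fun i j => φ (g i j)) (φ K) k := by
  simp [curvForm, hφ]

theorem map_intCoeff (φ : R →ₐ[ℝ] R') (hφ : ∀ i f, φ (D i f) = D' i (φ f)) :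
    φ (intCoeff D g G K) =
    intCoeff D' (fun i j => φ (g i j)) (fun k i j => φ (G k i j)) (φ K) := by
  simp [intCoeff, ← map_curvForm φ hφ, hφ]

theorem map_intLin (φ : R →ₐ[ℝ] R') (hφ : ∀ i f, φ (D i f) = D' i (φ f))
    (i j : Fin 2) : φ (intLin D g G K i j) =
    intLin D' (fun i j => φ (g i j)) (fun k i j => φ (G k i j)) (φ K) i j := by
  simp only [intLin, ← map_curvForm φ hφ, ← hφ]
  have h3 : φ 3 = 3 := map_ofNat φ 3
  split_ifs <;> simp [h3]

theorem map_intConst (φ : R →ₐ[ℝ] R') (hφ : ∀ i f, φ (D i f) = D' i (φ f))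
    (i : Fin 2) : φ (intConst D g G K i) =
    intConst D' (fun i j => φ (g i j)) (fun k i j => φ (G k i j)) (φ K) i := by
  simp only [intConst, ← map_curvForm φ hφ, ← map_intCoeff φ hφ, ← hφ]
  have h3 : φ 3 = 3 := map_ofNat φ 3
  simp [h3]

/-- The integrability conditions of an independent pair, evaluated at a point. -/
theorem RelKilling.exists_integrability (hc : MetricConn D g G K) {L a b : Fin 2 → R} {r s Om : R}
    (hOm : Om = D 0 (L 1) - D 1 (L 0)) (ha : RelKilling D G L a r) (hb : RelKilling D G L b s)
    (φ : R →ₐ[ℝ] R') (hφ : ∀ i f, φ (D i f) = D' i (φ f)) (hD' : ∀ f, D' 0 (D' 1 f) = D' 1 (D' 0 f))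
    (ψ : R' →ₐ[ℝ] ℝ) {W' : R'} (hW' : φ (wedge a b) * W' = 1) : ∃ m : Fin 2 → ℝ,
    6 * ψ (φ Om) ^ 2 + 3 * (ψ (φ (curvForm D g K 0)) * m 1 - ψ (φ (curvForm D g K 1)) * m 0) +
      ψ (φ (intCoeff D g G K)) = 0 ∧
    ∀ i, (30 * ψ (φ Om) ^ 2 - ψ (φ (intCoeff D g G K))) * m i +
      ∑ j, ψ (φ (intLin D g G K i j)) * m j + 12 * ψ (φ (∑ n, G n i n)) * ψ (φ Om) ^ 2 +
      15 * ψ (φ (curvForm D g K i)) * ψ (φ Om) + ψ (φ (intConst D g G K i)) = 0 := by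
  have hwm : φ (wedge a b) = wedge (fun i => φ (a i)) (fun i => φ (b i)) := by
    simp [wedge]
  rw [hwm] at hW'
  have hconn := hc.map φ hφ hD'
  obtain ⟨m, hm⟩ : ∃ m : Fin 2 → R', ∀ k, m k = (φ (b k) * φ r - φ (a k) * φ s) * W' := ⟨_, fun _ => rfl⟩
  have hch := RelKilling.charForm hconn (m := m) (Om := φ Om) (by rw [hOm, map_sub, hφ, hφ])
    (ha.map φ hφ) (hb.map φ hφ) (IsUnit.of_mul_eq_one _ hW')
    (fun k => by rw [hm]; linear_combination (φ (b k) * φ r - φ (a k) * φ s) * hW')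
  have h3 : ψ 3 = 3 := map_ofNat ψ 3
  have h6 : ψ 6 = 6 := map_ofNat ψ 6
  have h12 : ψ 12 = 12 := map_ofNat ψ 12
  have h15 : ψ 15 = 15 := map_ofNat ψ 15
  have h30 : ψ 30 = 30 := map_ofNat ψ 30
  refine ⟨fun k => ψ (m k), ?_, fun i => ?_⟩
  · have e := congrArg ψ (hch.integrability hconn)
    simpa only [← map_curvForm φ hφ, ← map_intCoeff φ hφ, map_add, map_mul, map_sub, map_pow, map_zero,
      h6, h3] using e
  · have e := congrArg ψ (hch.integrability_deriv hconn i)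
    simpa only [← map_curvForm φ hφ, ← map_intCoeff φ hφ, ← map_intConst φ hφ, ← map_intLin φ hφ,
      map_add, map_mul, map_sub, map_pow, map_sum, map_zero, h30, h12, h15] using e

end differentialMaps

section restriction

variable {O O' : TopologicalSpace.Opens E}

/-- Restriction of smooth functions. -/
noncomputable def resSm (h : O' ≤ O) : SmoothFn O →ₐ[ℝ] SmoothFn O' where
  toFun f := toSm (extZero O f.1) ((smoothFn_smooth f).mono h)
  map_one' := smoothFn_ext fun x => by
    rw [evalSm_toSm, evalSm_extZero 1 ⟨x, h x.2⟩, map_one, map_one]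
  map_mul' f f' := smoothFn_ext fun x => by
    rw [evalSm_toSm, evalSm_extZero (f * f') ⟨x, h x.2⟩, map_mul, map_mul, evalSm_toSm, evalSm_toSm,
      evalSm_extZero f ⟨x, h x.2⟩, evalSm_extZero f' ⟨x, h x.2⟩]
  map_zero' := smoothFn_ext fun x => by
    rw [evalSm_toSm, evalSm_extZero 0 ⟨x, h x.2⟩, map_zero, map_zero]
  map_add' f f' := smoothFn_ext fun x => by
    rw [evalSm_toSm, evalSm_extZero (f + f') ⟨x, h x.2⟩, map_add, map_add, evalSm_toSm, evalSm_toSm,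
      evalSm_extZero f ⟨x, h x.2⟩, evalSm_extZero f' ⟨x, h x.2⟩]
  commutes' c := smoothFn_ext fun x => by
    rw [evalSm_toSm, evalSm_extZero (algebraMap ℝ (SmoothFn O) c) ⟨x, h x.2⟩, AlgHom.commutes,
      AlgHom.commutes]

theorem evalSm_resSm (h : O' ≤ O) (f : SmoothFn O) (x : O') :
    evalSm x (resSm h f) = evalSm ⟨x, h x.2⟩ f := evalSm_extZero f ⟨x, h x.2⟩

theorem resSm_sd (h : O' ≤ O) (i : Fin 2) (f : SmoothFn O) :
    resSm h (sd O i f) = sd O' i (resSm h f) := smoothFn_ext fun x => by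
  rw [evalSm_resSm]
  change _ = evalSm x (sd O' i (toSm (extZero O f.1) ((smoothFn_smooth f).mono h)))
  rw [sd_toSm, evalSm_toSm, evalSm_sd]

end restriction

section characteristic

variable {g : E → Matrix (Fin 2) (Fin 2) ℝ} {O : TopologicalSpace.Opens E} {hg : IsMetric g O}
  {L a b : Fin 2 → SmoothFn O} {r s : SmoothFn O}

/-- The integrability conditions at a point at which the pair is independent. -/
theorem KillingPair.integrability (h : KillingPair hg L a b r s) {x : O}
    (hw : evalSm x (wedge a b) ≠ 0) : ∃ m : Fin 2 → ℝ,
    6 * evalSm x (sd O 0 (L 1) - sd O 1 (L 0)) ^ 2 +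
      3 * (evalSm x (curvForm (sd O) (metSm hg) (curvSm hg) 0) * m 1 -
        evalSm x (curvForm (sd O) (metSm hg) (curvSm hg) 1) * m 0) +
      evalSm x (intCoeff (sd O) (metSm hg) (chrSm hg) (curvSm hg)) = 0 ∧
    ∀ i, (30 * evalSm x (sd O 0 (L 1) - sd O 1 (L 0)) ^ 2 -
        evalSm x (intCoeff (sd O) (metSm hg) (chrSm hg) (curvSm hg))) * m i +
      ∑ j, evalSm x (intLin (sd O) (metSm hg) (chrSm hg) (curvSm hg) i j) * m j +
      12 * evalSm x (∑ n, chrSm hg n i n) * evalSm x (sd O 0 (L 1) - sd O 1 (L 0)) ^ 2 +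
      15 * evalSm x (curvForm (sd O) (metSm hg) (curvSm hg) i) *
        evalSm x (sd O 0 (L 1) - sd O 1 (L 0)) +
      evalSm x (intConst (sd O) (metSm hg) (chrSm hg) (curvSm hg) i) = 0 := by
  set W := wedge a b with hW
  have hopen : IsOpen {y : E | y ∈ (O : Set E) ∧ extZero O W.1 y ≠ 0} :=
    (smoothFn_smooth W).continuousOn.isOpen_inter_preimage O.2 isOpen_ne
  -- The determinant is a unit only after restriction to the set where it does not vanish;
  -- evaluation at x factors through this restriction.
  set O' : TopologicalSpace.Opens E := ⟨_, hopen⟩ with hO'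
  have hle : O' ≤ O := fun y hy => hy.1
  set φ := resSm hle with hφdef
  have hφ : ∀ i f, φ (sd O i f) = sd O' i (φ f) := resSm_sd hle
  have hx' : (x : E) ∈ O' := ⟨x.2, by rwa [evalSm_extZero]⟩
  have ev : ∀ f, evalSm (⟨x, hx'⟩ : O') (φ f) = evalSm x f := fun f => evalSm_resSm hle f ⟨x, hx'⟩
  obtain ⟨W', hW'⟩ := exists_smoothFn_inv (f := φ W) fun y => by
    rw [hφdef, evalSm_resSm, ← evalSm_extZero]
    exact y.2.2
  have hunit : φ W * W' = 1 := smoothFn_ext fun y => by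
    rw [map_mul, hW', map_one]
    refine mul_inv_cancel₀ ?_
    rw [hφdef, evalSm_resSm, ← evalSm_extZero]
    exact y.2.2
  have key := RelKilling.exists_integrability hg.metricConn rfl h.fst h.snd φ hφ sd_comm
    (evalSm (⟨x, hx'⟩ : O')) hunit
  simpa only [ev] using key

open Polynomial in
/-- The curvature of the cofactor satisfies an equation of degree six. -/
theorem exists_characteristic_polynomial {k₀ k₁ d : ℝ} (l : Fin 2 → Fin 2 → ℝ) (T e : Fin 2 → ℝ)
    (hk : k₀ ≠ 0 ∨ k₁ ≠ 0) : ∃ p : ℝ[X], p ≠ 0 ∧ p.natDegree ≤ 6 ∧ ∀ (w : ℝ) (m : Fin 2 → ℝ),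
    6 * w ^ 2 + 3 * (k₀ * m 1 - k₁ * m 0) + d = 0 →
    (∀ i, (30 * w ^ 2 - d) * m i + ∑ j, l i j * m j + 12 * T i * w ^ 2 + 15 * ![k₀, k₁] i * w + e i = 0) →
    p.IsRoot w := by
  set q := k₀ ^ 2 + k₁ ^ 2 with hq
  have hq0 : q ≠ 0 := by
    rcases hk with hk | hk
    · exact (by positivity : 0 < q).ne'
    · exact (by positivity : 0 < q).ne'
  -- Write m in the orthogonal frame of κ: M = κ∧m and N = κ·m. The first condition gives M = -2w² -
  -- d/3; the others, rotated to the same frame, are two linear equations for N, and p is the result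
  -- of eliminating N. The coefficient of X⁶ is -1800|κ|⁴, which is nonzero.
  set A := -k₁ * (k₀ * l 1 0 - k₁ * l 0 0) + k₀ * (k₀ * l 1 1 - k₁ * l 0 1) with hA
  set B := k₀ * (k₀ * l 1 0 - k₁ * l 0 0) + k₁ * (k₀ * l 1 1 - k₁ * l 0 1) with hB
  set A' := -k₁ * (k₀ * l 0 0 + k₁ * l 1 0) + k₀ * (k₀ * l 0 1 + k₁ * l 1 1) with hA'
  set B' := k₀ * (k₀ * l 0 0 + k₁ * l 1 0) + k₁ * (k₀ * l 0 1 + k₁ * l 1 1) with hB'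
  set p : ℝ[X] := (C (30 * q) * X ^ 2 + C (B' - q * d)) *
    ((C (30 * q) * X ^ 2 + C (A - q * d)) * (C (-2) * X ^ 2 + C (-d / 3)) +
      C (12 * q * (k₀ * T 1 - k₁ * T 0)) * X ^ 2 + C (q * (k₀ * e 1 - k₁ * e 0))) -
    C B * (C A' * (C (-2) * X ^ 2 + C (-d / 3)) + C (12 * q * (k₀ * T 0 + k₁ * T 1)) * X ^ 2 +
      C (15 * q ^ 2) * X + C (q * (k₀ * e 0 + k₁ * e 1))) with hp
  have hcoeff : p.coeff 6 = -1800 * q ^ 2 := by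
    rw [hp]
    compute_degree
    · ring
    all_goals norm_num
  refine ⟨p, fun h0 => ?_, ?_, fun w m h0 h1 => ?_⟩
  · rw [h0, coeff_zero] at hcoeff
    have : q ^ 2 ≠ 0 := pow_ne_zero 2 hq0
    exact this (by linarith)
  · rw [hp]
    compute_degree!
  · have c0 := h1 0
    have c1 := h1 1
    simp only [Fin.sum_univ_two, Matrix.cons_val_zero, Matrix.cons_val_one] at c0 c1
    set M := k₀ * m 1 - k₁ * m 0 with hM
    set N := k₀ * m 0 + k₁ * m 1 with hN
    have hMw : M = -2 * w ^ 2 + -d / 3 := by linarith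
    have m0 : q * m 0 = -k₁ * M + k₀ * N := by simp only [hq, hM, hN]; ring
    have m1 : q * m 1 = k₀ * M + k₁ * N := by simp only [hq, hM, hN]; ring
    have ea : (30 * q * w ^ 2 + (A - q * d)) * M + B * N +
        12 * q * (k₀ * T 1 - k₁ * T 0) * w ^ 2 + q * (k₀ * e 1 - k₁ * e 0) = 0 := by
      simp only [hA, hB]
      linear_combination q * k₀ * c1 - q * k₁ * c0 - (k₀ * l 1 0 - k₁ * l 0 0) * m0 -
        (k₀ * l 1 1 - k₁ * l 0 1) * m1
    have eb : (30 * q * w ^ 2 + (B' - q * d)) * N + A' * M +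
        12 * q * (k₀ * T 0 + k₁ * T 1) * w ^ 2 + 15 * q ^ 2 * w + q * (k₀ * e 0 + k₁ * e 1) = 0 := by
      simp only [hA', hB']
      linear_combination q * k₀ * c0 + q * k₁ * c1 - (k₀ * l 0 0 + k₁ * l 1 0) * m0 -
        (k₀ * l 0 1 + k₁ * l 1 1) * m1
    rw [IsRoot.def, hp]
    simp only [eval_sub, eval_add, eval_mul, eval_C, eval_pow, eval_X]
    rw [← hMw]
    linear_combination (30 * q * w ^ 2 + (B' - q * d)) * ea - B * eb

end characteristic

end FracLin

/-! ### Finiteness of the set of orbits. -/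

namespace FracLin

section finiteness

variable {g : E → Matrix (Fin 2) (Fin 2) ℝ} {O : TopologicalSpace.Opens E} {hg : IsMetric g O}

theorem isOpen_ne_zero (f : SmoothFn O) : IsOpen {x : O | evalSm x f ≠ 0} :=
  isOpen_ne_fun (continuous_smoothFn f) continuous_const

theorem evalSm_sd_of_isOpen {f : SmoothFn O} {V : Set O} (hV : IsOpen V) {x : O} (hx : x ∈ V)
    (h : ∀ y ∈ V, evalSm y f = 0) (i : Fin 2) : evalSm x (sd O i f) = 0 := by
  obtain ⟨W, hW, rfl⟩ := isOpen_induced_iff.1 hV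
  exact KillingPair.evalSm_sd_of_eventually hW hx h i

/-- The form κ is dK multiplied by an invertible matrix, so its vanishing means dK = 0, and K is
constant on a convex set. -/
theorem exists_curvForm_ne_zero (hc : Convex ℝ (O : Set E)) (hK : ¬ ConstCurv g O) :
    ∃ (k : Fin 2) (x : O), evalSm x (curvForm (sd O) (metSm hg) (curvSm hg) k) ≠ 0 := by
  by_contra hcon
  push Not at hcon
  refine hK ?_
  by_cases hne : Nonempty O
  swap
  · exact ⟨0, fun x hx => absurd ⟨⟨x, hx⟩⟩ hne⟩
  obtain ⟨x₀⟩ := hne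
  have hd : ∀ i, sd O i (curvSm hg) = 0 := by
    have key : ∀ x : O, evalSm x (sd O 0 (curvSm hg)) = 0 ∧ evalSm x (sd O 1 (curvSm hg)) = 0 := by
      intro x
      have h0 := hcon 0 x
      have h1 := hcon 1 x
      have hdet := (hg.posDef x x.2).det_pos.ne'
      rw [Matrix.det_fin_two] at hdet
      simp only [curvForm, map_sub, map_mul, metSm, evalSm_toSm] at h0 h1
      constructor
      · refine mul_right_cancel₀ hdet ?_
        linear_combination g x 0 0 * h1 - g x 1 0 * h0
      · refine mul_right_cancel₀ hdet ?_
        linear_combination g x 0 1 * h1 - g x 1 1 * h0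
    intro i
    refine smoothFn_ext fun x => ?_
    fin_cases i
    · exact (key x).1
    · exact (key x).2
  have h1 : (fun _ : Fin 1 => curvSm hg - algebraMap ℝ (SmoothFn O) (evalSm x₀ (curvSm hg))) = 0 :=
    flat_solution_eq_zero hc (C := 0) (x₀ := x₀) (fun i k => by
      rw [map_sub, hd, Derivation.map_algebraMap]
      simp) (fun k => by
      rw [map_sub, AlgHom.commutes]
      exact sub_self _)
  refine ⟨evalSm x₀ (curvSm hg), fun x hx => ?_⟩
  have := congrArg (evalSm (⟨x, hx⟩ : O)) (congrFun h1 0)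
  rw [map_sub, AlgHom.commutes, Pi.zero_apply, map_zero] at this
  exact sub_eq_zero.1 this

/-- Nonvanishing is open, so finitely many generic conditions can be imposed one after another on
shrinking open sets. -/
theorem exists_forall_ne_zero {ι : Type*} (s : Finset ι) (f : ι → SmoothFn O) {V : Set O}
    (hV : IsOpen V) (hne : V.Nonempty) (h : ∀ i ∈ s, ∀ V' ⊆ V, IsOpen V' → V'.Nonempty →
      ∃ x ∈ V', evalSm x (f i) ≠ 0) : ∃ x ∈ V, ∀ i ∈ s, evalSm x (f i) ≠ 0 := by
  classical
  induction s using Finset.induction_on with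
  | empty => exact ⟨hne.some, hne.some_mem, by simp⟩
  | insert i s _ ih =>
    obtain ⟨x, hx, hxs⟩ := ih fun j hj => h j (Finset.mem_insert_of_mem hj)
    obtain ⟨y, hy, hyi⟩ := h i (Finset.mem_insert_self _ _) (V ∩ ⋂ j ∈ s, {x | evalSm x (f j) ≠ 0})
      Set.inter_subset_left
      (hV.inter (isOpen_biInter_finset fun j _ => isOpen_ne_zero (f j)))
      ⟨x, hx, by simpa using hxs⟩
    refine ⟨y, hy.1, fun j hj => ?_⟩
    rcases Finset.mem_insert.1 hj with rfl | hj
    · exact hyi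
    · exact Set.mem_iInter₂.1 hy.2 j hj

namespace KillingPair

variable {L a b L' a' b' : Fin 2 → SmoothFn O} {r s r' s' : SmoothFn O}

/-- The curvature of the cofactor determines the pair, in nonconstant curvature. -/
theorem exists_par_of_curvature (h : KillingPair hg L a b r s) (h' : KillingPair hg L' a' b' r' s')
    (hc : Convex ℝ (O : Set E)) {V : Set O} (hV : IsOpen V) (hne : V.Nonempty) {k : Fin 2}
    (hk : ∀ x ∈ V, evalSm x (curvForm (sd O) (metSm hg) (curvSm hg) k) ≠ 0)
    (hOm : ∀ x ∈ V, evalSm x (sd O 0 (L 1) - sd O 1 (L 0)) =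
      evalSm x (sd O 0 (L' 1) - sd O 1 (L' 0))) :
    ∃ A : GL (Fin 2) ℝ, ∀ y, Par (covMat a b y) (A.1 * covMat a' b' y) := by
  obtain ⟨x₁, hx₁V, hx₁⟩ := (h.dense_wedge_ne_zero hc).inter_open_nonempty _ hV hne
  obtain ⟨x₂, ⟨hx₂V, hx₂⟩, hx₂'⟩ := (h'.dense_wedge_ne_zero hc).inter_open_nonempty _
    (hV.inter (isOpen_ne_zero (wedge a b))) ⟨x₁, hx₁V, hx₁⟩
  set V₁ := V ∩ {x | evalSm x (wedge a b) ≠ 0} ∩ {x | evalSm x (wedge a' b') ≠ 0} with hV₁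
  have hV₁o : IsOpen V₁ := (hV.inter (isOpen_ne_zero _)).inter (isOpen_ne_zero _)
  set Om := sd O 0 (L 1) - sd O 1 (L 0) with hOmdef
  set Om' := sd O 0 (L' 1) - sd O 1 (L' 0) with hOmdef'
  -- If Ω vanished on V₁, its equation would reduce to κw = 0, but both factors are nonzero there.
  obtain ⟨x, hx, hxO⟩ : ∃ x ∈ V₁, evalSm x Om ≠ 0 := by
    by_contra hcon
    push Not at hcon
    have hm : x₂ ∈ V₁ := ⟨⟨hx₂V, hx₂⟩, hx₂'⟩
    have e := congrArg (evalSm x₂) (h.fst.deriv_curvature hg.metricConn hOmdef h.snd k)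
    have e0 := evalSm_sd_of_isOpen hV₁o hm hcon k
    simp only [map_add, map_mul, map_sub, e0, hcon x₂ hm, mul_zero, zero_mul, sub_zero, zero_sub,
      map_zero, add_zero, mul_neg, neg_eq_zero] at e
    exact mul_ne_zero hx₂ (hk x₂ hx₂V) e
  -- Where Ω ≠ 0 its equation can be solved for m in terms of Ω, DΩ and the metric, all of which are
  -- common to the two pairs.
  refine h.exists_par_moebius h' hc hx.1.2 hx.2 (fun i => ?_) (hOm x hx.1.1)
  have e := congrArg (evalSm x) (h.fst.deriv_curvature hg.metricConn hOmdef h.snd i)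
  have e' := congrArg (evalSm x) (h'.fst.deriv_curvature hg.metricConn hOmdef' h'.snd i)
  have hd := evalSm_sd_of_isOpen (f := Om - Om') hV hx.1.1 (fun y hy => by
    rw [map_sub, hOm y hy, sub_self]) i
  have h3 : evalSm x 3 = 3 := rfl
  have hO := hOm x hx.1.1
  rw [map_sub, map_sub, sub_eq_zero] at hd
  simp only [map_add, map_mul, map_sub (evalSm x), map_zero, h3] at e e' ⊢
  rw [← hd, ← hO] at e'
  have w1 : evalSm x (wedge a b) ≠ 0 := hx.1.2
  have w2 : evalSm x (wedge a' b') ≠ 0 := hx.2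
  rw [div_eq_div_iff w1 w2]
  refine mul_left_cancel₀ (mul_ne_zero three_ne_zero hxO) ?_
  linear_combination evalSm x (wedge a b) * e' - evalSm x (wedge a' b') * e

end KillingPair

/-- In nonconstant curvature there are only finitely many orbits. -/
theorem finite_orbits (hg : IsMetric g O) (hc : Convex ℝ (O : Set E)) (hK : ¬ ConstCurv g O) :
    {S : Set (FLI g O) | ∃ F, S = orb O.2 hg ⊤ F}.Finite := by
  by_contra hinf
  obtain ⟨k, x₁, hx₁⟩ := exists_curvForm_ne_zero (hg := hg) hc hK
  -- Seven orbits, one more than the degree bound of the characteristic polynomial.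
  obtain ⟨t, htsub, htcard⟩ := Set.Infinite.exists_subset_card_eq hinf 7
  have hrep : ∀ S : t, ∃ r : Rep g O, S.1 = orb O.2 hg ⊤ r.frac := fun S => by
    obtain ⟨F, hF⟩ := htsub S.2
    obtain ⟨r, rfl⟩ := frac_surjective F
    exact ⟨r, hF⟩
  choose r hr using hrep
  choose L ρ σ hp using fun S => (r S).exists_killingPair hg ⟨x₁, x₁.2⟩
  set Om : t → SmoothFn O := fun S => sd O 0 (L S 1) - sd O 1 (L S 0) with hOm
  set V : Set O := {x | evalSm x (curvForm (sd O) (metSm hg) (curvSm hg) k) ≠ 0} with hV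
  -- Diagonal indices ask for independence of each pair, off-diagonal ones for distinct curvatures.
  -- Curvatures that agree on an open set would put both integrals in the same orbit.
  obtain ⟨x, hxV, hx⟩ := exists_forall_ne_zero (Finset.univ : Finset (t × t))
    (fun q => if q.1 = q.2 then wedge (lowSm hg (r q.1).smooth_P) (lowSm hg (r q.1).smooth_Q) else
      Om q.1 - Om q.2) (isOpen_ne_zero _) ⟨x₁, hx₁⟩ (by
    rintro ⟨i, j⟩ - V' hV' hV'o hne
    by_cases hij : i = j
    · subst hij
      simp only [if_true]
      obtain ⟨y, hy⟩ := ((hp i).dense_wedge_ne_zero hc).inter_open_nonempty _ hV'o hne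
      exact ⟨y, hy.1, hy.2⟩
    · simp only [hij, if_false]
      by_contra hcon
      push Not at hcon
      obtain ⟨A, hA⟩ := (hp i).exists_par_of_curvature (hp j) hc hV'o hne (fun y hy => hV' hy)
        fun y hy => sub_eq_zero.1 (by rw [← map_sub]; exact hcon y hy)
      refine hij (Subtype.ext ?_)
      rw [hr, hr]
      exact orb_eq_of_mem O.2 hg (mem_orb_of_covMat hA))
  have hw : ∀ i, evalSm x (wedge (lowSm hg (r i).smooth_P) (lowSm hg (r i).smooth_Q)) ≠ 0 := fun i => by
    simpa using hx (i, i) (Finset.mem_univ _)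
  have hinj : Function.Injective fun i => evalSm x (Om i) := fun i j hij => by
    by_contra hne
    have := hx (i, j) (Finset.mem_univ _)
    simp only [hne, if_false, map_sub (evalSm x)] at this
    exact this (sub_eq_zero.2 hij)
  obtain ⟨p, hp0, hdeg, hroot⟩ := exists_characteristic_polynomial
    (k₀ := evalSm x (curvForm (sd O) (metSm hg) (curvSm hg) 0))
    (k₁ := evalSm x (curvForm (sd O) (metSm hg) (curvSm hg) 1))
    (d := evalSm x (intCoeff (sd O) (metSm hg) (chrSm hg) (curvSm hg)))
    (fun i j => evalSm x (intLin (sd O) (metSm hg) (chrSm hg) (curvSm hg) i j))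
    (fun i => evalSm x (∑ n, chrSm hg n i n))
    (fun i => evalSm x (intConst (sd O) (metSm hg) (chrSm hg) (curvSm hg) i)) (by
      have : evalSm x (curvForm (sd O) (metSm hg) (curvSm hg) k) ≠ 0 := hxV
      fin_cases k
      · exact Or.inl this
      · exact Or.inr this)
  have hk : ∀ i, ![evalSm x (curvForm (sd O) (metSm hg) (curvSm hg) 0),
      evalSm x (curvForm (sd O) (metSm hg) (curvSm hg) 1)] i =
      evalSm x (curvForm (sd O) (metSm hg) (curvSm hg) i) := fun i => by fin_cases i <;> rfl
  have hr : ∀ i, p.IsRoot (evalSm x (Om i)) := fun i => by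
    obtain ⟨m, h0, h1⟩ := (hp i).integrability (hw i)
    exact hroot _ m h0 fun j => by rw [hk]; exact h1 j
  have hcard : (Finset.univ : Finset t).card ≤ p.roots.toFinset.card :=
    Finset.card_le_card_of_injOn (fun i => evalSm x (Om i))
      (fun i _ => by simpa using ⟨hp0, hr i⟩) hinj.injOn
  have h7 : (Finset.univ : Finset t).card = 7 := by simp [htcard]
  have := (Multiset.toFinset_card_le p.roots).trans (p.card_roots'.trans hdeg)
  omega

end finiteness

end FracLin

/-! ### The dichotomy between constant and nonconstant curvature. -/

open FracLin in
theorem theorem5 (U : Set E) (hU : IsOpen U) (hconv : Convex ℝ U) (hne : U.Nonempty)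
    (g : E → Matrix (Fin 2) (Fin 2) ℝ) (hg : IsMetric g U) :
    (Nonempty (FLI g U) → HasDim g U 5 ∨ HasDim g U 3) ∧
    (HasDim g U 5 ↔ ConstCurv g U) ∧
    (HasDim g U 5 →
      (∀ r : Rep g U, ∃ L : E → E, ContDiffOn ℝ ∞ L U ∧
        IsCofactor g U L r.P ∧ IsCofactor g U L r.Q ∧ GaugeTrivial g U L) ∧
      ConnectedSpace (FLI g U)) ∧
    (HasDim g U 3 →
      {O : Set (FLI g U) | ∃ F, O = orb hU hg ⊤ F}.Finite ∧
      (∀ F : FLI g U, IsClopen (orb hU hg ⊤ F)) ∧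
      Finite (ConnectedComponents (FLI g U)) ∧
      ∀ F : FLI g U, connectedComponent F = orb hU hg (Matrix.GLPos (Fin 2) ℝ) F) := by
  let O : TopologicalSpace.Opens E := ⟨U, hU⟩
  have hgO : IsMetric g O := hg
  have hcO : Convex ℝ (O : Set E) := hconv
  -- Constant curvature gives dimension five and excludes three; otherwise five is excluded, and
  -- three holds as soon as an integral exists.
  by_cases hK : ConstCurv g U
  · obtain ⟨x, hx⟩ := hne
    have hd : ∀ i, sd O i (curvSm hgO) = 0 := ConstCurv.sd_curvSm hK hgO
    obtain ⟨B, hB⟩ := exists_killingBasis hd hcO ⟨x, hx⟩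
    have h5 : HasDim g U 5 := hB.hasDim_five hd hcO
    have h3 : ¬ HasDim g U 3 := hB.not_hasDim_three hd hcO
    exact ⟨fun _ => Or.inl h5, ⟨fun _ => hK, fun _ => h5⟩,
      fun _ => ⟨exists_gaugeTrivial_cofactor hgO hK hcO ⟨x, hx⟩, hB.connectedSpace hd hcO⟩,
      fun h => absurd h h3⟩
  · have hfin : {S : Set (FLI g U) | ∃ F, S = orb hU hg ⊤ F}.Finite := finite_orbits hgO hcO hK
    have h5 : ¬ HasDim g U 5 := not_hasDim_five hU hg hne hfin
    exact ⟨fun hN => Or.inr (hasDim_three hU hg hne hN hfin),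
      ⟨fun h => absurd h h5, fun h => absurd h hK⟩, fun h => absurd h h5,
      fun _ => ⟨hfin, fun F => ⟨isClosed_orb hU hg hne F, isOpen_orb hU hg hne hfin F⟩,
        finite_connectedComponents hU hg hne hfin, connectedComponent_eq_orb hU hg hne hfin⟩⟩
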